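/- **Setting.** Let $G$ be a compact Lie group with Lie algebra $\mathfrak g$ acting smoothly on a smooth manifold $M$. Let $\mathcal H$ be a complex Hilbert space, $U=U(\mathcal H)$ and $PU=U/U(1)$ with the norm topology, and let $\pi\colon P\to M$ be a smooth $G$-equivariant principal $PU$-bundle. On $P^{[2]}=P\times_MP$ put $\pi_1(p,q)=q$, $\pi_2(p,q)=p$. The lifting bundle gerbe is the line bundle $L\to P^{[2]}$ whose fibre at $(p,q)$ is spanned by the unitary operators $u$ with $q=p[u]$; its product is composition of operators and $G$ acts by the identity $L_{(p,q)}\to L_{(gp,gq)}$. *Cartan model.* For $\xi\in\mathfrak g$ and a $G$-manifold $N$ let $\hat\xi$ be the vector field $\hat\xi(x)=\frac{d}{dt}|_{t=0}\exp(-t\xi)x$. Let $\Omega_G(N)=\prod_{k,j}(S^k(\mathfrak g^*)\otimes\Omega^j(N;\mathbb C))^G$, where $S^k(\mathfrak g^*)\otimes\Omega^j$ has degree $2k+j$ (the completion by formal power series is needed because exponentials are not polynomial), with $d_{\mathfrak g}=d-\iota_{\hat\xi}$. If $H\in\Omega_G(M)$ has degree $3$ and $d_{\mathfrak g}H=0$,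 then $H_G(M,H)$ denotes the cohomology of $(\Omega_G(M),d_{\mathfrak g}-H)$. For a $G$-invariant connection $\nabla$ the moment map is $\mu(\xi)=\mathcal L_\xi-\nabla_{\hat\xi}$, where $(\mathcal L_\xi s)(x)=\frac{d}{dt}|_{t=0}\exp(t\xi)\,s(\exp(-t\xi)x)$. *Gerbe connection and curving.* Let $\nabla_L$ be a $G$-invariant connection on $L$ compatible with the product, with curvature $F_L$ and moment map $\tilde\mu_L$, and let $f-\mu_L\in\Omega_G^2(P)$, with $f$ a $2$-form and $\mu_L\colon P\to\mathfrak g^*\otimes\mathbb C$, be an equivariant curving: $F_L=\pi_1^*f-\pi_2^*f$ and $\tilde\mu_L=\pi_2^*\mu_L-\pi_1^*\mu_L$. *Modules.* A $G$-equivariant module is a $G$-equivariant Hilbert bundle $E\to P$ with fibre $\mathcal H$, with a reduction $R$ of its frame bundle to the group $GL_{\mathrm{tr}}$ of invertible operators that differ from the identity by a trace class operator, and a $G$-equivariant isomorphism $\psi\colon\pi_1^*E\otimes L\to\pi_2^*E$ compatible with the product of $L$, such that $R$ is preserved, smoothly, by the action $r\mapsto\sigma_g\circ r$ of $G$ and by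 $r\mapsto\psi_u\circ r\circ u^{-1}$ for unitary $u\in L_{(p,q)}$, $r\in R_q$, where $\psi_u=\psi(\cdot\otimes u)\colon E_q\to E_p$. A $G$-equivariant module connection on $E$ is a $G$-invariant connection $\nabla_E$ with $\pi_1^*\nabla_E\otimes I+I\otimes\nabla_L=\psi^{-1}\pi_2^*\nabla_E\,\psi$. **Theorem.** Let $E=E_0\oplus E_1$ be a $\mathbb Z_2$-graded $G$-equivariant module. 1. There is $H\in\Omega_G(M)$ of degree $3$ with $\pi^*H=d_{\mathfrak g}(f-\mu_L)$ and $d_{\mathfrak g}H=0$. 2. Let $\nabla_0,\nabla_1$ be $G$-equivariant module connections on $E_0,E_1$, with curvatures $F_i$ and moment maps $\mu_{E_i}$, such that $P$ is covered by open sets with local frames of $E_0$, $E_1$ in the reductions $R_0$, $R_1$ in which $\nabla_i=d+A_i$ and $A_0-A_1$ is a smooth form with values in the trace class operators (with the trace norm). Then in all local frames belonging to $R_0$ and $R_1$ every component of $$\exp(F_0+\mu_{E_0}+f-\mu_L)-\exp(F_1+\mu_{E_1}+f-\mu_L)$$ is trace class, and its trace does not depend on the frames and descends to $M$: it is $\pi^*\omega$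 for some $\omega\in\Omega_G(M)$ with $(d_{\mathfrak g}-H)\omega=0$. 3. The class of $\omega$ in $H_G(M,H)$ is the same for all such pairs $(\nabla_0,\nabla_1)$. It is the twisted equivariant Chern character of $E$, with values in $H_G(M,H)$. -/

import Mathlib

open scoped Manifold ContDiff InnerProductSpace

noncomputable section

namespace TwistedChern

/-! ### Trace class operators -/

section TraceClass

variable {H : Type*} [NormedAddCommGroup H] [InnerProductSpace ℂ H]

/-- `T h = ∑ ⟪yᵢ, h⟫ xᵢ` with `∑ ‖xᵢ‖ ‖yᵢ‖ < ∞`. -/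
def NuclearRep (T : H →L[ℂ] H) (x y : ℕ → H) : Prop :=
  Summable (fun i => ‖x i‖ * ‖y i‖) ∧ ∀ h, HasSum (fun i => inner ℂ (y i) h • x i) (T h)

/-- Trace class operators, as the nuclear operators of a Hilbert space. -/
def IsTraceClass (T : H →L[ℂ] H) : Prop := ∃ x y : ℕ → H, NuclearRep T x y

/-- The trace norm: the infimum of `∑ ‖xᵢ‖ ‖yᵢ‖` over all nuclear representations. -/
def traceNorm (T : H →L[ℂ] H) : ℝ :=
  sInf {r | ∃ x y : ℕ → H, NuclearRep T x y ∧ r = ∑' i, ‖x i‖ * ‖y i‖}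

theorem NuclearRep.zero : NuclearRep (0 : H →L[ℂ] H) (fun _ => 0) (fun _ => 0) := by
  constructor
  · simp
  · intro h; simp

theorem NuclearRep.smul {T : H →L[ℂ] H} {x y : ℕ → H} (h : NuclearRep T x y) (c : ℂ) :
    NuclearRep (c • T) (fun i => c • x i) y := by
  constructor
  · simpa [norm_smul, mul_assoc] using h.1.mul_left ‖c‖
  · intro v
    simpa [smul_comm c] using (h.2 v).const_smul c

theorem NuclearRep.add {S T : H →L[ℂ] H} {x y x' y' : ℕ → H} (h : NuclearRep S x y)
    (h' : NuclearRep T x' y') :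
    ∃ x'' y'' : ℕ → H, NuclearRep (S + T) x'' y'' ∧
      ∑' i, ‖x'' i‖ * ‖y'' i‖ = (∑' i, ‖x i‖ * ‖y i‖) + ∑' i, ‖x' i‖ * ‖y' i‖ := by
  obtain ⟨e⟩ : Nonempty (ℕ ≃ ℕ ⊕ ℕ) := ⟨Equiv.natSumNatEquivNat.symm⟩
  have key : HasSum (fun i : ℕ => ‖Sum.elim x x' (e i)‖ * ‖Sum.elim y y' (e i)‖)
      ((∑' i, ‖x i‖ * ‖y i‖) + ∑' i, ‖x' i‖ * ‖y' i‖) := by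
    refine (e.hasSum_iff (f := fun s : ℕ ⊕ ℕ => ‖Sum.elim x x' s‖ * ‖Sum.elim y y' s‖)).2 ?_
    exact HasSum.sum (f := fun s : ℕ ⊕ ℕ => ‖Sum.elim x x' s‖ * ‖Sum.elim y y' s‖)
      h.1.hasSum h'.1.hasSum
  refine ⟨fun i => Sum.elim x x' (e i), fun i => Sum.elim y y' (e i),
    ⟨key.summable, fun v => ?_⟩, key.tsum_eq⟩
  refine (e.hasSum_iff
    (f := fun s : ℕ ⊕ ℕ => inner ℂ (Sum.elim y y' s) v • Sum.elim x x' s)).2 ?_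
  exact HasSum.sum (f := fun s : ℕ ⊕ ℕ => inner ℂ (Sum.elim y y' s) v • Sum.elim x x' s)
    (h.2 v) (h'.2 v)

theorem NuclearRep.norm_le {T : H →L[ℂ] H} {x y : ℕ → H} (h : NuclearRep T x y) (v : H) :
    ‖T v‖ ≤ (∑' i, ‖x i‖ * ‖y i‖) * ‖v‖ := by
  rw [← (h.2 v).tsum_eq, ← tsum_mul_right]
  have hb : ∀ i, ‖inner ℂ (y i) v • x i‖ ≤ ‖x i‖ * ‖y i‖ * ‖v‖ := fun i => by
    rw [norm_smul]
    have := mul_le_mul_of_nonneg_right (norm_inner_le_norm (𝕜 := ℂ) (y i) v) (norm_nonneg (x i))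
    linarith
  exact tsum_of_norm_bounded (h.1.mul_right ‖v‖).hasSum hb

theorem traceNorm_le {T : H →L[ℂ] H} {x y : ℕ → H} (h : NuclearRep T x y) :
    traceNorm T ≤ ∑' i, ‖x i‖ * ‖y i‖ := by
  apply csInf_le
  · refine ⟨0, ?_⟩
    rintro r ⟨x, y, -, rfl⟩
    exact tsum_nonneg fun i => by positivity
  · exact ⟨x, y, h, rfl⟩

theorem traceNorm_nonneg (T : H →L[ℂ] H) : 0 ≤ traceNorm T := by
  apply Real.sInf_nonneg
  rintro r ⟨x, y, -, rfl⟩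
  exact tsum_nonneg fun i => by positivity

theorem exists_rep_lt {T : H →L[ℂ] H} (hT : IsTraceClass T) {ε : ℝ} (hε : 0 < ε) :
    ∃ x y : ℕ → H, NuclearRep T x y ∧ ∑' i, ‖x i‖ * ‖y i‖ < traceNorm T + ε := by
  obtain ⟨x, y, h⟩ := hT
  have hne : {r | ∃ x y : ℕ → H, NuclearRep T x y ∧ r = ∑' i, ‖x i‖ * ‖y i‖}.Nonempty :=
    ⟨_, x, y, h, rfl⟩
  obtain ⟨r, ⟨x', y', h', rfl⟩, hr⟩ := exists_lt_of_csInf_lt hne (lt_add_of_pos_right _ hε)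
  exact ⟨x', y', h', hr⟩

theorem norm_le_traceNorm {T : H →L[ℂ] H} (hT : IsTraceClass T) (v : H) :
    ‖T v‖ ≤ traceNorm T * ‖v‖ := by
  apply le_of_forall_pos_le_add
  intro ε hε
  obtain ⟨x, y, h, hlt⟩ := exists_rep_lt hT (ε := ε / (‖v‖ + 1)) (by positivity)
  have h1 := h.norm_le v
  have h2 : ε / (‖v‖ + 1) * ‖v‖ ≤ ε := by
    rw [div_mul_eq_mul_div, div_le_iff₀ (by positivity)]
    nlinarith [norm_nonneg v]
  nlinarith [mul_le_mul_of_nonneg_right hlt.le (norm_nonneg v)]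

theorem traceNorm_smul_le {T : H →L[ℂ] H} (hT : IsTraceClass T) (c : ℂ) :
    traceNorm (c • T) ≤ ‖c‖ * traceNorm T := by
  apply le_of_forall_pos_le_add
  intro ε hε
  obtain ⟨x, y, h, hlt⟩ := exists_rep_lt hT (ε := ε / (‖c‖ + 1)) (by positivity)
  have h1 := traceNorm_le (h.smul c)
  simp only [norm_smul, mul_assoc, tsum_mul_left] at h1
  have h2 : ‖c‖ * (ε / (‖c‖ + 1)) ≤ ε := by
    rw [mul_div_assoc', div_le_iff₀ (by positivity)]
    nlinarith [norm_nonneg c]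
  nlinarith [mul_le_mul_of_nonneg_left hlt.le (norm_nonneg c)]

variable (H) in
/-- The trace class operators as a linear subspace of the bounded operators. -/
def traceClassSubmodule : Submodule ℂ (H →L[ℂ] H) where
  carrier := {T | IsTraceClass T}
  zero_mem' := ⟨_, _, NuclearRep.zero⟩
  add_mem' := by
    rintro S T ⟨x, y, h⟩ ⟨x', y', h'⟩
    obtain ⟨x'', y'', h'', -⟩ := h.add h'
    exact ⟨x'', y'', h''⟩
  smul_mem' := by
    rintro c T ⟨x, y, h⟩
    exact ⟨_, _, h.smul c⟩

variable (H) in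
/-- The space of trace class operators, which carries the trace norm. -/
def TraceClass : Type _ := traceClassSubmodule H

instance : AddCommGroup (TraceClass H) := inferInstanceAs (AddCommGroup (traceClassSubmodule H))

instance instModuleComplexTraceClass : Module ℂ (TraceClass H) :=
  inferInstanceAs (Module ℂ (traceClassSubmodule H))

/-- The underlying bounded operator. -/
def TraceClass.op : TraceClass H →ₗ[ℂ] (H →L[ℂ] H) := (traceClassSubmodule H).subtype

theorem TraceClass.isTraceClass (T : TraceClass H) : IsTraceClass T.op := T.2

instance : Norm (TraceClass H) := ⟨fun T => traceNorm T.op⟩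

theorem TraceClass.core : NormedSpace.Core ℂ (TraceClass H) where
  norm_nonneg T := traceNorm_nonneg _
  norm_smul c T := by
    change traceNorm (TraceClass.op (c • T)) = ‖c‖ * traceNorm T.op
    rw [map_smul]
    apply le_antisymm (traceNorm_smul_le T.isTraceClass c)
    by_cases hc : c = 0
    · simpa [hc] using traceNorm_nonneg (0 : H →L[ℂ] H)
    · have h := traceNorm_smul_le (c • T).isTraceClass c⁻¹
      rw [map_smul, inv_smul_smul₀ hc, norm_inv] at h
      have hpos : 0 < ‖c‖ := norm_pos_iff.2 hc
      calc ‖c‖ * traceNorm T.op ≤ ‖c‖ * (‖c‖⁻¹ * traceNorm (c • T.op)) := by gcongr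
        _ = _ := by rw [mul_inv_cancel_left₀ hpos.ne']
  norm_triangle S T := by
    change traceNorm (TraceClass.op (S + T)) ≤ traceNorm S.op + traceNorm T.op
    rw [map_add]
    apply le_of_forall_pos_le_add
    intro ε hε
    obtain ⟨x, y, h, hlt⟩ := exists_rep_lt S.isTraceClass (half_pos hε)
    obtain ⟨x', y', h', hlt'⟩ := exists_rep_lt T.isTraceClass (half_pos hε)
    obtain ⟨x'', y'', h'', he⟩ := h.add h'
    have := traceNorm_le h''
    linarith
  norm_eq_zero_iff T := by
    change traceNorm T.op = 0 ↔ _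
    constructor
    · intro h
      have h0 : T.op = 0 := by
        ext v
        have := norm_le_traceNorm T.isTraceClass v
        rw [h, zero_mul] at this
        simpa using this
      exact Subtype.ext h0
    · rintro rfl
      rw [map_zero]
      refine le_antisymm ?_ (traceNorm_nonneg _)
      simpa using traceNorm_le (NuclearRep.zero (H := H))

instance : NormedAddCommGroup (TraceClass H) := NormedAddCommGroup.ofCore TraceClass.core

instance : NormedSpace ℂ (TraceClass H) where
  norm_smul_le c T := (TraceClass.core.norm_smul c T).le

instance : NormedSpace ℝ (TraceClass H) := NormedSpace.restrictScalars ℝ ℂ (TraceClass H)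

/-- The trace of an operator: the sum of the diagonal matrix coefficients in a Hilbert basis. -/
def opTrace [CompleteSpace H] (T : H →L[ℂ] H) : ℂ :=
  ∑' e : (exists_hilbertBasis ℂ H).choose, inner ℂ (e : H) (T e)

end TraceClass

/-! ### Alternating forms on a vector space, and formal polynomial-valued forms -/

section MixedForm

variable {V : Type*} [AddCommGroup V] [Module ℝ V] [TopologicalSpace V]
  {A : Type*} [NormedRing A] [NormedAlgebra ℝ A]

/-- The tensor product of two multilinear maps with values in an algebra. -/
def tensorMul {i l n : ℕ} (h : i + l = n) (α : V [⋀^Fin i]→L[ℝ] A) (β : V [⋀^Fin l]→L[ℝ] A) :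
    ContinuousMultilinearMap ℝ (fun _ : Fin n => V) A where
  toMultilinearMap := ((LinearMap.mul' ℝ A).compMultilinearMap
    (α.toMultilinearMap.domCoprod β.toMultilinearMap)).domDomCongr
      (finSumFinEquiv.trans (finCongr h))
  cont := by
    change Continuous fun v : Fin n → V =>
      α (fun s => v (finCongr h (finSumFinEquiv (Sum.inl s)))) *
        β (fun s => v (finCongr h (finSumFinEquiv (Sum.inr s))))
    exact (α.cont.comp (continuous_pi fun s => continuous_apply _)).mul
      (β.cont.comp (continuous_pi fun s => continuous_apply _))

theorem tensorMul_apply {i l n : ℕ} (h : i + l = n) (α : V [⋀^Fin i]→L[ℝ] A)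
    (β : V [⋀^Fin l]→L[ℝ] A) (v : Fin n → V) :
    tensorMul h α β v = α (fun s => v (finCongr h (finSumFinEquiv (Sum.inl s)))) *
      β (fun s => v (finCongr h (finSumFinEquiv (Sum.inr s)))) := rfl

/-- The wedge product of forms with values in an algebra, normalised so that
`(α ∧ β)(v, w) = α v * β w - α w * β v` for one-forms. -/
def wedge {i l n : ℕ} (h : i + l = n) (α : V [⋀^Fin i]→L[ℝ] A) (β : V [⋀^Fin l]→L[ℝ] A) :
    V [⋀^Fin n]→L[ℝ] A :=
  ((i.factorial : ℝ)⁻¹ * (l.factorial : ℝ)⁻¹) •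
    ContinuousMultilinearMap.alternatization (tensorMul h α β)

/-- Contraction of a form with a vector, inserted in the first slot. -/
def contract {F : Type*} [NormedAddCommGroup F] [NormedSpace ℝ F] {j : ℕ} (v : V)
    (α : V [⋀^Fin (j + 1)]→L[ℝ] F) : V [⋀^Fin j]→L[ℝ] F where
  toMultilinearMap := (α.toAlternatingMap.curryLeft v).toMultilinearMap
  cont := by
    change Continuous fun w : Fin j → V => α (Matrix.vecCons v w)
    exact α.cont.comp (continuous_const.matrixVecCons continuous_id)
  map_eq_zero_of_eq' := (α.toAlternatingMap.curryLeft v).map_eq_zero_of_eq'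

variable (V A) in
/-- The value at a vector `ξ` of the Lie algebra and at a point with tangent space `V` of an
element of the completion `∏ₖⱼ Sᵏ(𝔤*) ⊗ Ωʲ` of `S(𝔤*) ⊗ Ω`, with coefficients in `A`;
the first index is the polynomial degree `k`, the second the form degree `j`. -/
abbrev MixedForm : Type _ := (_k j : ℕ) → V [⋀^Fin j]→L[ℝ] A

/-- The product of formal polynomial-valued forms. -/
def MixedForm.mul (α β : MixedForm V A) : MixedForm V A := fun k j =>
  ∑ p ∈ Finset.HasAntidiagonal.antidiagonal k, ∑ q ∈ (Finset.HasAntidiagonal.antidiagonal j).attach,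
    wedge (Finset.HasAntidiagonal.mem_antidiagonal.1 q.2) (α p.1 q.1.1) (β p.2 q.1.2)

/-- The unit. -/
def MixedForm.one : MixedForm V A
  | 0, 0 => ContinuousAlternatingMap.constOfIsEmpty ℝ V (Fin 0) 1
  | _, _ => 0

/-- Powers. -/
def MixedForm.pow (α : MixedForm V A) : ℕ → MixedForm V A
  | 0 => MixedForm.one
  | n + 1 => MixedForm.mul α (MixedForm.pow α n)

/-- The exponential series `∑ₙ αⁿ / n!` of an element with no component in bidegree `(0, 0)`:
for such `α` the terms with `n > k + j` have no component in bidegree `(k, j)`. -/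
def MixedForm.exp (α : MixedForm V A) : MixedForm V A := fun k j =>
  ∑ n ∈ Finset.range (k + j + 1), ((n.factorial : ℝ)⁻¹) • MixedForm.pow α n k j

end MixedForm

/-! ### Differential forms on a (possibly infinite-dimensional) manifold without boundary -/

section Forms

variable {E : Type*} [NormedAddCommGroup E] [NormedSpace ℝ E] {S : Type*} [TopologicalSpace S]
  (I : ModelWithCorners ℝ E S) {N : Type*} [TopologicalSpace N] [ChartedSpace S N]
  {F : Type*} [NormedAddCommGroup F] [NormedSpace ℝ F]

variable (N F) in
/-- Not necessarily smooth `F`-valued differential forms of degree `j`. -/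
abbrev RawForm (j : ℕ) : Type _ := (x : N) → (TangentSpace I x) [⋀^Fin j]→L[ℝ] F

/-- The expression of a form in the chart around `x`. -/
def chartRep {j : ℕ} (w : RawForm I N F j) (x : N) (y : E) : E [⋀^Fin j]→L[ℝ] F :=
  (w ((extChartAt I x).symm y)).compContinuousLinearMap
    (mfderiv 𝓘(ℝ, E) I (extChartAt I x).symm y : E →L[ℝ] TangentSpace I ((extChartAt I x).symm y))

/-- Smoothness of a form at a point. -/
def SmoothFormAt {j : ℕ} (w : RawForm I N F j) (x : N) : Prop :=
  ContDiffAt ℝ ∞ (chartRep I w x) (extChartAt I x x)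

/-- The exterior derivative. -/
def extD {j : ℕ} (w : RawForm I N F j) : RawForm I N F (j + 1) := fun x =>
  (extDeriv (chartRep I w x) (extChartAt I x x)).compContinuousLinearMap
    (mfderiv I 𝓘(ℝ, E) (extChartAt I x) x : TangentSpace I x →L[ℝ] E)

theorem SmoothFormAt.add {j : ℕ} {w η : RawForm I N F j} {x : N} (h : SmoothFormAt I w x)
    (h' : SmoothFormAt I η x) : SmoothFormAt I (w + η) x :=
  ContDiffAt.add h h'

theorem SmoothFormAt.zero {j : ℕ} {x : N} : SmoothFormAt I (0 : RawForm I N F j) x :=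
  contDiffAt_const (c := (0 : E [⋀^Fin j]→L[ℝ] F))

theorem SmoothFormAt.smul {j : ℕ} {w : RawForm I N ℂ j} {x : N}
    (h : SmoothFormAt I w x) (c : ℂ) : SmoothFormAt I (c • w) x := by
  have e : chartRep I (c • w) x = c • chartRep I w x := rfl
  unfold SmoothFormAt at h ⊢
  rw [e]
  exact h.const_smul c

theorem extD_add {j : ℕ} {w η : RawForm I N F j} (h : ∀ x, SmoothFormAt I w x)
    (h' : ∀ x, SmoothFormAt I η x) : extD I (w + η) = extD I w + extD I η := by
  funext x
  have : extDeriv (chartRep I (w + η) x) (extChartAt I x x) =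
      extDeriv (chartRep I w x) (extChartAt I x x) + extDeriv (chartRep I η x) (extChartAt I x x) :=
    extDeriv_add ((h x).differentiableAt (by simp)) ((h' x).differentiableAt (by simp))
  simp only [extD, this]
  rfl

theorem extD_smul {j : ℕ} {w : RawForm I N ℂ j}
    (h : ∀ x, SmoothFormAt I w x) (c : ℂ) : extD I (c • w) = c • extD I w := by
  funext x
  have hd : DifferentiableAt ℝ (chartRep I w x) (extChartAt I x x) :=
    (h x).differentiableAt (by simp)
  have : fderiv ℝ (chartRep I (c • w) x) (extChartAt I x x) =
      c • fderiv ℝ (chartRep I w x) (extChartAt I x x) :=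
    fderiv_const_smul hd c
  have h2 : extDeriv (chartRep I (c • w) x) (extChartAt I x x) =
      c • extDeriv (chartRep I w x) (extChartAt I x x) := by
    ext v
    simp only [extDeriv, this, ContinuousAlternatingMap.alternatizeUncurryFin_apply,
      ContinuousAlternatingMap.smul_apply, _root_.smul_apply, Finset.smul_sum]
    exact Finset.sum_congr rfl fun i _ => smul_comm _ _ _
  simp only [extD, h2]
  rfl

end Forms

/-! ### The Cartan model -/

section Cartan

variable {EG : Type*} [NormedAddCommGroup EG] [NormedSpace ℝ EG]
  {G : Type*} [TopologicalSpace G] [ChartedSpace EG G] [Group G]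
  {E : Type*} [NormedAddCommGroup E] [NormedSpace ℝ E]
  {N : Type*} [TopologicalSpace N] [ChartedSpace E N]

theorem wedge_add_right {V : Type*} [AddCommGroup V] [Module ℝ V] [TopologicalSpace V]
    {i l n : ℕ} (h : i + l = n) (α : V [⋀^Fin i]→L[ℝ] ℂ) (β β' : V [⋀^Fin l]→L[ℝ] ℂ) :
    wedge h α (β + β') = wedge h α β + wedge h α β' := by
  have : tensorMul h α (β + β') = tensorMul h α β + tensorMul h α β' := by
    ext v
    simp [tensorMul_apply, mul_add]
  simp [wedge, this]

theorem wedge_smul_right {V : Type*} [AddCommGroup V] [Module ℝ V] [TopologicalSpace V]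
    {i l n : ℕ} (h : i + l = n) (α : V [⋀^Fin i]→L[ℝ] ℂ) (β : V [⋀^Fin l]→L[ℝ] ℂ) (c : ℂ) :
    wedge h α (c • β) = c • wedge h α β := by
  ext v
  simp only [wedge, ContinuousAlternatingMap.smul_apply,
    ContinuousMultilinearMap.alternatization_apply_apply, tensorMul_apply, Finset.smul_sum]
  refine Finset.sum_congr rfl fun σ _ => ?_
  rw [smul_comm c, smul_comm c, smul_eq_mul, smul_eq_mul, mul_left_comm]

/-- The adjoint action of a Lie group on its Lie algebra. -/
def Ad (g : G) (ξ : GroupLieAlgebra 𝓘(ℝ, EG) G) : GroupLieAlgebra 𝓘(ℝ, EG) G :=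
  (mfderiv 𝓘(ℝ, EG) 𝓘(ℝ, EG) (fun h : G => g * h * g⁻¹) 1 ξ : EG)

variable (EG G E N) in
/-- Families, over the Lie algebra, of formal complex-valued forms, with no condition. -/
def RawCartan : Type _ :=
  GroupLieAlgebra 𝓘(ℝ, EG) G → (x : N) → MixedForm (TangentSpace 𝓘(ℝ, E) x) ℂ

instance : AddCommGroup (RawCartan EG G E N) :=
  inferInstanceAs (AddCommGroup (GroupLieAlgebra 𝓘(ℝ, EG) G → (x : N) →
    MixedForm (TangentSpace 𝓘(ℝ, E) x) ℂ))

instance : Module ℂ (RawCartan EG G E N) :=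
  inferInstanceAs (Module ℂ (GroupLieAlgebra 𝓘(ℝ, EG) G → (x : N) →
    MixedForm (TangentSpace 𝓘(ℝ, E) x) ℂ))

@[simp] theorem RawCartan.add_apply (α β : RawCartan EG G E N) (ξ : GroupLieAlgebra 𝓘(ℝ, EG) G)
    (x : N) (k j : ℕ) : (α + β) ξ x k j = α ξ x k j + β ξ x k j := rfl

@[simp] theorem RawCartan.smul_apply (c : ℂ) (α : RawCartan EG G E N)
    (ξ : GroupLieAlgebra 𝓘(ℝ, EG) G) (x : N) (k j : ℕ) : (c • α) ξ x k j = c • α ξ x k j := rfl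

/-- The product of families of formal forms. -/
def mulCartan (α β : RawCartan EG G E N) : RawCartan EG G E N := fun ξ x =>
  MixedForm.mul (α ξ x) (β ξ x)

theorem mulCartan_add_right (h α β : RawCartan EG G E N) :
    mulCartan h (α + β) = mulCartan h α + mulCartan h β := by
  funext ξ x k j
  simp only [mulCartan, MixedForm.mul, RawCartan.add_apply, wedge_add_right,
    Finset.sum_add_distrib]

theorem mulCartan_smul_right (h α : RawCartan EG G E N) (c : ℂ) :
    mulCartan h (c • α) = c • mulCartan h α := by
  funext ξ x k j
  simp only [mulCartan, MixedForm.mul, RawCartan.smul_apply, wedge_smul_right, Finset.smul_sum]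

variable [MulAction G N]

/-- The vector field `ξ̂` on a `G`-manifold induced by `ξ`, with the sign for which it acts on
functions by `(ξ̂ φ)(x) = d/dt φ(exp(-tξ) x)` at `t = 0`. -/
def fundVF (ξ : GroupLieAlgebra 𝓘(ℝ, EG) G) (x : N) : TangentSpace 𝓘(ℝ, E) x :=
  (-(mfderiv 𝓘(ℝ, EG) 𝓘(ℝ, E) (fun g : G => g • x) 1 ξ) : E)

/-- The Cartan differential `d - ι`, where `ι` raises the polynomial degree by one. -/
def dCartan (α : RawCartan EG G E N) : RawCartan EG G E N := fun ξ x k j =>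
  (match j with
    | 0 => 0
    | j + 1 => extD 𝓘(ℝ, E) (fun y => α ξ y k j) x) -
  (match k with
    | 0 => 0
    | k + 1 => contract (fundVF ξ x) (α ξ x k (j + 1)))

variable (EG G E N) in
/-- The (completed) Cartan complex `∏ₖⱼ (Sᵏ(𝔤*) ⊗ Ωʲ(N))ᴳ`: the component of bidegree `(k, j)` is a
homogeneous polynomial of degree `k` on the Lie algebra with values in smooth `j`-forms, and is
invariant under the group. -/
def cartanComplex : Submodule ℂ (RawCartan EG G E N) where
  carrier := {α |
    (∀ ξ k j x, SmoothFormAt 𝓘(ℝ, E) (fun y => α ξ y k j) x) ∧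
    (∀ k j, ∃ m : MultilinearMap ℝ (fun _ : Fin k => GroupLieAlgebra 𝓘(ℝ, EG) G)
        (RawForm 𝓘(ℝ, E) N ℂ j), ∀ ξ x, α ξ x k j = m (fun _ => ξ) x) ∧
    (∀ (g : G) ξ x k j, (α (Ad g ξ) (g • x) k j).compContinuousLinearMap
        (mfderiv 𝓘(ℝ, E) 𝓘(ℝ, E) (fun y : N => g • y) x) = α ξ x k j)}
  zero_mem' := by
    refine ⟨fun ξ k j x => SmoothFormAt.zero _, fun k j => ⟨0, fun ξ x => rfl⟩, ?_⟩
    intro g ξ x k j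
    rfl
  add_mem' := by
    rintro α β ⟨h1, h2, h3⟩ ⟨h1', h2', h3'⟩
    refine ⟨fun ξ k j x => SmoothFormAt.add _ (h1 ξ k j x) (h1' ξ k j x), fun k j => ?_, ?_⟩
    · obtain ⟨m, hm⟩ := h2 k j
      obtain ⟨m', hm'⟩ := h2' k j
      refine ⟨m + m', fun ξ x => ?_⟩
      simp [hm, hm']
    · intro g ξ x k j
      have e := h3 g ξ x k j
      have e' := h3' g ξ x k j
      change _ = α ξ x k j + β ξ x k j
      rw [← e, ← e']
      rfl
  smul_mem' := by
    rintro c α ⟨h1, h2, h3⟩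
    refine ⟨fun ξ k j x => SmoothFormAt.smul _ (h1 ξ k j x) c, fun k j => ?_, ?_⟩
    · obtain ⟨m, hm⟩ := h2 k j
      refine ⟨c • m, fun ξ x => ?_⟩
      simp [hm]
    · intro g ξ x k j
      have e := h3 g ξ x k j
      change _ = c • α ξ x k j
      rw [← e]
      rfl

/-- `α` is homogeneous of total degree `n`, where `Sᵏ(𝔤*) ⊗ Ωʲ` has degree `2k + j`. -/
def HasDegree (n : ℕ) (α : RawCartan EG G E N) : Prop :=
  ∀ ξ x k j, 2 * k + j ≠ n → α ξ x k j = 0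

theorem dCartan_add {α β : RawCartan EG G E N} (hα : α ∈ cartanComplex EG G E N)
    (hβ : β ∈ cartanComplex EG G E N) : dCartan (α + β) = dCartan α + dCartan β := by
  funext ξ x k j
  have hd : ∀ j, extD 𝓘(ℝ, E) (fun y => α ξ y k j + β ξ y k j) x =
      extD 𝓘(ℝ, E) (fun y => α ξ y k j) x + extD 𝓘(ℝ, E) (fun y => β ξ y k j) x := fun j =>
    congrFun (extD_add 𝓘(ℝ, E) (w := fun y => α ξ y k j) (η := fun y => β ξ y k j)
      (hα.1 ξ k j) (hβ.1 ξ k j)) x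
  have hc : ∀ k j, contract (fundVF ξ x) (α ξ x k (j + 1) + β ξ x k (j + 1)) =
      contract (fundVF ξ x) (α ξ x k (j + 1)) + contract (fundVF ξ x) (β ξ x k (j + 1)) :=
    fun k j => rfl
  change dCartan (α + β) ξ x k j = dCartan α ξ x k j + dCartan β ξ x k j
  cases j <;> cases k <;> simp only [dCartan, RawCartan.add_apply, hd, hc] <;> abel

theorem dCartan_smul {α : RawCartan EG G E N} (hα : α ∈ cartanComplex EG G E N) (c : ℂ) :
    dCartan (c • α) = c • dCartan α := by
  funext ξ x k j
  have hd : ∀ j, extD 𝓘(ℝ, E) (fun y => c • α ξ y k j) x =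
      c • extD 𝓘(ℝ, E) (fun y => α ξ y k j) x := fun j =>
    congrFun (extD_smul 𝓘(ℝ, E) (w := fun y => α ξ y k j) (hα.1 ξ k j) c) x
  have hc : ∀ k j, contract (fundVF ξ x) (c • α ξ x k (j + 1)) =
      c • contract (fundVF ξ x) (α ξ x k (j + 1)) := fun k j => rfl
  change dCartan (c • α) ξ x k j = c • dCartan α ξ x k j
  cases j <;> cases k <;> simp only [dCartan, RawCartan.smul_apply, hd, hc, smul_sub, smul_zero]

/-- The twisted differential `d_𝔤 - h` on the Cartan complex. -/
def twistedD (h : RawCartan EG G E N) : cartanComplex EG G E N →ₗ[ℂ] RawCartan EG G E N where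
  toFun α := dCartan α.1 - mulCartan h α.1
  map_add' α β := by
    rw [Submodule.coe_add, dCartan_add α.2 β.2, mulCartan_add_right]
    abel
  map_smul' c α := by
    rw [Submodule.coe_smul, dCartan_smul α.2, mulCartan_smul_right, RingHom.id_apply, smul_sub]

/-- The cocycles of the twisted differential. -/
abbrev twistedCocycles (h : RawCartan EG G E N) : Submodule ℂ (cartanComplex EG G E N) :=
  LinearMap.ker (twistedD h)

/-- The twisted equivariant cohomology: cocycles modulo coboundaries of the complex
`(Ω_G, d_𝔤 - h)`. -/
abbrev TwistedCohomology (h : RawCartan EG G E N) : Type _ :=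
  twistedCocycles h ⧸ (((LinearMap.range (twistedD h)).comap
    (cartanComplex EG G E N).subtype).comap (twistedCocycles h).subtype)

end Cartan

/-! ### Equivariant principal `PU(H)`-bundles and their lifting bundle gerbe -/

section Gerbe

variable (EG : Type*) [NormedAddCommGroup EG] [NormedSpace ℝ EG]
  (G : Type*) [TopologicalSpace G] [ChartedSpace EG G] [Group G]
  (EM : Type*) [NormedAddCommGroup EM] [NormedSpace ℝ EM]
  (M : Type*) [TopologicalSpace M] [ChartedSpace EM M] [MulAction G M]
  (EP : Type*) [NormedAddCommGroup EP] [NormedSpace ℝ EP]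
  (P : Type*) [TopologicalSpace P] [ChartedSpace EP P] [MulAction G P]
  (H : Type*) [NormedAddCommGroup H] [InnerProductSpace ℂ H] [CompleteSpace H]

/-- A smooth `G`-equivariant principal `PU(H)`-bundle `P → M`, where `U(H)` has the norm topology
and the charts `a ↦ u exp(ia)`, with `a` self-adjoint. The right action of `PU(H)` is given as an
action of `U(H)` for which the stabiliser of every point is the group of unitary scalars. -/
structure EquivPUBundle where
  /-- the projection -/
  proj : P → M
  proj_smooth : ContMDiff 𝓘(ℝ, EP) 𝓘(ℝ, EM) ∞ proj
  proj_equivariant : ∀ (g : G) p, proj (g • p) = g • proj p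
  /-- the right action of the unitary group -/
  act : P → unitary (H →L[ℂ] H) → P
  act_one : ∀ p, act p 1 = p
  act_mul : ∀ p u v, act p (u * v) = act (act p u) v
  act_eq_self_iff : ∀ p u, act p u = p ↔ ∃ c : ℂ, (u : H →L[ℂ] H) = c • 1
  proj_eq_iff : ∀ p q, proj p = proj q ↔ ∃ u, act p u = q
  act_smooth : ∀ u, ContMDiff (𝓘(ℝ, EP).prod 𝓘(ℝ, selfAdjoint (H →L[ℂ] H))) 𝓘(ℝ, EP) ∞
    (fun x : P × selfAdjoint (H →L[ℂ] H) => act x.1 (u * selfAdjoint.expUnitary x.2))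
  smul_smooth : ContMDiffSMul 𝓘(ℝ, EG) 𝓘(ℝ, EP) ∞ G P
  act_equivariant : ∀ (g : G) p u, g • act p u = act (g • p) u
  /-- Local triviality: around each point of `M` there is a smooth local section `s` such that
  the map `q ↦ [w]` determined by `q = s(π(q))[w]` lifts locally to a smooth map to `U(H)`. -/
  locally_trivial : ∀ m : M, ∃ (W : Set M) (s : M → P), IsOpen W ∧ m ∈ W ∧
    ContMDiffOn 𝓘(ℝ, EM) 𝓘(ℝ, EP) ∞ s W ∧ (∀ x ∈ W, proj (s x) = x) ∧
    ∀ p, proj p ∈ W → ∃ w : P → unitary (H →L[ℂ] H),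
      ContMDiffAt 𝓘(ℝ, EP) 𝓘(ℝ, H →L[ℂ] H) ∞ (fun q => (w q : H →L[ℂ] H)) p ∧
      ∀ᶠ q in nhds p, act (s (proj q)) (w q) = q

variable {EG G EM M EP P H}

namespace EquivPUBundle

variable (B : EquivPUBundle EG G EM M EP P H)

/-- The fibre at `(p, q)` of the lifting bundle gerbe: the complex line spanned by the unitary
operators `u` with `q = p[u]` (and `0` if `p`, `q` are not in the same fibre of `P`).
The product `L_{(p,q)} ⊗ L_{(q,r)} → L_{(p,r)}` is the composition of operators, and the group `G`
acts by the identity `L_{(p,q)} → L_{(gp,gq)}`. -/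
def L (p q : P) : Submodule ℂ (H →L[ℂ] H) :=
  Submodule.span ℂ {T | ∃ u : unitary (H →L[ℂ] H), T = u ∧ B.act p u = q}

/-- The derivative at `(p, u)` of the action map `P × U(H) → P`. The tangent space of `U(H)` at `u`
is identified with the self-adjoint operators by `a ↦ u i a`. -/
def dact (p : P) (u : unitary (H →L[ℂ] H)) (X : TangentSpace 𝓘(ℝ, EP) p)
    (a : selfAdjoint (H →L[ℂ] H)) : TangentSpace 𝓘(ℝ, EP) (B.act p u) :=
  (mfderiv (𝓘(ℝ, EP).prod 𝓘(ℝ, selfAdjoint (H →L[ℂ] H))) 𝓘(ℝ, EP)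
    (fun x : P × selfAdjoint (H →L[ℂ] H) => B.act x.1 (u * selfAdjoint.expUnitary x.2))
    (p, 0) (X, a) : EP)

/-- The tangent vector of `P × U(H)`, regarded as a subset of `P × B(H)`, at `(p, u)` given by `X`
and `u i a`. -/
def tvec (p : P) (u : unitary (H →L[ℂ] H)) (X : TangentSpace 𝓘(ℝ, EP) p)
    (a : selfAdjoint (H →L[ℂ] H)) :
    TangentSpace (𝓘(ℝ, EP).prod 𝓘(ℝ, H →L[ℂ] H)) ((p, u) : P × (H →L[ℂ] H)) :=
  ((X, (u : H →L[ℂ] H) * (Complex.I • (a : H →L[ℂ] H))) : EP × (H →L[ℂ] H))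

/-- A `G`-invariant bundle gerbe connection on the lifting bundle gerbe `L → P^[2]`.
The unitary frame bundle of `L` is the `U(1)`-bundle `P × U(H) → P^[2]`, `(p, u) ↦ (p, p[u])`, and
the connection is given by its connection form there: `∇ u = θ ⊗ u` for a local section `u` with
unitary values. The form is the restriction to `P × U(H)` of a form on `P × B(H)` of which only the
values on vectors tangent to `P × U(H)` matter. -/
structure GerbeConnection where
  /-- the connection form -/
  form : RawForm (𝓘(ℝ, EP).prod 𝓘(ℝ, H →L[ℂ] H)) (P × (H →L[ℂ] H)) ℂ 1
  smooth : ∀ (p : P) (u : unitary (H →L[ℂ] H)), SmoothFormAt _ form (p, (u : H →L[ℂ] H))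
  /-- the form reproduces the generator of the `U(1)`-action -/
  vertical : ∀ (p : P) (u : unitary (H →L[ℂ] H)) (t : ℝ),
    form (p, (u : H →L[ℂ] H)) (fun _ => tvec p u 0 (t • 1)) = t * Complex.I
  /-- the form is invariant under the `U(1)`-action -/
  scalar_invariant : ∀ (p : P) (u v : unitary (H →L[ℂ] H)) (c : ℂ) X a,
    (v : H →L[ℂ] H) = c • (u : H →L[ℂ] H) →
    form (p, (v : H →L[ℂ] H)) (fun _ => tvec p v X a) =
      form (p, (u : H →L[ℂ] H)) (fun _ => tvec p u X a)
  /-- compatibility with the product: `∇(uv) = (∇u) v + u ∇v` -/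
  multiplicative : ∀ (p : P) (u v : unitary (H →L[ℂ] H)) X (a b : selfAdjoint (H →L[ℂ] H)),
    form (p, (u * v : H →L[ℂ] H)) (fun _ =>
      ((X, (u : H →L[ℂ] H) * (Complex.I • (a : H →L[ℂ] H)) * v +
        (u * v : H →L[ℂ] H) * (Complex.I • (b : H →L[ℂ] H))) : EP × (H →L[ℂ] H))) =
      form (p, (u : H →L[ℂ] H)) (fun _ => tvec p u X a) +
      form (B.act p u, (v : H →L[ℂ] H)) (fun _ => tvec (B.act p u) v (B.dact p u X a) b)
  /-- invariance under `G` -/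
  invariant : ∀ (g : G) (p : P) (u : unitary (H →L[ℂ] H)) X a,
    form (g • p, (u : H →L[ℂ] H)) (fun _ =>
      tvec (g • p) u (mfderiv 𝓘(ℝ, EP) 𝓘(ℝ, EP) (fun q : P => g • q) p X) a) =
      form (p, (u : H →L[ℂ] H)) (fun _ => tvec p u X a)

/-- The moment map `μ̃_L(ξ) = ℒ_ξ - ∇_ξ̂` of the gerbe connection at the point `(p, p[u])`,
computed on the `G`-invariant section with constant value `u`. -/
def GerbeConnection.moment {B : EquivPUBundle EG G EM M EP P H} (θ : B.GerbeConnection) (p : P)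
    (u : unitary (H →L[ℂ] H)) (ξ : GroupLieAlgebra 𝓘(ℝ, EG) G) : ℂ :=
  -θ.form (p, (u : H →L[ℂ] H)) (fun _ => tvec p u (fundVF ξ p) 0)

/-- An equivariant curving `f - μ_L ∈ Ω_G²(P)` for a gerbe connection with curvature `F_L` and moment
map `μ̃_L`. With `π₁(p, q) = q` and `π₂(p, q) = p` it satisfies `F_L = π₁^* f - π₂^* f` and
`μ̃_L = π₂^* μ_L - π₁^* μ_L`; both equations are pulled back to `P × U(H)`. -/
structure EquivCurving {B : EquivPUBundle EG G EM M EP P H} (θ : B.GerbeConnection) where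
  /-- the curving -/
  f : RawForm 𝓘(ℝ, EP) P ℂ 2
  /-- the moment map -/
  muL : GroupLieAlgebra 𝓘(ℝ, EG) G → P → ℂ
  /-- `f - μ_L` as an element of the Cartan complex -/
  cartan : cartanComplex EG G EP P
  degree_two : HasDegree 2 cartan.1
  cartan_f : ∀ ξ p, cartan.1 ξ p 0 2 = f p
  cartan_muL : ∀ ξ p v, cartan.1 ξ p 1 0 v = -muL ξ p
  curvature_eq : ∀ (p : P) (u : unitary (H →L[ℂ] H)) X Y a b,
    extD _ θ.form (p, (u : H →L[ℂ] H)) ![tvec p u X a, tvec p u Y b] =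
      f (B.act p u) ![B.dact p u X a, B.dact p u Y b] - f p ![X, Y]
  moment_eq : ∀ (p : P) (u : unitary (H →L[ℂ] H)) ξ,
    θ.moment p u ξ = muL ξ p - muL ξ (B.act p u)

/-! ### Equivariant bundle gerbe modules and their connections -/

/-- A `G`-equivariant bundle gerbe module for the lifting bundle gerbe: a `G`-equivariant
`GL_tr`-vector bundle `E → P`, with an action `E_q ⊗ L_{(p,q)} → E_p` of `L`.

The reduction `R` of the frame bundle of `E` to `GL_tr` (the invertible operators which differ from
the identity by a trace class operator) is given by local smooth frames. Both `f ↦ σ_g ∘ f` and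
`f ↦ ψ_u ∘ f ∘ u⁻¹` preserve `R`, and do so smoothly. -/
structure EquivModule (E : P → Type*) [∀ p, AddCommGroup (E p)] [∀ p, Module ℂ (E p)] where
  /-- the domain of the local frame around a point -/
  dom : P → Set P
  isOpen_dom : ∀ a, IsOpen (dom a)
  mem_dom : ∀ a, a ∈ dom a
  /-- the local frame around `a`; only its values on `dom a` matter -/
  frame : (a p : P) → H ≃ₗ[ℂ] E p
  /-- transition functions, minus the identity -/
  trans : P → P → P → TraceClass H
  trans_smooth : ∀ a b, ContMDiffOn 𝓘(ℝ, EP) 𝓘(ℝ, TraceClass H) ∞ (trans a b) (dom a ∩ dom b)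
  frame_trans : ∀ a b, ∀ p ∈ dom a ∩ dom b, ∀ h,
    frame b p h = frame a p (h + (trans a b p).op h)
  /-- the action `σ_g : E_p → E_{gp}` of the group -/
  sigma : (g : G) → (p q : P) → g • p = q → (E p ≃ₗ[ℂ] E q)
  sigma_one : ∀ p (h : (1 : G) • p = p) e, sigma 1 p p h e = e
  sigma_mul : ∀ (g g' : G) p q r (h : g' • p = q) (h' : g • q = r) (h'' : (g * g') • p = r) e,
    sigma (g * g') p r h'' e = sigma g q r h' (sigma g' p q h e)
  /-- the matrices of `σ_g` in the local frames, minus the identity -/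
  sigmaMat : P → P → G × P → TraceClass H
  sigmaMat_smooth : ∀ a b, ContMDiffOn (𝓘(ℝ, EG).prod 𝓘(ℝ, EP)) 𝓘(ℝ, TraceClass H) ∞
    (sigmaMat a b) {x | x.2 ∈ dom a ∧ x.1 • x.2 ∈ dom b}
  sigma_frame : ∀ a b g p q (h : g • p = q), p ∈ dom a → q ∈ dom b → ∀ v,
    sigma g p q h (frame a p v) = frame b q (v + (sigmaMat a b (g, p)).op v)
  /-- the action `ψ : E_q ⊗ L_{(p,q)} → E_p` of the bundle gerbe -/
  psi : (p q : P) → B.L p q →ₗ[ℂ] E q →ₗ[ℂ] E p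
  psi_one : ∀ p (u : B.L p p), (u : H →L[ℂ] H) = 1 → ∀ e, psi p p u e = e
  psi_mul : ∀ p q r (u : B.L p q) (v : B.L q r) (w : B.L p r),
    (w : H →L[ℂ] H) = u * v → ∀ e, psi p r w e = psi p q u (psi q r v e)
  psi_sigma : ∀ (g : G) p q p' q' (hp : g • p = p') (hq : g • q = q') (u : B.L p q)
    (u' : B.L p' q'), (u' : H →L[ℂ] H) = u → ∀ e,
    sigma g p p' hp (psi p q u e) = psi p' q' u' (sigma g q q' hq e)
  /-- the matrices of `ψ_u` in the local frames, composed with `u⁻¹`, minus the identity -/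
  psiMat : P → P → P × unitary (H →L[ℂ] H) → TraceClass H
  psiMat_smooth : ∀ a b u, ContMDiffOn (𝓘(ℝ, EP).prod 𝓘(ℝ, selfAdjoint (H →L[ℂ] H)))
    𝓘(ℝ, TraceClass H) ∞
    (fun x : P × selfAdjoint (H →L[ℂ] H) => psiMat a b (x.1, u * selfAdjoint.expUnitary x.2))
    {x | x.1 ∈ dom a ∧ B.act x.1 (u * selfAdjoint.expUnitary x.2) ∈ dom b}
  psi_frame : ∀ a b p q (u : unitary (H →L[ℂ] H)) (u' : B.L p q), (u' : H →L[ℂ] H) = u →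
    B.act p u = q → p ∈ dom a → q ∈ dom b → ∀ v,
    psi p q u' (frame b q v) =
      frame a p ((u : H →L[ℂ] H) v + (psiMat a b (p, u)).op ((u : H →L[ℂ] H) v))

/-- The matrix of `ψ_u : E_{p[u]} → E_p` in the local frames around `a` and `b`. -/
def EquivModule.psiMatrix {B : EquivPUBundle EG G EM M EP P H} {E : P → Type*}
    [∀ p, AddCommGroup (E p)] [∀ p, Module ℂ (E p)] (𝓔 : B.EquivModule E) (a b p : P)
    (u : unitary (H →L[ℂ] H)) : H →L[ℂ] H :=
  (1 + (𝓔.psiMat a b (p, u)).op) * (u : H →L[ℂ] H)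

/-- The derivative of `psiMatrix` at `(p, u)` in the direction of the tangent vector `(X, u i c)` of
`P × U(H)`. -/
def EquivModule.dpsiMatrix {B : EquivPUBundle EG G EM M EP P H} {E : P → Type*}
    [∀ p, AddCommGroup (E p)] [∀ p, Module ℂ (E p)] (𝓔 : B.EquivModule E) (a b p : P)
    (u : unitary (H →L[ℂ] H)) (X : TangentSpace 𝓘(ℝ, EP) p) (c : selfAdjoint (H →L[ℂ] H)) :
    H →L[ℂ] H :=
  (mfderiv (𝓘(ℝ, EP).prod 𝓘(ℝ, selfAdjoint (H →L[ℂ] H))) 𝓘(ℝ, H →L[ℂ] H)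
    (fun x : P × selfAdjoint (H →L[ℂ] H) =>
      𝓔.psiMatrix a b x.1 (u * selfAdjoint.expUnitary x.2)) (p, 0) (X, c) : H →L[ℂ] H)

/-- A `G`-equivariant module connection. In the local frame around `a` the connection is
`d + A a`. -/
structure EquivModule.Connection {B : EquivPUBundle EG G EM M EP P H} {E : P → Type*}
    [∀ p, AddCommGroup (E p)] [∀ p, Module ℂ (E p)] (𝓔 : B.EquivModule E)
    (θ : B.GerbeConnection) where
  /-- the local connection forms -/
  A : P → RawForm 𝓘(ℝ, EP) P (H →L[ℂ] H) 1
  smooth : ∀ a, ∀ p ∈ 𝓔.dom a, SmoothFormAt 𝓘(ℝ, EP) (A a) p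
  /-- the change of frame -/
  gauge : ∀ a b, ∀ p ∈ 𝓔.dom a ∩ 𝓔.dom b, ∀ X : TangentSpace 𝓘(ℝ, EP) p,
    (1 + (𝓔.trans a b p).op) * A b p (fun _ => X) =
      A a p (fun _ => X) * (1 + (𝓔.trans a b p).op) +
        (mfderiv 𝓘(ℝ, EP) 𝓘(ℝ, TraceClass H) (𝓔.trans a b) p X : TraceClass H).op
  /-- invariance: `∇_{g X} (σ_g s) = σ_g (∇_X s)` -/
  invariant : ∀ a b (g : G) p, p ∈ 𝓔.dom a → g • p ∈ 𝓔.dom b → ∀ X : TangentSpace 𝓘(ℝ, EP) p,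
    (mfderiv 𝓘(ℝ, EP) 𝓘(ℝ, TraceClass H) (fun q => 𝓔.sigmaMat a b (g, q)) p X :
        TraceClass H).op +
      A b (g • p) (fun _ => mfderiv 𝓘(ℝ, EP) 𝓘(ℝ, EP) (fun q : P => g • q) p X) *
        (1 + (𝓔.sigmaMat a b (g, p)).op) =
      (1 + (𝓔.sigmaMat a b (g, p)).op) * A a p (fun _ => X)
  /-- compatibility with the gerbe connection: `∇ (ψ (e ⊗ u)) = ψ (∇ e ⊗ u + e ⊗ ∇ u)` -/
  compatible : ∀ a b p (u : unitary (H →L[ℂ] H)), p ∈ 𝓔.dom a → B.act p u ∈ 𝓔.dom b →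
    ∀ (X : TangentSpace 𝓘(ℝ, EP) p) (c : selfAdjoint (H →L[ℂ] H)),
    𝓔.dpsiMatrix a b p u X c + A a p (fun _ => X) * 𝓔.psiMatrix a b p u =
      𝓔.psiMatrix a b p u * (A b (B.act p u) (fun _ => B.dact p u X c) +
        θ.form (p, (u : H →L[ℂ] H)) (fun _ => tvec p u X c) • 1)

namespace EquivModule.Connection

variable {B : EquivPUBundle EG G EM M EP P H} {E : P → Type*} [∀ p, AddCommGroup (E p)]
  [∀ p, Module ℂ (E p)] {𝓔 : B.EquivModule E} {θ : B.GerbeConnection}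

/-- The curvature `F = dA + A ∧ A` in the local frame around `a`. -/
def curvature (D : 𝓔.Connection θ) (a : P) : RawForm 𝓘(ℝ, EP) P (H →L[ℂ] H) 2 := fun p =>
  extD 𝓘(ℝ, EP) (D.A a) p + wedge (rfl : 1 + 1 = 2) (D.A a p) (D.A a p)

/-- The moment map `μ(ξ) = ℒ_ξ - ∇_ξ̂` in the local frame around `a`, computed on the sections that
are constant in this frame; `(ℒ_ξ s)(p)` is the derivative at `g = 1` of `σ_g (s (g⁻¹ p))`. -/
def moment (D : 𝓔.Connection θ) (a : P) (ξ : GroupLieAlgebra 𝓘(ℝ, EG) G) (p : P) : H →L[ℂ] H :=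
  (mfderiv 𝓘(ℝ, EG) 𝓘(ℝ, TraceClass H) (fun g : G => 𝓔.sigmaMat a a (g, g⁻¹ • p)) 1 ξ :
    TraceClass H).op - D.A a p (fun _ => fundVF ξ p)

/-- The equivariant form `F + μ_E + f - μ_L` in the local frame around `a`. -/
def total (D : 𝓔.Connection θ) (κ : EquivCurving θ) (a : P) (ξ : GroupLieAlgebra 𝓘(ℝ, EG) G)
    (p : P) : MixedForm (TangentSpace 𝓘(ℝ, EP) p) (H →L[ℂ] H)
  | 0, 2 => D.curvature a p +
      ((ContinuousLinearMap.toSpanSingleton ℂ (1 : H →L[ℂ] H)).restrictScalars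
        ℝ).compContinuousAlternatingMap (κ.f p)
  | 1, 0 => ContinuousAlternatingMap.constOfIsEmpty ℝ _ (Fin 0)
      (D.moment a ξ p - κ.muL ξ p • (1 : H →L[ℂ] H))
  | _, _ => 0

end EquivModule.Connection

variable {B}
variable {E₀ : P → Type*} [∀ p, AddCommGroup (E₀ p)] [∀ p, Module ℂ (E₀ p)]
  {E₁ : P → Type*} [∀ p, AddCommGroup (E₁ p)] [∀ p, Module ℂ (E₁ p)]
  {𝓔₀ : B.EquivModule E₀} {𝓔₁ : B.EquivModule E₁} {θ : B.GerbeConnection}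

/-- The difference of two module connections is trace class: `P` is covered by open sets with local
frames in which the difference of the connection forms is a smooth form with values in the trace
class operators. -/
def TraceClassDifference (D₀ : 𝓔₀.Connection θ) (D₁ : 𝓔₁.Connection θ) : Prop :=
  ∀ p : P, ∃ (a b : P) (W : Set P), IsOpen W ∧ p ∈ W ∧ W ⊆ 𝓔₀.dom a ∩ 𝓔₁.dom b ∧
    ∃ δ : RawForm 𝓘(ℝ, EP) P (TraceClass H) 1, ∀ q ∈ W, SmoothFormAt 𝓘(ℝ, EP) δ q ∧
      ∀ X : TangentSpace 𝓘(ℝ, EP) q,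
        D₀.A a q (fun _ => X) - D₁.A b q (fun _ => X) = (δ q (fun _ => X)).op

/-- `exp(F₀ + μ_{E₀} + f - μ_L) - exp(F₁ + μ_{E₁} + f - μ_L)` in the local frames around `a` of `E₀`
and around `b` of `E₁`. -/
def expDiff (D₀ : 𝓔₀.Connection θ) (D₁ : 𝓔₁.Connection θ) (κ : EquivCurving θ) (a b : P)
    (ξ : GroupLieAlgebra 𝓘(ℝ, EG) G) (p : P) :
    MixedForm (TangentSpace 𝓘(ℝ, EP) p) (H →L[ℂ] H) :=
  MixedForm.exp (D₀.total κ a ξ p) - MixedForm.exp (D₁.total κ b ξ p)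

/-- The pullback to `P` of a family of formal forms on `M`. -/
def pullback (B : EquivPUBundle EG G EM M EP P H) (α : RawCartan EG G EM M) :
    RawCartan EG G EP P := fun ξ p k j =>
  (α ξ (B.proj p) k j).compContinuousLinearMap (mfderiv 𝓘(ℝ, EP) 𝓘(ℝ, EM) B.proj p)

end EquivPUBundle

end Gerbe

end TwistedChern

end

open TwistedChern

open scoped Manifold ContDiff InnerProductSpace Topology

noncomputable section

set_option linter.unusedSectionVars false

namespace TwistedChern

/-! ### Algebra of the wedge product -/

section Wedge

/-- A permutation of `Fin (n + 1)` is determined by the preimage `s` of `0` and the induced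
permutation of the remaining elements. -/
def permInsertEquiv (n : ℕ) : Fin (n + 1) × Equiv.Perm (Fin n) ≃ Equiv.Perm (Fin (n + 1)) where
  toFun x := Equiv.Perm.decomposeFin.symm (0, x.2) * Fin.cycleRange x.1
  invFun σ := (σ.symm 0, (Equiv.Perm.decomposeFin (σ * (Fin.cycleRange (σ.symm 0))⁻¹)).2)
  left_inv := by
    rintro ⟨s, ρ⟩
    have h : (Equiv.Perm.decomposeFin.symm (0, ρ) * Fin.cycleRange s).symm 0 = s := by
      rw [Equiv.symm_apply_eq]
      simp
    simp [h, mul_assoc]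
  right_inv := by
    intro σ
    have h : (Equiv.Perm.decomposeFin (σ * (Fin.cycleRange (σ.symm 0))⁻¹)).1 = 0 := by
      rw [← Equiv.Perm.decomposeFin_symm_apply_zero
        (Equiv.Perm.decomposeFin (σ * (Fin.cycleRange (σ.symm 0))⁻¹)).1
        (Equiv.Perm.decomposeFin (σ * (Fin.cycleRange (σ.symm 0))⁻¹)).2]
      simp only [Prod.mk.eta, Equiv.symm_apply_apply, Equiv.Perm.mul_apply]
      change σ ((Fin.cycleRange (σ.symm 0)).symm 0) = 0
      simp
    have h2 : ((0 : Fin (n + 1)), (Equiv.Perm.decomposeFin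
        (σ * (Fin.cycleRange (σ.symm 0))⁻¹)).2) =
        Equiv.Perm.decomposeFin (σ * (Fin.cycleRange (σ.symm 0))⁻¹) := Prod.ext h.symm rfl
    simp [h2]

theorem cons_comp_permInsertEquiv {V : Type*} {n : ℕ} (v : V) (w : Fin n → V) (s : Fin (n + 1))
    (ρ : Equiv.Perm (Fin n)) :
    Matrix.vecCons v w ∘ permInsertEquiv n (s, ρ) = s.insertNth v (w ∘ ρ) := by
  rw [← Fin.cons_comp_cycleRange]
  funext t
  simp only [permInsertEquiv, Equiv.coe_fn_mk, Function.comp_apply, Equiv.Perm.mul_apply]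
  generalize s.cycleRange t = r
  refine Fin.cases ?_ (fun i => ?_) r
  · simp [Matrix.vecCons]
  · simp [Matrix.vecCons]

theorem sum_perm_cons {V A : Type*} [AddCommGroup A] {n : ℕ} (t : (Fin (n + 1) → V) → A) (v : V)
    (w : Fin n → V) :
    ∑ σ : Equiv.Perm (Fin (n + 1)), Equiv.Perm.sign σ • t (Matrix.vecCons v w ∘ σ) =
      ∑ ρ : Equiv.Perm (Fin n), Equiv.Perm.sign ρ •
        ∑ s : Fin (n + 1), (-1 : ℤ) ^ (s : ℕ) • t (s.insertNth v (w ∘ ρ)) := by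
  rw [← (permInsertEquiv n).sum_comp, Fintype.sum_prod_type_right]
  refine Finset.sum_congr rfl fun ρ _ => ?_
  rw [Finset.smul_sum]
  refine Finset.sum_congr rfl fun s _ => ?_
  rw [cons_comp_permInsertEquiv]
  simp only [permInsertEquiv, Equiv.coe_fn_mk, Equiv.Perm.sign_mul,
    Equiv.Perm.decomposeFin.symm_sign, if_true, one_mul, Fin.sign_cycleRange, mul_smul]
  simp [Units.smul_def]

variable {V : Type*} [AddCommGroup V] [Module ℝ V] [TopologicalSpace V]
  {A : Type*} [NormedRing A] [NormedAlgebra ℝ A]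

theorem wedge_apply {i l n : ℕ} (h : i + l = n) (α : V [⋀^Fin i]→L[ℝ] A)
    (β : V [⋀^Fin l]→L[ℝ] A) (v : Fin n → V) :
    wedge h α β v = ((i.factorial : ℝ)⁻¹ * (l.factorial : ℝ)⁻¹) •
      ∑ σ : Equiv.Perm (Fin n), Equiv.Perm.sign σ • tensorMul h α β (v ∘ σ) := by
  rw [wedge, ContinuousAlternatingMap.smul_apply,
    ContinuousMultilinearMap.alternatization_apply_apply]

/-- The wedge product, extended by `0` if the degrees do not match. -/
def wedge' (i l n : ℕ) (α : V [⋀^Fin i]→L[ℝ] A) (β : V [⋀^Fin l]→L[ℝ] A) :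
    V [⋀^Fin n]→L[ℝ] A :=
  if h : i + l = n then wedge h α β else 0

theorem wedge'_eq {i l n : ℕ} (h : i + l = n) (α : V [⋀^Fin i]→L[ℝ] A)
    (β : V [⋀^Fin l]→L[ℝ] A) : wedge' i l n α β = wedge h α β := dif_pos h

/-- The part of the contraction of a product in which the first factor is contracted. -/
def contractFst (v : V) : (i l n : ℕ) → (V [⋀^Fin i]→L[ℝ] A) → (V [⋀^Fin l]→L[ℝ] A) →
    V [⋀^Fin n]→L[ℝ] A
  | 0, _, _, _, _ => 0
  | i + 1, l, n, α, β => wedge' i l n (contract v α) β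

/-- The part of the contraction of a product in which the second factor is contracted. -/
def contractSnd (v : V) : (i l n : ℕ) → (V [⋀^Fin i]→L[ℝ] A) → (V [⋀^Fin l]→L[ℝ] A) →
    V [⋀^Fin n]→L[ℝ] A
  | _, 0, _, _, _ => 0
  | i, l + 1, n, α, β => (-1 : ℝ) ^ i • wedge' i l n α (contract v β)

theorem sum_insertNth_left {i l n : ℕ} (h : i + l = n + 1) (α : V [⋀^Fin i]→L[ℝ] A)
    (β : V [⋀^Fin l]→L[ℝ] A) (v : V) (w : Fin n → V) :
    ((i.factorial : ℝ)⁻¹ * (l.factorial : ℝ)⁻¹) • ∑ ρ : Equiv.Perm (Fin n), Equiv.Perm.sign ρ •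
      ∑ s : Fin i, (-1 : ℤ) ^ (s : ℕ) •
        tensorMul h α β ((finCongr h (Fin.castAdd l s)).insertNth v (w ∘ ρ)) =
      contractFst v i l n α β w := by
  cases i with
  | zero => simp [contractFst]
  | succ i =>
    have h' : i + l = n := by omega
    subst h'
    have key : ∀ (u : Fin (i + l) → V) (s : Fin (i + 1)), (-1 : ℤ) ^ (s : ℕ) •
        tensorMul h α β ((finCongr h (Fin.castAdd l s)).insertNth v u) =
        tensorMul rfl (contract v α) β u := by
      intro u s
      rw [tensorMul_apply, tensorMul_apply]
      have e1 : (fun t => (Fin.insertNth (finCongr h (Fin.castAdd l s)) v u : Fin _ → V)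
          (finCongr h (finSumFinEquiv (Sum.inl t)))) =
          s.insertNth v (fun t => u (Fin.castAdd l t)) := by
        funext t
        refine Fin.succAboveCases s ?_ (fun r => ?_) t
        · simp
        · have : finCongr h (finSumFinEquiv (Sum.inl (s.succAbove r))) =
              (finCongr h (Fin.castAdd l s)).succAbove (Fin.castAdd l r) := by
            ext
            simp [Fin.succAbove, Fin.lt_def]
            split_ifs <;> simp
          rw [this, Fin.insertNth_apply_succAbove, Fin.insertNth_apply_succAbove]
      have e2 : (fun t => (Fin.insertNth (finCongr h (Fin.castAdd l s)) v u : Fin _ → V)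
          (finCongr h (finSumFinEquiv (Sum.inr t)))) = fun t => u (Fin.natAdd i t) := by
        funext t
        have : finCongr h (finSumFinEquiv (Sum.inr t)) =
            (finCongr h (Fin.castAdd l s)).succAbove (Fin.natAdd i t) := by
          ext
          have := s.2
          simp [Fin.succAbove, Fin.lt_def]
          split_ifs <;> simp <;> omega
        rw [this, Fin.insertNth_apply_succAbove]
      have e3 : α (s.insertNth v fun t => u (Fin.castAdd l t)) = (-1 : ℤ) ^ (s : ℕ) •
          contract v α (fun t => u (Fin.castAdd l t)) :=
        α.toAlternatingMap.map_insertNth s v _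
      rw [e1, e2, e3, ← smul_mul_assoc, smul_smul, ← mul_pow]
      simp
    simp only [key, Finset.sum_const, Finset.card_univ, Fintype.card_fin, contractFst]
    rw [wedge'_eq rfl, wedge_apply]
    simp only [smul_comm _ (i + 1) _, ← Finset.smul_sum]
    rw [← Nat.cast_smul_eq_nsmul ℝ, smul_smul]
    congr 1
    rw [Nat.factorial_succ]
    push_cast
    field_simp

theorem sum_insertNth_right {i l n : ℕ} (h : i + l = n + 1) (α : V [⋀^Fin i]→L[ℝ] A)
    (β : V [⋀^Fin l]→L[ℝ] A) (v : V) (w : Fin n → V) :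
    ((i.factorial : ℝ)⁻¹ * (l.factorial : ℝ)⁻¹) • ∑ ρ : Equiv.Perm (Fin n), Equiv.Perm.sign ρ •
      ∑ s : Fin l, (-1 : ℤ) ^ (i + s : ℕ) •
        tensorMul h α β ((finCongr h (Fin.natAdd i s)).insertNth v (w ∘ ρ)) =
      contractSnd v i l n α β w := by
  cases l with
  | zero => simp [contractSnd]
  | succ l =>
    have h' : i + l = n := by omega
    subst h'
    have key : ∀ (u : Fin (i + l) → V) (s : Fin (l + 1)), (-1 : ℤ) ^ (i + s : ℕ) •
        tensorMul h α β ((finCongr h (Fin.natAdd i s)).insertNth v u) =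
        (-1 : ℤ) ^ i • tensorMul rfl α (contract v β) u := by
      intro u s
      rw [tensorMul_apply, tensorMul_apply]
      have e1 : (fun t => (Fin.insertNth (finCongr h (Fin.natAdd i s)) v u : Fin _ → V)
          (finCongr h (finSumFinEquiv (Sum.inr t)))) =
          s.insertNth v (fun t => u (Fin.natAdd i t)) := by
        funext t
        refine Fin.succAboveCases s ?_ (fun r => ?_) t
        · simp
        · have : finCongr h (finSumFinEquiv (Sum.inr (s.succAbove r))) =
              (finCongr h (Fin.natAdd i s)).succAbove (Fin.natAdd i r) := by
            ext
            simp [Fin.succAbove, Fin.lt_def]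
            split_ifs <;> simp <;> omega
          rw [this, Fin.insertNth_apply_succAbove, Fin.insertNth_apply_succAbove]
      have e2 : (fun t => (Fin.insertNth (finCongr h (Fin.natAdd i s)) v u : Fin _ → V)
          (finCongr h (finSumFinEquiv (Sum.inl t)))) = fun t => u (Fin.castAdd l t) := by
        funext t
        have : finCongr h (finSumFinEquiv (Sum.inl t)) =
            (finCongr h (Fin.natAdd i s)).succAbove (Fin.castAdd l t) := by
          ext
          have := t.2
          simp [Fin.succAbove, Fin.lt_def]
          split_ifs <;> simp <;> omega
        rw [this, Fin.insertNth_apply_succAbove]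
      have e3 : β (s.insertNth v fun t => u (Fin.natAdd i t)) = (-1 : ℤ) ^ (s : ℕ) •
          contract v β (fun t => u (Fin.natAdd i t)) :=
        β.toAlternatingMap.map_insertNth s v _
      rw [e1, e2, e3, mul_smul_comm, smul_smul, pow_add, mul_assoc, ← mul_pow]
      simp
    simp only [key, Finset.sum_const, Finset.card_univ, Fintype.card_fin, contractSnd]
    rw [wedge'_eq rfl, ContinuousAlternatingMap.smul_apply, wedge_apply]
    have comm : ∀ (ρ : Equiv.Perm (Fin (i + l))) (x : A), Equiv.Perm.sign ρ •
        (l + 1) • (-1 : ℤ) ^ i • x = (l + 1) • (-1 : ℤ) ^ i • Equiv.Perm.sign ρ • x := fun ρ x => by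
      rw [smul_comm (Equiv.Perm.sign ρ) (l + 1), smul_comm (Equiv.Perm.sign ρ) ((-1 : ℤ) ^ i)]
    simp only [comm, ← Finset.smul_sum]
    rw [← Nat.cast_smul_eq_nsmul ℝ, ← Int.cast_smul_eq_zsmul ℝ, smul_smul, smul_smul, smul_smul]
    congr 1
    rw [Nat.factorial_succ]
    push_cast
    field_simp

theorem contract_wedge {i l n : ℕ} (h : i + l = n + 1) (α : V [⋀^Fin i]→L[ℝ] A)
    (β : V [⋀^Fin l]→L[ℝ] A) (v : V) :
    contract v (wedge h α β) = contractFst v i l n α β + contractSnd v i l n α β := by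
  ext w
  change wedge h α β (Matrix.vecCons v w) = contractFst v i l n α β w + contractSnd v i l n α β w
  rw [wedge_apply, sum_perm_cons, ← sum_insertNth_left h, ← sum_insertNth_right h, ← smul_add,
    ← Finset.sum_add_distrib]
  congr 1
  refine Finset.sum_congr rfl fun ρ _ => ?_
  rw [← smul_add, ← (finSumFinEquiv.trans (finCongr h)).sum_comp, Fintype.sum_sum_type]
  simp

theorem wedge_zero_zero (α β : V [⋀^Fin 0]→L[ℝ] A) (v : Fin 0 → V) :
    wedge (rfl : 0 + 0 = 0) α β v = α v * β v := by
  rw [wedge_apply]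
  simp [tensorMul_apply, Subsingleton.elim _ v]

theorem wedge_add_left' {i l n : ℕ} (h : i + l = n) (α α' : V [⋀^Fin i]→L[ℝ] A)
    (β : V [⋀^Fin l]→L[ℝ] A) : wedge h (α + α') β = wedge h α β + wedge h α' β := by
  ext v
  simp only [wedge_apply, ContinuousAlternatingMap.add_apply, tensorMul_apply, add_mul, smul_add,
    Finset.sum_add_distrib]

theorem wedge_add_right' {i l n : ℕ} (h : i + l = n) (α : V [⋀^Fin i]→L[ℝ] A)
    (β β' : V [⋀^Fin l]→L[ℝ] A) : wedge h α (β + β') = wedge h α β + wedge h α β' := by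
  ext v
  simp only [wedge_apply, ContinuousAlternatingMap.add_apply, tensorMul_apply, mul_add, smul_add,
    Finset.sum_add_distrib]

theorem wedge_smul_left' {i l n : ℕ} (h : i + l = n) (c : ℝ) (α : V [⋀^Fin i]→L[ℝ] A)
    (β : V [⋀^Fin l]→L[ℝ] A) : wedge h (c • α) β = c • wedge h α β := by
  ext v
  simp only [wedge_apply, ContinuousAlternatingMap.smul_apply, tensorMul_apply, smul_mul_assoc,
    smul_comm _ c, ← Finset.smul_sum]

theorem wedge_smul_right' {i l n : ℕ} (h : i + l = n) (c : ℝ) (α : V [⋀^Fin i]→L[ℝ] A)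
    (β : V [⋀^Fin l]→L[ℝ] A) : wedge h α (c • β) = c • wedge h α β := by
  ext v
  simp only [wedge_apply, ContinuousAlternatingMap.smul_apply, tensorMul_apply, mul_smul_comm,
    smul_comm _ c, ← Finset.smul_sum]

theorem wedge_compContinuousLinearMap {V' : Type*} [AddCommGroup V'] [Module ℝ V']
    [TopologicalSpace V'] {i l n : ℕ} (h : i + l = n) (α : V [⋀^Fin i]→L[ℝ] A)
    (β : V [⋀^Fin l]→L[ℝ] A) (φ : V' →L[ℝ] V) :
    (wedge h α β).compContinuousLinearMap φ =
      wedge h (α.compContinuousLinearMap φ) (β.compContinuousLinearMap φ) := by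
  ext v
  simp only [ContinuousAlternatingMap.compContinuousLinearMap_apply, wedge_apply, tensorMul_apply]
  rfl

theorem wedge_map {A' : Type*} [NormedRing A'] [NormedAlgebra ℝ A'] {i l n : ℕ} (h : i + l = n)
    (α : V [⋀^Fin i]→L[ℝ] A) (β : V [⋀^Fin l]→L[ℝ] A) (φ : A →L[ℝ] A')
    (hφ : ∀ a b, φ (a * b) = φ a * φ b) :
    φ.compContinuousAlternatingMap (wedge h α β) =
      wedge h (φ.compContinuousAlternatingMap α) (φ.compContinuousAlternatingMap β) := by
  ext v
  simp only [ContinuousLinearMap.compContinuousAlternatingMap_coe, Function.comp_apply,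
    wedge_apply, tensorMul_apply, map_smul, map_sum, Units.smul_def, map_zsmul, hφ]

theorem contract_vecCons {F : Type*} [NormedAddCommGroup F] [NormedSpace ℝ F] {j : ℕ} (v : V)
    (α : V [⋀^Fin (j + 1)]→L[ℝ] F) (w : Fin j → V) :
    contract v α w = α (Matrix.vecCons v w) := rfl

theorem ext_contract {F : Type*} [NormedAddCommGroup F] [NormedSpace ℝ F] {j : ℕ}
    {α β : V [⋀^Fin (j + 1)]→L[ℝ] F} (h : ∀ v, contract v α = contract v β) : α = β := by
  ext v
  have := congrArg (fun γ : V [⋀^Fin j]→L[ℝ] F => γ (Matrix.vecTail v)) (h (Matrix.vecHead v))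
  simpa only [contract_vecCons, Matrix.cons_head_tail] using this

end Wedge

/-! ### The ring of formal polynomial-valued forms -/

section MFRing

variable {V : Type*} [AddCommGroup V] [Module ℝ V] [TopologicalSpace V]
  {A : Type*} [NormedRing A] [NormedAlgebra ℝ A]

theorem altMap_smul_zero {F : Type*} [NormedAddCommGroup F] [NormedSpace ℝ F] {j : ℕ} (c : ℝ) :
    c • (0 : V [⋀^Fin j]→L[ℝ] F) = 0 := by
  ext v
  simp

theorem altMap_zero_smul {F : Type*} [NormedAddCommGroup F] [NormedSpace ℝ F] {j : ℕ}
    (α : V [⋀^Fin j]→L[ℝ] F) : (0 : ℝ) • α = 0 := by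
  ext v
  simp

variable (V A) in
/-- Formal polynomial-valued forms, with their ring structure. -/
def MF : Type _ := MixedForm V A

instance : AddCommGroup (MF V A) := inferInstanceAs (AddCommGroup (MixedForm V A))

instance : Module ℝ (MF V A) := inferInstanceAs (Module ℝ (MixedForm V A))

namespace MF

@[simp] theorem add_apply (α β : MF V A) (k j : ℕ) : (α + β) k j = α k j + β k j := rfl
@[simp] theorem sub_apply (α β : MF V A) (k j : ℕ) : (α - β) k j = α k j - β k j := rfl
@[simp] theorem neg_apply (α : MF V A) (k j : ℕ) : (-α) k j = -α k j := rfl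
@[simp] theorem zero_apply (k j : ℕ) : (0 : MF V A) k j = 0 := rfl
@[simp] theorem smul_apply (c : ℝ) (α : MF V A) (k j : ℕ) : (c • α) k j = c • α k j := rfl

theorem sum_apply {ι : Type*} (s : Finset ι) (α : ι → MF V A) (k j : ℕ) :
    (∑ i ∈ s, α i) k j = ∑ i ∈ s, α i k j := by
  classical
  induction s using Finset.induction_on with
  | empty => rfl
  | insert a s ha ih => rw [Finset.sum_insert ha, Finset.sum_insert ha, add_apply, ih]

@[ext] theorem ext {α β : MF V A} (h : ∀ k j, α k j = β k j) : α = β :=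
  funext fun k => funext fun j => h k j

instance : Mul (MF V A) := ⟨fun α β => MixedForm.mul α β⟩

instance : One (MF V A) := ⟨MixedForm.one⟩

theorem mul_def (α β : MF V A) : α * β = MixedForm.mul α β := rfl

theorem mul_apply (α β : MF V A) (k j : ℕ) : (α * β) k j =
    ∑ p ∈ Finset.HasAntidiagonal.antidiagonal k, ∑ q ∈ Finset.HasAntidiagonal.antidiagonal j,
      wedge' q.1 q.2 j (α p.1 q.1) (β p.2 q.2) := by
  rw [mul_def]
  refine Finset.sum_congr rfl fun p _ => ?_
  rw [← Finset.sum_attach (Finset.HasAntidiagonal.antidiagonal j)]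
  exact Finset.sum_congr rfl fun q _ => (wedge'_eq _ _ _).symm

/-- The parity operator. -/
def eps : MF V A →ₗ[ℝ] MF V A where
  toFun α := fun k j => (-1 : ℝ) ^ j • α k j
  map_add' α β := by ext k j : 1; exact smul_add _ _ _
  map_smul' c α := by ext k j v; exact smul_comm ((-1 : ℝ) ^ j) c (α k j v)

theorem eps_apply (α : MF V A) (k j : ℕ) : eps α k j = (-1 : ℝ) ^ j • α k j := rfl

/-- Contraction with a vector, in the form variables only. -/
def cont (v : V) : MF V A →ₗ[ℝ] MF V A where
  toFun α := fun k j => contract v (α k (j + 1))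
  map_add' _ _ := rfl
  map_smul' _ _ := rfl

theorem cont_apply (v : V) (α : MF V A) (k j : ℕ) : cont v α k j = contract v (α k (j + 1)) := rfl

theorem eps_eps (α : MF V A) : eps (eps α) = α := by
  ext k j : 1
  rw [eps_apply, eps_apply, smul_smul, ← mul_pow]
  simp

theorem cont_eps (v : V) (α : MF V A) : cont v (eps α) = -eps (cont v α) := by
  ext k j : 1
  change contract v ((-1 : ℝ) ^ (j + 1) • α k (j + 1)) = -((-1 : ℝ) ^ j • contract v (α k (j + 1)))
  ext w
  change (-1 : ℝ) ^ (j + 1) • α k (j + 1) (Matrix.vecCons v w) =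
    -((-1 : ℝ) ^ j • α k (j + 1) (Matrix.vecCons v w))
  rw [pow_succ, mul_neg_one, neg_smul]

theorem wedge'_add_left (i l n : ℕ) (α α' : V [⋀^Fin i]→L[ℝ] A) (β : V [⋀^Fin l]→L[ℝ] A) :
    wedge' i l n (α + α') β = wedge' i l n α β + wedge' i l n α' β := by
  unfold wedge'; split_ifs <;> simp [wedge_add_left']

theorem wedge'_add_right (i l n : ℕ) (α : V [⋀^Fin i]→L[ℝ] A) (β β' : V [⋀^Fin l]→L[ℝ] A) :
    wedge' i l n α (β + β') = wedge' i l n α β + wedge' i l n α β' := by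
  unfold wedge'; split_ifs <;> simp [wedge_add_right']

theorem wedge'_smul_left (i l n : ℕ) (c : ℝ) (α : V [⋀^Fin i]→L[ℝ] A) (β : V [⋀^Fin l]→L[ℝ] A) :
    wedge' i l n (c • α) β = c • wedge' i l n α β := by
  unfold wedge'; split_ifs
  · exact wedge_smul_left' _ _ _ _
  · rw [altMap_smul_zero]

theorem wedge'_smul_right (i l n : ℕ) (c : ℝ) (α : V [⋀^Fin i]→L[ℝ] A) (β : V [⋀^Fin l]→L[ℝ] A) :
    wedge' i l n α (c • β) = c • wedge' i l n α β := by
  unfold wedge'; split_ifs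
  · exact wedge_smul_right' _ _ _ _
  · rw [altMap_smul_zero]

theorem wedge'_zero_left (i l n : ℕ) (β : V [⋀^Fin l]→L[ℝ] A) :
    wedge' i l n (0 : V [⋀^Fin i]→L[ℝ] A) β = 0 := by
  have h := wedge'_smul_left i l n 0 0 β
  rwa [altMap_zero_smul, altMap_zero_smul] at h

theorem wedge'_zero_right (i l n : ℕ) (α : V [⋀^Fin i]→L[ℝ] A) :
    wedge' i l n α (0 : V [⋀^Fin l]→L[ℝ] A) = 0 := by
  have h := wedge'_smul_right i l n 0 α 0
  rwa [altMap_zero_smul, altMap_zero_smul] at h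

theorem add_mul' (α α' β : MF V A) : (α + α') * β = α * β + α' * β := by
  ext k j : 1
  simp only [mul_apply, add_apply, wedge'_add_left, Finset.sum_add_distrib]

theorem mul_add' (α β β' : MF V A) : α * (β + β') = α * β + α * β' := by
  ext k j : 1
  simp only [mul_apply, add_apply, wedge'_add_right, Finset.sum_add_distrib]

theorem smul_mul' (c : ℝ) (α β : MF V A) : (c • α) * β = c • (α * β) := by
  ext k j : 1
  simp only [mul_apply, smul_apply, wedge'_smul_left, Finset.smul_sum]

theorem mul_smul' (c : ℝ) (α β : MF V A) : α * (c • β) = c • (α * β) := by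
  ext k j : 1
  simp only [mul_apply, smul_apply, wedge'_smul_right, Finset.smul_sum]

theorem eps_mul (α β : MF V A) : eps (α * β) = eps α * eps β := by
  ext k j : 1
  simp only [mul_apply, eps_apply, wedge'_smul_left, wedge'_smul_right, Finset.smul_sum, smul_smul,
    ← pow_add]
  refine Finset.sum_congr rfl fun p _ => Finset.sum_congr rfl fun q hq => ?_
  rw [add_comm q.2, Finset.HasAntidiagonal.mem_antidiagonal.1 hq]

theorem cont_mul (v : V) (α β : MF V A) :
    cont v (α * β) = cont v α * β + eps α * cont v β := by
  ext k j : 1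
  have hsum : cont v (α * β) k j = ∑ p ∈ Finset.HasAntidiagonal.antidiagonal k,
      ∑ q ∈ Finset.HasAntidiagonal.antidiagonal (j + 1),
        (contractFst v q.1 q.2 j (α p.1 q.1) (β p.2 q.2) +
          contractSnd v q.1 q.2 j (α p.1 q.1) (β p.2 q.2)) := by
    have hadd : ∀ (s : Finset (ℕ × ℕ)) (γ : ℕ × ℕ → V [⋀^Fin (j + 1)]→L[ℝ] A),
        contract v (∑ p ∈ s, γ p) = ∑ p ∈ s, contract v (γ p) := fun s γ =>
      map_sum (⟨⟨fun γ => contract v γ, rfl⟩, fun _ _ => rfl⟩ :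
        (V [⋀^Fin (j + 1)]→L[ℝ] A) →+ (V [⋀^Fin j]→L[ℝ] A)) γ s
    rw [cont_apply, mul_apply, hadd]
    refine Finset.sum_congr rfl fun p _ => ?_
    rw [hadd]
    refine Finset.sum_congr rfl fun q hq => ?_
    rw [wedge'_eq (Finset.HasAntidiagonal.mem_antidiagonal.1 hq), contract_wedge]
  rw [hsum, add_apply, mul_apply, mul_apply, ← Finset.sum_add_distrib]
  refine Finset.sum_congr rfl fun p _ => ?_
  rw [Finset.sum_add_distrib]
  congr 1
  · rw [Finset.Nat.sum_antidiagonal_succ]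
    simp only [contractFst, zero_add]
    rfl
  · rw [Finset.Nat.sum_antidiagonal_succ']
    simp only [contractSnd, zero_add, eps_apply, wedge'_smul_left]
    rfl

/-- The power series formed by the components of form degree `0`. -/
def series (α : MF V A) : PowerSeries A := PowerSeries.mk fun k => α k 0 ![]

theorem series_mul (α β : MF V A) : series (α * β) = series α * series β := by
  ext k
  rw [PowerSeries.coeff_mul]
  simp only [series, PowerSeries.coeff_mk, mul_apply, Finset.Nat.antidiagonal_zero,
    Finset.sum_singleton, wedge'_eq (rfl : 0 + 0 = 0), ContinuousAlternatingMap.sum_apply,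
    wedge_zero_zero]

theorem apply_zero_eq_of_series_eq {α β : MF V A} (h : series α = series β) (k : ℕ) :
    α k 0 = β k 0 := by
  ext v
  rw [Subsingleton.elim v ![]]
  simpa [series] using congrArg (PowerSeries.coeff k) h

theorem one_apply_zero_zero : (1 : MF V A) 0 0 =
    ContinuousAlternatingMap.constOfIsEmpty ℝ V (Fin 0) 1 := rfl

theorem one_apply_succ_left (k j : ℕ) : (1 : MF V A) (k + 1) j = 0 := rfl

theorem one_apply_succ_right (k j : ℕ) : (1 : MF V A) k (j + 1) = 0 := by
  cases k <;> rfl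

theorem cont_one (v : V) : cont v (1 : MF V A) = 0 := by
  ext k j : 1
  rw [cont_apply, one_apply_succ_right]
  rfl

theorem eps_one : eps (1 : MF V A) = 1 := by
  ext k j : 1
  rw [eps_apply]
  cases j with
  | zero => simp
  | succ j => rw [one_apply_succ_right, altMap_smul_zero]

theorem series_one : series (1 : MF V A) = 1 := by
  ext k
  simp only [series, PowerSeries.coeff_mk, PowerSeries.coeff_one]
  cases k with
  | zero => simp [one_apply_zero_zero]
  | succ k => simp [one_apply_succ_left]

theorem apply_succ_eq {α β : MF V A} {k j : ℕ} (h : ∀ v, cont v α k j = cont v β k j) :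
    α k (j + 1) = β k (j + 1) := ext_contract h

theorem zero_mul' (β : MF V A) : 0 * β = 0 := by
  have h := smul_mul' 0 0 β
  rwa [zero_smul, zero_smul] at h

theorem mul_zero' (α : MF V A) : α * 0 = 0 := by
  have h := mul_smul' 0 α 0
  rwa [zero_smul, zero_smul] at h

theorem mul_assoc' (α β γ : MF V A) : α * β * γ = α * (β * γ) := by
  ext k j : 1
  induction j generalizing α β γ with
  | zero => exact apply_zero_eq_of_series_eq (by simp only [series_mul, mul_assoc]) k
  | succ j ih =>
    refine apply_succ_eq fun v => ?_
    simp only [cont_mul, eps_mul, add_mul', mul_add', add_apply, ih]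
    abel

theorem one_mul' (α : MF V A) : 1 * α = α := by
  ext k j : 1
  induction j generalizing α with
  | zero => exact apply_zero_eq_of_series_eq (by simp only [series_mul, series_one, one_mul]) k
  | succ j ih =>
    refine apply_succ_eq fun v => ?_
    simp only [cont_mul, cont_one, eps_one, zero_mul', zero_add, ih]

theorem mul_one' (α : MF V A) : α * 1 = α := by
  ext k j : 1
  induction j generalizing α with
  | zero => exact apply_zero_eq_of_series_eq (by simp only [series_mul, series_one, mul_one]) k
  | succ j ih =>
    refine apply_succ_eq fun v => ?_
    simp only [cont_mul, cont_one, mul_zero', add_zero, ih]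

instance : Ring (MF V A) where
  __ := (inferInstance : AddCommGroup (MF V A))
  mul := (· * ·)
  one := 1
  left_distrib := mul_add'
  right_distrib := add_mul'
  zero_mul := zero_mul'
  mul_zero := mul_zero'
  mul_assoc := mul_assoc'
  one_mul := one_mul'
  mul_one := mul_one'

instance : Algebra ℝ (MF V A) := Algebra.ofModule smul_mul' (fun c α β => mul_smul' c α β)

theorem pow_eq (α : MF V A) (n : ℕ) : MixedForm.pow α n = (α ^ n : MF V A) := by
  induction n with
  | zero => rw [pow_zero]; rfl
  | succ n ih => rw [pow_succ', mul_def, ← ih]; rfl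

theorem pow_apply_eq_zero {α : MF V A} (h : α 0 0 = 0) (n : ℕ) :
    ∀ k j, k + j < n → (α ^ n) k j = 0 := by
  induction n with
  | zero => intro k j hk; omega
  | succ n ih =>
    intro k j hk
    rw [pow_succ', mul_apply]
    refine Finset.sum_eq_zero fun p hp => Finset.sum_eq_zero fun q hq => ?_
    rw [Finset.HasAntidiagonal.mem_antidiagonal] at hp hq
    by_cases h0 : p.1 = 0 ∧ q.1 = 0
    · obtain ⟨p1, p2⟩ := p
      obtain ⟨q1, q2⟩ := q
      obtain ⟨rfl, rfl⟩ := h0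
      dsimp only
      rw [h, wedge'_zero_left]
    · rw [ih p.2 q.2 (by omega), wedge'_zero_right]

/-- The partial sums of the exponential series. -/
def expSum (N : ℕ) (α : MF V A) : MF V A :=
  ∑ n ∈ Finset.range N, ((n.factorial : ℝ)⁻¹) • α ^ n

theorem exp_apply {α : MF V A} (h : α 0 0 = 0) {N k j : ℕ} (hN : k + j < N) :
    MixedForm.exp α k j = expSum N α k j := by
  have h1 : MixedForm.exp α k j = expSum (k + j + 1) α k j := by
    rw [expSum, sum_apply]
    refine Finset.sum_congr rfl fun n _ => ?_
    rw [pow_eq]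
    rfl
  rw [h1, expSum, expSum, sum_apply, sum_apply]
  refine Finset.sum_subset (Finset.range_subset_range.2 hN) fun n _ hn => ?_
  rw [smul_apply, pow_apply_eq_zero h n k j (by simpa using hn), altMap_smul_zero]

/-! #### Functoriality -/

/-- Composition with a linear map of the values. -/
def map {A' : Type*} [NormedRing A'] [NormedAlgebra ℝ A'] (φ : A →L[ℝ] A') :
    MF V A →ₗ[ℝ] MF V A' where
  toFun α := fun k j => φ.compContinuousAlternatingMap (α k j)
  map_add' α β := by ext k j v; exact map_add φ _ _
  map_smul' c α := by ext k j v; exact map_smul φ _ _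

theorem map_apply {A' : Type*} [NormedRing A'] [NormedAlgebra ℝ A'] (φ : A →L[ℝ] A')
    (α : MF V A) (k j : ℕ) : map φ α k j = φ.compContinuousAlternatingMap (α k j) := rfl

section Map

variable {A' : Type*} [NormedRing A'] [NormedAlgebra ℝ A'] (φ : A →L[ℝ] A')

theorem map_mul (hφ : ∀ a b, φ (a * b) = φ a * φ b) (α β : MF V A) :
    map φ (α * β) = map φ α * map φ β := by
  ext k j v
  simp only [map_apply, mul_apply, ContinuousLinearMap.compContinuousAlternatingMap_coe,
    Function.comp_apply, ContinuousAlternatingMap.sum_apply, map_sum]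
  refine Finset.sum_congr rfl fun p _ => Finset.sum_congr rfl fun q hq => ?_
  rw [wedge'_eq (Finset.HasAntidiagonal.mem_antidiagonal.1 hq),
    wedge'_eq (Finset.HasAntidiagonal.mem_antidiagonal.1 hq), ← wedge_map _ _ _ _ hφ]
  rfl

theorem map_one (hφ : φ 1 = 1) : map φ (1 : MF V A) = 1 := by
  ext k j v
  rw [map_apply]
  cases j with
  | zero =>
    cases k with
    | zero => simp [one_apply_zero_zero, hφ]
    | succ k => simp [one_apply_succ_left]
  | succ j => simp [one_apply_succ_right]

theorem map_pow (hφ : ∀ a b, φ (a * b) = φ a * φ b) (hφ1 : φ 1 = 1) (α : MF V A) (n : ℕ) :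
    map φ (α ^ n) = map φ α ^ n := by
  induction n with
  | zero => simp [map_one φ hφ1]
  | succ n ih => rw [pow_succ, pow_succ, map_mul φ hφ, ih]

theorem map_expSum (hφ : ∀ a b, φ (a * b) = φ a * φ b) (hφ1 : φ 1 = 1) (α : MF V A) (N : ℕ) :
    map φ (expSum N α) = expSum N (map φ α) := by
  simp only [expSum, map_sum, map_smul, map_pow φ hφ hφ1]

theorem cont_map (v : V) (α : MF V A) : cont v (map φ α) = map φ (cont v α) := rfl

theorem eps_map (α : MF V A) : eps (map φ α) = map φ (eps α) := by
  ext k j v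
  simp [eps_apply, map_apply]

/-- If the values of `α` commute under `φ` with everything, then so does `α`, up to signs. -/
theorem map_mul_comm_aux (j : ℕ) : ∀ (α β : MF V A) (_ : ∀ k j v a, φ (α k j v * a) = φ (a * α k j v))
    (k : ℕ), (eps α = α → map φ (α * β) k j = map φ (β * α) k j) ∧
      (eps α = -α → map φ (α * β) k j = map φ (eps β * α) k j) := by
  induction j with
  | zero =>
    intro α β hα k
    have key : map φ (α * β) k 0 = map φ (β * α) k 0 := by
      ext v
      simp only [map_apply, mul_apply, ContinuousLinearMap.compContinuousAlternatingMap_coe,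
        Function.comp_apply, ContinuousAlternatingMap.sum_apply, map_sum,
        Finset.Nat.antidiagonal_zero, Finset.sum_singleton, wedge'_eq (rfl : 0 + 0 = 0),
        wedge_zero_zero, hα]
      rw [← Finset.Nat.sum_antidiagonal_swap]
      rfl
    refine ⟨fun _ => key, fun _ => key.trans ?_⟩
    ext v
    simp [map_apply, mul_apply, eps_apply]
  | succ j ih =>
    intro α β hα k
    have hc : ∀ w k j v a, φ (cont w α k j v * a) = φ (a * cont w α k j v) :=
      fun w k j v a => hα k (j + 1) _ a
    constructor
    · intro he
      refine apply_succ_eq fun v => ?_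
      have ho : eps (cont v α) = -cont v α := by
        rw [← neg_inj, ← cont_eps, he, neg_neg]
      simp only [cont_map, cont_mul, map_add, add_apply, he, (ih _ β (hc v) k).2 ho,
        (ih α _ hα k).1 he, add_comm]
    · intro he
      refine apply_succ_eq fun v => ?_
      have ho : eps (cont v α) = cont v α := by
        rw [← neg_inj, ← cont_eps, he, map_neg]
      simp only [cont_map, cont_mul, map_add, add_apply, he, cont_eps, eps_eps, neg_mul, map_neg,
        neg_apply, (ih _ β (hc v) k).1 ho, (ih α _ hα k).2 he, add_comm]

theorem map_mul_comm_even {α : MF V A} (hα : ∀ k j v a, φ (α k j v * a) = φ (a * α k j v))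
    (he : eps α = α) (β : MF V A) : map φ (α * β) = map φ (β * α) :=
  ext fun k j => (map_mul_comm_aux φ j α β hα k).1 he

theorem map_mul_comm_odd {α : MF V A} (hα : ∀ k j v a, φ (α k j v * a) = φ (a * α k j v))
    (he : eps α = -α) (β : MF V A) : map φ (α * β) = map φ (eps β * α) :=
  ext fun k j => (map_mul_comm_aux φ j α β hα k).2 he

end Map

theorem mul_comm_even {α : MF V A} (hα : ∀ k j v a, α k j v * a = a * α k j v)
    (he : eps α = α) (β : MF V A) : α * β = β * α :=
  map_mul_comm_even (ContinuousLinearMap.id ℝ A) hα he β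

theorem mul_comm_odd {α : MF V A} (hα : ∀ k j v a, α k j v * a = a * α k j v)
    (he : eps α = -α) (β : MF V A) : α * β = eps β * α :=
  map_mul_comm_odd (ContinuousLinearMap.id ℝ A) hα he β

section Comp

variable {V' : Type*} [AddCommGroup V'] [Module ℝ V'] [TopologicalSpace V'] (φ : V' →L[ℝ] V)

/-- Pullback along a linear map, as a function. -/
def compFun (α : MF V A) : MF V' A := fun k j => (α k j).compContinuousLinearMap φ

theorem compFun_apply (α : MF V A) (k j : ℕ) :
    compFun φ α k j = (α k j).compContinuousLinearMap φ := rfl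

/-- Pullback along a linear map. -/
def comp : MF V A →+* MF V' A where
  toFun := compFun φ
  map_add' _ _ := rfl
  map_zero' := rfl
  map_one' := by
    ext k j v
    rw [compFun_apply, ContinuousAlternatingMap.compContinuousLinearMap_apply]
    cases j with
    | zero => cases k <;> rfl
    | succ j => rw [one_apply_succ_right, one_apply_succ_right]; rfl
  map_mul' α β := by
    ext k j v
    rw [compFun_apply, ContinuousAlternatingMap.compContinuousLinearMap_apply, mul_apply, mul_apply,
      ContinuousAlternatingMap.sum_apply, ContinuousAlternatingMap.sum_apply]
    refine Finset.sum_congr rfl fun p _ => ?_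
    rw [ContinuousAlternatingMap.sum_apply, ContinuousAlternatingMap.sum_apply]
    refine Finset.sum_congr rfl fun q hq => ?_
    rw [wedge'_eq (Finset.HasAntidiagonal.mem_antidiagonal.1 hq),
      wedge'_eq (Finset.HasAntidiagonal.mem_antidiagonal.1 hq), compFun_apply, compFun_apply,
      ← wedge_compContinuousLinearMap]
    rfl

theorem comp_apply (α : MF V A) (k j : ℕ) :
    comp φ α k j = (α k j).compContinuousLinearMap φ := rfl

theorem map_comp {A' : Type*} [NormedRing A'] [NormedAlgebra ℝ A'] (ψ : A →L[ℝ] A')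
    (α : MF V A) : map ψ (comp φ α) = comp φ (map ψ α) := rfl

theorem eps_comp (α : MF V A) : eps (comp φ α) = comp φ (eps α) := rfl

end Comp

/-! #### Elements with a single component -/

/-- The element with a single component, of bidegree `(k, j)`. -/
def single (k j : ℕ) (α : V [⋀^Fin j]→L[ℝ] A) : MF V A :=
  (Pi.single k (Pi.single j α) : MixedForm V A)

theorem single_apply_same (k j : ℕ) (α : V [⋀^Fin j]→L[ℝ] A) : single k j α k j = α := by
  simp [single]

theorem single_apply_of_ne {k j k' j' : ℕ} (h : ¬(k' = k ∧ j' = j)) (α : V [⋀^Fin j]→L[ℝ] A) :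
    single k j α k' j' = 0 := by
  by_cases hk : k' = k
  · subst hk
    have hj : j' ≠ j := fun hj => h ⟨rfl, hj⟩
    simp [single, Pi.single_eq_of_ne hj]
  · simp [single, Pi.single_eq_of_ne hk]

theorem eps_single (k j : ℕ) (α : V [⋀^Fin j]→L[ℝ] A) :
    eps (single k j α) = (-1 : ℝ) ^ j • single k j α := by
  ext k' j' : 1
  rw [eps_apply, smul_apply]
  by_cases h : k' = k ∧ j' = j
  · obtain ⟨rfl, rfl⟩ := h
    rfl
  · rw [single_apply_of_ne h, altMap_smul_zero, altMap_smul_zero]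

theorem single_mul_single (k i k' l : ℕ) (α : V [⋀^Fin i]→L[ℝ] A) (β : V [⋀^Fin l]→L[ℝ] A) :
    single k i α * single k' l β = single (k + k') (i + l) (wedge rfl α β) := by
  ext a b : 1
  rw [mul_apply]
  by_cases h : a = k + k' ∧ b = i + l
  · obtain ⟨rfl, rfl⟩ := h
    rw [Finset.sum_eq_single_of_mem (k, k') (by simp), Finset.sum_eq_single_of_mem (i, l) (by simp)]
    · rw [single_apply_same, single_apply_same, single_apply_same, wedge'_eq rfl]
    · intro q hq hne
      rw [Finset.HasAntidiagonal.mem_antidiagonal] at hq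
      rw [single_apply_of_ne, wedge'_zero_left]
      rintro ⟨-, h⟩
      exact hne (Prod.ext h (by dsimp only at *; omega))
    · intro p hp hne
      rw [Finset.HasAntidiagonal.mem_antidiagonal] at hp
      refine Finset.sum_eq_zero fun q _ => ?_
      rw [single_apply_of_ne, wedge'_zero_left]
      rintro ⟨h, -⟩
      exact hne (Prod.ext h (by dsimp only at *; omega))
  · rw [single_apply_of_ne h]
    refine Finset.sum_eq_zero fun p hp => Finset.sum_eq_zero fun q hq => ?_
    rw [Finset.HasAntidiagonal.mem_antidiagonal] at hp hq
    by_cases h1 : p.1 = k ∧ q.1 = i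
    · rw [single_apply_of_ne (k' := p.2), wedge'_zero_right]
      rintro ⟨h2, h3⟩
      exact h ⟨by omega, by omega⟩
    · rw [single_apply_of_ne h1, wedge'_zero_left]

/-- An element of the algebra as a constant function. -/
def const (a : A) : MF V A := single 0 0 (ContinuousAlternatingMap.constOfIsEmpty ℝ V (Fin 0) a)

theorem const_one : const (V := V) (1 : A) = 1 := by
  ext k j : 1
  rw [const]
  by_cases h : k = 0 ∧ j = 0
  · obtain ⟨rfl, rfl⟩ := h
    rw [single_apply_same, one_apply_zero_zero]
  · rw [single_apply_of_ne h]
    cases j with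
    | zero =>
      cases k with
      | zero => exact absurd ⟨rfl, rfl⟩ h
      | succ k => rfl
    | succ j => rw [one_apply_succ_right]

theorem const_mul_const (a b : A) : const (V := V) a * const b = const (a * b) := by
  rw [const, const, single_mul_single, const]
  congr 1
  ext v
  rw [wedge_zero_zero]
  simp

theorem cont_const (v : V) (a : A) : cont v (const a : MF V A) = 0 := by
  ext k j : 1
  rw [cont_apply, const, single_apply_of_ne (by omega)]
  rfl

theorem eps_const (a : A) : eps (const a : MF V A) = const a := by
  rw [const, eps_single, pow_zero, one_smul]

theorem const_mul_apply (a : A) (α : MF V A) (k j : ℕ) (v : Fin j → V) :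
    (const a * α : MF V A) k j v = a * α k j v := by
  induction j generalizing α with
  | zero =>
    rw [mul_apply, ContinuousAlternatingMap.sum_apply, Finset.sum_eq_single_of_mem (0, k) (by simp)]
    · simp only [Finset.Nat.antidiagonal_zero, Finset.sum_singleton, wedge'_eq (rfl : 0 + 0 = 0),
        wedge_zero_zero, const, single_apply_same]
      rfl
    · intro p hp hne
      rw [Finset.HasAntidiagonal.mem_antidiagonal] at hp
      simp only [Finset.Nat.antidiagonal_zero, Finset.sum_singleton]
      rw [const, single_apply_of_ne, wedge'_zero_left]
      · rfl
      · rintro ⟨h, -⟩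
        exact hne (Prod.ext h (by dsimp only at *; omega))
  | succ j ih =>
    have h := congrArg (fun γ : MF V A => γ k j (Matrix.vecTail v))
      (cont_mul (Matrix.vecHead v) (const a) α)
    simp only [cont_const, zero_mul, zero_add, eps_const, ih, cont_apply, contract_vecCons,
      Matrix.cons_head_tail] at h
    exact h

theorem mul_const_apply (a : A) (α : MF V A) (k j : ℕ) (v : Fin j → V) :
    (α * const a : MF V A) k j v = α k j v * a := by
  induction j generalizing α with
  | zero =>
    rw [mul_apply, ContinuousAlternatingMap.sum_apply, Finset.sum_eq_single_of_mem (k, 0) (by simp)]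
    · simp only [Finset.Nat.antidiagonal_zero, Finset.sum_singleton, wedge'_eq (rfl : 0 + 0 = 0),
        wedge_zero_zero, const, single_apply_same]
      rfl
    · intro p hp hne
      rw [Finset.HasAntidiagonal.mem_antidiagonal] at hp
      simp only [Finset.Nat.antidiagonal_zero, Finset.sum_singleton]
      rw [const, single_apply_of_ne, wedge'_zero_right]
      · rfl
      · rintro ⟨h, -⟩
        exact hne (Prod.ext (by dsimp only at *; omega) h)
  | succ j ih =>
    have h := congrArg (fun γ : MF V A => γ k j (Matrix.vecTail v))
      (cont_mul (Matrix.vecHead v) α (const a))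
    simp only [cont_const, mul_zero, add_zero, ih, cont_apply, contract_vecCons,
      Matrix.cons_head_tail] at h
    exact h

theorem single_add (k j : ℕ) (α β : V [⋀^Fin j]→L[ℝ] A) :
    single k j (α + β) = single k j α + single k j β := by
  ext k' j' : 1
  by_cases h : k' = k ∧ j' = j
  · obtain ⟨rfl, rfl⟩ := h
    simp [single_apply_same]
  · simp [single_apply_of_ne h]

theorem single_smul (k j : ℕ) (c : ℝ) (α : V [⋀^Fin j]→L[ℝ] A) :
    single k j (c • α) = c • single k j α := by
  ext k' j' : 1
  by_cases h : k' = k ∧ j' = j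
  · obtain ⟨rfl, rfl⟩ := h
    simp [single_apply_same]
  · rw [smul_apply, single_apply_of_ne h, single_apply_of_ne h, altMap_smul_zero]

end MF

end MFRing

/-! ### Exterior calculus in normed spaces -/

section Flat

variable {E : Type*} [NormedAddCommGroup E] [NormedSpace ℝ E]
  {A : Type*} [NormedRing A] [NormedAlgebra ℝ A]

theorem norm_tensorMul_le {i l n : ℕ} (h : i + l = n) (α : E [⋀^Fin i]→L[ℝ] A)
    (β : E [⋀^Fin l]→L[ℝ] A) (v : Fin n → E) :
    ‖tensorMul h α β v‖ ≤ ‖α‖ * ‖β‖ * ∏ s, ‖v s‖ := by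
  rw [tensorMul_apply, ← (finSumFinEquiv.trans (finCongr h)).prod_comp, Fintype.prod_sum_type]
  refine (norm_mul_le _ _).trans ?_
  calc _ ≤ (‖α‖ * ∏ s, ‖v (finCongr h (finSumFinEquiv (Sum.inl s)))‖) *
        (‖β‖ * ∏ s, ‖v (finCongr h (finSumFinEquiv (Sum.inr s)))‖) := by
        gcongr
        · exact α.le_opNorm _
        · exact β.le_opNorm _
    _ = _ := by simp only [Equiv.trans_apply]; ring

theorem norm_wedge_le {i l n : ℕ} (h : i + l = n) (α : E [⋀^Fin i]→L[ℝ] A)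
    (β : E [⋀^Fin l]→L[ℝ] A) :
    ‖wedge h α β‖ ≤ ((i.factorial : ℝ)⁻¹ * (l.factorial : ℝ)⁻¹ *
      Fintype.card (Equiv.Perm (Fin n))) * ‖α‖ * ‖β‖ := by
  refine ContinuousAlternatingMap.opNorm_le_bound _ (by positivity) fun v => ?_
  rw [wedge_apply, norm_smul]
  have h1 : ‖∑ σ : Equiv.Perm (Fin n), Equiv.Perm.sign σ • tensorMul h α β (v ∘ σ)‖ ≤
      ∑ σ : Equiv.Perm (Fin n), ‖α‖ * ‖β‖ * ∏ s, ‖v s‖ := by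
    refine norm_sum_le_of_le _ fun σ _ => ?_
    have h2 : ‖Equiv.Perm.sign σ • tensorMul h α β (v ∘ σ)‖ = ‖tensorMul h α β (v ∘ σ)‖ := by
      rcases Int.units_eq_one_or (Equiv.Perm.sign σ) with hs | hs <;> simp [hs]
    rw [h2]
    refine (norm_tensorMul_le h α β _).trans (le_of_eq ?_)
    congr 1
    exact Equiv.prod_comp σ fun s => ‖v s‖
  calc _ ≤ ‖(i.factorial : ℝ)⁻¹ * (l.factorial : ℝ)⁻¹‖ *
        ∑ σ : Equiv.Perm (Fin n), ‖α‖ * ‖β‖ * ∏ s, ‖v s‖ := by gcongr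
    _ = _ := by
        rw [Real.norm_of_nonneg (by positivity), Finset.sum_const, Finset.card_univ, nsmul_eq_mul]
        ring

/-- The wedge product as a continuous bilinear map. -/
def wedgeL (i l n : ℕ) :
    (E [⋀^Fin i]→L[ℝ] A) →L[ℝ] (E [⋀^Fin l]→L[ℝ] A) →L[ℝ] (E [⋀^Fin n]→L[ℝ] A) :=
  LinearMap.mkContinuous₂
    (LinearMap.mk₂ ℝ (wedge' i l n) (MF.wedge'_add_left i l n) (MF.wedge'_smul_left i l n)
      (MF.wedge'_add_right i l n) (fun c α β => MF.wedge'_smul_right i l n c α β))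
    ((i.factorial : ℝ)⁻¹ * (l.factorial : ℝ)⁻¹ * Fintype.card (Equiv.Perm (Fin n)))
    (fun α β => by
      rw [LinearMap.mk₂_apply]
      by_cases h : i + l = n
      · rw [wedge'_eq h]
        exact norm_wedge_le h α β
      · rw [wedge', dif_neg h, norm_zero]
        positivity)

variable {F : Type*} [NormedAddCommGroup F] [NormedSpace ℝ F]

/-- Contraction with a fixed vector as a continuous linear map. -/
def contractL (j : ℕ) (v : E) : (E [⋀^Fin (j + 1)]→L[ℝ] F) →L[ℝ] (E [⋀^Fin j]→L[ℝ] F) :=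
  LinearMap.mkContinuous
    { toFun := fun α => contract v α, map_add' := fun _ _ => rfl, map_smul' := fun _ _ => rfl }
    ‖v‖ (fun α => ContinuousAlternatingMap.opNorm_le_bound _ (by positivity) fun w => by
      refine (α.le_opNorm _).trans (le_of_eq ?_)
      rw [Fin.prod_univ_succ]
      change ‖α‖ * (‖v‖ * ∏ i, ‖w i‖) = _
      ring)

theorem contractL_apply (j : ℕ) (v : E) (α : E [⋀^Fin (j + 1)]→L[ℝ] F) :
    contractL j v α = contract v α := rfl

theorem contract_alternatizeUncurryFin_zero (v : E) (φ : E →L[ℝ] E [⋀^Fin 0]→L[ℝ] F) :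
    contract v (ContinuousAlternatingMap.alternatizeUncurryFin φ) = φ v := by
  ext w
  rw [contract_vecCons, ContinuousAlternatingMap.alternatizeUncurryFin_apply]
  simp [Subsingleton.elim _ w]

theorem contract_alternatizeUncurryFin_succ {j : ℕ} (v : E)
    (φ : E →L[ℝ] E [⋀^Fin (j + 1)]→L[ℝ] F) :
    contract v (ContinuousAlternatingMap.alternatizeUncurryFin φ) =
      φ v - ContinuousAlternatingMap.alternatizeUncurryFin (contractL j v ∘L φ) := by
  ext w
  rw [contract_vecCons, ContinuousAlternatingMap.alternatizeUncurryFin_apply, Fin.sum_univ_succ,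
    ContinuousAlternatingMap.sub_apply, ContinuousAlternatingMap.alternatizeUncurryFin_apply,
    sub_eq_add_neg, ← Finset.sum_neg_distrib]
  congr 1
  · simp [Matrix.vecCons]
  · refine Finset.sum_congr rfl fun i _ => ?_
    rw [Fin.val_succ, pow_succ, mul_neg_one, neg_smul]
    congr 2
    simp only [Matrix.cons_val_succ, ContinuousLinearMap.comp_apply, contractL_apply,
      contract_vecCons]
    congr 1
    funext t
    refine Fin.cases ?_ (fun r => ?_) t
    · simp [Fin.removeNth]
    · simp [Fin.removeNth, Matrix.vecCons]

theorem altMap_neg_one_pow_succ_smul {j : ℕ} (n : ℕ) (α : E [⋀^Fin j]→L[ℝ] F) :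
    (-1 : ℝ) ^ (n + 1) • α = -((-1 : ℝ) ^ n • α) := by
  ext v
  simp [pow_succ]

variable (E A) in
/-- First derivatives of fields of formal forms. -/
def DMF : Type _ := (_k j : ℕ) → E →L[ℝ] E [⋀^Fin j]→L[ℝ] A

namespace DMF

/-- The derivative in the direction `w`. -/
def eval (Φ : DMF E A) (w : E) : MF E A := fun k j => Φ k j w

theorem eval_apply (Φ : DMF E A) (w : E) (k j : ℕ) : Φ.eval w k j = Φ k j w := rfl

theorem ext_eval {Φ Ψ : DMF E A} (h : ∀ w, Φ.eval w = Ψ.eval w) : Φ = Ψ := by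
  funext k j
  ext w : 1
  exact congrArg (fun α : MF E A => α k j) (h w)

instance : Add (DMF E A) := ⟨fun Φ Ψ k j => Φ k j + Ψ k j⟩

theorem eval_add (Φ Ψ : DMF E A) (w : E) : (Φ + Ψ).eval w = Φ.eval w + Ψ.eval w := rfl

/-- Total antisymmetrisation. -/
def alt (Φ : DMF E A) : MF E A := fun k j =>
  match j with
  | 0 => 0
  | j + 1 => ContinuousAlternatingMap.alternatizeUncurryFin (Φ k j)

theorem alt_zero (Φ : DMF E A) (k : ℕ) : Φ.alt k 0 = 0 := rfl

theorem alt_succ (Φ : DMF E A) (k j : ℕ) :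
    Φ.alt k (j + 1) = ContinuousAlternatingMap.alternatizeUncurryFin (Φ k j) := rfl

theorem alt_add (Φ Ψ : DMF E A) : (Φ + Ψ).alt = Φ.alt + Ψ.alt := by
  ext k j : 1
  cases j with
  | zero => simp [alt_zero]
  | succ j => exact ContinuousAlternatingMap.alternatizeUncurryFin_add _ _

/-- Contraction with a fixed vector. -/
def cont (v : E) (Φ : DMF E A) : DMF E A := fun k j => contractL j v ∘L Φ k (j + 1)

theorem eval_cont (v : E) (Φ : DMF E A) (w : E) : (cont v Φ).eval w = MF.cont v (Φ.eval w) := rfl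

/-- The parity operator. -/
def eps (Φ : DMF E A) : DMF E A := fun k j => (-1 : ℝ) ^ j • Φ k j

theorem eval_eps (Φ : DMF E A) (w : E) : (eps Φ).eval w = MF.eps (Φ.eval w) := rfl

theorem eps_alt (Φ : DMF E A) : MF.eps Φ.alt = -(eps Φ).alt := by
  ext k j : 1
  rw [MF.eps_apply, MF.neg_apply]
  cases j with
  | zero => simp [alt_zero]
  | succ j =>
    rw [alt_succ, alt_succ, eps, ContinuousAlternatingMap.alternatizeUncurryFin_smul]
    exact altMap_neg_one_pow_succ_smul j _

theorem cont_alt (v : E) (Φ : DMF E A) : MF.cont v Φ.alt = Φ.eval v - (cont v Φ).alt := by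
  ext k j : 1
  rw [MF.cont_apply, alt_succ, MF.sub_apply, eval_apply]
  cases j with
  | zero => rw [contract_alternatizeUncurryFin_zero, alt_zero, sub_zero]
  | succ j => rw [contract_alternatizeUncurryFin_succ, alt_succ]; rfl

/-- Product with a form on the right. -/
def mulRight (Φ : DMF E A) (β : MF E A) : DMF E A := fun k j =>
  ∑ p ∈ Finset.HasAntidiagonal.antidiagonal k, ∑ q ∈ Finset.HasAntidiagonal.antidiagonal j,
    ((wedgeL q.1 q.2 j).flip (β p.2 q.2)) ∘L Φ p.1 q.1

/-- Product with a form on the left. -/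
def mulLeft (α : MF E A) (Φ : DMF E A) : DMF E A := fun k j =>
  ∑ p ∈ Finset.HasAntidiagonal.antidiagonal k, ∑ q ∈ Finset.HasAntidiagonal.antidiagonal j,
    (wedgeL q.1 q.2 j (α p.1 q.1)) ∘L Φ p.2 q.2

theorem eval_mulRight (Φ : DMF E A) (β : MF E A) (w : E) :
    (Φ.mulRight β).eval w = Φ.eval w * β := by
  ext k j : 1
  rw [MF.mul_apply, eval_apply, mulRight, _root_.sum_apply]
  refine Finset.sum_congr rfl fun p _ => ?_
  rw [_root_.sum_apply]
  rfl

theorem eval_mulLeft (α : MF E A) (Φ : DMF E A) (w : E) :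
    (mulLeft α Φ).eval w = α * Φ.eval w := by
  ext k j : 1
  rw [MF.mul_apply, eval_apply, mulLeft, _root_.sum_apply]
  refine Finset.sum_congr rfl fun p _ => ?_
  rw [_root_.sum_apply]
  rfl

theorem alt_mulRight (Φ : DMF E A) (β : MF E A) : (Φ.mulRight β).alt = Φ.alt * β := by
  ext k j : 1
  induction j generalizing Φ β with
  | zero =>
    rw [alt_zero, MF.mul_apply]
    simp [alt_zero, MF.wedge'_zero_left]
  | succ j ih =>
    refine MF.apply_succ_eq fun v => ?_
    have h : cont v (Φ.mulRight β) =
        (cont v Φ).mulRight β + (eps Φ).mulRight (MF.cont v β) := ext_eval fun w => by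
      simp only [eval_cont, eval_mulRight, MF.cont_mul, eval_add, eval_eps]
    simp only [cont_alt, h, MF.cont_mul, eval_mulRight, alt_add, eps_alt, MF.sub_apply,
      MF.add_apply, ih, sub_mul, neg_mul, MF.neg_apply]
    abel

theorem alt_mulLeft (α : MF E A) (Φ : DMF E A) : (mulLeft α Φ).alt = MF.eps α * Φ.alt := by
  ext k j : 1
  induction j generalizing Φ α with
  | zero =>
    rw [alt_zero, MF.mul_apply]
    simp [alt_zero, MF.wedge'_zero_right]
  | succ j ih =>
    refine MF.apply_succ_eq fun v => ?_
    have h : cont v (mulLeft α Φ) =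
        mulLeft (MF.cont v α) Φ + mulLeft (MF.eps α) (cont v Φ) := ext_eval fun w => by
      simp only [eval_cont, eval_mulLeft, MF.cont_mul, eval_add]
    simp only [cont_alt, h, MF.cont_mul, eval_mulLeft, alt_add, MF.sub_apply,
      MF.add_apply, ih, mul_sub, MF.eps_eps, MF.cont_eps, neg_mul, MF.neg_apply]
    abel

end DMF

/-- The exterior derivative of a field of formal forms on a normed space. -/
def flatD (α : E → MF E A) (x : E) : MF E A := fun k j =>
  match j with
  | 0 => 0
  | j + 1 => extDeriv (fun y => α y k j) x

/-- The derivative of a field of formal forms. -/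
def DMF.ofField (α : E → MF E A) (x : E) : DMF E A := fun k j => fderiv ℝ (fun y => α y k j) x

theorem DMF.eval_ofField (α : E → MF E A) (x w : E) (k j : ℕ) :
    (DMF.ofField α x).eval w k j = fderiv ℝ (fun y => α y k j) x w := rfl

theorem flatD_eq_alt (α : E → MF E A) (x : E) : flatD α x = (DMF.ofField α x).alt := by
  ext k j : 1
  cases j <;> rfl

theorem hasFDerivAt_mul {α β : E → MF E A} {x : E}
    (hα : ∀ k j, DifferentiableAt ℝ (fun y => α y k j) x)
    (hβ : ∀ k j, DifferentiableAt ℝ (fun y => β y k j) x) (k j : ℕ) :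
    HasFDerivAt (fun y => (α y * β y) k j)
      (∑ p ∈ Finset.HasAntidiagonal.antidiagonal k, ∑ q ∈ Finset.HasAntidiagonal.antidiagonal j,
        ((wedgeL q.1 q.2 j).precompR E (α x p.1 q.1) (fderiv ℝ (fun y => β y p.2 q.2) x) +
          (wedgeL q.1 q.2 j).precompL E (fderiv ℝ (fun y => α y p.1 q.1) x) (β x p.2 q.2))) x := by
  simp only [MF.mul_apply]
  exact HasFDerivAt.fun_sum fun p _ => HasFDerivAt.fun_sum fun q _ =>
      (wedgeL q.1 q.2 j).hasFDerivAt_of_bilinear (hα p.1 q.1).hasFDerivAt (hβ p.2 q.2).hasFDerivAt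

theorem contDiffAt_mul {α β : E → MF E A} {x : E} {n : WithTop ℕ∞}
    (hα : ∀ k j, ContDiffAt ℝ n (fun y => α y k j) x)
    (hβ : ∀ k j, ContDiffAt ℝ n (fun y => β y k j) x) (k j : ℕ) :
    ContDiffAt ℝ n (fun y => (α y * β y) k j) x := by
  simp only [MF.mul_apply]
  refine ContDiffAt.sum fun p _ => ContDiffAt.sum fun q _ => ?_
  change ContDiffAt ℝ n (fun y => wedgeL q.1 q.2 j (α y p.1 q.1) (β y p.2 q.2)) x
  exact ((wedgeL q.1 q.2 j).contDiff.contDiffAt.comp x (hα p.1 q.1)).clm_apply (hβ p.2 q.2)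

theorem ofField_mul {α β : E → MF E A} {x : E}
    (hα : ∀ k j, DifferentiableAt ℝ (fun y => α y k j) x)
    (hβ : ∀ k j, DifferentiableAt ℝ (fun y => β y k j) x) :
    DMF.ofField (fun y => α y * β y) x =
      (DMF.ofField α x).mulRight (β x) + DMF.mulLeft (α x) (DMF.ofField β x) := by
  refine DMF.ext_eval fun w => ?_
  rw [DMF.eval_add, DMF.eval_mulLeft, DMF.eval_mulRight]
  ext k j : 1
  rw [DMF.eval_ofField, MF.add_apply, MF.mul_apply, MF.mul_apply, (hasFDerivAt_mul hα hβ k j).fderiv,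
    _root_.sum_apply, ← Finset.sum_add_distrib]
  refine Finset.sum_congr rfl fun p _ => ?_
  rw [_root_.sum_apply, ← Finset.sum_add_distrib]
  refine Finset.sum_congr rfl fun q _ => ?_
  rw [add_comm (wedge' _ _ _ _ _)]
  rfl

theorem flatD_mul {α β : E → MF E A} {x : E}
    (hα : ∀ k j, DifferentiableAt ℝ (fun y => α y k j) x)
    (hβ : ∀ k j, DifferentiableAt ℝ (fun y => β y k j) x) :
    flatD (fun y => α y * β y) x = flatD α x * β x + MF.eps (α x) * flatD β x := by
  rw [flatD_eq_alt, ofField_mul hα hβ, DMF.alt_add, DMF.alt_mulRight, DMF.alt_mulLeft,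
    ← flatD_eq_alt, ← flatD_eq_alt]

end Flat

/-! ### Pullback and exterior derivative of differential forms -/

section CompSmooth

variable {E : Type*} [NormedAddCommGroup E] [NormedSpace ℝ E]
  {E' : Type*} [NormedAddCommGroup E'] [NormedSpace ℝ E']
  {F : Type*} [NormedAddCommGroup F] [NormedSpace ℝ F]
  {X : Type*} [NormedAddCommGroup X] [NormedSpace ℝ X]

/-- Alternatization as a continuous linear map. -/
def alternatizationL (j : ℕ) :
    ContinuousMultilinearMap ℝ (fun _ : Fin j => E) F →L[ℝ] E [⋀^Fin j]→L[ℝ] F :=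
  LinearMap.mkContinuous
    { toFun := fun m => ContinuousMultilinearMap.alternatization m
      map_add' := fun m m' => map_add _ m m'
      map_smul' := fun c m => by
        ext v
        simp only [ContinuousMultilinearMap.alternatization_apply_apply, RingHom.id_apply,
          ContinuousAlternatingMap.smul_apply, Finset.smul_sum, _root_.smul_apply]
        exact Finset.sum_congr rfl fun σ _ => smul_comm _ _ _ }
    (Fintype.card (Equiv.Perm (Fin j))) (fun m => by
      refine ContinuousAlternatingMap.opNorm_le_bound _ (by positivity) fun v => ?_
      change ‖ContinuousMultilinearMap.alternatization m v‖ ≤ _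
      rw [ContinuousMultilinearMap.alternatization_apply_apply]
      have h1 : ‖∑ σ : Equiv.Perm (Fin j), Equiv.Perm.sign σ • m (v ∘ σ)‖ ≤
          ∑ σ : Equiv.Perm (Fin j), ‖m‖ * ∏ s, ‖v s‖ := by
        refine norm_sum_le_of_le _ fun σ _ => ?_
        have h2 : ‖Equiv.Perm.sign σ • m (v ∘ σ)‖ = ‖m (v ∘ σ)‖ := by
          rcases Int.units_eq_one_or (Equiv.Perm.sign σ) with hs | hs <;> simp [hs]
        rw [h2]
        refine (m.le_opNorm _).trans (le_of_eq ?_)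
        congr 1
        exact Equiv.prod_comp σ fun s => ‖v s‖
      refine h1.trans (le_of_eq ?_)
      rw [Finset.sum_const, Finset.card_univ, nsmul_eq_mul]
      ring)

theorem alternatizationL_coe {j : ℕ} (α : E [⋀^Fin j]→L[ℝ] F) :
    alternatizationL j α.toContinuousMultilinearMap = (j.factorial : ℝ) • α := by
  ext v
  have h := congrArg (fun m : E [⋀^Fin j]→ₗ[ℝ] F => m v)
    (AlternatingMap.coe_alternatization α.toAlternatingMap)
  simp only [Fintype.card_fin, MultilinearMap.alternatization_apply] at h
  change ContinuousMultilinearMap.alternatization _ v = _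
  rw [ContinuousMultilinearMap.alternatization_apply_apply]
  refine Eq.trans ?_ (h.trans ?_)
  · rfl
  · rw [ContinuousAlternatingMap.smul_apply, Nat.cast_smul_eq_nsmul]
    rfl

theorem ContDiffAt.compContinuousLinearMap_form {j : ℕ} {n : WithTop ℕ∞}
    {f : X → E' [⋀^Fin j]→L[ℝ] F} {g : X → E →L[ℝ] E'} {x : X} (hf : ContDiffAt ℝ n f x)
    (hg : ContDiffAt ℝ n g x) :
    ContDiffAt ℝ n (fun y => (f y).compContinuousLinearMap (g y)) x := by
  have h1 : ContDiffAt ℝ n (fun y => ContinuousMultilinearMap.compContinuousLinearMapContinuousMultilinear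
      ℝ (fun _ : Fin j => E) (fun _ => E') F (fun _ => g y)) x :=
    (ContinuousMultilinearMap.contDiff _).contDiffAt.comp x (contDiffAt_pi.2 fun _ => hg)
  have h2 : ContDiffAt ℝ n (fun y => (f y).toContinuousMultilinearMap) x :=
    ((ContinuousAlternatingMap.toContinuousMultilinearMapCLM ℝ :
      (E' [⋀^Fin j]→L[ℝ] F) →L[ℝ] _)).contDiff.contDiffAt.comp x hf
  have h3 := ((alternatizationL j).contDiff.contDiffAt.comp x (h1.clm_apply h2)).const_smul
    ((j.factorial : ℝ)⁻¹)
  refine h3.congr_of_eventuallyEq (Filter.Eventually.of_forall fun y => ?_)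
  have h4 : alternatizationL j ((f y).compContinuousLinearMap (g y)).toContinuousMultilinearMap =
    (j.factorial : ℝ) • (f y).compContinuousLinearMap (g y) := alternatizationL_coe _
  change _ = (j.factorial : ℝ)⁻¹ • alternatizationL j
    ((f y).compContinuousLinearMap (g y)).toContinuousMultilinearMap
  rw [h4, smul_smul, inv_mul_cancel₀ (by positivity), one_smul]

end CompSmooth

section Pullback

variable {E : Type*} [NormedAddCommGroup E] [NormedSpace ℝ E] {S : Type*} [TopologicalSpace S]
  (I : ModelWithCorners ℝ E S) {N : Type*} [TopologicalSpace N] [ChartedSpace S N]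
  {E' : Type*} [NormedAddCommGroup E'] [NormedSpace ℝ E'] {S' : Type*} [TopologicalSpace S']
  (I' : ModelWithCorners ℝ E' S') {N' : Type*} [TopologicalSpace N'] [ChartedSpace S' N']
  {E'' : Type*} [NormedAddCommGroup E''] [NormedSpace ℝ E''] {S'' : Type*} [TopologicalSpace S'']
  (I'' : ModelWithCorners ℝ E'' S'') {N'' : Type*} [TopologicalSpace N''] [ChartedSpace S'' N'']
  {F : Type*} [NormedAddCommGroup F] [NormedSpace ℝ F]

/-- Pullback of a form. -/
def pb {j : ℕ} (φ : N → N') (w : RawForm I' N' F j) : RawForm I N F j := fun x =>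
  (w (φ x)).compContinuousLinearMap (mfderiv I I' φ x)

theorem pb_apply {j : ℕ} (φ : N → N') (w : RawForm I' N' F j) (x : N)
    (v : Fin j → TangentSpace I x) : pb I I' φ w x v = w (φ x) (fun i => mfderiv I I' φ x (v i)) :=
  rfl

variable {I I' I''} in
theorem rawForm_congr_point {j : ℕ} (w : RawForm I' N' F j) {a b : N'} (h : a = b)
    (u : Fin j → E') : (w a (u : Fin j → TangentSpace I' a) : F) =
      w b (u : Fin j → TangentSpace I' b) := by
  subst h; rfl

theorem pb_congr_map {j : ℕ} {φ ψ : N → N'} (w : RawForm I' N' F j) {x : N}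
    (h : φ =ᶠ[𝓝 x] ψ) : pb I I' φ w x = pb I I' ψ w x := by
  ext v
  have h2 : ∀ v : TangentSpace I x, (mfderiv I I' φ x v : E') = mfderiv I I' ψ x v := fun v => by
    rw [h.mfderiv_eq]
    rfl
  rw [pb_apply, pb_apply]
  refine (rawForm_congr_point w h.self_of_nhds _).trans ?_
  congr 1
  funext i
  exact h2 (v i)

theorem pb_comp {j : ℕ} {φ : N → N'} {ψ : N' → N''} (w : RawForm I'' N'' F j) {x : N}
    (hψ : MDifferentiableAt I' I'' ψ (φ x)) (hφ : MDifferentiableAt I I' φ x) :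
    pb I I'' (ψ ∘ φ) w x = pb I I' φ (pb I' I'' ψ w) x := by
  ext v
  rw [pb_apply, pb_apply, pb_apply, mfderiv_comp x hψ hφ]
  rfl

theorem chartRep_eq_pb {j : ℕ} (w : RawForm I N F j) (x : N) (y : E) :
    chartRep I w x y = pb 𝓘(ℝ, E) I (extChartAt I x).symm w y := rfl

/-- The form is of class `C^n` at a point. -/
def FormContDiffAt {j : ℕ} (n : WithTop ℕ∞) (w : RawForm I N F j) (x : N) : Prop :=
  ContDiffAt ℝ n (chartRep I w x) (extChartAt I x x)

theorem SmoothFormAt.formContDiffAt {j : ℕ} {w : RawForm I N F j} {x : N}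
    (h : SmoothFormAt I w x) : FormContDiffAt I ∞ w x := h

variable {I} in
theorem FormContDiffAt.of_le {j : ℕ} {n m : WithTop ℕ∞} {w : RawForm I N F j} {x : N}
    (h : FormContDiffAt I n w x) (hm : m ≤ n) : FormContDiffAt I m w x := ContDiffAt.of_le h hm

theorem extD_eq [IsManifold I 1 N] {j : ℕ} (w : RawForm I N F j) (x : N) :
    extD I w x = (extDeriv (chartRep I w x) (extChartAt I x x) : E [⋀^Fin (j + 1)]→L[ℝ] F) := by
  ext v
  change extDeriv (chartRep I w x) (extChartAt I x x)
    (fun i => mfderiv I 𝓘(ℝ, E) (extChartAt I x) x (v i)) = _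
  rw [mfderiv_extChartAt_self]
  rfl

variable [I.Boundaryless] [I'.Boundaryless] [I''.Boundaryless]

theorem tendsto_extChartAt_symm (x : N) :
    Filter.Tendsto (extChartAt I x).symm (𝓝 (extChartAt I x x)) (𝓝 x) := by
  have := (continuousAt_extChartAt_symm (I := I) x).tendsto
  rwa [extChartAt_to_inv] at this

theorem chartRep_eventuallyEq {j : ℕ} {w η : RawForm I N F j} {x : N}
    (h : ∀ᶠ y in 𝓝 x, w y = η y) :
    chartRep I w x =ᶠ[𝓝 (extChartAt I x x)] chartRep I η x := by
  filter_upwards [(tendsto_extChartAt_symm I x).eventually h] with y hy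
  rw [chartRep, chartRep, hy]

theorem FormContDiffAt.congr {j : ℕ} {n : WithTop ℕ∞} {w η : RawForm I N F j} {x : N}
    (hη : FormContDiffAt I n η x) (h : ∀ᶠ y in 𝓝 x, w y = η y) : FormContDiffAt I n w x :=
  ContDiffAt.congr_of_eventuallyEq hη (chartRep_eventuallyEq I h)

theorem SmoothFormAt.congr {j : ℕ} {w η : RawForm I N F j} {x : N}
    (hη : SmoothFormAt I η x) (h : ∀ᶠ y in 𝓝 x, w y = η y) : SmoothFormAt I w x :=
  ContDiffAt.congr_of_eventuallyEq hη (chartRep_eventuallyEq I h)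

theorem extD_congr {j : ℕ} {w η : RawForm I N F j} {x : N}
    (h : ∀ᶠ y in 𝓝 x, w y = η y) : extD I w x = extD I η x := by
  rw [extD, extD, (chartRep_eventuallyEq I h).extDeriv_eq]

variable [IsManifold I ∞ N] [IsManifold I' ∞ N'] [IsManifold I'' ∞ N'']

theorem contMDiffAt_extChartAt_symm {x : N} {y : E} (hy : y ∈ (extChartAt I x).target)
    {n : WithTop ℕ∞} [IsManifold I n N] : ContMDiffAt 𝓘(ℝ, E) I n (extChartAt I x).symm y :=
  (contMDiffOn_extChartAt_symm x).contMDiffAt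
    ((isOpen_extChartAt_target x).mem_nhds hy)

/-- The expression of a map in charts. -/
def chartMap (φ : N → N') (x : N) : E → E' :=
  extChartAt I' (φ x) ∘ φ ∘ (extChartAt I x).symm

theorem chartMap_apply_self (φ : N → N') (x : N) :
    chartMap I I' φ x (extChartAt I x x) = extChartAt I' (φ x) (φ x) := by
  simp [chartMap]

theorem contDiffAt_chartMap {n : WithTop ℕ∞} {φ : N → N'} {x : N} (hφ : ContMDiffAt I I' n φ x) :
    ContDiffAt ℝ n (chartMap I I' φ x) (extChartAt I x x) := by
  have h := (contMDiffAt_iff.1 hφ).2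
  rwa [I.range_eq_univ, contDiffWithinAt_univ] at h

theorem chartRep_pb {j : ℕ} {φ : N → N'} {x : N} (hφ : ContMDiffAt I I' 1 φ x)
    (w : RawForm I' N' F j) :
    chartRep I (pb I I' φ w) x =ᶠ[𝓝 (extChartAt I x x)] fun y =>
      (chartRep I' w (φ x) (chartMap I I' φ x y)).compContinuousLinearMap
        (fderiv ℝ (chartMap I I' φ x) y) := by
  have h1 : ∀ᶠ y in 𝓝 (extChartAt I x x), ContMDiffAt I I' 1 φ ((extChartAt I x).symm y) :=
    (tendsto_extChartAt_symm I x).eventually ((contMDiffAt_iff_contMDiffAt_nhds (by simp)).1 hφ)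
  have hs : ∀ᶠ z in 𝓝 x, φ z ∈ (extChartAt I' (φ x)).source :=
    hφ.continuousAt.eventually (extChartAt_source_mem_nhds (φ x))
  have h2 : ∀ᶠ y in 𝓝 (extChartAt I x x), ∀ᶠ y' in 𝓝 y,
      φ ((extChartAt I x).symm y') ∈ (extChartAt I' (φ x)).source :=
    ((tendsto_extChartAt_symm I x).eventually hs).eventually_nhds
  filter_upwards [h1, h2, extChartAt_target_mem_nhds x,
    (contDiffAt_chartMap I I' hφ).eventually (by simp)] with y h1 h2 h3 h4
  have hd1 : MDifferentiableAt 𝓘(ℝ, E) I (extChartAt I x).symm y :=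
    (contMDiffAt_extChartAt_symm (n := 1) I h3).mdifferentiableAt (by simp)
  have hd2 : MDifferentiableAt I I' φ ((extChartAt I x).symm y) := h1.mdifferentiableAt (by simp)
  have h5 : chartMap I I' φ x y ∈ (extChartAt I' (φ x)).target :=
    (extChartAt I' (φ x)).map_source h2.self_of_nhds
  have hd3 : MDifferentiableAt 𝓘(ℝ, E') I' (extChartAt I' (φ x)).symm (chartMap I I' φ x y) :=
    (contMDiffAt_extChartAt_symm (n := 1) I' h5).mdifferentiableAt (by simp)
  have hd4 : MDifferentiableAt 𝓘(ℝ, E) 𝓘(ℝ, E') (chartMap I I' φ x) y :=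
    (h4.differentiableAt (by simp)).mdifferentiableAt
  rw [chartRep_eq_pb, ← pb_comp 𝓘(ℝ, E) I I' w hd2 hd1]
  have h6 : φ ∘ (extChartAt I x).symm =ᶠ[𝓝 y] (extChartAt I' (φ x)).symm ∘ chartMap I I' φ x := by
    filter_upwards [h2] with y' h2
    exact ((extChartAt I' (φ x)).left_inv h2).symm
  rw [pb_congr_map _ _ _ h6, pb_comp 𝓘(ℝ, E) 𝓘(ℝ, E') I' w hd3 hd4]
  rw [← mfderiv_eq_fderiv]
  rfl

theorem FormContDiffAt.pb {j : ℕ} {n m : WithTop ℕ∞} {φ : N → N'} {x : N}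
    (hφ : ContMDiffAt I I' m φ x) (hm : n + 1 ≤ m) {w : RawForm I' N' F j}
    (hw : FormContDiffAt I' n w (φ x)) : FormContDiffAt I n (TwistedChern.pb I I' φ w) x := by
  have h1 : ContMDiffAt I I' 1 φ x := hφ.of_le (le_trans le_add_self hm)
  refine ContDiffAt.congr_of_eventuallyEq ?_ (chartRep_pb I I' h1 w)
  have hc := contDiffAt_chartMap I I' hφ
  have hw' : ContDiffAt ℝ n (chartRep I' w (φ x)) (chartMap I I' φ x (extChartAt I x x)) := by
    rw [chartMap_apply_self]
    exact hw
  exact ContDiffAt.compContinuousLinearMap_form (hw'.comp _ (hc.of_le (le_trans le_self_add hm)))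
    (hc.fderiv_right hm)

theorem SmoothFormAt.pb {j : ℕ} {φ : N → N'} {x : N}
    (hφ : ContMDiffAt I I' ∞ φ x) {w : RawForm I' N' F j}
    (hw : SmoothFormAt I' w (φ x)) : SmoothFormAt I (TwistedChern.pb I I' φ w) x :=
  FormContDiffAt.pb I I' hφ (by simp) hw

theorem mfderiv_eq_fderiv_chartMap {φ : N → N'} {x : N} (h : MDifferentiableAt I I' φ x) (v : E) :
    (mfderiv I I' φ x v : E') = fderiv ℝ (chartMap I I' φ x) (extChartAt I x x) v := by
  rw [h.mfderiv]
  change fderivWithin ℝ (chartMap I I' φ x) (Set.range I) (extChartAt I x x) v = _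
  rw [I.range_eq_univ, fderivWithin_univ]

theorem extD_pb {j : ℕ} {φ : N → N'} {x : N}
    (hφ : ContMDiffAt I I' 2 φ x) {w : RawForm I' N' F j}
    (hw : FormContDiffAt I' 1 w (φ x)) :
    extD I (TwistedChern.pb I I' φ w) x = TwistedChern.pb I I' φ (extD I' w) x := by
  have h1 : ContMDiffAt I I' 1 φ x := hφ.of_le (by norm_num)
  have hc := contDiffAt_chartMap I I' hφ
  have hw' : DifferentiableAt ℝ (chartRep I' w (φ x)) (chartMap I I' φ x (extChartAt I x x)) := by
    rw [chartMap_apply_self]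
    exact ContDiffAt.differentiableAt hw (by simp)
  have e := extDeriv_pullback hw' hc (by simp)
  ext v
  rw [extD_eq, (chartRep_pb I I' h1 w).extDeriv_eq, e, pb_apply, extD_eq]
  change extDeriv (chartRep I' w (φ x)) _ (fun i => fderiv ℝ (chartMap I I' φ x) _ (v i)) = _
  rw [chartMap_apply_self]
  congr 1
  funext i
  exact (mfderiv_eq_fderiv_chartMap I I' (h1.mdifferentiableAt (by simp)) (v i)).symm

theorem chartRep_model {j : ℕ} (w : RawForm 𝓘(ℝ, E) E F j) (x y : E) :
    chartRep 𝓘(ℝ, E) w x y = (w y : E [⋀^Fin j]→L[ℝ] F) := by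
  ext v
  change w y (fun i => mfderiv 𝓘(ℝ, E) 𝓘(ℝ, E) id y (v i)) = w y v
  rw [mfderiv_id]
  rfl

theorem extD_eq_extDeriv {j : ℕ} (w : RawForm 𝓘(ℝ, E) E F j) (x : E) :
    extD 𝓘(ℝ, E) w x = extDeriv (F := F) (E := E) (fun y => w y) x := by
  rw [extD_eq, funext (chartRep_model w x)]
  rfl

theorem formContDiffAt_model_iff {j : ℕ} {n : WithTop ℕ∞} (w : RawForm 𝓘(ℝ, E) E F j) (x : E) :
    FormContDiffAt 𝓘(ℝ, E) n w x ↔ ContDiffAt ℝ n (F := E [⋀^Fin j]→L[ℝ] F) (fun y => w y) x := by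
  rw [FormContDiffAt, funext (chartRep_model w x)]
  rfl

/-- A form is the pullback of its expression in a chart. -/
theorem pb_chartRep {j : ℕ} (w : RawForm I N F j) {x z : N} (hz : z ∈ (extChartAt I x).source) :
    pb I 𝓘(ℝ, E) (extChartAt I x) (fun y => (chartRep I w x y : E [⋀^Fin j]→L[ℝ] F)) z = w z := by
  have ht := (extChartAt I x).map_source hz
  have h1 : MDifferentiableAt 𝓘(ℝ, E) I (extChartAt I x).symm (extChartAt I x z) :=
    (contMDiffAt_extChartAt_symm (n := 1) I ht).mdifferentiableAt (by simp)
  have h2 : MDifferentiableAt I 𝓘(ℝ, E) (extChartAt I x) z :=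
    mdifferentiableAt_extChartAt (by simpa using hz)
  have e : pb I 𝓘(ℝ, E) (extChartAt I x) (fun y => (chartRep I w x y : E [⋀^Fin j]→L[ℝ] F)) z =
      pb I I ((extChartAt I x).symm ∘ extChartAt I x) w z := (pb_comp I 𝓘(ℝ, E) I w h1 h2).symm
  have h3 : (extChartAt I x).symm ∘ extChartAt I x =ᶠ[𝓝 z] id := by
    filter_upwards [(isOpen_extChartAt_source x).mem_nhds hz] with z' hz'
    exact (extChartAt I x).left_inv hz'
  rw [e, pb_congr_map I I w h3]
  ext v
  rw [pb_apply, mfderiv_id]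
  rfl

theorem FormContDiffAt.eventually {j : ℕ} {n : ℕ} {w : RawForm I N F j} {x : N}
    (h : FormContDiffAt I n w x) : ∀ᶠ z in 𝓝 x, FormContDiffAt I n w z := by
  have h1 : ∀ᶠ y in 𝓝 (extChartAt I x x), ContDiffAt ℝ n (chartRep I w x) y :=
    ContDiffAt.eventually h (by simp)
  filter_upwards [(continuousAt_extChartAt x).eventually h1, extChartAt_source_mem_nhds (I := I) x]
    with z hz hs
  have h2 : FormContDiffAt I n (TwistedChern.pb I 𝓘(ℝ, E) (extChartAt I x)
      (fun y => (chartRep I w x y : E [⋀^Fin j]→L[ℝ] F))) z :=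
    FormContDiffAt.pb (m := ∞) I 𝓘(ℝ, E) (contMDiffAt_extChartAt' (by simpa using hs))
      (by exact_mod_cast le_top) ((formContDiffAt_model_iff _ _).2 hz)
  refine h2.congr I ?_
  filter_upwards [(isOpen_extChartAt_source x).mem_nhds hs] with z' hz'
  exact (pb_chartRep I w hz').symm

theorem chartRep_extD {j : ℕ} {w : RawForm I N F j} {x : N} (h : FormContDiffAt I 1 w x) :
    chartRep I (extD I w) x =ᶠ[𝓝 (extChartAt I x x)] extDeriv (chartRep I w x) := by
  filter_upwards [extChartAt_target_mem_nhds x,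
    (tendsto_extChartAt_symm I x).eventually (FormContDiffAt.eventually (n := 1) I h)] with y hy hw
  rw [chartRep_eq_pb, ← extD_pb 𝓘(ℝ, E) I (contMDiffAt_extChartAt_symm I hy) hw, extD_eq_extDeriv]
  rfl

theorem SmoothFormAt.extD {j : ℕ} {w : RawForm I N F j} {x : N} (h : SmoothFormAt I w x) :
    SmoothFormAt I (TwistedChern.extD I w) x := by
  refine ContDiffAt.congr_of_eventuallyEq ?_ (chartRep_extD I (FormContDiffAt.of_le h (by simp)))
  have h2 : ContDiffAt ℝ ∞ (fderiv ℝ (chartRep I w x)) (extChartAt I x x) :=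
    ContDiffAt.fderiv_right h (by simp)
  exact (ContinuousAlternatingMap.alternatizeUncurryFinCLM ℝ E F).contDiff.contDiffAt.comp _ h2

theorem extD_extD {j : ℕ} {w : RawForm I N F j} {x : N} (h : FormContDiffAt I 2 w x) :
    extD I (extD I w) x = 0 := by
  rw [extD_eq, (chartRep_extD I (FormContDiffAt.of_le h (by norm_num))).extDeriv_eq]
  exact extDeriv_extDeriv_apply h (by simp)

end Pullback

/-! ### Exterior derivative of fields of formal forms -/

theorem two_le_infty : (2 : WithTop ℕ∞) ≤ ∞ :=
  WithTop.coe_le_coe.2 (le_top : (2 : ℕ∞) ≤ ⊤)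

section Fields

variable {E : Type*} [NormedAddCommGroup E] [NormedSpace ℝ E] {S : Type*} [TopologicalSpace S]
  (I : ModelWithCorners ℝ E S) {N : Type*} [TopologicalSpace N] [ChartedSpace S N]
  {E' : Type*} [NormedAddCommGroup E'] [NormedSpace ℝ E'] {S' : Type*} [TopologicalSpace S']
  (I' : ModelWithCorners ℝ E' S') {N' : Type*} [TopologicalSpace N'] [ChartedSpace S' N']
  {F : Type*} [NormedAddCommGroup F] [NormedSpace ℝ F]
  {F' : Type*} [NormedAddCommGroup F'] [NormedSpace ℝ F']
  {A : Type*} [NormedRing A] [NormedAlgebra ℝ A]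
  {A' : Type*} [NormedRing A'] [NormedAlgebra ℝ A']

theorem chartRep_add {j : ℕ} (w η : RawForm I N F j) (x : N) :
    chartRep I (fun y => w y + η y) x = fun y => chartRep I w x y + chartRep I η x y := rfl

theorem chartRep_smul {j : ℕ} (c : ℝ) (w : RawForm I N F j) (x : N) :
    chartRep I (fun y => c • w y) x = fun y => c • chartRep I w x y := rfl

theorem chartRep_map {j : ℕ} (φ : F →L[ℝ] F') (w : RawForm I N F j) (x : N) :
    chartRep I (fun y => φ.compContinuousAlternatingMap (w y)) x =
      fun y => φ.compContinuousAlternatingMap (chartRep I w x y) := rfl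

theorem SmoothFormAt.const_smul {j : ℕ} {w : RawForm I N F j} {x : N}
    (h : SmoothFormAt I w x) (c : ℝ) : SmoothFormAt I (fun y => c • w y) x :=
  ContDiffAt.const_smul c h

theorem SmoothFormAt.map {j : ℕ} {w : RawForm I N F j} {x : N}
    (h : SmoothFormAt I w x) (φ : F →L[ℝ] F') :
    SmoothFormAt I (fun y => φ.compContinuousAlternatingMap (w y)) x :=
  (ContinuousLinearMap.compContinuousAlternatingMapCLM ℝ E F F' (ι := Fin j) φ).contDiff.contDiffAt.comp _ h

section extD

variable [IsManifold I 1 N]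

theorem extD_add_at {j : ℕ} {w η : RawForm I N F j} {x : N} (h : FormContDiffAt I 1 w x)
    (h' : FormContDiffAt I 1 η x) :
    extD I (fun y => w y + η y) x = extD I w x + extD I η x := by
  have : extDeriv (fun y => chartRep I w x y + chartRep I η x y) (extChartAt I x x) =
      extDeriv (chartRep I w x) (extChartAt I x x) + extDeriv (chartRep I η x) (extChartAt I x x) :=
    extDeriv_add (ContDiffAt.differentiableAt h (by simp))
      (ContDiffAt.differentiableAt h' (by simp))
  rw [extD_eq, chartRep_add, this, extD_eq, extD_eq]
  rfl

theorem extD_smul_at {j : ℕ} {w : RawForm I N F j} {x : N} (c : ℝ) :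
    extD I (fun y => c • w y) x = c • extD I w x := by
  have : extDeriv (fun y => c • chartRep I w x y) (extChartAt I x x) =
      c • extDeriv (chartRep I w x) (extChartAt I x x) :=
    extDeriv_smul c _
  rw [extD_eq, chartRep_smul, this, extD_eq]
  rfl

theorem extD_map {j : ℕ} {w : RawForm I N F j} {x : N} (h : FormContDiffAt I 1 w x)
    (φ : F →L[ℝ] F') : extD I (fun y => φ.compContinuousAlternatingMap (w y)) x =
      φ.compContinuousAlternatingMap (extD I w x) := by
  have hd : DifferentiableAt ℝ (chartRep I w x) (extChartAt I x x) :=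
    ContDiffAt.differentiableAt h (by simp)
  have h1 := ((ContinuousLinearMap.compContinuousAlternatingMapCLM ℝ E F F'
    (ι := Fin j) φ).hasFDerivAt.comp _ hd.hasFDerivAt).fderiv
  rw [extD_eq, chartRep_map, extD_eq]
  ext v
  change ContinuousAlternatingMap.alternatizeUncurryFin (fderiv ℝ
    ((ContinuousLinearMap.compContinuousAlternatingMapCLM ℝ E F F' (ι := Fin j) φ) ∘
      chartRep I w x) (extChartAt I x x)) v = φ (extDeriv (chartRep I w x) (extChartAt I x x) v)
  rw [h1, extDeriv, ContinuousAlternatingMap.alternatizeUncurryFin_apply,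
    ContinuousAlternatingMap.alternatizeUncurryFin_apply, map_sum]
  refine Finset.sum_congr rfl fun i _ => ?_
  rw [map_zsmul]
  rfl

end extD

variable [I.Boundaryless] [I'.Boundaryless]

/-- A field of formal forms is smooth at a point. -/
def SmoothFieldAt (α : (x : N) → MF (TangentSpace I x) A) (x : N) : Prop :=
  ∀ k j, SmoothFormAt I (fun y => α y k j) x

/-- The exterior derivative of a field of formal forms. -/
def extDF (α : (x : N) → MF (TangentSpace I x) A) (x : N) : MF (TangentSpace I x) A := fun k j =>
  match j with
  | 0 => 0
  | j + 1 => extD I (fun y => α y k j) x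

/-- The expression of a field of formal forms in a chart. -/
def chartField (α : (x : N) → MF (TangentSpace I x) A) (x : N) (y : E) : MF E A :=
  MF.comp (mfderiv 𝓘(ℝ, E) I (extChartAt I x).symm y) (α ((extChartAt I x).symm y))

/-- Pullback of a field of formal forms. -/
def pbF (φ : N → N') (α : (x : N') → MF (TangentSpace I' x) A) (x : N) : MF (TangentSpace I x) A :=
  MF.comp (mfderiv I I' φ x) (α (φ x))

theorem pbF_apply (φ : N → N') (α : (x : N') → MF (TangentSpace I' x) A) (x : N) (k j : ℕ) :
    pbF I I' φ α x k j = pb I I' φ (fun y => α y k j) x := rfl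

theorem extDF_zero (α : (x : N) → MF (TangentSpace I x) A) (x : N) (k : ℕ) :
    extDF I α x k 0 = 0 := rfl

theorem extDF_succ (α : (x : N) → MF (TangentSpace I x) A) (x : N) (k j : ℕ) :
    extDF I α x k (j + 1) = extD I (fun y => α y k j) x := rfl

theorem chartField_apply (α : (x : N) → MF (TangentSpace I x) A) (x : N) (y : E) (k j : ℕ) :
    chartField I α x y k j = chartRep I (fun z => α z k j) x y := rfl

theorem chartField_mul (α β : (x : N) → MF (TangentSpace I x) A) (x : N) (y : E) :
    chartField I (fun z => α z * β z) x y = chartField I α x y * chartField I β x y :=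
  map_mul (MF.comp _) _ _

theorem extDF_congr {α β : (x : N) → MF (TangentSpace I x) A} {x : N}
    (h : ∀ᶠ y in 𝓝 x, α y = β y) : extDF I α x = extDF I β x := by
  ext k j : 1
  cases j with
  | zero => rfl
  | succ j => exact extD_congr I (h.mono fun y hy => by rw [hy])

theorem SmoothFieldAt.add {α β : (x : N) → MF (TangentSpace I x) A} {x : N}
    (hα : SmoothFieldAt I α x) (hβ : SmoothFieldAt I β x) :
    SmoothFieldAt I (fun y => α y + β y) x := fun k j =>
  SmoothFormAt.add I (hα k j) (hβ k j)

theorem SmoothFieldAt.smul {α : (x : N) → MF (TangentSpace I x) A} {x : N}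
    (hα : SmoothFieldAt I α x) (c : ℝ) : SmoothFieldAt I (fun y => c • α y) x := fun k j =>
  SmoothFormAt.const_smul I (hα k j) c

theorem SmoothFieldAt.zero {x : N} :
    SmoothFieldAt I (fun y => (0 : MF (TangentSpace I y) A)) x := fun _ _ =>
  SmoothFormAt.zero I

theorem SmoothFieldAt.sum {ι : Type*} (s : Finset ι)
    {α : ι → (x : N) → MF (TangentSpace I x) A} {x : N}
    (hα : ∀ i ∈ s, SmoothFieldAt I (α i) x) : SmoothFieldAt I (fun y => ∑ i ∈ s, α i y) x := by
  classical
  induction s using Finset.induction_on with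
  | empty => simpa using SmoothFieldAt.zero I
  | insert i s hi ih =>
    simp only [Finset.sum_insert hi]
    exact SmoothFieldAt.add I (hα i (Finset.mem_insert_self _ _))
      (ih fun i hi => hα i (Finset.mem_insert_of_mem hi))

theorem SmoothFieldAt.mul {α β : (x : N) → MF (TangentSpace I x) A} {x : N}
    (hα : SmoothFieldAt I α x) (hβ : SmoothFieldAt I β x) :
    SmoothFieldAt I (fun y => α y * β y) x := fun k j => by
  have h := contDiffAt_mul (n := ∞) (α := chartField I α x) (β := chartField I β x) (x := extChartAt I x x)
    (fun k j => hα k j) (fun k j => hβ k j) k j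
  simp only [← chartField_mul] at h
  exact h

theorem SmoothFieldAt.map {α : (x : N) → MF (TangentSpace I x) A} {x : N}
    (hα : SmoothFieldAt I α x) (φ : A →L[ℝ] A') : SmoothFieldAt I (fun y => MF.map φ (α y)) x :=
  fun k j => SmoothFormAt.map I (hα k j) φ

section Calculus
variable [IsManifold I 1 N]

theorem extDF_eq_flatD (α : (x : N) → MF (TangentSpace I x) A) (x : N) :
    extDF I α x = (flatD (chartField I α x) (extChartAt I x x) : MF E A) := by
  ext k j : 1
  cases j with
  | zero => rfl
  | succ j => exact extD_eq I _ _

theorem extDF_mul {α β : (x : N) → MF (TangentSpace I x) A} {x : N}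
    (hα : SmoothFieldAt I α x) (hβ : SmoothFieldAt I β x) :
    extDF I (fun y => α y * β y) x = extDF I α x * β x + MF.eps (α x) * extDF I β x := by
  have key : ∀ γ : (x : N) → MF (TangentSpace I x) A,
      chartField I γ x (extChartAt I x x) = (γ x : MF E A) := fun γ => by
    ext k j v
    rw [chartField_apply]
    change γ ((extChartAt I x).symm (extChartAt I x x)) k j
      (fun i => mfderiv 𝓘(ℝ, E) I (extChartAt I x).symm (extChartAt I x x) (v i)) = _
    have h1 : mfderiv 𝓘(ℝ, E) I (extChartAt I x).symm (extChartAt I x x) =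
        ContinuousLinearMap.id ℝ E := by
      rw [← mfderivWithin_univ, ← I.range_eq_univ]
      exact mfderivWithin_range_extChartAt_symm
    rw [h1]
    exact rawForm_congr_point (I' := I) (fun y => γ y k j) (extChartAt_to_inv x) v
  rw [extDF_eq_flatD]
  have h0 : chartField I (fun y => α y * β y) x =
      fun y => chartField I α x y * chartField I β x y := funext (chartField_mul I α β x)
  have h3 := flatD_mul (α := chartField I α x) (β := chartField I β x) (x := extChartAt I x x) (fun k j => ContDiffAt.differentiableAt (hα k j) (by simp))
    (fun k j => ContDiffAt.differentiableAt (hβ k j) (by simp))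
  rw [key, key] at h3
  rw [h0]
  refine h3.trans ?_
  rw [extDF_eq_flatD, extDF_eq_flatD]
  rfl

theorem extDF_add {α β : (x : N) → MF (TangentSpace I x) A} {x : N}
    (hα : SmoothFieldAt I α x) (hβ : SmoothFieldAt I β x) :
    extDF I (fun y => α y + β y) x = extDF I α x + extDF I β x := by
  ext k j : 1
  cases j with
  | zero => exact (add_zero _).symm
  | succ j =>
    exact extD_add_at I ((hα k j).formContDiffAt.of_le (by simp))
      ((hβ k j).formContDiffAt.of_le (by simp))

theorem extDF_smul {α : (x : N) → MF (TangentSpace I x) A} {x : N} (c : ℝ) :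
    extDF I (fun y => c • α y) x = c • extDF I α x := by
  ext k j : 1
  cases j with
  | zero => exact (altMap_smul_zero c).symm
  | succ j => exact extD_smul_at I c

theorem extDF_map {α : (x : N) → MF (TangentSpace I x) A} {x : N}
    (hα : SmoothFieldAt I α x) (φ : A →L[ℝ] A') :
    extDF I (fun y => MF.map φ (α y)) x = MF.map φ (extDF I α x) := by
  ext k j : 1
  cases j with
  | zero => ext v; exact (map_zero φ).symm
  | succ j => exact extD_map I ((hα k j).formContDiffAt.of_le (by simp)) φ

theorem SmoothFieldAt.one {x : N} :
    SmoothFieldAt I (fun y => (1 : MF (TangentSpace I y) A)) x := fun k j => by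
  cases j with
  | succ j => cases k <;> exact SmoothFormAt.zero (F := A) I
  | zero =>
    cases k with
    | succ k => exact SmoothFormAt.zero (F := A) I
    | zero =>
      exact contDiffAt_const (𝕜 := ℝ) (E := E)
        (c := ContinuousAlternatingMap.constOfIsEmpty ℝ E (Fin 0) (1 : A))

theorem SmoothFieldAt.pow {α : (x : N) → MF (TangentSpace I x) A} {x : N}
    (hα : SmoothFieldAt I α x) (n : ℕ) : SmoothFieldAt I (fun y => α y ^ n) x := by
  induction n with
  | zero => simpa only [pow_zero] using SmoothFieldAt.one I
  | succ n ih =>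
    simp only [pow_succ]
    exact SmoothFieldAt.mul I ih hα

theorem SmoothFieldAt.expSum {α : (x : N) → MF (TangentSpace I x) A} {x : N}
    (hα : SmoothFieldAt I α x) (n : ℕ) : SmoothFieldAt I (fun y => MF.expSum n (α y)) x :=
  SmoothFieldAt.sum I _ fun i _ => SmoothFieldAt.smul I (SmoothFieldAt.pow I hα i) _

end Calculus

variable [IsManifold I ∞ N] [IsManifold I' ∞ N']

theorem SmoothFieldAt.pbF {φ : N → N'} {α : (x : N') → MF (TangentSpace I' x) A} {x : N}
    (hφ : ContMDiffAt I I' ∞ φ x) (hα : SmoothFieldAt I' α (φ x)) :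
    SmoothFieldAt I (TwistedChern.pbF I I' φ α) x := fun k j =>
  SmoothFormAt.pb I I' hφ (hα k j)

theorem extDF_pbF {φ : N → N'} {α : (x : N') → MF (TangentSpace I' x) A} {x : N}
    (hφ : ContMDiffAt I I' ∞ φ x) (hα : SmoothFieldAt I' α (φ x)) :
    extDF I (pbF I I' φ α) x = pbF I I' φ (extDF I' α) x := by
  ext k j : 1
  cases j with
  | zero => ext v; rfl
  | succ j =>
    exact extD_pb I I' (hφ.of_le two_le_infty)
      ((hα k j).formContDiffAt.of_le (by simp))

theorem SmoothFieldAt.extDF {α : (x : N) → MF (TangentSpace I x) A} {x : N}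
    (hα : SmoothFieldAt I α x) : SmoothFieldAt I (TwistedChern.extDF I α) x := fun k j => by
  cases j with
  | zero => exact SmoothFormAt.zero I
  | succ j => exact SmoothFormAt.extD I (hα k j)

theorem extDF_extDF {α : (x : N) → MF (TangentSpace I x) A} {x : N}
    (hα : SmoothFieldAt I α x) : extDF I (extDF I α) x = 0 := by
  ext k j : 1
  rcases j with _ | _ | j
  · rfl
  · change extD I (fun y => (0 : TangentSpace I y [⋀^Fin 0]→L[ℝ] A)) x = 0
    have := extD_smul_at I (w := fun y : N => (0 : TangentSpace I y [⋀^Fin 0]→L[ℝ] A)) (x := x) 0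
    simp only [altMap_zero_smul] at this
    exact this
  · exact extD_extD I ((hα k j).formContDiffAt.of_le two_le_infty)

/-! #### Functions and one-forms -/

theorem chartRep_zero_form (w : RawForm I N F 0) (x : N) :
    (fun y => chartRep I w x y ![]) = (fun z => w z ![]) ∘ (extChartAt I x).symm := by
  funext y
  change w _ _ = w _ _
  congr 1
  exact Subsingleton.elim _ _

theorem smoothFormAt_zero_iff (w : RawForm I N F 0) (x : N) :
    SmoothFormAt I w x ↔ ContMDiffAt I 𝓘(ℝ, F) ∞ (fun z => w z ![]) x := by
  have e : chartRep I w x = fun y =>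
      ContinuousAlternatingMap.constOfIsEmptyLIE ℝ E F (Fin 0) (chartRep I w x y ![]) := by
    funext y
    ext v
    change _ = chartRep I w x y ![]
    congr 1
    exact Subsingleton.elim _ _
  have h1 : SmoothFormAt I w x ↔
      ContDiffAt ℝ ∞ (fun y => chartRep I w x y ![]) (extChartAt I x x) := by
    rw [SmoothFormAt]
    constructor
    · intro h
      exact (ContinuousAlternatingMap.apply ℝ E F ![]).contDiff.contDiffAt.comp _ h
    · intro h
      rw [e]
      exact (LinearIsometryEquiv.contDiff _).contDiffAt.comp _ h
  rw [h1, chartRep_zero_form, contMDiffAt_iff_target]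
  constructor
  · intro h
    have hc : ContMDiffAt I 𝓘(ℝ, F) ∞
        (((fun z => w z ![]) ∘ (extChartAt I x).symm) ∘ extChartAt I x) x :=
      h.contMDiffAt.comp x (contMDiffAt_extChartAt)
    have hc2 : ContMDiffAt I 𝓘(ℝ, F) ∞ (fun z => w z ![]) x := by
      refine hc.congr_of_eventuallyEq ?_
      filter_upwards [extChartAt_source_mem_nhds (I := I) x] with z hz
      refine (rawForm_congr_point w ((extChartAt I x).left_inv hz).symm ![]).trans ?_
      rfl
    exact contMDiffAt_iff_target.1 hc2
  · intro h
    have h2 : ContMDiffAt I 𝓘(ℝ, F) ∞ (fun z => w z ![]) x := contMDiffAt_iff_target.2 h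
    have := contDiffAt_chartMap I 𝓘(ℝ, F) h2
    exact this

theorem extD_zero_form {w : RawForm I N F 0} {x : N} (h : SmoothFormAt I w x)
    (v : Fin 1 → TangentSpace I x) :
    extD I w x v = (mfderiv I 𝓘(ℝ, F) (fun z => w z ![]) x (v 0) : F) := by
  have h2 := (smoothFormAt_zero_iff I w x).1 h
  have hd : DifferentiableAt ℝ (chartRep I w x) (extChartAt I x x) :=
    ContDiffAt.differentiableAt h (by simp)
  rw [extD_eq]
  refine Eq.trans ?_
    (mfderiv_eq_fderiv_chartMap I 𝓘(ℝ, F) (h2.mdifferentiableAt (by simp)) (v 0)).symm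
  have h3 : chartMap I 𝓘(ℝ, F) (fun z => w z ![]) x = fun y => chartRep I w x y ![] := by
    rw [chartRep_zero_form]
    rfl
  rw [h3]
  have h4 : HasFDerivAt (fun y => chartRep I w x y ![])
      ((ContinuousAlternatingMap.apply ℝ E F ![]) ∘L
        fderiv ℝ (chartRep I w x) (extChartAt I x x)) (extChartAt I x x) :=
    (ContinuousAlternatingMap.apply ℝ E F ![]).hasFDerivAt.comp _ hd.hasFDerivAt
  rw [h4.fderiv, extDeriv]
  refine (ContinuousAlternatingMap.alternatizeUncurryFin_apply (E := E) _ _).trans ?_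
  refine (Fin.sum_univ_one _).trans ?_
  change (-1 : ℤ) ^ ((0 : Fin 1) : ℕ) • _ = fderiv ℝ (chartRep I w x) (extChartAt I x x) (v 0) ![]
  rw [Fin.val_zero, pow_zero, one_smul]
  congr 1
  exact Subsingleton.elim _ _

end Fields

/-! ### Cartan's formula for forms on a product, along a slice -/

section Slice

variable {EQ : Type*} [NormedAddCommGroup EQ] [NormedSpace ℝ EQ]
  {E : Type*} [NormedAddCommGroup E] [NormedSpace ℝ E]
  {F : Type*} [NormedAddCommGroup F] [NormedSpace ℝ F]

theorem extDeriv_slice {j : ℕ} {b : EQ × E → (EQ × E) [⋀^Fin (j + 1)]→L[ℝ] F} {a : EQ} {y : E}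
    (hb : DifferentiableAt ℝ b (a, y)) (ξ : EQ)
    (hind : ∀ᶠ t in 𝓝 a, (b (t, y)).compContinuousLinearMap (ContinuousLinearMap.inr ℝ EQ E) =
      (b (a, y)).compContinuousLinearMap (ContinuousLinearMap.inr ℝ EQ E)) :
    extDeriv (fun y => (contract (ξ, (0 : E)) (b (a, y))).compContinuousLinearMap
      (ContinuousLinearMap.inr ℝ EQ E)) y =
    -(contract (ξ, (0 : E)) (extDeriv b (a, y))).compContinuousLinearMap
      (ContinuousLinearMap.inr ℝ EQ E) := by
  have h1 : (fderiv ℝ b (a, y) (ξ, 0)).compContinuousLinearMap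
      (ContinuousLinearMap.inr ℝ EQ E) = 0 := by
    have hd : HasFDerivAt (fun t => (b (t, y)).compContinuousLinearMap
        (ContinuousLinearMap.inr ℝ EQ E))
        (ContinuousAlternatingMap.compContinuousLinearMapCLM (ι := Fin (j + 1)) (F := F)
          (ContinuousLinearMap.inr ℝ EQ E) ∘L (fderiv ℝ b (a, y) ∘L
            ContinuousLinearMap.inl ℝ EQ E)) a :=
      (ContinuousAlternatingMap.compContinuousLinearMapCLM (ι := Fin (j + 1)) (F := F)
          (ContinuousLinearMap.inr ℝ EQ E)).hasFDerivAt.comp a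
        (HasFDerivAt.comp a (f := fun t => (t, y)) hb.hasFDerivAt (hasFDerivAt_prodMk_left a y))
    have hc := hd.unique ((hasFDerivAt_const _ a).congr_of_eventuallyEq hind)
    exact DFunLike.congr_fun hc ξ
  have h2 := contract_alternatizeUncurryFin_succ (ξ, (0 : E)) (fderiv ℝ b (a, y))
  have h3 : DifferentiableAt ℝ (fun z => contractL j (ξ, (0 : E)) (b z)) (a, y) :=
    (contractL (F := F) j (ξ, (0 : E))).differentiableAt.comp _ hb
  have h4 : fderiv ℝ (fun z => contractL j (ξ, (0 : E)) (b z)) (a, y) =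
      contractL j (ξ, (0 : E)) ∘L fderiv ℝ b (a, y) :=
    ((contractL (F := F) j (ξ, (0 : E))).hasFDerivAt.comp _ hb.hasFDerivAt).fderiv
  have hinr : ∀ y : E, fderiv ℝ (fun y : E => (a, y)) y = ContinuousLinearMap.inr ℝ EQ E :=
    fun y => (hasFDerivAt_prodMk_right a y).fderiv
  have h5 := extDeriv_pullback (r := 2) (f := fun y : E => (a, y)) (x := y) h3
    (contDiff_prodMk_right a).contDiffAt (by simp)
  simp only [hinr] at h5
  refine h5.trans ?_
  rw [extDeriv, extDeriv, h4, h2]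
  ext v
  have h6 : (fderiv ℝ b (a, y) (ξ, 0)).compContinuousLinearMap
      (ContinuousLinearMap.inr ℝ EQ E) v = 0 := by rw [h1]; rfl
  simp only [ContinuousAlternatingMap.compContinuousLinearMap_apply,
    ContinuousAlternatingMap.neg_apply, ContinuousAlternatingMap.sub_apply] at h6 ⊢
  rw [h6, zero_sub, neg_neg]

variable {SQ : Type*} [TopologicalSpace SQ] (J : ModelWithCorners ℝ EQ SQ)
  {Q : Type*} [TopologicalSpace Q] [ChartedSpace SQ Q]
  {S : Type*} [TopologicalSpace S] (I : ModelWithCorners ℝ E S)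
  {N : Type*} [TopologicalSpace N] [ChartedSpace S N]

/-- Contraction of a form on `Q × N` with a vector tangent to `Q`, restricted to a slice. -/
def slice {j : ℕ} (β : RawForm (J.prod I) (Q × N) F (j + 1)) (q : Q) (ξ : TangentSpace J q) :
    RawForm I N F j := fun y =>
  (contract (V := EQ × E) (ξ, (0 : E)) (β (q, y))).compContinuousLinearMap
    (ContinuousLinearMap.inr ℝ EQ E)

/-- Restriction of a form on `Q × N` to a slice. -/
def restrictSlice {j : ℕ} (β : RawForm (J.prod I) (Q × N) F j) (q : Q) : RawForm I N F j :=
  fun y => ContinuousAlternatingMap.compContinuousLinearMap (M := EQ × E) (M' := E) (β (q, y))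
    (ContinuousLinearMap.inr ℝ EQ E)

variable [J.Boundaryless] [I.Boundaryless] [IsManifold J ∞ Q] [IsManifold I ∞ N]

theorem mfderiv_extChartAt_symm_self (x : N) :
    mfderiv 𝓘(ℝ, E) I (extChartAt I x).symm (extChartAt I x x) = ContinuousLinearMap.id ℝ E := by
  rw [← mfderivWithin_univ, ← I.range_eq_univ]
  exact mfderivWithin_range_extChartAt_symm

/-- The product of two inverse charts. -/
def prodChartSymm (q : Q) (x : N) : EQ × E → Q × N :=
  fun z => ((extChartAt J q).symm z.1, (extChartAt I x).symm z.2)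

theorem contMDiffAt_prodChartSymm {q : Q} {x : N} {z : EQ × E}
    (h1 : z.1 ∈ (extChartAt J q).target) (h2 : z.2 ∈ (extChartAt I x).target) :
    ContMDiffAt 𝓘(ℝ, EQ × E) (J.prod I) ∞ (prodChartSymm J I q x) z :=
  ((contMDiffAt_extChartAt_symm J h1).comp z contDiff_fst.contMDiff.contMDiffAt).prodMk
    ((contMDiffAt_extChartAt_symm I h2).comp z contDiff_snd.contMDiff.contMDiffAt)

theorem mfderiv_prodChartSymm {q : Q} {x : N} {z : EQ × E}
    (h1 : z.1 ∈ (extChartAt J q).target) (h2 : z.2 ∈ (extChartAt I x).target) (u : EQ) (v : E) :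
    (mfderiv 𝓘(ℝ, EQ × E) (J.prod I) (prodChartSymm J I q x) z (u, v) : EQ × E) =
      (mfderiv 𝓘(ℝ, EQ) J (extChartAt J q).symm z.1 u,
        mfderiv 𝓘(ℝ, E) I (extChartAt I x).symm z.2 v) := by
  have d1 := (contMDiffAt_extChartAt_symm (n := ∞) J h1).mdifferentiableAt (by simp)
  have d2 := (contMDiffAt_extChartAt_symm (n := ∞) I h2).mdifferentiableAt (by simp)
  have e1 : MDifferentiableAt 𝓘(ℝ, EQ × E) 𝓘(ℝ, EQ) (Prod.fst : EQ × E → EQ) z :=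
    (contDiff_fst (n := ∞)).contMDiff.contMDiffAt.mdifferentiableAt (by simp)
  have e2 : MDifferentiableAt 𝓘(ℝ, EQ × E) 𝓘(ℝ, E) (Prod.snd : EQ × E → E) z :=
    (contDiff_snd (n := ∞)).contMDiff.contMDiffAt.mdifferentiableAt (by simp)
  have h : mfderiv 𝓘(ℝ, EQ × E) (J.prod I) (prodChartSymm J I q x) z =
      (mfderiv 𝓘(ℝ, EQ × E) J ((extChartAt J q).symm ∘ Prod.fst) z).prod
        (mfderiv 𝓘(ℝ, EQ × E) I ((extChartAt I x).symm ∘ Prod.snd) z) :=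
    (d1.comp z e1).mfderiv_prod (d2.comp z e2)
  rw [h, mfderiv_comp z d1 e1, mfderiv_comp z d2 e2, mfderiv_eq_fderiv, mfderiv_eq_fderiv,
    fderiv_fst, fderiv_snd]
  rfl

theorem chartRep_slice {j : ℕ} (β : RawForm (J.prod I) (Q × N) F (j + 1)) (q : Q)
    (ξ : TangentSpace J q) {x : N} {y : E} (hy : y ∈ (extChartAt I x).target) :
    chartRep I (slice J I β q ξ) x y =
      (contract ((ξ, (0 : E)) : EQ × E)
        (pb 𝓘(ℝ, EQ × E) (J.prod I) (prodChartSymm J I q x) β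
          (extChartAt J q q, y))).compContinuousLinearMap (ContinuousLinearMap.inr ℝ EQ E) := by
  ext v
  have hq := mem_extChartAt_target (I := J) q
  have e1 : ∀ (u : EQ) (v : E), (mfderiv 𝓘(ℝ, EQ × E) (J.prod I) (prodChartSymm J I q x)
      (extChartAt J q q, y) (u, v) : EQ × E) =
      (u, mfderiv 𝓘(ℝ, E) I (extChartAt I x).symm y v) := fun u v => by
    rw [mfderiv_prodChartSymm J I (z := (extChartAt J q q, y)) hq hy, mfderiv_extChartAt_symm_self]
    rfl
  change β (q, (extChartAt I x).symm y) _ = β (prodChartSymm J I q x (extChartAt J q q, y)) _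
  have hp : prodChartSymm J I q x (extChartAt J q q, y) = (q, (extChartAt I x).symm y) := by
    simp [prodChartSymm]
  refine Eq.trans ?_ (rawForm_congr_point β hp.symm _)
  congr 1
  funext i
  refine Fin.cases ?_ (fun i => ?_) i
  · exact ((e1 ξ 0).trans (congrArg (Prod.mk (ξ : EQ)) (map_zero _))).symm
  · exact (e1 0 (v i)).symm

theorem SmoothFormAt.pb_prodChartSymm {j : ℕ} {β : RawForm (J.prod I) (Q × N) F j} {q : Q} {x : N}
    (hβ : SmoothFormAt (J.prod I) β (q, x)) :
    SmoothFormAt 𝓘(ℝ, EQ × E) (TwistedChern.pb 𝓘(ℝ, EQ × E) (J.prod I) (prodChartSymm J I q x) β)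
      (extChartAt J q q, extChartAt I x x) := by
  refine SmoothFormAt.pb _ _ (contMDiffAt_prodChartSymm J I (mem_extChartAt_target q)
    (mem_extChartAt_target x)) ?_
  have hp : prodChartSymm J I q x (extChartAt J q q, extChartAt I x x) = (q, x) := by
    simp [prodChartSymm]
  rwa [hp]

theorem SmoothFormAt.slice {j : ℕ} {β : RawForm (J.prod I) (Q × N) F (j + 1)} {q : Q} {x : N}
    (ξ : TangentSpace J q) (hβ : SmoothFormAt (J.prod I) β (q, x)) :
    SmoothFormAt I (TwistedChern.slice J I β q ξ) x := by
  have h1 := (formContDiffAt_model_iff (n := ∞) _ _).1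
    (SmoothFormAt.pb_prodChartSymm J I hβ).formContDiffAt
  have h2 : ContDiffAt ℝ ∞ (fun y => contractL (F := F) j ((ξ, (0 : E)) : EQ × E)
      (TwistedChern.pb 𝓘(ℝ, EQ × E) (J.prod I) (prodChartSymm J I q x) β (extChartAt J q q, y)))
      (extChartAt I x x) :=
    (contractL (F := F) j ((ξ, (0 : E)) : EQ × E)).contDiff.contDiffAt.comp (extChartAt I x x)
      (ContDiffAt.comp (extChartAt I x x) (f := fun y => (extChartAt J q q, y)) h1
        (contDiff_prodMk_right _).contDiffAt)
  have h3 := ContDiffAt.compContinuousLinearMap_form h2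
    (contDiffAt_const (c := ContinuousLinearMap.inr ℝ EQ E))
  refine ContDiffAt.congr_of_eventuallyEq h3 ?_
  filter_upwards [extChartAt_target_mem_nhds (I := I) x] with y hy
  exact chartRep_slice J I β q ξ hy

theorem extD_slice {j : ℕ} {β : RawForm (J.prod I) (Q × N) F (j + 1)} {q : Q} {x : N}
    (ξ : TangentSpace J q) (hβ : SmoothFormAt (J.prod I) β (q, x))
    (hind : ∀ᶠ t in 𝓝 q, restrictSlice J I β t x = restrictSlice J I β q x) :
    extD I (slice J I β q ξ) x = -slice J I (extD (J.prod I) β) q ξ x := by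
  have h1 := (formContDiffAt_model_iff (n := ∞) _ _).1
    (SmoothFormAt.pb_prodChartSymm J I hβ).formContDiffAt
  have hx := mem_extChartAt_target (I := I) x
  have hq := mem_extChartAt_target (I := J) q
  have hp : prodChartSymm J I q x (extChartAt J q q, extChartAt I x x) = (q, x) := by
    simp [prodChartSymm]
  have h2 := extDeriv_slice (b := fun z => pb 𝓘(ℝ, EQ × E) (J.prod I) (prodChartSymm J I q x) β z)
    (a := extChartAt J q q) (y := extChartAt I x x) (h1.differentiableAt (by simp)) ξ (by
      filter_upwards [(tendsto_extChartAt_symm J q).eventually hind,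
        extChartAt_target_mem_nhds (I := J) q] with t ht htt
      ext v
      have key : ∀ t ∈ (extChartAt J q).target,
          (pb 𝓘(ℝ, EQ × E) (J.prod I) (prodChartSymm J I q x) β
            (t, extChartAt I x x)).compContinuousLinearMap (ContinuousLinearMap.inr ℝ EQ E) v =
          restrictSlice J I β ((extChartAt J q).symm t) x v := fun t ht => by
        change β (prodChartSymm J I q x (t, extChartAt I x x)) _ =
          β ((extChartAt J q).symm t, x) (fun i => ((0, v i) : EQ × E))
        refine Eq.trans ?_ (rawForm_congr_point β (a := prodChartSymm J I q x (t, extChartAt I x x))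
          (by simp [prodChartSymm]) _)
        congr 1
        funext i
        refine (mfderiv_prodChartSymm J I (z := (t, extChartAt I x x)) ht hx 0 (v i)).trans ?_
        refine Prod.ext (map_zero (mfderiv 𝓘(ℝ, EQ) J (extChartAt J q).symm t)) ?_
        exact DFunLike.congr_fun (mfderiv_extChartAt_symm_self I x) (v i)
      refine (key t htt).trans (Eq.trans ?_ (key _ hq).symm)
      rw [ht, extChartAt_to_inv (I := J) q])
  rw [extD_eq]
  have h3 : chartRep I (slice J I β q ξ) x =ᶠ[𝓝 (extChartAt I x x)] fun y =>
      (contract ((ξ, (0 : E)) : EQ × E)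
        (pb 𝓘(ℝ, EQ × E) (J.prod I) (prodChartSymm J I q x) β
          (extChartAt J q q, y))).compContinuousLinearMap (ContinuousLinearMap.inr ℝ EQ E) := by
    filter_upwards [extChartAt_target_mem_nhds (I := I) x] with y hy
    exact chartRep_slice J I β q ξ hy
  rw [h3.extDeriv_eq]
  refine h2.trans ?_
  have hfc : FormContDiffAt (J.prod I) 1 β (prodChartSymm J I q x
      (extChartAt J q q, extChartAt I x x)) := by
    rw [hp]
    exact hβ.formContDiffAt.of_le (by simp)
  have h4 := extD_pb 𝓘(ℝ, EQ × E) (J.prod I)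
    ((contMDiffAt_prodChartSymm J I (z := (extChartAt J q q, extChartAt I x x)) hq hx).of_le
      two_le_infty) hfc
  rw [extD_eq_extDeriv] at h4
  rw [h4]
  ext v
  change -(extD (J.prod I) β (prodChartSymm J I q x (extChartAt J q q, extChartAt I x x)) _) =
    -(extD (J.prod I) β (q, x) _)
  congr 1
  refine (rawForm_congr_point (extD (J.prod I) β) hp _).trans ?_
  congr 1
  funext i
  have e1 : ∀ (u : EQ) (v : E), (mfderiv 𝓘(ℝ, EQ × E) (J.prod I) (prodChartSymm J I q x)
      (extChartAt J q q, extChartAt I x x) (u, v) : EQ × E) = (u, v) := fun u v => by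
    rw [mfderiv_prodChartSymm J I (z := (extChartAt J q q, extChartAt I x x)) hq hx,
      mfderiv_extChartAt_symm_self, mfderiv_extChartAt_symm_self]
    rfl
  refine Fin.cases ?_ (fun i => ?_) i
  · exact e1 ξ 0
  · exact e1 0 (v i)

end Slice

/-! ### The ideal of trace class operators and the trace -/

section TraceIdeal

variable {H : Type*} [NormedAddCommGroup H] [InnerProductSpace ℂ H]

theorem NuclearRep.comp_left {K : H →L[ℂ] H} {x y : ℕ → H} (h : NuclearRep K x y)
    (T : H →L[ℂ] H) : NuclearRep (T * K) (fun i => T (x i)) y := by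
  constructor
  · refine Summable.of_nonneg_of_le (fun i => by positivity) (fun i => ?_) (h.1.mul_left ‖T‖)
    rw [← mul_assoc]
    gcongr
    exact T.le_opNorm _
  · intro v
    simpa using (h.2 v).mapL T

theorem traceNorm_comp_left_le {K : H →L[ℂ] H} (hK : IsTraceClass K) (T : H →L[ℂ] H) :
    traceNorm (T * K) ≤ ‖T‖ * traceNorm K := by
  apply le_of_forall_pos_le_add
  intro ε hε
  obtain ⟨x, y, h, hlt⟩ := exists_rep_lt hK (ε := ε / (‖T‖ + 1)) (by positivity)
  have h1 := traceNorm_le (h.comp_left T)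
  have h2 : ∑' i, ‖T (x i)‖ * ‖y i‖ ≤ ∑' i, ‖T‖ * (‖x i‖ * ‖y i‖) := by
    refine (h.comp_left T).1.tsum_le_tsum (fun i => ?_) (h.1.mul_left ‖T‖)
    rw [← mul_assoc]
    gcongr
    exact T.le_opNorm _
  rw [tsum_mul_left] at h2
  have h3 : ‖T‖ * (ε / (‖T‖ + 1)) ≤ ε := by
    rw [mul_div_assoc', div_le_iff₀ (by positivity)]
    nlinarith [norm_nonneg T]
  nlinarith [mul_le_mul_of_nonneg_left hlt.le (norm_nonneg T)]

variable [CompleteSpace H]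

theorem NuclearRep.comp_right {K : H →L[ℂ] H} {x y : ℕ → H} (h : NuclearRep K x y)
    (T : H →L[ℂ] H) : NuclearRep (K * T) x (fun i => ContinuousLinearMap.adjoint T (y i)) := by
  constructor
  · refine Summable.of_nonneg_of_le (fun i => by positivity) (fun i => ?_) (h.1.mul_left ‖T‖)
    calc ‖x i‖ * ‖ContinuousLinearMap.adjoint T (y i)‖ ≤ ‖x i‖ * (‖T‖ * ‖y i‖) := by
          gcongr
          simpa using (ContinuousLinearMap.adjoint T).le_opNorm (y i)
      _ = _ := by ring
  · intro v
    simpa [ContinuousLinearMap.adjoint_inner_left] using h.2 (T v)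

theorem traceNorm_comp_right_le {K : H →L[ℂ] H} (hK : IsTraceClass K) (T : H →L[ℂ] H) :
    traceNorm (K * T) ≤ traceNorm K * ‖T‖ := by
  apply le_of_forall_pos_le_add
  intro ε hε
  obtain ⟨x, y, h, hlt⟩ := exists_rep_lt hK (ε := ε / (‖T‖ + 1)) (by positivity)
  have h1 := traceNorm_le (h.comp_right T)
  have h2 : ∑' i, ‖x i‖ * ‖ContinuousLinearMap.adjoint T (y i)‖ ≤
      ∑' i, ‖T‖ * (‖x i‖ * ‖y i‖) := by
    refine (h.comp_right T).1.tsum_le_tsum (fun i => ?_) (h.1.mul_left ‖T‖)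
    calc ‖x i‖ * ‖ContinuousLinearMap.adjoint T (y i)‖ ≤ ‖x i‖ * (‖T‖ * ‖y i‖) := by
          gcongr
          simpa using (ContinuousLinearMap.adjoint T).le_opNorm (y i)
      _ = _ := by ring
  rw [tsum_mul_left] at h2
  have h3 : ‖T‖ * (ε / (‖T‖ + 1)) ≤ ε := by
    rw [mul_div_assoc', div_le_iff₀ (by positivity)]
    nlinarith [norm_nonneg T]
  nlinarith [mul_le_mul_of_nonneg_left hlt.le (norm_nonneg T)]

theorem summable_norm_inner_mul_inner {ι : Type*} {e : ι → H} (ho : Orthonormal ℂ e) (u v : H) :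
    Summable (fun i => ‖inner ℂ u (e i) * inner ℂ (e i) v‖) ∧
      ∑' i, ‖inner ℂ u (e i) * inner ℂ (e i) v‖ ≤ ‖v‖ * ‖u‖ := by
  have hs : ∀ u : H, Summable fun i => ‖inner ℂ (e i) u‖ ^ 2 := fun u =>
    ho.inner_products_summable u
  obtain ⟨h1, h2⟩ := Real.summable_and_inner_le_Lp_mul_Lq_tsum_of_nonneg
    Real.HolderConjugate.two_two (f := fun i => ‖inner ℂ (e i) u‖) (g := fun i => ‖inner ℂ (e i) v‖)
    (fun _ => norm_nonneg _) (fun _ => norm_nonneg _)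
    (by simpa using hs u) (by simpa using hs v)
  have e1 : (fun i => ‖inner ℂ u (e i) * inner ℂ (e i) v‖) =
      fun i => ‖inner ℂ (e i) u‖ * ‖inner ℂ (e i) v‖ := by
    funext i
    rw [norm_mul, norm_inner_symm]
  rw [e1]
  refine ⟨h1, h2.trans ?_⟩
  have h3 : ∀ u : H, (∑' i, ‖inner ℂ (e i) u‖ ^ (2 : ℝ)) ^ (1 / (2 : ℝ)) ≤ ‖u‖ := by
    intro u
    rw [← Real.sqrt_eq_rpow]
    apply Real.sqrt_le_iff.2 ⟨norm_nonneg _, ?_⟩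
    simpa using ho.tsum_inner_products_le (x := u)
  rw [mul_comm]
  exact mul_le_mul (h3 v) (h3 u) (by positivity) (norm_nonneg _)

theorem NuclearRep.hasSum_inner_basis {T : H →L[ℂ] H} {x y : ℕ → H} (h : NuclearRep T x y)
    {ι : Type*} (b : HilbertBasis ι ℂ H) :
    HasSum (fun e => inner ℂ (b e) (T (b e))) (∑' i, inner ℂ (y i) (x i)) := by
  have hs : Summable (fun p : ℕ × ι => inner ℂ (y p.1) (b p.2) * inner ℂ (b p.2) (x p.1)) := by
    apply Summable.of_norm
    have h0 : (0 : ℕ × ι → ℝ) ≤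
        fun p => ‖inner ℂ (y p.1) (b p.2) * inner ℂ (b p.2) (x p.1)‖ := fun p => norm_nonneg _
    refine (summable_prod_of_nonneg h0).2
      ⟨fun i => (summable_norm_inner_mul_inner b.orthonormal (y i) (x i)).1, ?_⟩
    exact Summable.of_nonneg_of_le (fun i => tsum_nonneg fun _ => norm_nonneg _)
      (fun i => (summable_norm_inner_mul_inner b.orthonormal (y i) (x i)).2) h.1
  have h2 := hs.hasSum.prod_fiberwise fun i => b.hasSum_inner_mul_inner (y i) (x i)
  have h3 : ∀ e, HasSum (fun i => inner ℂ (y i) (b e) * inner ℂ (b e) (x i))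
      (inner ℂ (b e) (T (b e))) := fun e => by
    have := (h.2 (b e)).mapL (innerSL ℂ (b e))
    simpa [inner_smul_right] using this
  have h4 : HasSum (fun p : ι × ℕ => inner ℂ (y p.2) (b p.1) * inner ℂ (b p.1) (x p.2))
      (∑' p : ℕ × ι, inner ℂ (y p.1) (b p.2) * inner ℂ (b p.2) (x p.1)) :=
    (Equiv.prodComm ι ℕ).hasSum_iff.2 hs.hasSum
  rw [h2.tsum_eq]
  exact h4.prod_fiberwise h3

/-- The trace is computed by every nuclear representation. -/
theorem NuclearRep.hasSum_trace {T : H →L[ℂ] H} {x y : ℕ → H} (h : NuclearRep T x y) :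
    HasSum (fun e : (exists_hilbertBasis ℂ H).choose => inner ℂ (e : H) (T e))
      (∑' i, inner ℂ (y i) (x i)) := by
  obtain ⟨b, hb⟩ := (exists_hilbertBasis ℂ H).choose_spec
  have h1 := h.hasSum_inner_basis b
  rwa [hb] at h1

theorem NuclearRep.opTrace_eq {T : H →L[ℂ] H} {x y : ℕ → H} (h : NuclearRep T x y) :
    opTrace T = ∑' i, inner ℂ (y i) (x i) := h.hasSum_trace.tsum_eq

theorem norm_opTrace_le {T : H →L[ℂ] H} (hT : IsTraceClass T) : ‖opTrace T‖ ≤ traceNorm T := by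
  apply le_of_forall_pos_le_add
  intro ε hε
  obtain ⟨x, y, h, hlt⟩ := exists_rep_lt hT hε
  rw [h.opTrace_eq]
  refine le_trans ?_ hlt.le
  refine tsum_of_norm_bounded h.1.hasSum fun i => ?_
  rw [mul_comm]
  exact norm_inner_le_norm _ _

theorem opTrace_mul_comm {K : H →L[ℂ] H} (hK : IsTraceClass K) (T : H →L[ℂ] H) :
    opTrace (T * K) = opTrace (K * T) := by
  obtain ⟨x, y, h⟩ := hK
  rw [(h.comp_left T).opTrace_eq, (h.comp_right T).opTrace_eq]
  simp [ContinuousLinearMap.adjoint_inner_left]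

namespace TraceClass

theorem op_injective : Function.Injective (op : TraceClass H →ₗ[ℂ] (H →L[ℂ] H)) :=
  Subtype.val_injective

theorem norm_op_le (K : TraceClass H) : ‖K.op‖ ≤ ‖K‖ :=
  K.op.opNorm_le_bound (norm_nonneg _) fun v => norm_le_traceNorm K.isTraceClass v

/-- The underlying operator, as a continuous linear map. -/
def opL : TraceClass H →L[ℝ] (H →L[ℂ] H) :=
  LinearMap.mkContinuous (op.restrictScalars ℝ) 1 fun K => by
    rw [one_mul]
    exact K.norm_op_le

theorem opL_apply (K : TraceClass H) : opL K = K.op := rfl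

/-- A trace class operator. -/
def ofOp (T : H →L[ℂ] H) (h : IsTraceClass T) : TraceClass H := ⟨T, h⟩

/-- The product `TK`. -/
def compL (T : H →L[ℂ] H) (K : TraceClass H) : TraceClass H :=
  ofOp (T * K.op) (by
    obtain ⟨x, y, h⟩ := K.isTraceClass
    exact ⟨_, _, h.comp_left T⟩)

/-- The product `KT`. -/
def compR (K : TraceClass H) (T : H →L[ℂ] H) : TraceClass H :=
  ofOp (K.op * T) (by
    obtain ⟨x, y, h⟩ := K.isTraceClass
    exact ⟨_, _, h.comp_right T⟩)

@[simp] theorem op_compL (T : H →L[ℂ] H) (K : TraceClass H) : (compL T K).op = T * K.op := rfl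

@[simp] theorem op_compR (T : H →L[ℂ] H) (K : TraceClass H) : (compR K T).op = K.op * T := rfl

theorem norm_compL_le (T : H →L[ℂ] H) (K : TraceClass H) : ‖compL T K‖ ≤ ‖T‖ * ‖K‖ :=
  traceNorm_comp_left_le K.isTraceClass T

theorem norm_compR_le (T : H →L[ℂ] H) (K : TraceClass H) : ‖compR K T‖ ≤ ‖K‖ * ‖T‖ :=
  traceNorm_comp_right_le K.isTraceClass T

/-- The trace as a continuous linear map. -/
def traceL : TraceClass H →L[ℝ] ℂ :=
  LinearMap.mkContinuous
    { toFun := fun K => opTrace K.op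
      map_add' := fun K K' => by
        obtain ⟨x, y, h⟩ := K.isTraceClass
        obtain ⟨x', y', h'⟩ := K'.isTraceClass
        have := h.hasSum_trace.add h'.hasSum_trace
        rw [h.opTrace_eq, h'.opTrace_eq, ← this.tsum_eq, opTrace]
        simp
      map_smul' := fun c K => by
        have e : (c • K).op = (c : ℂ) • K.op := map_smul op (c : ℂ) K
        rw [opTrace, e, opTrace]
        simp only [_root_.smul_apply, inner_smul_right, tsum_mul_left]
        rfl } 1 fun K => by
    rw [one_mul]
    exact norm_opTrace_le K.isTraceClass

end TraceClass

/-! ### Pairs of operators with trace class difference -/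

variable (H) in
/-- Pairs of bounded operators whose difference is trace class: `(T, K)` stands for the pair of
`T + K` and `T`. -/
def OpPair : Type _ := (H →L[ℂ] H) × TraceClass H

namespace OpPair

instance : AddCommGroup (OpPair H) := inferInstanceAs (AddCommGroup ((H →L[ℂ] H) × TraceClass H))

instance : Module ℝ (OpPair H) := inferInstanceAs (Module ℝ ((H →L[ℂ] H) × TraceClass H))

/-- The pair of `T + K` and `T`. -/
def mk (T : H →L[ℂ] H) (K : TraceClass H) : OpPair H := (T, K)

/-- The second operator of the pair. -/
def low : OpPair H →ₗ[ℝ] (H →L[ℂ] H) := LinearMap.fst ℝ _ _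

/-- The difference of the operators. -/
def diff : OpPair H →ₗ[ℝ] TraceClass H := LinearMap.snd ℝ _ _

@[simp] theorem low_mk (T : H →L[ℂ] H) (K : TraceClass H) : low (mk T K) = T := rfl

@[simp] theorem diff_mk (T : H →L[ℂ] H) (K : TraceClass H) : diff (mk T K) = K := rfl

theorem ext' {a b : OpPair H} (h : low a = low b) (h' : diff a = diff b) : a = b := Prod.ext h h'

instance : Norm (OpPair H) := ⟨fun a => ‖low a‖ + ‖diff a‖⟩

theorem norm_def (a : OpPair H) : ‖a‖ = ‖low a‖ + ‖diff a‖ := rfl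

theorem core : NormedSpace.Core ℝ (OpPair H) where
  norm_nonneg a := add_nonneg (norm_nonneg _) (norm_nonneg _)
  norm_smul c a := by
    rw [norm_def, norm_def, map_smul, map_smul, norm_smul, norm_smul, mul_add]
  norm_triangle a b := by
    rw [norm_def, norm_def, norm_def, map_add, map_add]
    have := norm_add_le (low a) (low b)
    have := norm_add_le (diff a) (diff b)
    linarith
  norm_eq_zero_iff a := by
    rw [norm_def]
    constructor
    · intro h
      have h1 := norm_nonneg (low a)
      have h2 := norm_nonneg (diff a)
      refine ext' ?_ ?_
      · rw [map_zero]; exact norm_eq_zero.1 (by linarith)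
      · rw [map_zero]; exact norm_eq_zero.1 (by linarith)
    · rintro rfl
      simp

instance : NormedAddCommGroup (OpPair H) := NormedAddCommGroup.ofCore core

instance : Mul (OpPair H) :=
  ⟨fun a b => mk (low a * low b) (TraceClass.compL (low a) (diff b) +
    TraceClass.compR (diff a) (low b) + TraceClass.compL (diff a).op (diff b))⟩

instance : One (OpPair H) := ⟨mk 1 0⟩

@[simp] theorem low_mul (a b : OpPair H) : low (a * b) = low a * low b := rfl

@[simp] theorem low_one : low (1 : OpPair H) = 1 := rfl

theorem diff_mul (a b : OpPair H) : diff (a * b) = TraceClass.compL (low a) (diff b) +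
    TraceClass.compR (diff a) (low b) + TraceClass.compL (diff a).op (diff b) := rfl

/-- The first operator of the pair. -/
def high : OpPair H →ₗ[ℝ] (H →L[ℂ] H) := low + TraceClass.op.restrictScalars ℝ ∘ₗ diff

theorem high_apply (a : OpPair H) : high a = low a + (diff a).op := rfl

@[simp] theorem high_mk (T : H →L[ℂ] H) (K : TraceClass H) : high (mk T K) = T + K.op := rfl

@[simp] theorem high_mul (a b : OpPair H) : high (a * b) = high a * high b := by
  rw [high_apply, high_apply, high_apply, diff_mul, low_mul, map_add, map_add,
    TraceClass.op_compL, TraceClass.op_compR, TraceClass.op_compL]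
  noncomm_ring

@[simp] theorem high_one : high (1 : OpPair H) = 1 := by
  rw [high_apply]
  exact add_zero _

theorem ext_op {a b : OpPair H} (h : low a = low b) (h' : high a = high b) : a = b := by
  refine ext' h (TraceClass.op_injective ?_)
  rw [high_apply, high_apply, h] at h'
  exact add_left_cancel h'

instance : Ring (OpPair H) where
  __ := (inferInstance : AddCommGroup (OpPair H))
  left_distrib a b c := by apply ext_op <;> simp [mul_add]
  right_distrib a b c := by apply ext_op <;> simp [add_mul]
  zero_mul a := by apply ext_op <;> simp
  mul_zero a := by apply ext_op <;> simp
  mul_assoc a b c := by apply ext_op <;> simp [mul_assoc]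
  one_mul a := by apply ext_op <;> simp
  mul_one a := by apply ext_op <;> simp

instance : NormedRing (OpPair H) where
  __ := (inferInstance : NormedAddCommGroup (OpPair H))
  __ := (inferInstance : Ring (OpPair H))
  norm_mul_le a b := by
    rw [norm_def, norm_def, norm_def, low_mul, diff_mul]
    have h1 := norm_mul_le (low a) (low b)
    have h2 := TraceClass.norm_compL_le (low a) (diff b)
    have h3 := TraceClass.norm_compR_le (low b) (diff a)
    have h4 := TraceClass.norm_compL_le (diff a).op (diff b)
    have h5 := mul_le_mul_of_nonneg_right (diff a).norm_op_le (norm_nonneg (diff b))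
    have h6 := norm_add₃_le (a := TraceClass.compL (low a) (diff b))
      (b := TraceClass.compR (diff a) (low b)) (c := TraceClass.compL (diff a).op (diff b))
    nlinarith

instance : Algebra ℝ (OpPair H) := Algebra.ofModule
  (fun c a b => by apply ext_op <;> simp) (fun c a b => by apply ext_op <;> simp)

instance : NormedAlgebra ℝ (OpPair H) where
  norm_smul_le c a := (core.norm_smul c a).le

/-- `low` as a continuous linear map. -/
def lowL : OpPair H →L[ℝ] (H →L[ℂ] H) :=
  LinearMap.mkContinuous low 1 fun a => by
    rw [one_mul, norm_def]
    exact le_add_of_nonneg_right (norm_nonneg _)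

/-- `diff` as a continuous linear map. -/
def diffL : OpPair H →L[ℝ] TraceClass H :=
  LinearMap.mkContinuous diff 1 fun a => by
    rw [one_mul, norm_def]
    exact le_add_of_nonneg_left (norm_nonneg _)

/-- `high` as a continuous linear map. -/
def highL : OpPair H →L[ℝ] (H →L[ℂ] H) := lowL + TraceClass.opL ∘L diffL

/-- Bounded operators, as equal pairs. -/
def inlL : (H →L[ℂ] H) →L[ℝ] OpPair H :=
  LinearMap.mkContinuous (LinearMap.inl ℝ _ _ : (H →L[ℂ] H) →ₗ[ℝ] (H →L[ℂ] H) × TraceClass H) 1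
    fun T => by
      change ‖T‖ + ‖(0 : TraceClass H)‖ ≤ _
      simp

/-- Trace class operators, as pairs with second operator zero. -/
def inrL : TraceClass H →L[ℝ] OpPair H :=
  LinearMap.mkContinuous (LinearMap.inr ℝ _ _ : TraceClass H →ₗ[ℝ] (H →L[ℂ] H) × TraceClass H) 1
    fun K => by
      change ‖(0 : H →L[ℂ] H)‖ + ‖K‖ ≤ _
      simp

theorem lowL_apply (a : OpPair H) : lowL a = low a := rfl

theorem highL_apply (a : OpPair H) : highL a = high a := rfl

@[simp] theorem low_inlL (T : H →L[ℂ] H) : low (inlL T) = T := rfl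
@[simp] theorem diff_inlL (T : H →L[ℂ] H) : diff (inlL T) = 0 := rfl
@[simp] theorem low_inrL (K : TraceClass H) : low (inrL K) = 0 := rfl
@[simp] theorem diff_inrL (K : TraceClass H) : diff (inrL K) = K := rfl
@[simp] theorem high_inlL (T : H →L[ℂ] H) : high (inlL T) = T := add_zero _
@[simp] theorem high_inrL (K : TraceClass H) : high (inrL K) = K.op := zero_add _

/-- The supertrace. -/
def strL : OpPair H →L[ℝ] ℂ := TraceClass.traceL ∘L diffL

theorem strL_apply (a : OpPair H) : strL a = opTrace (diff a).op := rfl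

theorem strL_mul_comm (a b : OpPair H) : strL (a * b) = strL (b * a) := by
  have key : ∀ a b : OpPair H, strL (a * b) = opTrace (low a * (diff b).op) +
      opTrace ((diff a).op * low b) + opTrace ((diff a).op * (diff b).op) := fun a b => by
    change TraceClass.traceL (diff (a * b)) = _
    rw [diff_mul, map_add, map_add]
    rfl
  rw [key, key, opTrace_mul_comm (diff b).isTraceClass, opTrace_mul_comm (diff b).isTraceClass,
    ← opTrace_mul_comm (diff a).isTraceClass]
  ring

/-- Complex scalars. -/
def scalarL : ℂ →L[ℝ] OpPair H :=
  inlL ∘L (ContinuousLinearMap.toSpanSingleton ℂ (1 : H →L[ℂ] H)).restrictScalars ℝ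

@[simp] theorem low_scalarL (c : ℂ) : low (scalarL c : OpPair H) = c • 1 := rfl
@[simp] theorem high_scalarL (c : ℂ) : high (scalarL c : OpPair H) = c • 1 := add_zero _

theorem scalarL_mul_comm (c : ℂ) (a : OpPair H) : scalarL c * a = a * scalarL c := by
  apply ext_op <;> simp

theorem strL_scalarL_mul (c : ℂ) (a : OpPair H) : strL (scalarL c * a) = c * strL a := by
  rw [strL_apply, strL_apply]
  have : (diff (scalarL c * a)).op = c • (diff a).op := by
    have h1 := high_apply (scalarL c * a)
    rw [high_mul, low_mul, high_scalarL, low_scalarL, high_apply] at h1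
    have : (c • (1 : H →L[ℂ] H)) * (low a + (diff a).op) = c • (1 : H →L[ℂ] H) * low a + c • (diff a).op := by
      simp
    rw [this] at h1
    exact (add_left_cancel h1).symm
  rw [this, opTrace, opTrace]
  simp only [_root_.smul_apply, inner_smul_right, tsum_mul_left]

end OpPair

end TraceIdeal

/-! ### Smooth actions of Lie groups -/

section Chain

variable {E : Type*} [NormedAddCommGroup E] [NormedSpace ℝ E] {S : Type*} [TopologicalSpace S]
  {I : ModelWithCorners ℝ E S} {N : Type*} [TopologicalSpace N] [ChartedSpace S N]
  {E' : Type*} [NormedAddCommGroup E'] [NormedSpace ℝ E'] {S' : Type*} [TopologicalSpace S']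
  {I' : ModelWithCorners ℝ E' S'} {N' : Type*} [TopologicalSpace N'] [ChartedSpace S' N']
  {E'' : Type*} [NormedAddCommGroup E''] [NormedSpace ℝ E''] {S'' : Type*} [TopologicalSpace S'']
  {I'' : ModelWithCorners ℝ E'' S''} {N'' : Type*} [TopologicalSpace N''] [ChartedSpace S'' N'']

theorem mfderiv_comp_vec {g : N' → N''} {f : N → N'} {x : N} {y : N'} (hy : f x = y)
    (hg : MDifferentiableAt I' I'' g y) (hf : MDifferentiableAt I I' f x) (v : TangentSpace I x) :
    @Eq E'' (mfderiv I I'' (g ∘ f) x v) (mfderiv I' I'' g y (mfderiv I I' f x v : E')) := by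
  subst hy
  rw [mfderiv_comp x hg hf]
  rfl

theorem mfderiv_congr_vec {f g : N → N'} {x : N} (h : f =ᶠ[𝓝 x] g) (v : TangentSpace I x) :
    @Eq E' (mfderiv I I' f x v) (mfderiv I I' g x v) := by
  rw [h.mfderiv_eq]
  rfl

theorem mfderiv_congr_point_vec {f : N → N'} {x y : N} (h : x = y) (v : E) :
    @Eq E' (mfderiv I I' f x v) (mfderiv I I' f y v) := by
  subst h
  rfl

end Chain

section Contract

variable {V : Type*} [AddCommGroup V] [Module ℝ V] [TopologicalSpace V]
  {F : Type*} [NormedAddCommGroup F] [NormedSpace ℝ F] {j : ℕ}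

theorem contract_add_vec (u v : V) (α : V [⋀^Fin (j + 1)]→L[ℝ] F) :
    contract (u + v) α = contract u α + contract v α := by
  ext w
  exact DFunLike.congr_fun (map_add α.toAlternatingMap.curryLeft u v) w

theorem contract_smul_vec (c : ℝ) (v : V) (α : V [⋀^Fin (j + 1)]→L[ℝ] F) :
    contract (c • v) α = c • contract v α := by
  ext w
  exact DFunLike.congr_fun (map_smul α.toAlternatingMap.curryLeft c v) w

theorem contract_neg_vec (v : V) (α : V [⋀^Fin (j + 1)]→L[ℝ] F) :
    contract (-v) α = -contract v α := by
  ext w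
  exact DFunLike.congr_fun (map_neg α.toAlternatingMap.curryLeft v) w

theorem contract_contract_self (v : V) (α : V [⋀^Fin (j + 2)]→L[ℝ] F) :
    contract v (contract v α) = 0 := by
  ext w
  refine α.map_eq_zero_of_eq _ (i := 0) (j := 1) ?_ (by simp)
  rfl

end Contract

section Action

variable {EG : Type*} [NormedAddCommGroup EG] [NormedSpace ℝ EG]
  {G : Type*} [TopologicalSpace G] [ChartedSpace EG G] [Group G] [LieGroup 𝓘(ℝ, EG) ∞ G]
  {E : Type*} [NormedAddCommGroup E] [NormedSpace ℝ E]
  {N : Type*} [TopologicalSpace N] [ChartedSpace E N] [IsManifold 𝓘(ℝ, E) ∞ N]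
  [MulAction G N] [ContMDiffSMul 𝓘(ℝ, EG) 𝓘(ℝ, E) ∞ G N]
  {F : Type*} [NormedAddCommGroup F] [NormedSpace ℝ F]

variable (EG G E N) in
theorem contMDiff_act : ContMDiff (𝓘(ℝ, EG).prod 𝓘(ℝ, E)) 𝓘(ℝ, E) ∞
    (fun x : G × N => x.1 • x.2) :=
  ContMDiffSMul.contMDiff_smul

variable (EG E) in
include EG in
theorem contMDiff_smul_left (g : G) : ContMDiff 𝓘(ℝ, E) 𝓘(ℝ, E) ∞ (fun x : N => g • x) :=
  (contMDiff_act EG G E N).comp (contMDiff_const.prodMk contMDiff_id)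

variable (EG E) in
include EG in
theorem contMDiff_smul_right (x : N) : ContMDiff 𝓘(ℝ, EG) 𝓘(ℝ, E) ∞ (fun g : G => g • x) :=
  (contMDiff_act EG G E N).comp (contMDiff_id.prodMk contMDiff_const)

theorem contMDiff_conj (g : G) : ContMDiff 𝓘(ℝ, EG) 𝓘(ℝ, EG) ∞ (fun h : G => g * h * g⁻¹) :=
  (contMDiff_const.mul contMDiff_id).mul contMDiff_const

theorem mfderiv_act (g : G) (x : N) (ξ : EG) (Y : E) :
    (mfderiv (𝓘(ℝ, EG).prod 𝓘(ℝ, E)) 𝓘(ℝ, E) (fun x : G × N => x.1 • x.2) (g, x) (ξ, Y) : E) =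
      (mfderiv 𝓘(ℝ, EG) 𝓘(ℝ, E) (fun h : G => h • x) g ξ : E) +
      (mfderiv 𝓘(ℝ, E) 𝓘(ℝ, E) (fun y : N => g • y) x Y : E) :=
  mfderiv_prod_eq_add_apply ((contMDiff_act EG G E N).contMDiffAt.mdifferentiableAt (by simp))

theorem mfderiv_one_smul (x : N) (Y : E) :
    (mfderiv 𝓘(ℝ, E) 𝓘(ℝ, E) (fun y : N => (1 : G) • y) x Y : E) = Y := by
  have : (fun y : N => (1 : G) • y) = id := funext fun y => one_smul G y
  rw [this, mfderiv_id]
  rfl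

theorem mfderiv_act_one (x : N) (ξ : GroupLieAlgebra 𝓘(ℝ, EG) G) (Y : TangentSpace 𝓘(ℝ, E) x) :
    @Eq E (mfderiv (𝓘(ℝ, EG).prod 𝓘(ℝ, E)) 𝓘(ℝ, E) (fun x : G × N => x.1 • x.2) (1, x)
      ((ξ, Y) : EG × E)) (-fundVF ξ x + Y) := by
  refine (mfderiv_act (EG := EG) (E := E) (1 : G) x ξ Y).trans ?_
  exact congrArg₂ (HAdd.hAdd : E → E → E)
    (neg_neg (mfderiv 𝓘(ℝ, EG) 𝓘(ℝ, E) (fun h : G => h • x) 1 ξ : E)).symm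
    (mfderiv_one_smul (E := E) x Y)

theorem fundVF_zero (x : N) :
    (fundVF (0 : GroupLieAlgebra 𝓘(ℝ, EG) G) x : TangentSpace 𝓘(ℝ, E) x) = 0 := by
  refine (congrArg (Neg.neg : E → E)
    (map_zero (mfderiv 𝓘(ℝ, EG) 𝓘(ℝ, E) (fun g : G => g • x) 1))).trans ?_
  exact neg_zero

theorem fundVF_add (ξ η : GroupLieAlgebra 𝓘(ℝ, EG) G) (x : N) :
    (fundVF (ξ + η) x : TangentSpace 𝓘(ℝ, E) x) = fundVF ξ x + fundVF η x := by
  refine (congrArg (Neg.neg : E → E)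
    (map_add (mfderiv 𝓘(ℝ, EG) 𝓘(ℝ, E) (fun g : G => g • x) 1) ξ η)).trans ?_
  exact neg_add (α := E) _ _

theorem fundVF_smul (c : ℝ) (ξ : GroupLieAlgebra 𝓘(ℝ, EG) G) (x : N) :
    (fundVF (c • ξ) x : TangentSpace 𝓘(ℝ, E) x) = c • fundVF ξ x := by
  refine (congrArg (Neg.neg : E → E)
    (map_smul (mfderiv 𝓘(ℝ, EG) 𝓘(ℝ, E) (fun g : G => g • x) 1) c ξ)).trans ?_
  exact (smul_neg (A := E) c _).symm

theorem mfderiv_smul_fundVF (g : G) (ξ : GroupLieAlgebra 𝓘(ℝ, EG) G) (x : N) :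
    mfderiv 𝓘(ℝ, E) 𝓘(ℝ, E) (fun y : N => g • y) x (fundVF ξ x) = fundVF (Ad g ξ) (g • x) := by
  have e : (fun y : N => g • y) ∘ (fun h : G => h • x) =
      (fun k : G => k • (g • x)) ∘ (fun h : G => g * h * g⁻¹) := by
    funext h
    simp [smul_smul]
  have d1 : MDifferentiableAt 𝓘(ℝ, E) 𝓘(ℝ, E) (fun y : N => g • y) x :=
    (contMDiff_smul_left EG E g).contMDiffAt.mdifferentiableAt (by simp)
  have d2 : MDifferentiableAt 𝓘(ℝ, EG) 𝓘(ℝ, E) (fun h : G => h • x) 1 :=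
    (contMDiff_smul_right EG E x).contMDiffAt.mdifferentiableAt (by simp)
  have d3 : MDifferentiableAt 𝓘(ℝ, EG) 𝓘(ℝ, E) (fun h : G => h • (g • x)) 1 :=
    (contMDiff_smul_right EG E (g • x)).contMDiffAt.mdifferentiableAt (by simp)
  have d4 : MDifferentiableAt 𝓘(ℝ, EG) 𝓘(ℝ, EG) (fun h : G => g * h * g⁻¹) 1 :=
    (contMDiff_conj g).contMDiffAt.mdifferentiableAt (by simp)
  have h1 := mfderiv_comp_vec (f := fun h : G => h • x) (one_smul G x) d1 d2 ξ
  have h2 := mfderiv_comp_vec (f := fun h : G => g * h * g⁻¹) (by simp) d3 d4 ξ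
  rw [e] at h1
  refine (map_neg (mfderiv 𝓘(ℝ, E) 𝓘(ℝ, E) (fun y : N => g • y) x) _).trans ?_
  exact congrArg (Neg.neg : E → E) (h1.symm.trans h2)

/-- Contraction with the fundamental vector field, expressed through the action map. -/
theorem slice_pb_act {j : ℕ} (w : RawForm 𝓘(ℝ, E) N F (j + 1)) (ξ : GroupLieAlgebra 𝓘(ℝ, EG) G)
    (x : N) : slice 𝓘(ℝ, EG) 𝓘(ℝ, E) (pb (𝓘(ℝ, EG).prod 𝓘(ℝ, E)) 𝓘(ℝ, E)
      (fun x : G × N => x.1 • x.2) w) 1 ξ x = -contract (fundVF ξ x) (w x) := by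
  rw [← contract_neg_vec]
  ext v
  change w ((1 : G) • x) _ = w x _
  refine (rawForm_congr_point w (one_smul G x) _).trans ?_
  congr 1
  funext i
  refine Fin.cases ?_ (fun i => ?_) i
  · exact (mfderiv_act_one (E := E) x ξ 0).trans (add_zero (M := E) _)
  · refine (mfderiv_act_one (EG := EG) (E := E) (G := G) x 0 (v i)).trans ?_
    rw [fundVF_zero, neg_zero]
    exact zero_add (M := E) _

theorem restrictSlice_pb_act {j : ℕ} (w : RawForm 𝓘(ℝ, E) N F j) (g : G)
    (x : N) : restrictSlice 𝓘(ℝ, EG) 𝓘(ℝ, E) (pb (𝓘(ℝ, EG).prod 𝓘(ℝ, E)) 𝓘(ℝ, E)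
      (fun x : G × N => x.1 • x.2) w) g x = pb 𝓘(ℝ, E) 𝓘(ℝ, E) (fun y => g • y) w x := by
  ext v
  change w (g • x) _ = w (g • x) _
  congr 1
  funext i
  refine (mfderiv_act (EG := EG) (E := E) g x 0 (v i)).trans ?_
  exact (congrArg₂ (HAdd.hAdd : E → E → E)
    (map_zero (mfderiv 𝓘(ℝ, EG) 𝓘(ℝ, E) (fun g : G => g • x) g)) rfl).trans (zero_add (M := E) _)

section Cartan

variable {j : ℕ} {w : RawForm 𝓘(ℝ, E) N F (j + 1)} (hw : ∀ x, SmoothFormAt 𝓘(ℝ, E) w x)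
  (ξ : GroupLieAlgebra 𝓘(ℝ, EG) G) (x : N)
include hw

theorem SmoothFormAt.contract_fundVF :
    SmoothFormAt 𝓘(ℝ, E) (fun y => contract (fundVF ξ y) (w y)) x := by
  have h1 := SmoothFormAt.slice 𝓘(ℝ, EG) 𝓘(ℝ, E) (q := (1 : G)) (x := x) ξ
    (SmoothFormAt.pb (𝓘(ℝ, EG).prod 𝓘(ℝ, E)) 𝓘(ℝ, E) (contMDiff_act EG G E N).contMDiffAt
      (hw ((1 : G) • x)))
  rw [funext (slice_pb_act w ξ)] at h1
  have h2 := SmoothFormAt.const_smul 𝓘(ℝ, E) h1 (-1)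
  convert h2 using 1
  funext y
  ext v
  simp

/-- Cartan's formula for an invariant form. -/
theorem extD_contract_fundVF
    (hinv : ∀ (g : G) x, pb 𝓘(ℝ, E) 𝓘(ℝ, E) (fun y => g • y) w x = w x) :
    extD 𝓘(ℝ, E) (fun y => contract (fundVF ξ y) (w y)) x =
      -contract (fundVF ξ x) (extD 𝓘(ℝ, E) w x) := by
  have hs := SmoothFormAt.pb (𝓘(ℝ, EG).prod 𝓘(ℝ, E)) 𝓘(ℝ, E) (contMDiff_act EG G E N).contMDiffAt
      (x := ((1 : G), x)) (hw ((1 : G) • x))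
  have h1 := extD_slice 𝓘(ℝ, EG) 𝓘(ℝ, E) (q := (1 : G)) (x := x) ξ hs
    (Filter.Eventually.of_forall fun g => by
      rw [restrictSlice_pb_act, restrictSlice_pb_act, hinv, hinv])
  have h2 : slice 𝓘(ℝ, EG) 𝓘(ℝ, E) (extD (𝓘(ℝ, EG).prod 𝓘(ℝ, E))
      (pb (𝓘(ℝ, EG).prod 𝓘(ℝ, E)) 𝓘(ℝ, E) (fun x : G × N => x.1 • x.2) w)) 1 ξ x =
      slice 𝓘(ℝ, EG) 𝓘(ℝ, E) (pb (𝓘(ℝ, EG).prod 𝓘(ℝ, E)) 𝓘(ℝ, E)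
        (fun x : G × N => x.1 • x.2) (extD 𝓘(ℝ, E) w)) 1 ξ x := by
    have := extD_pb (𝓘(ℝ, EG).prod 𝓘(ℝ, E)) 𝓘(ℝ, E) (x := ((1 : G), x))
      ((contMDiff_act EG G E N).contMDiffAt.of_le two_le_infty)
      ((hw ((1 : G) • x)).formContDiffAt.of_le (by simp))
    rw [slice, slice, this]
  rw [h2, slice_pb_act, neg_neg, funext (slice_pb_act w ξ)] at h1
  have h3 := extD_smul_at 𝓘(ℝ, E) (w := fun y => -contract (fundVF ξ y) (w y)) (x := x) (-1)
  rw [h1] at h3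
  convert h3 using 1
  · congr 1
    funext y
    ext v
    simp
  · ext v
    simp

end Cartan

/-! #### The derivative of the adjoint action -/

theorem mixed_second_deriv_eq_zero {k : EG × EG → EG} {c : EG} (hk : ContDiffAt ℝ 2 k (c, c))
    (h1 : ∀ᶠ a in 𝓝 c, k (a, c) = c) (h2 : ∀ᶠ b in 𝓝 c, k (c, b) = b)
    (h3 : ∀ᶠ a in 𝓝 c, k (a, a) = a) (ξ : EG) :
    HasFDerivAt (fun a => fderiv ℝ k (a, c) (0, ξ))
      (((ContinuousLinearMap.apply ℝ EG ((0, ξ) : EG × EG)) ∘L fderiv ℝ (fderiv ℝ k) (c, c)) ∘L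
        ContinuousLinearMap.inl ℝ EG EG) c ∧
    fderiv ℝ (fderiv ℝ k) (c, c) (ξ, 0) (0, ξ) = 0 := by
  have hd : DifferentiableAt ℝ (fderiv ℝ k) (c, c) :=
    (hk.fderiv_right (m := 1) (by norm_num)).differentiableAt (by simp)
  have hk1 : ∀ᶠ z in 𝓝 (c, c), DifferentiableAt ℝ k z :=
    (hk.eventually (by simp)).mono fun z hz => hz.differentiableAt (by simp)
  have key : ∀ (L : EG →L[ℝ] EG × EG) (f : EG → EG × EG) (_ : ∀ a, HasFDerivAt f L a)
      (_ : f c = (c, c)) (y : EG) (_ : ∀ᶠ a in 𝓝 c, HasFDerivAt (k ∘ f) (fderiv ℝ k (c, c) ∘L L) a),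
      fderiv ℝ (fderiv ℝ k) (c, c) (L y) (L y) = 0 := by
    intro L f hf hfc y he
    have e1 : ∀ᶠ a in 𝓝 c, fderiv ℝ k (f a) (L y) = fderiv ℝ k (c, c) (L y) := by
      have : ∀ᶠ a in 𝓝 c, DifferentiableAt ℝ k (f a) :=
        ((hf c).continuousAt.tendsto.eventually (by rwa [hfc]))
      filter_upwards [this, he] with a ha hb
      have := (ha.hasFDerivAt.comp a (hf a)).unique hb
      exact DFunLike.congr_fun this y
    have e2 : HasFDerivAt (fun a => fderiv ℝ k (f a) (L y))
        (((ContinuousLinearMap.apply ℝ EG (L y)) ∘L fderiv ℝ (fderiv ℝ k) (c, c)) ∘L L) c := by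
      have hd' : HasFDerivAt (fderiv ℝ k) (fderiv ℝ (fderiv ℝ k) (c, c)) (f c) := by
        rw [hfc]
        exact hd.hasFDerivAt
      exact ((ContinuousLinearMap.apply ℝ EG (L y)).hasFDerivAt.comp c (hd'.comp c (hf c)))
    have e3 := e2.unique ((hasFDerivAt_const _ c).congr_of_eventuallyEq e1)
    exact DFunLike.congr_fun e3 y
  have hkc := (hk.differentiableAt (by simp)).hasFDerivAt
  have aux : ∀ (L : EG →L[ℝ] EG × EG) (f : EG → EG × EG) (_ : ∀ a, HasFDerivAt f L a)
      (_ : f c = (c, c)) (T : EG →L[ℝ] EG) (u : EG → EG) (_ : ∀ a, HasFDerivAt u T a)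
      (_ : ∀ᶠ a in 𝓝 c, k (f a) = u a) (y : EG),
      fderiv ℝ (fderiv ℝ k) (c, c) (L y) (L y) = 0 := by
    intro L f hf hfc T u hu he y
    refine key L f hf hfc y ?_
    have hT : fderiv ℝ k (c, c) ∘L L = T := by
      have hkc' : HasFDerivAt k (fderiv ℝ k (c, c)) (f c) := by rwa [hfc]
      exact (hkc'.comp c (hf c)).unique ((hu c).congr_of_eventuallyEq he)
    rw [hT]
    filter_upwards [he.eventually_nhds] with a ha
    exact (hu a).congr_of_eventuallyEq ha
  have q1 := aux (ContinuousLinearMap.inl ℝ EG EG) (fun a => (a, c))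
    (fun a => hasFDerivAt_prodMk_left a c) rfl 0 (fun _ => c) (fun a => hasFDerivAt_const _ _) h1 ξ
  have q2 := aux (ContinuousLinearMap.inr ℝ EG EG) (fun b => (c, b))
    (fun b => hasFDerivAt_prodMk_right c b) rfl (ContinuousLinearMap.id ℝ EG) id
    (fun a => hasFDerivAt_id a) h2 ξ
  have q3 := aux ((ContinuousLinearMap.id ℝ EG).prod (ContinuousLinearMap.id ℝ EG))
    (fun a => (a, a)) (fun a => (hasFDerivAt_id a).prodMk (hasFDerivAt_id a)) rfl
    (ContinuousLinearMap.id ℝ EG) id (fun a => hasFDerivAt_id a) h3 ξ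
  have hsym : IsSymmSndFDerivAt ℝ k (c, c) := hk.isSymmSndFDerivAt (by simp)
  refine ⟨?_, ?_⟩
  · exact (ContinuousLinearMap.apply ℝ EG ((0, ξ) : EG × EG)).hasFDerivAt.comp c
      (HasFDerivAt.comp c (f := fun a => (a, c)) hd.hasFDerivAt (hasFDerivAt_prodMk_left c c))
  · have e : ((ContinuousLinearMap.id ℝ EG).prod (ContinuousLinearMap.id ℝ EG)) ξ =
        ContinuousLinearMap.inl ℝ EG EG ξ + ContinuousLinearMap.inr ℝ EG EG ξ := by simp
    rw [e, map_add, map_add, _root_.add_apply, _root_.add_apply, q1, q2,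
      hsym (ContinuousLinearMap.inr ℝ EG EG ξ) (ContinuousLinearMap.inl ℝ EG EG ξ), zero_add,
      add_zero, ← two_smul ℝ] at q3
    exact (smul_eq_zero.1 q3).resolve_left two_ne_zero

theorem Ad_inv_eq_fderiv (ξ : GroupLieAlgebra 𝓘(ℝ, EG) G) :
    ∃ k : EG × EG → EG, ContDiffAt ℝ 2 k (extChartAt 𝓘(ℝ, EG) (1 : G) 1, extChartAt 𝓘(ℝ, EG) (1 : G) 1) ∧
      (∀ᶠ a in 𝓝 (extChartAt 𝓘(ℝ, EG) (1 : G) 1), k (a, extChartAt 𝓘(ℝ, EG) (1 : G) 1) =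
        extChartAt 𝓘(ℝ, EG) (1 : G) 1) ∧
      (∀ᶠ b in 𝓝 (extChartAt 𝓘(ℝ, EG) (1 : G) 1), k (extChartAt 𝓘(ℝ, EG) (1 : G) 1, b) = b) ∧
      (∀ᶠ a in 𝓝 (extChartAt 𝓘(ℝ, EG) (1 : G) 1), k (a, a) = a) ∧
      (∀ᶠ a in 𝓝 (extChartAt 𝓘(ℝ, EG) (1 : G) 1), @Eq EG
        (Ad ((extChartAt 𝓘(ℝ, EG) (1 : G)).symm a)⁻¹ ξ)
        (fderiv ℝ k (a, extChartAt 𝓘(ℝ, EG) (1 : G) 1) (0, ξ))) := by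
  set φ := extChartAt 𝓘(ℝ, EG) (1 : G) with hφ
  have hφ1 : φ.symm (φ 1) = 1 := extChartAt_to_inv 1
  have hcd : ContDiffAt ℝ 2 (fun z : EG × EG => φ ((φ.symm z.1)⁻¹ * φ.symm z.2 * φ.symm z.1))
      (φ 1, φ 1) := by
    have h1 : ContMDiffAt 𝓘(ℝ, EG × EG) 𝓘(ℝ, EG) ∞ (fun z : EG × EG => φ.symm z.1) (φ 1, φ 1) :=
      (contMDiffAt_extChartAt_symm 𝓘(ℝ, EG) (mem_extChartAt_target 1)).comp (φ 1, φ 1)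
        contDiff_fst.contMDiff.contMDiffAt
    have h2 : ContMDiffAt 𝓘(ℝ, EG × EG) 𝓘(ℝ, EG) ∞ (fun z : EG × EG => φ.symm z.2) (φ 1, φ 1) :=
      (contMDiffAt_extChartAt_symm 𝓘(ℝ, EG) (mem_extChartAt_target 1)).comp (φ 1, φ 1)
        contDiff_snd.contMDiff.contMDiffAt
    have h3 := (h1.inv.mul h2).mul h1
    have h4 : ContMDiffAt 𝓘(ℝ, EG) 𝓘(ℝ, EG) ∞ φ
        ((φ.symm (φ 1))⁻¹ * φ.symm (φ 1) * φ.symm (φ 1)) := by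
      rw [hφ1, inv_one, one_mul, one_mul]
      exact contMDiffAt_extChartAt
    exact (contMDiffAt_iff_contDiffAt.1 (h4.comp (φ 1, φ 1) h3)).of_le two_le_infty
  refine ⟨fun z => φ ((φ.symm z.1)⁻¹ * φ.symm z.2 * φ.symm z.1), hcd, ?_, ?_, ?_, ?_⟩
  · exact Filter.Eventually.of_forall fun a => by simp [hφ1]
  · filter_upwards [extChartAt_target_mem_nhds (I := 𝓘(ℝ, EG)) (1 : G)] with b hb
    simp only [hφ1, inv_one, one_mul, mul_one]
    exact φ.right_inv hb
  · filter_upwards [extChartAt_target_mem_nhds (I := 𝓘(ℝ, EG)) (1 : G)] with b hb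
    simp only [inv_mul_cancel, one_mul]
    exact φ.right_inv hb
  · have hk : ∀ᶠ a in 𝓝 (φ 1), DifferentiableAt ℝ
        (fun z : EG × EG => φ ((φ.symm z.1)⁻¹ * φ.symm z.2 * φ.symm z.1)) (a, φ 1) :=
      ((hcd.eventually (by simp)).mono fun z hz => hz.differentiableAt (by simp)).curry_nhds.mono
        fun a ha => ha.self_of_nhds
    filter_upwards [hk] with a ha
    set g := φ.symm a
    have d4 : MDifferentiableAt 𝓘(ℝ, EG) 𝓘(ℝ, EG) (fun h : G => g⁻¹ * h * g⁻¹⁻¹) 1 :=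
      (contMDiff_conj g⁻¹).contMDiffAt.mdifferentiableAt (by simp)
    refine (mfderiv_eq_fderiv_chartMap 𝓘(ℝ, EG) 𝓘(ℝ, EG) d4 (ξ : EG)).trans ?_
    have e : chartMap 𝓘(ℝ, EG) 𝓘(ℝ, EG) (fun h : G => g⁻¹ * h * g⁻¹⁻¹) 1 =
        (fun z : EG × EG => φ ((φ.symm z.1)⁻¹ * φ.symm z.2 * φ.symm z.1)) ∘ fun b => (a, b) := by
      funext b
      simp only [chartMap, Function.comp_apply, mul_one, inv_inv, inv_mul_cancel]
      rfl
    rw [e, (ha.hasFDerivAt.comp (φ 1) (hasFDerivAt_prodMk_right a (φ 1))).fderiv]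
    rfl

theorem mfderiv_fundVF_eq_zero [FiniteDimensional ℝ EG] {c : GroupLieAlgebra 𝓘(ℝ, EG) G → N → F}
    {x : N} (hlin : ∃ l : GroupLieAlgebra 𝓘(ℝ, EG) G →ₗ[ℝ] F, ∀ ξ, c ξ x = l ξ)
    (hinv : ∀ (g : G) ξ x, c (Ad g ξ) (g • x) = c ξ x) (ξ : GroupLieAlgebra 𝓘(ℝ, EG) G)
    (hc : MDifferentiableAt 𝓘(ℝ, E) 𝓘(ℝ, F) (c ξ) x) :
    @Eq F (mfderiv 𝓘(ℝ, E) 𝓘(ℝ, F) (c ξ) x (fundVF ξ x)) 0 := by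
  obtain ⟨l, hl⟩ := hlin
  obtain ⟨k, hk, h1, h2, h3, h4⟩ := Ad_inv_eq_fderiv (G := G) ξ
  obtain ⟨q1, q2⟩ := mixed_second_deriv_eq_zero hk h1 h2 h3 ξ
  set φ := extChartAt 𝓘(ℝ, EG) (1 : G) with hφ
  let l' : EG →L[ℝ] F := LinearMap.toContinuousLinearMap (E := EG) l
  have e1 : (fun a => c ξ (φ.symm a • x)) =ᶠ[𝓝 (φ 1)] fun a => l' (fderiv ℝ k (a, φ 1) (0, ξ)) := by
    filter_upwards [h4] with a ha
    have e := hinv (φ.symm a)⁻¹ ξ (φ.symm a • x)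
    rw [inv_smul_smul, hl] at e
    rw [← e]
    exact congrArg l' ha
  have e2 := ((l'.hasFDerivAt.comp _ q1).congr_of_eventuallyEq e1).fderiv
  have d2 : MDifferentiableAt 𝓘(ℝ, EG) 𝓘(ℝ, E) (fun h : G => h • x) 1 :=
    (contMDiff_smul_right EG E x).contMDiffAt.mdifferentiableAt (by simp)
  have d3 : MDifferentiableAt 𝓘(ℝ, EG) 𝓘(ℝ, EG) φ.symm (φ 1) :=
    (contMDiffAt_extChartAt_symm (n := ∞) 𝓘(ℝ, EG)
      (mem_extChartAt_target 1)).mdifferentiableAt (by simp)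
  have d4 : MDifferentiableAt 𝓘(ℝ, EG) 𝓘(ℝ, F) (c ξ ∘ fun h : G => h • x) 1 :=
    MDifferentiableAt.comp (I' := 𝓘(ℝ, E)) 1 (by rwa [one_smul]) d2
  have e3 := mfderiv_comp_vec (f := φ.symm) (extChartAt_to_inv 1) d4 d3 (ξ : EG)
  have e4 := mfderiv_comp_vec (f := fun h : G => h • x) (one_smul G x) hc d2 ξ
  rw [mfderiv_extChartAt_symm_self] at e3
  refine (map_neg (mfderiv 𝓘(ℝ, E) 𝓘(ℝ, F) (c ξ) x) _).trans ?_
  refine (congrArg (Neg.neg : F → F) (?_ : @Eq F _ 0)).trans neg_zero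
  refine e4.symm.trans (e3.symm.trans ?_)
  rw [mfderiv_eq_fderiv]
  refine (DFunLike.congr_fun e2 ξ).trans ?_
  exact (congrArg l' q2).trans (map_zero l')

end Action

/-! ### Smooth maps to the unitary group -/

section Unitary

variable {H : Type*} [NormedAddCommGroup H] [InnerProductSpace ℂ H] [CompleteSpace H]

theorem contDiff_opExp : ContDiff ℝ ∞ (NormedSpace.exp : (H →L[ℂ] H) → (H →L[ℂ] H)) :=
  contDiff_iff_contDiffAt.2 fun x => (NormedSpace.exp_analytic (𝕂 := ℝ) x).contDiffAt

variable (H) in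
/-- The inclusion of the self-adjoint operators. -/
def saIncl : selfAdjoint (H →L[ℂ] H) →L[ℝ] (H →L[ℂ] H) where
  toFun a := a
  map_add' _ _ := rfl
  map_smul' _ _ := rfl
  cont := continuous_subtype_val

variable (H) in
/-- The map `a ↦ ia` on the self-adjoint operators. -/
def saI : selfAdjoint (H →L[ℂ] H) →L[ℝ] (H →L[ℂ] H) where
  toFun a := Complex.I • (a : H →L[ℂ] H)
  map_add' _ _ := smul_add _ _ _
  map_smul' c a := smul_comm Complex.I c (a : H →L[ℂ] H)
  cont := (continuous_const_smul Complex.I).comp continuous_subtype_val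

variable (H) in
/-- The self-adjoint part of an operator. -/
def saPart : (H →L[ℂ] H) →L[ℝ] selfAdjoint (H →L[ℂ] H) where
  toFun T := selfAdjointPart ℝ T
  map_add' _ _ := map_add _ _ _
  map_smul' _ _ := map_smul _ _ _
  cont := (selfAdjointPartL ℝ (H →L[ℂ] H)).cont

theorem hasFDerivAt_mul_exp {K B : Type*} [NormedAddCommGroup K] [NormedSpace ℝ K] [NormedRing B]
    [NormedAlgebra ℝ B] [CompleteSpace B] (u : B) (L : K →L[ℝ] B) :
    HasFDerivAt (fun a => u * NormedSpace.exp (L a)) ((ContinuousLinearMap.mul ℝ B u) ∘L L) 0 := by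
  have h1 : HasFDerivAt (NormedSpace.exp : B → B) (1 : B →L[ℝ] B) (L 0) := by
    rw [map_zero]
    exact (hasStrictFDerivAt_exp_zero (𝕂 := ℝ) (𝔸 := B)).hasFDerivAt
  exact (ContinuousLinearMap.mul ℝ B u).hasFDerivAt.comp (0 : K) (h1.comp (0 : K) L.hasFDerivAt)

/-- A smooth logarithm for the unitary operators near the identity. -/
theorem exists_log : ∃ l : (H →L[ℂ] H) → selfAdjoint (H →L[ℂ] H), ContDiffAt ℝ ∞ l 1 ∧ l 1 = 0 ∧
    ∀ᶠ v in 𝓝 (1 : H →L[ℂ] H), v ∈ unitary (H →L[ℂ] H) →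
      (selfAdjoint.expUnitary (l v) : H →L[ℂ] H) = v := by
  have h0 : NormedSpace.exp (0 : H →L[ℂ] H) = 1 := NormedSpace.exp_zero
  have hd : HasFDerivAt (NormedSpace.exp : (H →L[ℂ] H) → (H →L[ℂ] H))
      ((ContinuousLinearEquiv.refl ℝ (H →L[ℂ] H) : (H →L[ℂ] H) ≃L[ℝ] (H →L[ℂ] H)) :
        (H →L[ℂ] H) →L[ℝ] (H →L[ℂ] H)) 0 :=
    (hasStrictFDerivAt_exp_zero (𝕂 := ℝ) (𝔸 := H →L[ℂ] H)).hasFDerivAt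
  have hcd : ContDiffAt ℝ ∞ (NormedSpace.exp : (H →L[ℂ] H) → (H →L[ℂ] H)) 0 :=
    contDiff_opExp.contDiffAt
  have hn : (∞ : WithTop ℕ∞) ≠ 0 := by simp
  have hst := hcd.hasStrictFDerivAt' hd hn
  set L := hcd.localInverse hd hn with hL
  have hLc : ContDiffAt ℝ ∞ L 1 := by
    have := hcd.to_localInverse hd hn
    rwa [h0] at this
  have hL1 : L 1 = 0 := by
    have := hcd.localInverse_apply_image hd hn
    rwa [h0] at this
  have hl : ∀ᶠ x in 𝓝 (0 : H →L[ℂ] H), L (NormedSpace.exp x) = x := hst.eventually_left_inverse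
  have hr : ∀ᶠ v in 𝓝 (1 : H →L[ℂ] H), NormedSpace.exp (L v) = v := by
    have := hst.eventually_right_inverse
    rwa [h0] at this
  have htend : Filter.Tendsto L (𝓝 1) (𝓝 0) := by
    have := hLc.continuousAt.tendsto
    rwa [hL1] at this
  have ht1 : Filter.Tendsto (fun v => star (L v)) (𝓝 1) (𝓝 0) := by
    simpa using htend.star
  have ht2 : Filter.Tendsto (fun v => -L v) (𝓝 1) (𝓝 0) := by
    simpa using htend.neg
  refine ⟨fun v => saPart H (-Complex.I • L v), ?_, ?_, ?_⟩
  · exact (ContinuousLinearMap.contDiff (𝕜 := ℝ) (E := H →L[ℂ] H)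
      (F := selfAdjoint (H →L[ℂ] H)) (saPart H)).contDiffAt.comp 1 (hLc.const_smul (-Complex.I))
  · simp [hL1]
  · filter_upwards [hr, ht1.eventually hl, ht2.eventually hl] with v h1 h2 h3 hv
    have hskew : star (L v) = -L v := by
      rw [← h2, ← h3]
      congr 1
      have e1 : NormedSpace.exp (star (L v)) = star v := by rw [← NormedSpace.star_exp, h1]
      have e2 : NormedSpace.exp (-L v) * v = 1 := by
        nth_rewrite 2 [← h1]
        let _ : NormedAlgebra ℚ (H →L[ℂ] H) := NormedAlgebra.restrictScalars ℚ ℂ (H →L[ℂ] H)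
        rw [← NormedSpace.exp_add_of_commute (Commute.neg_left (Commute.refl _)), neg_add_cancel, h0]
      rw [e1]
      calc star v = NormedSpace.exp (-L v) * v * star v := by rw [e2, one_mul]
        _ = _ := by rw [mul_assoc, (Unitary.mem_iff.1 hv).2, mul_one]
    have hsa : IsSelfAdjoint (-Complex.I • L v) := by
      rw [isSelfAdjoint_iff, star_smul, hskew]
      simp
    rw [selfAdjoint.expUnitary_coe]
    have e3 : ((saPart H (-Complex.I • L v) : selfAdjoint (H →L[ℂ] H)) :
        H →L[ℂ] H) = -Complex.I • L v := by
      exact hsa.coe_selfAdjointPart_apply ℝ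
    rw [e3, smul_smul]
    simpa using h1

variable {E : Type*} [NormedAddCommGroup E] [NormedSpace ℝ E] {S : Type*} [TopologicalSpace S]
  {I : ModelWithCorners ℝ E S} {N : Type*} [TopologicalSpace N] [ChartedSpace S N]

/-- A map to the unitary group which is of class `C^n` in the norm topology is of class `C^n` in
the charts `y ↦ u exp(iy)`. -/
theorem exists_unitary_chart {n : WithTop ℕ∞} (hn : n ≤ ∞) (hn1 : n ≠ 0)
    {w : N → unitary (H →L[ℂ] H)} {x : N}
    (hw : ContMDiffAt I 𝓘(ℝ, H →L[ℂ] H) n (fun z => (w z : H →L[ℂ] H)) x) :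
    ∃ y : N → selfAdjoint (H →L[ℂ] H), ContMDiffAt I 𝓘(ℝ, selfAdjoint (H →L[ℂ] H)) n y x ∧
      y x = 0 ∧ (∀ᶠ z in 𝓝 x, w z = w x * selfAdjoint.expUnitary (y z)) ∧
      ∀ Y : TangentSpace I x,
        @Eq (H →L[ℂ] H) (mfderiv I 𝓘(ℝ, H →L[ℂ] H) (fun z => (w z : H →L[ℂ] H)) x Y)
          ((w x : H →L[ℂ] H) * (Complex.I •
            saIncl H (mfderiv I 𝓘(ℝ, selfAdjoint (H →L[ℂ] H)) y x Y))) := by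
  obtain ⟨l, hl, hl1, hlog⟩ := exists_log (H := H)
  set v : N → (H →L[ℂ] H) := fun z => star (w x : H →L[ℂ] H) * (w z : H →L[ℂ] H) with hv
  have hvx : v x = 1 := (Unitary.mem_iff.1 (w x).2).1
  have hvc : ContMDiffAt I 𝓘(ℝ, H →L[ℂ] H) n v x :=
    ((ContinuousLinearMap.mul ℝ (H →L[ℂ] H) (star (w x : H →L[ℂ] H))).contDiff.contMDiff.contMDiffAt).comp x hw
  have hlv : ContMDiffAt 𝓘(ℝ, H →L[ℂ] H) 𝓘(ℝ, selfAdjoint (H →L[ℂ] H)) n l (v x) := by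
    rw [hvx]
    exact (hl.of_le hn).contMDiffAt
  have hyc := hlv.comp x hvc
  have hev : ∀ᶠ z in 𝓝 x, w z = w x * selfAdjoint.expUnitary (l (v z)) := by
    have ht : Filter.Tendsto v (𝓝 x) (𝓝 1) := by
      have := hvc.continuousAt.tendsto
      rwa [hvx] at this
    filter_upwards [ht.eventually hlog] with z hz
    have hz' := hz (mul_mem (Unitary.star_mem (w x).2) (w z).2)
    apply Subtype.ext
    rw [Submonoid.coe_mul, hz', hv]
    simp only [← mul_assoc]
    rw [(Unitary.mem_iff.1 (w x).2).2, one_mul]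
  refine ⟨l ∘ v, hyc, ?_, hev, fun Y => ?_⟩
  · simp only [Function.comp_apply, hvx, hl1]
  · have e1 : (fun z => (w z : H →L[ℂ] H)) =ᶠ[𝓝 x]
        (fun a : selfAdjoint (H →L[ℂ] H) => (w x : H →L[ℂ] H) *
          NormedSpace.exp (saI H a)) ∘ (l ∘ v) := by
      filter_upwards [hev] with z hz
      rw [hz]
      rfl
    have e2 : HasFDerivAt (fun a : selfAdjoint (H →L[ℂ] H) => (w x : H →L[ℂ] H) *
          NormedSpace.exp (saI H a)) _ 0 :=
      hasFDerivAt_mul_exp (K := selfAdjoint (H →L[ℂ] H)) (w x : H →L[ℂ] H) (saI H)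
    refine (mfderiv_congr_vec e1 Y).trans ?_
    have hy0 : (l ∘ v) x = 0 := by simp only [Function.comp_apply, hvx, hl1]
    have e3 := mfderiv_comp_vec hy0 e2.differentiableAt.mdifferentiableAt
      (hyc.mdifferentiableAt hn1) Y
    rw [mfderiv_eq_fderiv, e2.fderiv] at e3
    exact e3

end Unitary

section Chain

variable {E : Type*} [NormedAddCommGroup E] [NormedSpace ℝ E] {S : Type*} [TopologicalSpace S]
  {I : ModelWithCorners ℝ E S} {N : Type*} [TopologicalSpace N] [ChartedSpace S N]
  {E' : Type*} [NormedAddCommGroup E'] [NormedSpace ℝ E'] {S' : Type*} [TopologicalSpace S']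
  {I' : ModelWithCorners ℝ E' S'} {N' : Type*} [TopologicalSpace N'] [ChartedSpace S' N']
  {K : Type*} [NormedAddCommGroup K] [NormedSpace ℝ K] {T : Type*} [TopologicalSpace T]
  {J : ModelWithCorners ℝ K T} {Q : Type*} [TopologicalSpace Q] [ChartedSpace T Q]
  {E'' : Type*} [NormedAddCommGroup E''] [NormedSpace ℝ E''] {S'' : Type*} [TopologicalSpace S'']
  {I'' : ModelWithCorners ℝ E'' S''} {N'' : Type*} [TopologicalSpace N''] [ChartedSpace S'' N'']

theorem mfderiv_prodMk_vec {φ : N → N'} {y : N → Q} {x : N} (hφ : MDifferentiableAt I I' φ x)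
    (hy : MDifferentiableAt I J y x) (Y : TangentSpace I x) :
    @Eq (E' × K) (mfderiv I (I'.prod J) (fun z => (φ z, y z)) x Y)
      (mfderiv I I' φ x Y, mfderiv I J y x Y) :=
  congrArg (fun L : TangentSpace I x →L[ℝ] E' × K => L Y) (hφ.mfderiv_prod hy)

/-- The chain rule for a function which is given near `x` as `Φ (φ z, y z)`. -/
theorem mfderiv_comp_prodMk {Φ : N' × Q → N''} {φ : N → N'} {y : N → Q} {x : N} {c : Q}
    (hφ : MDifferentiableAt I I' φ x) (hy : MDifferentiableAt I J y x) (hc : y x = c)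
    (hΦ : MDifferentiableAt (I'.prod J) I'' Φ (φ x, c)) {f : N → N''}
    (hf : f =ᶠ[𝓝 x] fun z => Φ (φ z, y z)) (Y : TangentSpace I x) :
    @Eq E'' (mfderiv I I'' f x Y)
      (mfderiv (I'.prod J) I'' Φ (φ x, c) ((mfderiv I I' φ x Y, mfderiv I J y x Y) : E' × K)) := by
  refine (mfderiv_congr_vec hf Y).trans ?_
  have h1 : MDifferentiableAt I (I'.prod J) (fun z => (φ z, y z)) x := hφ.prodMk hy
  refine (mfderiv_comp_vec (I' := I'.prod J) (f := fun z => (φ z, y z)) (y := (φ x, c))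
    (by rw [hc]) hΦ h1 Y).trans ?_
  exact congrArg (fun v : E' × K => (mfderiv (I'.prod J) I'' Φ (φ x, c) v : E''))
    (mfderiv_prodMk_vec hφ hy Y)

end Chain

section Lift

variable {EG : Type*} [NormedAddCommGroup EG] [NormedSpace ℝ EG]
  {G : Type*} [TopologicalSpace G] [ChartedSpace EG G] [Group G] [LieGroup 𝓘(ℝ, EG) ∞ G]
  {EM : Type*} [NormedAddCommGroup EM] [NormedSpace ℝ EM]
  {M : Type*} [TopologicalSpace M] [ChartedSpace EM M] [IsManifold 𝓘(ℝ, EM) ∞ M]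
  [MulAction G M]
  {EP : Type*} [NormedAddCommGroup EP] [NormedSpace ℝ EP]
  {P : Type*} [TopologicalSpace P] [ChartedSpace EP P] [IsManifold 𝓘(ℝ, EP) ∞ P]
  [MulAction G P]
  {H : Type*} [NormedAddCommGroup H] [InnerProductSpace ℂ H] [CompleteSpace H]
  (B : EquivPUBundle EG G EM M EP P H)

/-- Near `q` the points of `P` are written as `φ(q)[w(q)]`, with `φ` and `w` of class `C^n`. -/
structure LiftAt (n : WithTop ℕ∞) (φ : P → P) (w : P → unitary (H →L[ℂ] H)) (q : P) : Prop where
  base : ContMDiffAt 𝓘(ℝ, EP) 𝓘(ℝ, EP) n φ q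
  lift : ContMDiffAt 𝓘(ℝ, EP) 𝓘(ℝ, H →L[ℂ] H) n (fun q => (w q : H →L[ℂ] H)) q
  act_eq : ∀ᶠ q' in 𝓝 q, B.act (φ q') (w q') = q'

variable {B} {φ : P → P} {w : P → unitary (H →L[ℂ] H)} {q : P}

theorem LiftAt.eventually (h : LiftAt B ∞ φ w q) : ∀ᶠ q' in 𝓝 q, LiftAt B 1 φ w q' := by
  have h1 : (1 : WithTop ℕ∞) ≤ ∞ := le_trans (by norm_num) two_le_infty
  have e1 := (contMDiffAt_iff_contMDiffAt_nhds (by simp)).1 (h.base.of_le h1)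
  have e2 := (contMDiffAt_iff_contMDiffAt_nhds (by simp)).1 (h.lift.of_le h1)
  filter_upwards [e1, e2, h.act_eq.eventually_nhds] with q' h1 h2 h3
  exact ⟨h1, h2, h3⟩

theorem LiftAt.of_le {n m : WithTop ℕ∞} (h : LiftAt B n φ w q) (hm : m ≤ n) : LiftAt B m φ w q :=
  ⟨h.base.of_le hm, h.lift.of_le hm, h.act_eq⟩

theorem LiftAt.exists_chart (h : LiftAt B 1 φ w q) : ∃ y : P → selfAdjoint (H →L[ℂ] H),
    MDifferentiableAt 𝓘(ℝ, EP) 𝓘(ℝ, selfAdjoint (H →L[ℂ] H)) y q ∧ y q = 0 ∧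
    (∀ᶠ z in 𝓝 q, w z = w q * selfAdjoint.expUnitary (y z)) ∧
    (∀ Y : TangentSpace 𝓘(ℝ, EP) q,
      @Eq (EP × (H →L[ℂ] H)) (mfderiv 𝓘(ℝ, EP) (𝓘(ℝ, EP).prod 𝓘(ℝ, H →L[ℂ] H))
        (fun z => (φ z, (w z : H →L[ℂ] H))) q Y)
      (EquivPUBundle.tvec (φ q) (w q) (mfderiv 𝓘(ℝ, EP) 𝓘(ℝ, EP) φ q Y)
        (mfderiv 𝓘(ℝ, EP) 𝓘(ℝ, selfAdjoint (H →L[ℂ] H)) y q Y))) ∧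
    ∀ Y : TangentSpace 𝓘(ℝ, EP) q, @Eq EP
      (B.dact (φ q) (w q) (mfderiv 𝓘(ℝ, EP) 𝓘(ℝ, EP) φ q Y)
        (mfderiv 𝓘(ℝ, EP) 𝓘(ℝ, selfAdjoint (H →L[ℂ] H)) y q Y)) Y := by
  obtain ⟨y, hy, hy0, hyw, hdw⟩ := exists_unitary_chart
    (le_trans (by norm_num) two_le_infty) one_ne_zero h.lift
  have hφ := h.base.mdifferentiableAt one_ne_zero
  have hw := h.lift.mdifferentiableAt one_ne_zero
  have hy' := hy.mdifferentiableAt one_ne_zero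
  refine ⟨y, hy', hy0, hyw, fun Y => ?_, fun Y => ?_⟩
  · refine (mfderiv_prodMk_vec hφ hw Y).trans ?_
    exact congrArg (Prod.mk (mfderiv 𝓘(ℝ, EP) 𝓘(ℝ, EP) φ q Y : EP)) (hdw Y)
  · have e : (fun z : P => z) =ᶠ[𝓝 q] fun z => (fun x : P × selfAdjoint (H →L[ℂ] H) =>
        B.act x.1 (w q * selfAdjoint.expUnitary x.2)) (φ z, y z) := by
      filter_upwards [hyw, h.act_eq] with z h1 h2
      rw [← h1, h2]
    have h2 := mfderiv_comp_prodMk hφ hy' hy0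
      ((B.act_smooth (w q)).mdifferentiable (by simp) (φ q, 0)) e Y
    refine h2.symm.trans ?_
    exact congrArg (fun L : EP →L[ℝ] EP => L Y) (mfderiv_id (I := 𝓘(ℝ, EP)) (x := q))

end Lift

/-! ### Descent of forms along the projection of a principal bundle -/

section Descent

variable {EG : Type*} [NormedAddCommGroup EG] [NormedSpace ℝ EG]
  {G : Type*} [TopologicalSpace G] [ChartedSpace EG G] [Group G] [LieGroup 𝓘(ℝ, EG) ∞ G]
  {EM : Type*} [NormedAddCommGroup EM] [NormedSpace ℝ EM]
  {M : Type*} [TopologicalSpace M] [ChartedSpace EM M] [IsManifold 𝓘(ℝ, EM) ∞ M]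
  [MulAction G M] [ContMDiffSMul 𝓘(ℝ, EG) 𝓘(ℝ, EM) ∞ G M]
  {EP : Type*} [NormedAddCommGroup EP] [NormedSpace ℝ EP]
  {P : Type*} [TopologicalSpace P] [ChartedSpace EP P] [IsManifold 𝓘(ℝ, EP) ∞ P]
  [MulAction G P]
  {H : Type*} [NormedAddCommGroup H] [InnerProductSpace ℂ H] [CompleteSpace H]
  (B : EquivPUBundle EG G EM M EP P H)

/-- A form on `P` which agrees with its pullbacks along the maps `φ` for which `q = φ(q)[w(q)]`
with a smooth map `w`; these are the pullbacks of forms on `M`. -/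
def IsBasic {j : ℕ} (τ : RawForm 𝓘(ℝ, EP) P ℂ j) : Prop :=
  ∀ φ w q, LiftAt B ∞ φ w q → pb 𝓘(ℝ, EP) 𝓘(ℝ, EP) φ τ q = τ q

/-- The local section around a point of the base. -/
def sec (m : M) : M → P := (B.locally_trivial m).choose_spec.choose

theorem sec_spec (m : M) : ∃ W : Set M, IsOpen W ∧ m ∈ W ∧
    ContMDiffOn 𝓘(ℝ, EM) 𝓘(ℝ, EP) ∞ (sec B m) W ∧ (∀ x ∈ W, B.proj (sec B m x) = x) ∧
    ∀ p, B.proj p ∈ W → ∃ w : P → unitary (H →L[ℂ] H),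
      ContMDiffAt 𝓘(ℝ, EP) 𝓘(ℝ, H →L[ℂ] H) ∞ (fun q => (w q : H →L[ℂ] H)) p ∧
      ∀ᶠ q in nhds p, B.act (sec B m (B.proj q)) (w q) = q :=
  ⟨_, (B.locally_trivial m).choose_spec.choose_spec⟩

/-- The pullback of a form on `P` along the local sections. -/
def descend (j : ℕ) : RawForm 𝓘(ℝ, EP) P ℂ j →ₗ[ℝ] RawForm 𝓘(ℝ, EM) M ℂ j where
  toFun τ m := pb 𝓘(ℝ, EM) 𝓘(ℝ, EP) (sec B m) τ m
  map_add' _ _ := rfl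
  map_smul' _ _ := rfl

theorem descend_apply {j : ℕ} (τ : RawForm 𝓘(ℝ, EP) P ℂ j) (m : M) :
    descend B j τ m = pb 𝓘(ℝ, EM) 𝓘(ℝ, EP) (sec B m) τ m := rfl

variable {B}

theorem IsBasic.pb_section {j : ℕ} {τ : RawForm 𝓘(ℝ, EP) P ℂ j} (hτ : IsBasic B τ) {s : M → P}
    {m : M} (hs : ContMDiffAt 𝓘(ℝ, EM) 𝓘(ℝ, EP) ∞ s m) (hsm : ∀ᶠ x in 𝓝 m, B.proj (s x) = x) :
    descend B j τ m = pb 𝓘(ℝ, EM) 𝓘(ℝ, EP) s τ m := by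
  obtain ⟨W, hW, hmW, hc, hp, hw⟩ := sec_spec B m
  have hpm := hsm.self_of_nhds
  obtain ⟨w, hwc, hwe⟩ := hw (s m) (by rwa [hpm])
  have hc' : ContMDiffAt 𝓘(ℝ, EM) 𝓘(ℝ, EP) ∞ (sec B m) (B.proj (s m)) := by
    rw [hpm]
    exact hc.contMDiffAt (hW.mem_nhds hmW)
  have hφ : ContMDiffAt 𝓘(ℝ, EP) 𝓘(ℝ, EP) ∞ (sec B m ∘ B.proj) (s m) :=
    hc'.comp (s m) B.proj_smooth.contMDiffAt
  have h1 := hτ (sec B m ∘ B.proj) w (s m) ⟨hφ, hwc, hwe⟩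
  have h2 : pb 𝓘(ℝ, EM) 𝓘(ℝ, EP) s τ m =
      pb 𝓘(ℝ, EM) 𝓘(ℝ, EP) s (pb 𝓘(ℝ, EP) 𝓘(ℝ, EP) (sec B m ∘ B.proj) τ) m := by
    rw [pb, pb, h1]
  rw [h2, ← pb_comp _ _ _ _ (hφ.mdifferentiableAt (by simp)) (hs.mdifferentiableAt (by simp)),
    descend_apply]
  refine pb_congr_map _ _ _ ?_
  filter_upwards [hsm] with x hx
  simp [hx]

theorem IsBasic.smooth_descend {j : ℕ} {τ : RawForm 𝓘(ℝ, EP) P ℂ j} (hτ : IsBasic B τ)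
    (hs : ∀ q, SmoothFormAt 𝓘(ℝ, EP) τ q) (m : M) : SmoothFormAt 𝓘(ℝ, EM) (descend B j τ) m := by
  obtain ⟨W, hW, hmW, hc, hp, -⟩ := sec_spec B m
  refine SmoothFormAt.congr 𝓘(ℝ, EM) (SmoothFormAt.pb 𝓘(ℝ, EM) 𝓘(ℝ, EP)
    (hc.contMDiffAt (hW.mem_nhds hmW)) (hs _)) ?_
  filter_upwards [hW.mem_nhds hmW] with x hx
  refine hτ.pb_section (hc.contMDiffAt (hW.mem_nhds hx)) ?_
  filter_upwards [hW.mem_nhds hx] with z hz using hp z hz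

theorem IsBasic.pb_descend {j : ℕ} {τ : RawForm 𝓘(ℝ, EP) P ℂ j} (hτ : IsBasic B τ) (q : P) :
    pb 𝓘(ℝ, EP) 𝓘(ℝ, EM) B.proj (descend B j τ) q = τ q := by
  obtain ⟨W, hW, hmW, hc, hp, hw⟩ := sec_spec B (B.proj q)
  obtain ⟨w, hwc, hwe⟩ := hw q hmW
  have hc' := hc.contMDiffAt (hW.mem_nhds hmW)
  have hφ : ContMDiffAt 𝓘(ℝ, EP) 𝓘(ℝ, EP) ∞ (sec B (B.proj q) ∘ B.proj) q :=
    hc'.comp q B.proj_smooth.contMDiffAt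
  have h1 := hτ (sec B (B.proj q) ∘ B.proj) w q ⟨hφ, hwc, hwe⟩
  rw [pb_comp _ 𝓘(ℝ, EM) _ _ (hc'.mdifferentiableAt (by simp))
    (B.proj_smooth.contMDiffAt.mdifferentiableAt (by simp))] at h1
  exact h1

variable (B)

/-- Pullback along the projection is injective. -/
theorem pb_proj_injective {j : ℕ} {η η' : RawForm 𝓘(ℝ, EM) M ℂ j}
    (h : pb 𝓘(ℝ, EP) 𝓘(ℝ, EM) B.proj η = pb 𝓘(ℝ, EP) 𝓘(ℝ, EM) B.proj η') : η = η' := by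
  have key : ∀ (η : RawForm 𝓘(ℝ, EM) M ℂ j) (m : M), η m = pb 𝓘(ℝ, EM) 𝓘(ℝ, EP) (sec B m)
      (pb 𝓘(ℝ, EP) 𝓘(ℝ, EM) B.proj η) m := fun η m => by
    obtain ⟨W, hW, hmW, hc, hp, -⟩ := sec_spec B m
    rw [← pb_comp _ _ _ _ (B.proj_smooth.contMDiffAt.mdifferentiableAt (by simp))
      ((hc.contMDiffAt (hW.mem_nhds hmW)).mdifferentiableAt (by simp))]
    have h2 : B.proj ∘ sec B m =ᶠ[𝓝 m] id := by
      filter_upwards [hW.mem_nhds hmW] with x hx using hp x hx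
    rw [pb_congr_map _ _ _ h2]
    ext v
    rw [pb_apply, mfderiv_id]
    rfl
  funext m
  rw [key η, key η', h]

theorem pullback_apply (η : RawCartan EG G EM M) (ξ : GroupLieAlgebra 𝓘(ℝ, EG) G) (p : P)
    (k j : ℕ) : B.pullback η ξ p k j = pb 𝓘(ℝ, EP) 𝓘(ℝ, EM) B.proj (fun m => η ξ m k j) p := rfl

theorem pullback_injective {η η' : RawCartan EG G EM M} (h : B.pullback η = B.pullback η') :
    η = η' := by
  funext ξ m k j
  refine congrFun (pb_proj_injective B (η := fun m => η ξ m k j) (η' := fun m => η' ξ m k j) ?_) m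
  funext p
  rw [← pullback_apply, ← pullback_apply, h]

theorem HasDegree.of_pullback {n : ℕ} {η : RawCartan EG G EM M} (h : HasDegree n (B.pullback η)) :
    HasDegree n η := fun ξ m k j hkj => by
  refine congrFun (pb_proj_injective B (η := fun m => η ξ m k j) (η' := fun _ => 0) ?_) m
  funext p
  rw [← pullback_apply, h ξ p k j hkj]
  rfl

theorem mfderiv_proj_fundVF (ξ : GroupLieAlgebra 𝓘(ℝ, EG) G) (p : P) :
    @Eq EM (mfderiv 𝓘(ℝ, EP) 𝓘(ℝ, EM) B.proj p (fundVF ξ p)) (fundVF ξ (B.proj p)) := by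
  have := B.smul_smooth
  have h1 := mfderiv_comp_vec (I := 𝓘(ℝ, EG)) (I' := 𝓘(ℝ, EP)) (I'' := 𝓘(ℝ, EM))
    (f := fun g : G => g • p) (g := B.proj) (x := 1) (one_smul G p)
    (B.proj_smooth.contMDiffAt.mdifferentiableAt (by simp))
    ((contMDiff_smul_right EG EP p).contMDiffAt.mdifferentiableAt (by simp)) ξ
  have h2 : B.proj ∘ (fun g : G => g • p) = fun g : G => g • B.proj p :=
    funext fun g => B.proj_equivariant g p
  rw [h2] at h1
  refine (map_neg (mfderiv 𝓘(ℝ, EP) 𝓘(ℝ, EM) B.proj p)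
    (mfderiv 𝓘(ℝ, EG) 𝓘(ℝ, EP) (fun g : G => g • p) 1 ξ : EP)).trans ?_
  exact congrArg (Neg.neg : EM → EM) h1.symm

theorem pullback_dCartan {η : RawCartan EG G EM M}
    (hη : ∀ ξ k j x, SmoothFormAt 𝓘(ℝ, EM) (fun y => η ξ y k j) x) :
    B.pullback (dCartan η) = dCartan (B.pullback η) := by
  funext ξ p k j
  have hd : ∀ k j, pb 𝓘(ℝ, EP) 𝓘(ℝ, EM) B.proj (extD 𝓘(ℝ, EM) (fun y => η ξ y k j)) p =
      extD 𝓘(ℝ, EP) (fun y => B.pullback η ξ y k j) p := fun k j =>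
    (extD_pb 𝓘(ℝ, EP) 𝓘(ℝ, EM) (B.proj_smooth.contMDiffAt.of_le two_le_infty)
      ((SmoothFormAt.formContDiffAt _ (hη ξ k j _)).of_le (by simp))).symm
  have hc : ∀ k j, (contract (fundVF ξ (B.proj p)) (η ξ (B.proj p) k (j + 1))
      ).compContinuousLinearMap (mfderiv 𝓘(ℝ, EP) 𝓘(ℝ, EM) B.proj p) =
      contract (fundVF ξ p) (B.pullback η ξ p k (j + 1)) := fun k j => by
    ext v
    change η ξ (B.proj p) k (j + 1) (Matrix.vecCons _ _) = η ξ (B.proj p) k (j + 1) _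
    congr 1
    funext i
    refine Fin.cases ?_ (fun i => ?_) i
    · exact (mfderiv_proj_fundVF B ξ p).symm
    · rfl
  have hs : ∀ a b : TangentSpace 𝓘(ℝ, EM) (B.proj p) [⋀^Fin j]→L[ℝ] ℂ,
      (a - b).compContinuousLinearMap (mfderiv 𝓘(ℝ, EP) 𝓘(ℝ, EM) B.proj p) =
      a.compContinuousLinearMap (mfderiv 𝓘(ℝ, EP) 𝓘(ℝ, EM) B.proj p) -
      b.compContinuousLinearMap (mfderiv 𝓘(ℝ, EP) 𝓘(ℝ, EM) B.proj p) := fun a b => rfl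
  refine (hs _ _).trans (congrArg₂ _ ?_ ?_)
  · cases j with
    | zero => rfl
    | succ j => exact hd k j
  · cases k with
    | zero => rfl
    | succ k => exact hc k j

theorem pullback_mulCartan (α β : RawCartan EG G EM M) :
    B.pullback (mulCartan α β) = mulCartan (B.pullback α) (B.pullback β) := by
  funext ξ p
  exact map_mul (MF.comp (A := ℂ) (mfderiv 𝓘(ℝ, EP) 𝓘(ℝ, EM) B.proj p))
    (show MF (TangentSpace 𝓘(ℝ, EM) (B.proj p)) ℂ from α ξ (B.proj p))
    (show MF (TangentSpace 𝓘(ℝ, EM) (B.proj p)) ℂ from β ξ (B.proj p))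

theorem pullback_sub (α β : RawCartan EG G EM M) :
    B.pullback (α - β) = B.pullback α - B.pullback β := rfl

/-- Basic elements of the Cartan complex of `P` come from `M`. -/
theorem exists_descent {α : RawCartan EG G EP P} (hα : α ∈ cartanComplex EG G EP P)
    (hb : ∀ ξ k j, IsBasic B (fun y => α ξ y k j)) :
    ∃ η ∈ cartanComplex EG G EM M, B.pullback η = α := by
  have := B.smul_smooth
  let η : RawCartan EG G EM M := fun ξ m k j => descend B j (fun y => α ξ y k j) m
  have hη : B.pullback η = α := by
    funext ξ p k j
    exact (hb ξ k j).pb_descend p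
  refine ⟨η, ⟨fun ξ k j m => (hb ξ k j).smooth_descend (hα.1 ξ k j) m, fun k j => ?_, ?_⟩, hη⟩
  · obtain ⟨m, hm⟩ := hα.2.1 k j
    refine ⟨(descend B j).compMultilinearMap m, fun ξ x => ?_⟩
    have : (fun y => α ξ y k j) = m (fun _ => ξ) := funext fun y => hm ξ y
    exact congrArg (fun τ => descend B j τ x) this
  · intro g ξ x k j
    refine congrFun (pb_proj_injective B (η := pb 𝓘(ℝ, EM) 𝓘(ℝ, EM) (fun y : M => g • y)
      (fun y => η (Ad g ξ) y k j)) (η' := fun y => η ξ y k j) ?_) x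
    funext p
    have hg : MDifferentiableAt 𝓘(ℝ, EM) 𝓘(ℝ, EM) (fun y : M => g • y) (B.proj p) :=
      (contMDiff_smul_left EG EM g).contMDiffAt.mdifferentiableAt (by simp)
    have hg' : MDifferentiableAt 𝓘(ℝ, EP) 𝓘(ℝ, EP) (fun y : P => g • y) p :=
      (contMDiff_smul_left EG EP g).contMDiffAt.mdifferentiableAt (by simp)
    have hp : ∀ q, MDifferentiableAt 𝓘(ℝ, EP) 𝓘(ℝ, EM) B.proj q := fun q =>
      B.proj_smooth.contMDiffAt.mdifferentiableAt (by simp)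
    rw [← pb_comp _ _ _ _ hg (hp p), ← pullback_apply B η ξ, hη, ← hα.2.2 g ξ p k j]
    have e : (fun y : M => g • y) ∘ B.proj = B.proj ∘ (fun y : P => g • y) :=
      funext fun y => (B.proj_equivariant g y).symm
    rw [e, pb_comp _ 𝓘(ℝ, EP) _ _ (hp _) hg', ← hη]
    rfl

end Descent

/-! ### Elements of the Cartan complex -/

theorem SmoothFormAt.sub {E : Type*} [NormedAddCommGroup E] [NormedSpace ℝ E] {S : Type*}
    [TopologicalSpace S] (I : ModelWithCorners ℝ E S) {N : Type*} [TopologicalSpace N]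
    [ChartedSpace S N] {F : Type*} [NormedAddCommGroup F] [NormedSpace ℝ F] {j : ℕ}
    {w η : RawForm I N F j} {x : N} (h : SmoothFormAt I w x) (h' : SmoothFormAt I η x) :
    SmoothFormAt I (fun y => w y - η y) x :=
  ContDiffAt.sub h h'

section Poly

variable {𝔤 : Type*} [AddCommGroup 𝔤] [Module ℝ 𝔤]
  {V : Type*} [AddCommGroup V] [Module ℝ V] [TopologicalSpace V]
  {F : Type*} [NormedAddCommGroup F] [NormedSpace ℝ F]

/-- A homogeneous polynomial of degree `k` with values in `j`-forms on a vector space. -/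
def IsPoly (k : ℕ) {j : ℕ} (α : 𝔤 → V [⋀^Fin j]→L[ℝ] F) : Prop :=
  ∃ m : MultilinearMap ℝ (fun _ : Fin k => 𝔤) (V [⋀^Fin j]→L[ℝ] F), ∀ ξ, α ξ = m (fun _ => ξ)

theorem IsPoly.zero (k j : ℕ) : IsPoly k (fun _ : 𝔤 => (0 : V [⋀^Fin j]→L[ℝ] F)) :=
  ⟨0, fun _ => rfl⟩

theorem IsPoly.const {j : ℕ} (c : V [⋀^Fin j]→L[ℝ] F) : IsPoly 0 (fun _ : 𝔤 => c) :=
  ⟨MultilinearMap.constOfIsEmpty ℝ _ c, fun _ => rfl⟩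

theorem IsPoly.linear {j : ℕ} (l : 𝔤 →ₗ[ℝ] V [⋀^Fin j]→L[ℝ] F) : IsPoly 1 (fun ξ => l ξ) :=
  ⟨MultilinearMap.ofSubsingleton ℝ 𝔤 (V [⋀^Fin j]→L[ℝ] F) (0 : Fin 1) l, fun _ => rfl⟩

theorem IsPoly.exists_linear {j : ℕ} {α : 𝔤 → V [⋀^Fin j]→L[ℝ] F} (h : IsPoly 1 α) :
    ∃ l : 𝔤 →ₗ[ℝ] V [⋀^Fin j]→L[ℝ] F, ∀ ξ, α ξ = l ξ := by
  obtain ⟨m, hm⟩ := h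
  refine ⟨(MultilinearMap.ofSubsingleton ℝ 𝔤 (V [⋀^Fin j]→L[ℝ] F) (0 : Fin 1)).symm m,
    fun ξ => ?_⟩
  rw [hm]
  rfl

end Poly

section CartanComplex

variable {EG : Type*} [NormedAddCommGroup EG] [NormedSpace ℝ EG]
  {G : Type*} [TopologicalSpace G] [ChartedSpace EG G] [Group G] [LieGroup 𝓘(ℝ, EG) ∞ G]
  {E : Type*} [NormedAddCommGroup E] [NormedSpace ℝ E]
  {N : Type*} [TopologicalSpace N] [ChartedSpace E N] [IsManifold 𝓘(ℝ, E) ∞ N]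
  [MulAction G N]

theorem mem_cartanComplex {α : RawCartan EG G E N}
    (hs : ∀ ξ k j x, SmoothFormAt 𝓘(ℝ, E) (fun y => α ξ y k j) x)
    (hp : ∀ k j x, IsPoly k (fun ξ => α ξ x k j))
    (hi : ∀ (g : G) ξ k j x, pb 𝓘(ℝ, E) 𝓘(ℝ, E) (fun y => g • y) (fun y => α (Ad g ξ) y k j) x =
      α ξ x k j) : α ∈ cartanComplex EG G E N := by
  refine ⟨hs, fun k j => ?_, fun g ξ x k j => hi g ξ k j x⟩
  choose m hm using hp k j
  exact ⟨MultilinearMap.pi m, fun ξ x => hm x ξ⟩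

theorem isPoly_of_mem {α : RawCartan EG G E N} (hα : α ∈ cartanComplex EG G E N) (k j : ℕ) (x : N) :
    IsPoly k (fun ξ => α ξ x k j) := by
  obtain ⟨m, hm⟩ := hα.2.1 k j
  exact ⟨(LinearMap.proj (R := ℝ) (φ := fun x : N => TangentSpace 𝓘(ℝ, E) x [⋀^Fin j]→L[ℝ] ℂ)
    x).compMultilinearMap m, fun ξ => hm ξ x⟩

theorem extD_zero_eq {F : Type*} [NormedAddCommGroup F] [NormedSpace ℝ F] {j : ℕ} (x : N) :
    extD 𝓘(ℝ, E) (fun y => (0 : TangentSpace 𝓘(ℝ, E) y [⋀^Fin j]→L[ℝ] F)) x = 0 := by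
  have h := extD_smul_at 𝓘(ℝ, E)
    (w := fun y => (0 : TangentSpace 𝓘(ℝ, E) y [⋀^Fin j]→L[ℝ] F)) (x := x) 0
  simp only [altMap_zero_smul] at h
  exact h

theorem HasDegree.dCartan {n : ℕ} {α : RawCartan EG G E N} (h : HasDegree n α) :
    HasDegree (n + 1) (dCartan α) := fun ξ x k j hkj => by
  have h1 : ∀ j', j = j' + 1 → extD 𝓘(ℝ, E) (fun y => α ξ y k j') x = 0 := fun j' hj => by
    have : (fun y => α ξ y k j') = fun y => 0 := funext fun y => h ξ y k j' (by omega)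
    rw [this]
    exact extD_zero_eq x
  have h2 : ∀ k', k = k' + 1 → contract (fundVF ξ x) (α ξ x k' (j + 1)) = 0 := fun k' hk => by
    rw [h ξ x k' (j + 1) (by omega)]
    rfl
  rcases j with _ | j <;> rcases k with _ | k
  · exact sub_zero _
  · exact (congrArg₂ HSub.hSub rfl (h2 k rfl)).trans (sub_zero _)
  · exact (congrArg₂ HSub.hSub (h1 j rfl) rfl).trans (sub_zero _)
  · exact (congrArg₂ HSub.hSub (h1 j rfl) (h2 k rfl)).trans (sub_zero _)

variable [ContMDiffSMul 𝓘(ℝ, EG) 𝓘(ℝ, E) ∞ G N]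

theorem smooth_dCartan {α : RawCartan EG G E N}
    (hs : ∀ ξ k j x, SmoothFormAt 𝓘(ℝ, E) (fun y => α ξ y k j) x)
    (ξ : GroupLieAlgebra 𝓘(ℝ, EG) G) (k j : ℕ) (x : N) :
    SmoothFormAt 𝓘(ℝ, E) (fun y => dCartan α ξ y k j) x := by
  rcases j with _ | j <;> rcases k with _ | k
  · exact SmoothFormAt.sub _ (SmoothFormAt.zero _) (SmoothFormAt.zero _)
  · exact SmoothFormAt.sub _ (SmoothFormAt.zero _)
      (SmoothFormAt.contract_fundVF (hs ξ k (0 + 1)) ξ x)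
  · exact SmoothFormAt.sub _ (SmoothFormAt.extD _ (hs ξ 0 j x)) (SmoothFormAt.zero _)
  · exact SmoothFormAt.sub _ (SmoothFormAt.extD _ (hs ξ (k + 1) j x))
      (SmoothFormAt.contract_fundVF (hs ξ k (j + 1 + 1)) ξ x)

theorem pb_contract_fundVF {j : ℕ} {F : Type*} [NormedAddCommGroup F] [NormedSpace ℝ F] (g : G)
    (ξ : GroupLieAlgebra 𝓘(ℝ, EG) G) (w : RawForm 𝓘(ℝ, E) N F (j + 1)) (x : N) :
    pb 𝓘(ℝ, E) 𝓘(ℝ, E) (fun y => g • y) (fun y => contract (fundVF (Ad g ξ) y) (w y)) x =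
      contract (fundVF ξ x) (pb 𝓘(ℝ, E) 𝓘(ℝ, E) (fun y => g • y) w x) := by
  ext v
  change w (g • x) (Matrix.vecCons _ _) = w (g • x) _
  congr 1
  funext i
  refine Fin.cases ?_ (fun i => ?_) i
  · exact (mfderiv_smul_fundVF (E := E) g ξ x).symm
  · rfl

theorem invariant_dCartan {α : RawCartan EG G E N}
    (hs : ∀ ξ k j x, SmoothFormAt 𝓘(ℝ, E) (fun y => α ξ y k j) x)
    (hi : ∀ (g : G) ξ k j x, pb 𝓘(ℝ, E) 𝓘(ℝ, E) (fun y => g • y) (fun y => α (Ad g ξ) y k j) x =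
      α ξ x k j) (g : G) (ξ : GroupLieAlgebra 𝓘(ℝ, EG) G) (k j : ℕ) (x : N) :
    pb 𝓘(ℝ, E) 𝓘(ℝ, E) (fun y => g • y) (fun y => dCartan α (Ad g ξ) y k j) x =
      dCartan α ξ x k j := by
  have hsub : ∀ a b : RawForm 𝓘(ℝ, E) N ℂ j,
      pb 𝓘(ℝ, E) 𝓘(ℝ, E) (fun y => g • y) (fun y => a y - b y) x =
      pb 𝓘(ℝ, E) 𝓘(ℝ, E) (fun y => g • y) a x - pb 𝓘(ℝ, E) 𝓘(ℝ, E) (fun y => g • y) b x :=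
    fun a b => rfl
  refine (hsub _ _).trans (congrArg₂ _ ?_ ?_)
  · rcases j with _ | j
    · rfl
    · refine (extD_pb 𝓘(ℝ, E) 𝓘(ℝ, E) ((contMDiff_smul_left EG E g).contMDiffAt.of_le two_le_infty)
        ((SmoothFormAt.formContDiffAt _ (hs _ k j _)).of_le (by simp))).symm.trans ?_
      exact congrArg (fun w => extD 𝓘(ℝ, E) w x) (funext (hi g ξ k j))
  · rcases k with _ | k
    · rfl
    · refine (pb_contract_fundVF g ξ (fun y => α (Ad g ξ) y k (j + 1)) x).trans ?_
      rw [hi]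

end CartanComplex

/-! ### The action of the Lie algebra on a principal bundle -/

section Curving

variable {EG : Type*} [NormedAddCommGroup EG] [NormedSpace ℝ EG]
  {G : Type*} [TopologicalSpace G] [ChartedSpace EG G] [Group G] [LieGroup 𝓘(ℝ, EG) ∞ G]
  {EP : Type*} [NormedAddCommGroup EP] [NormedSpace ℝ EP]
  {P : Type*} [TopologicalSpace P] [ChartedSpace EP P] [IsManifold 𝓘(ℝ, EP) ∞ P]
  [MulAction G P]

theorem mfderiv_orbit_comp [ContMDiffSMul 𝓘(ℝ, EG) 𝓘(ℝ, EP) ∞ G P]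
    {K : Type*} [NormedAddCommGroup K] [NormedSpace ℝ K]
    {E'' : Type*} [NormedAddCommGroup E''] [NormedSpace ℝ E''] {S'' : Type*} [TopologicalSpace S'']
    {I'' : ModelWithCorners ℝ E'' S''} {N'' : Type*} [TopologicalSpace N''] [ChartedSpace S'' N'']
    {Φ : P × K → N''} {p : P} {c : K} (hΦ : MDifferentiableAt (𝓘(ℝ, EP).prod 𝓘(ℝ, K)) I'' Φ (p, c))
    {f : G → N''} (hf : ∀ g, f g = Φ (g • p, c)) (ξ : GroupLieAlgebra 𝓘(ℝ, EG) G) :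
    @Eq E'' (mfderiv 𝓘(ℝ, EG) I'' f 1 ξ) (mfderiv (𝓘(ℝ, EP).prod 𝓘(ℝ, K)) I'' Φ (p, c)
      ((-fundVF ξ p, 0) : EP × K)) := by
  have h1 : (1 : G) • p = p := one_smul G p
  have hΦ' : MDifferentiableAt (𝓘(ℝ, EP).prod 𝓘(ℝ, K)) I'' Φ ((1 : G) • p, c) := by rwa [h1]
  refine (mfderiv_comp_prodMk (I := 𝓘(ℝ, EG)) (φ := fun g : G => g • p) (y := fun _ => c)
    ((contMDiff_smul_right EG EP p).contMDiffAt.mdifferentiableAt (by simp))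
    mdifferentiableAt_const rfl hΦ' (Filter.Eventually.of_forall hf) ξ).trans ?_
  refine (mfderiv_congr_point_vec (I := 𝓘(ℝ, EP).prod 𝓘(ℝ, K)) (I' := I'') (f := Φ)
    (x := ((1 : G) • p, c)) (y := (p, c)) (by rw [h1]) _).trans ?_
  refine congrArg (fun v : EP × K => (mfderiv (𝓘(ℝ, EP).prod 𝓘(ℝ, K)) I'' Φ (p, c) v : E'')) ?_
  refine Prod.ext ?_ ?_
  · exact (neg_neg (mfderiv 𝓘(ℝ, EG) 𝓘(ℝ, EP) (fun h : G => h • p) 1 ξ : EP)).symm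
  · exact congrArg (fun L : EG →L[ℝ] K => L ξ) (mfderiv_const (I := 𝓘(ℝ, EG)) (I' := 𝓘(ℝ, K))
      (x := (1 : G)) (c := c))

variable
  {EM : Type*} [NormedAddCommGroup EM] [NormedSpace ℝ EM]
  {M : Type*} [TopologicalSpace M] [ChartedSpace EM M] [IsManifold 𝓘(ℝ, EM) ∞ M]
  [MulAction G M] [ContMDiffSMul 𝓘(ℝ, EG) 𝓘(ℝ, EM) ∞ G M]
  {H : Type*} [NormedAddCommGroup H] [InnerProductSpace ℂ H] [CompleteSpace H]
  {B : EquivPUBundle EG G EM M EP P H}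

variable (B) in
theorem dact_neg_fundVF (ξ : GroupLieAlgebra 𝓘(ℝ, EG) G) (p : P) (u : unitary (H →L[ℂ] H)) :
    @Eq EP (B.dact p u (-fundVF ξ p) 0) (-fundVF ξ (B.act p u)) := by
  have := B.smul_smooth
  have h := mfderiv_orbit_comp (f := fun g : G => g • B.act p u)
    ((B.act_smooth u).mdifferentiable (by simp) (p, 0)) (fun g => by
      simp only [selfAdjoint.expUnitary_zero, mul_one]
      exact B.act_equivariant g p u) ξ
  refine h.symm.trans ?_
  exact (neg_neg (mfderiv 𝓘(ℝ, EG) 𝓘(ℝ, EP) (fun h : G => h • B.act p u) 1 ξ : EP)).symm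

end Curving

theorem rawForm_congr {E : Type*} [NormedAddCommGroup E] [NormedSpace ℝ E] {S : Type*}
    [TopologicalSpace S] {I : ModelWithCorners ℝ E S} {N : Type*} [TopologicalSpace N]
    [ChartedSpace S N] {F : Type*} [NormedAddCommGroup F] [NormedSpace ℝ F] {j : ℕ}
    (w : RawForm I N F j) {a b : N} (h : a = b) {u u' : Fin j → E} (hu : ∀ i, u i = u' i) :
    (w a (u : Fin j → TangentSpace I a) : F) = w b (u' : Fin j → TangentSpace I b) := by
  subst h
  rw [funext hu]

/-! ### The three-form of an equivariant curving -/

section ThreeForm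

variable {EG : Type*} [NormedAddCommGroup EG] [NormedSpace ℝ EG]
  {G : Type*} [TopologicalSpace G] [ChartedSpace EG G] [Group G] [LieGroup 𝓘(ℝ, EG) ∞ G]
  {EP : Type*} [NormedAddCommGroup EP] [NormedSpace ℝ EP]
  {P : Type*} [TopologicalSpace P] [ChartedSpace EP P] [IsManifold 𝓘(ℝ, EP) ∞ P]
  [MulAction G P]
  {EM : Type*} [NormedAddCommGroup EM] [NormedSpace ℝ EM]
  {M : Type*} [TopologicalSpace M] [ChartedSpace EM M] [IsManifold 𝓘(ℝ, EM) ∞ M]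
  [MulAction G M] [ContMDiffSMul 𝓘(ℝ, EG) 𝓘(ℝ, EM) ∞ G M]
  {H : Type*} [NormedAddCommGroup H] [InnerProductSpace ℂ H] [CompleteSpace H]
  {B : EquivPUBundle EG G EM M EP P H} {θ : B.GerbeConnection}
  {φ : P → P} {w : P → unitary (H →L[ℂ] H)} {q : P}

variable (φ w) in
/-- The map to `P × B(H)` determined by a lift. -/
def liftMap (z : P) : P × (H →L[ℂ] H) := (φ z, (w z : H →L[ℂ] H))

variable (G φ w) in
/-- The translates of a lift, as a map on `G × P`. -/
def liftMapG (x : G × P) : P × (H →L[ℂ] H) := (x.1 • φ x.2, (w x.2 : H →L[ℂ] H))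

theorem LiftAt.contMDiffAt_liftMap {n : WithTop ℕ∞} (h : LiftAt B n φ w q) :
    ContMDiffAt 𝓘(ℝ, EP) (𝓘(ℝ, EP).prod 𝓘(ℝ, H →L[ℂ] H)) n (liftMap φ w) q :=
  h.base.prodMk h.lift

theorem LiftAt.contMDiffAt_liftMapG (h : LiftAt B ∞ φ w q) (g : G) :
    ContMDiffAt (𝓘(ℝ, EG).prod 𝓘(ℝ, EP)) (𝓘(ℝ, EP).prod 𝓘(ℝ, H →L[ℂ] H)) ∞ (liftMapG G φ w)
      (g, q) := by
  have := B.smul_smooth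
  have h1 : ContMDiffAt (𝓘(ℝ, EG).prod 𝓘(ℝ, EP)) (𝓘(ℝ, EG).prod 𝓘(ℝ, EP)) ∞
      (fun x : G × P => (x.1, φ x.2)) (g, q) :=
    contMDiffAt_fst.prodMk (ContMDiffAt.comp (g, q) (g := φ) (f := Prod.snd) h.base contMDiffAt_snd)
  exact ((contMDiff_act EG G EP P).contMDiffAt.comp (g, q) h1).prodMk
    (ContMDiffAt.comp (g, q) (f := Prod.snd) h.lift contMDiffAt_snd)

theorem LiftAt.mfderiv_liftMapG (h : LiftAt B 1 φ w q) (g : G) (ξ : EG) (Y : EP) :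
    @Eq (EP × (H →L[ℂ] H)) (mfderiv (𝓘(ℝ, EG).prod 𝓘(ℝ, EP)) (𝓘(ℝ, EP).prod 𝓘(ℝ, H →L[ℂ] H))
      (liftMapG G φ w) (g, q) ((ξ, Y) : EG × EP))
      ((mfderiv (𝓘(ℝ, EG).prod 𝓘(ℝ, EP)) 𝓘(ℝ, EP) (fun x : G × P => x.1 • x.2) (g, φ q)
          ((ξ, mfderiv 𝓘(ℝ, EP) 𝓘(ℝ, EP) φ q Y) : EG × EP) : EP),
        (mfderiv 𝓘(ℝ, EP) 𝓘(ℝ, H →L[ℂ] H) (fun q => (w q : H →L[ℂ] H)) q Y : H →L[ℂ] H)) := by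
  have := B.smul_smooth
  have hsnd : MDifferentiableAt (𝓘(ℝ, EG).prod 𝓘(ℝ, EP)) 𝓘(ℝ, EP) (Prod.snd : G × P → P) (g, q) :=
    mdifferentiableAt_snd
  have hdsnd : @Eq EP (mfderiv (𝓘(ℝ, EG).prod 𝓘(ℝ, EP)) 𝓘(ℝ, EP) (Prod.snd : G × P → P) (g, q)
      ((ξ, Y) : EG × EP)) Y := by rw [mfderiv_snd]; rfl
  have hdfst : @Eq EG (mfderiv (𝓘(ℝ, EG).prod 𝓘(ℝ, EP)) 𝓘(ℝ, EG) (Prod.fst : G × P → G) (g, q)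
      ((ξ, Y) : EG × EP)) ξ := by rw [mfderiv_fst]; rfl
  have hφ := h.base.mdifferentiableAt one_ne_zero
  have hw := h.lift.mdifferentiableAt one_ne_zero
  have hφ2 : MDifferentiableAt (𝓘(ℝ, EG).prod 𝓘(ℝ, EP)) 𝓘(ℝ, EP) (φ ∘ Prod.snd) (g, q) :=
    MDifferentiableAt.comp (g, q) hφ hsnd
  have hw2 : MDifferentiableAt (𝓘(ℝ, EG).prod 𝓘(ℝ, EP)) 𝓘(ℝ, H →L[ℂ] H)
      ((fun q => (w q : H →L[ℂ] H)) ∘ (Prod.snd : G × P → P)) (g, q) :=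
    MDifferentiableAt.comp (g, q) hw hsnd
  have hact : MDifferentiableAt (𝓘(ℝ, EG).prod 𝓘(ℝ, EP)) 𝓘(ℝ, EP) (fun x : G × P => x.1 • x.2)
      (g, φ q) := (contMDiff_act EG G EP P).contMDiffAt.mdifferentiableAt (by simp)
  have e1 := mfderiv_comp_vec (I := 𝓘(ℝ, EG).prod 𝓘(ℝ, EP)) (f := Prod.snd) (x := (g, q)) rfl hφ
    hsnd ((ξ, Y) : EG × EP)
  have e2 := mfderiv_comp_vec (I := 𝓘(ℝ, EG).prod 𝓘(ℝ, EP)) (f := Prod.snd) (x := (g, q)) rfl hw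
    hsnd ((ξ, Y) : EG × EP)
  have e3 := mfderiv_comp_prodMk (I := 𝓘(ℝ, EG).prod 𝓘(ℝ, EP)) (x := (g, q))
    (φ := (Prod.fst : G × P → G)) (y := φ ∘ Prod.snd) (f := fun x : G × P => x.1 • φ x.2)
    mdifferentiableAt_fst hφ2 rfl hact
    (Filter.Eventually.of_forall fun z => rfl) ((ξ, Y) : EG × EP)
  refine (mfderiv_prodMk_vec (φ := fun x : G × P => x.1 • φ x.2)
    (MDifferentiableAt.comp (g, q) hact (mdifferentiableAt_fst.prodMk hφ2)) hw2 _).trans ?_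
  refine Prod.ext ?_ ?_
  · refine e3.trans ?_
    refine congrArg (fun v : EG × EP => (mfderiv (𝓘(ℝ, EG).prod 𝓘(ℝ, EP)) 𝓘(ℝ, EP)
      (fun x : G × P => x.1 • x.2) (g, φ q) v : EP)) (Prod.ext hdfst ?_)
    exact e1.trans (congrArg (fun v : EP => (mfderiv 𝓘(ℝ, EP) 𝓘(ℝ, EP) φ q v : EP)) hdsnd)
  · exact e2.trans (congrArg (fun v : EP => (mfderiv 𝓘(ℝ, EP) 𝓘(ℝ, H →L[ℂ] H)
      (fun q => (w q : H →L[ℂ] H)) q v : H →L[ℂ] H)) hdsnd)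

variable (κ : EquivPUBundle.EquivCurving θ)

theorem LiftAt.pb_curvature (h : LiftAt B 1 φ w q) :
    pb 𝓘(ℝ, EP) (𝓘(ℝ, EP).prod 𝓘(ℝ, H →L[ℂ] H)) (liftMap φ w) (extD _ θ.form) q =
      κ.f q - pb 𝓘(ℝ, EP) 𝓘(ℝ, EP) φ κ.f q := by
  obtain ⟨y, -, -, -, hΓ, hact⟩ := h.exists_chart
  ext v
  have h1 := κ.curvature_eq (φ q) (w q) (mfderiv 𝓘(ℝ, EP) 𝓘(ℝ, EP) φ q (v 0))
    (mfderiv 𝓘(ℝ, EP) 𝓘(ℝ, EP) φ q (v 1))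
    (mfderiv 𝓘(ℝ, EP) 𝓘(ℝ, selfAdjoint (H →L[ℂ] H)) y q (v 0))
    (mfderiv 𝓘(ℝ, EP) 𝓘(ℝ, selfAdjoint (H →L[ℂ] H)) y q (v 1))
  refine Eq.trans ?_ (h1.trans ?_)
  · change extD _ θ.form (φ q, (w q : H →L[ℂ] H)) _ = extD _ θ.form (φ q, (w q : H →L[ℂ] H)) _
    congr 1
    funext i
    fin_cases i
    · exact hΓ (v 0)
    · exact hΓ (v 1)
  refine congrArg₂ (HSub.hSub : ℂ → ℂ → ℂ) ?_ ?_
  · refine rawForm_congr κ.f h.act_eq.self_of_nhds fun i => ?_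
    fin_cases i
    · exact hact (v 0)
    · exact hact (v 1)
  · refine rawForm_congr (j := 2) κ.f rfl fun i => ?_
    fin_cases i <;> rfl

theorem smooth_f (x : P) : SmoothFormAt 𝓘(ℝ, EP) κ.f x := by
  have h := κ.cartan.2.1 0 0 2 x
  rwa [funext (κ.cartan_f 0)] at h

theorem LiftAt.extD_f (h : LiftAt B ∞ φ w q) :
    pb 𝓘(ℝ, EP) 𝓘(ℝ, EP) φ (extD 𝓘(ℝ, EP) κ.f) q = extD 𝓘(ℝ, EP) κ.f q := by
  have hΓ := h.contMDiffAt_liftMap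
  have hθ : SmoothFormAt _ θ.form (liftMap φ w q) := θ.smooth (φ q) (w q)
  have h1 : extD 𝓘(ℝ, EP) (pb 𝓘(ℝ, EP) (𝓘(ℝ, EP).prod 𝓘(ℝ, H →L[ℂ] H)) (liftMap φ w)
      (extD _ θ.form)) q = 0 := by
    rw [extD_pb _ _ (hΓ.of_le two_le_infty)
      ((SmoothFormAt.extD _ hθ).formContDiffAt.of_le (by simp)), pb,
      extD_extD _ (hθ.formContDiffAt.of_le two_le_infty)]
    rfl
  have h2 : extD 𝓘(ℝ, EP) (pb 𝓘(ℝ, EP) (𝓘(ℝ, EP).prod 𝓘(ℝ, H →L[ℂ] H)) (liftMap φ w)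
      (extD _ θ.form)) q =
      extD 𝓘(ℝ, EP) (fun z => κ.f z + (-1 : ℝ) • pb 𝓘(ℝ, EP) 𝓘(ℝ, EP) φ κ.f z) q := by
    refine extD_congr _ (h.eventually.mono fun z hz => ?_)
    rw [hz.pb_curvature κ]
    ext v
    simp [sub_eq_add_neg]
  have hs := SmoothFormAt.pb 𝓘(ℝ, EP) 𝓘(ℝ, EP) h.base (smooth_f κ (φ q))
  rw [h1, extD_add_at _ ((smooth_f κ q).formContDiffAt.of_le (by simp))
    ((SmoothFormAt.const_smul _ hs _).formContDiffAt.of_le (by simp)), extD_smul_at,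
    extD_pb _ _ (h.base.of_le two_le_infty) ((smooth_f κ _).formContDiffAt.of_le (by simp))] at h2
  ext v
  have h3 := congrArg (fun α : TangentSpace 𝓘(ℝ, EP) q [⋀^Fin 3]→L[ℝ] ℂ => α v) h2
  simp only [neg_one_smul, ← sub_eq_add_neg] at h3
  exact (sub_eq_zero.1 h3.symm).symm

theorem form_tvec_neg (p : P) (u : unitary (H →L[ℂ] H)) (X : EP) :
    θ.form (p, (u : H →L[ℂ] H)) (fun _ => EquivPUBundle.tvec p u (-X : EP) 0) =
      -θ.form (p, (u : H →L[ℂ] H)) (fun _ => EquivPUBundle.tvec p u X 0) := by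
  have h := congrArg (fun α : (EP × (H →L[ℂ] H)) [⋀^Fin 0]→L[ℝ] ℂ => α ![])
    (contract_neg_vec (V := EP × (H →L[ℂ] H)) (EquivPUBundle.tvec p u X 0)
      (θ.form (p, (u : H →L[ℂ] H))))
  have h0 : ∀ X : EP, EquivPUBundle.tvec (EP := EP) p u X 0 = ((X, 0) : EP × (H →L[ℂ] H)) :=
    fun X => Prod.ext rfl (by
      change (u : H →L[ℂ] H) * (Complex.I • (0 : H →L[ℂ] H)) = 0
      rw [smul_zero, mul_zero])
  refine Eq.trans ?_ (h.trans (congrArg Neg.neg ?_))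
  · refine rawForm_congr θ.form rfl fun i => ?_
    fin_cases i
    refine (h0 (-X)).trans ?_
    refine Eq.trans ?_ (congrArg (Neg.neg : EP × (H →L[ℂ] H) → _) (h0 X)).symm
    exact Prod.ext rfl neg_zero.symm
  · refine rawForm_congr θ.form rfl fun i => ?_
    fin_cases i
    rfl

/-- The moment map of the curving, up to sign, as a form of degree zero. -/
def muForm (ξ : GroupLieAlgebra 𝓘(ℝ, EG) G) : RawForm 𝓘(ℝ, EP) P ℂ 0 :=
  fun y => κ.cartan.1 ξ y 1 0

theorem muForm_apply (ξ : GroupLieAlgebra 𝓘(ℝ, EG) G) (y : P)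
    (v : Fin 0 → TangentSpace 𝓘(ℝ, EP) y) : muForm κ ξ y v = -κ.muL ξ y := κ.cartan_muL ξ y v

theorem smooth_muForm (ξ : GroupLieAlgebra 𝓘(ℝ, EG) G) (x : P) :
    SmoothFormAt 𝓘(ℝ, EP) (muForm κ ξ) x := κ.cartan.2.1 ξ 1 0 x

theorem mfderiv_act_zero_left [ContMDiffSMul 𝓘(ℝ, EG) 𝓘(ℝ, EP) ∞ G P] (g : G) (p : P) (Y : EP) :
    @Eq EP (mfderiv (𝓘(ℝ, EG).prod 𝓘(ℝ, EP)) 𝓘(ℝ, EP) (fun x : G × P => x.1 • x.2) (g, p)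
      ((0, Y) : EG × EP)) (mfderiv 𝓘(ℝ, EP) 𝓘(ℝ, EP) (fun y : P => g • y) p Y) :=
  (mfderiv_act (EG := EG) (E := EP) g p 0 Y).trans ((congrArg₂ (HAdd.hAdd : EP → EP → EP)
    (map_zero (mfderiv 𝓘(ℝ, EG) 𝓘(ℝ, EP) (fun g : G => g • p) g)) rfl).trans (zero_add (M := EP) _))

theorem LiftAt.restrictSlice_liftMapG (h : LiftAt B 1 φ w q) (g : G) :
    restrictSlice 𝓘(ℝ, EG) 𝓘(ℝ, EP) (pb (𝓘(ℝ, EG).prod 𝓘(ℝ, EP))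
      (𝓘(ℝ, EP).prod 𝓘(ℝ, H →L[ℂ] H)) (liftMapG G φ w) θ.form) g q =
    pb 𝓘(ℝ, EP) (𝓘(ℝ, EP).prod 𝓘(ℝ, H →L[ℂ] H)) (liftMap φ w) θ.form q := by
  have := B.smul_smooth
  obtain ⟨y, -, -, -, hΓ, hact⟩ := h.exists_chart
  ext v
  have h1 := θ.invariant g (φ q) (w q) (mfderiv 𝓘(ℝ, EP) 𝓘(ℝ, EP) φ q (v 0))
    (mfderiv 𝓘(ℝ, EP) 𝓘(ℝ, selfAdjoint (H →L[ℂ] H)) y q (v 0))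
  refine Eq.trans ?_ (h1.trans ?_)
  · refine rawForm_congr (j := 1) θ.form (a := (g • φ q, (w q : H →L[ℂ] H))) rfl fun i => ?_
    fin_cases i
    refine (h.mfderiv_liftMapG g 0 (v 0)).trans (Prod.ext ?_ ?_)
    · exact mfderiv_act_zero_left g (φ q) _
    · have h2 := hΓ (v 0)
      have h3 := mfderiv_prodMk_vec (h.base.mdifferentiableAt one_ne_zero)
        (h.lift.mdifferentiableAt one_ne_zero) (v 0)
      have h4 := congrArg (Prod.snd : EP × (H →L[ℂ] H) → _) (h3.symm.trans h2)
      exact h4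
  · refine rawForm_congr (j := 1) θ.form (a := (φ q, (w q : H →L[ℂ] H))) rfl fun i => ?_
    fin_cases i
    exact (hΓ (v 0)).symm

theorem LiftAt.mfderiv_liftMapG_orbit (h : LiftAt B 1 φ w q) (ξ : GroupLieAlgebra 𝓘(ℝ, EG) G) :
    @Eq (EP × (H →L[ℂ] H)) (mfderiv (𝓘(ℝ, EG).prod 𝓘(ℝ, EP)) (𝓘(ℝ, EP).prod 𝓘(ℝ, H →L[ℂ] H))
      (liftMapG G φ w) (1, q) ((ξ, 0) : EG × EP))
      (EquivPUBundle.tvec (φ q) (w q) (-fundVF ξ (φ q) : EP) 0) := by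
  have := B.smul_smooth
  refine (h.mfderiv_liftMapG 1 ξ 0).trans (Prod.ext ?_ ?_)
  · refine (congrArg (fun v : EP => (mfderiv (𝓘(ℝ, EG).prod 𝓘(ℝ, EP)) 𝓘(ℝ, EP)
      (fun x : G × P => x.1 • x.2) (1, φ q) ((ξ, v) : EG × EP) : EP))
      (map_zero (mfderiv 𝓘(ℝ, EP) 𝓘(ℝ, EP) φ q))).trans ?_
    exact (mfderiv_act_one (E := EP) (φ q) ξ 0).trans (add_zero (M := EP) _)
  · refine (map_zero (mfderiv 𝓘(ℝ, EP) 𝓘(ℝ, H →L[ℂ] H) (fun q => (w q : H →L[ℂ] H)) q)).trans ?_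
    change (0 : H →L[ℂ] H) = (w q : H →L[ℂ] H) * (Complex.I • (0 : H →L[ℂ] H))
    rw [smul_zero, mul_zero]

theorem LiftAt.slice_liftMapG (h : LiftAt B 1 φ w q) (ξ : GroupLieAlgebra 𝓘(ℝ, EG) G) :
    slice 𝓘(ℝ, EG) 𝓘(ℝ, EP) (pb (𝓘(ℝ, EG).prod 𝓘(ℝ, EP))
      (𝓘(ℝ, EP).prod 𝓘(ℝ, H →L[ℂ] H)) (liftMapG G φ w) θ.form) 1 ξ q =
    muForm κ ξ q + (-1 : ℝ) • pb 𝓘(ℝ, EP) 𝓘(ℝ, EP) φ (muForm κ ξ) q := by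
  ext v
  have e1 : slice 𝓘(ℝ, EG) 𝓘(ℝ, EP) (pb (𝓘(ℝ, EG).prod 𝓘(ℝ, EP))
      (𝓘(ℝ, EP).prod 𝓘(ℝ, H →L[ℂ] H)) (liftMapG G φ w) θ.form) 1 ξ q v =
      θ.form (φ q, (w q : H →L[ℂ] H))
        (fun _ => EquivPUBundle.tvec (φ q) (w q) (-fundVF ξ (φ q) : EP) 0) := by
    refine rawForm_congr (j := 1) θ.form (a := ((1 : G) • φ q, (w q : H →L[ℂ] H)))
      (b := (φ q, (w q : H →L[ℂ] H))) (by rw [one_smul]) fun i => ?_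
    fin_cases i
    exact h.mfderiv_liftMapG_orbit ξ
  have e2 := κ.moment_eq (φ q) (w q) ξ
  rw [h.act_eq.self_of_nhds] at e2
  refine (e1.trans (form_tvec_neg (φ q) (w q) _)).trans (e2.trans ?_)
  rw [ContinuousAlternatingMap.add_apply, ContinuousAlternatingMap.smul_apply, muForm_apply,
    pb_apply, muForm_apply]
  simp
  ring

theorem LiftAt.slice_curvature (h : LiftAt B 1 φ w q) (ξ : GroupLieAlgebra 𝓘(ℝ, EG) G) :
    slice 𝓘(ℝ, EG) 𝓘(ℝ, EP) (pb (𝓘(ℝ, EG).prod 𝓘(ℝ, EP))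
      (𝓘(ℝ, EP).prod 𝓘(ℝ, H →L[ℂ] H)) (liftMapG G φ w) (extD _ θ.form)) 1 ξ q =
    pb 𝓘(ℝ, EP) 𝓘(ℝ, EP) φ (fun z => contract (fundVF ξ z) (κ.f z)) q -
      contract (fundVF ξ q) (κ.f q) := by
  have := B.smul_smooth
  obtain ⟨y, -, -, -, hΓ, hact⟩ := h.exists_chart
  ext v
  have h1 := κ.curvature_eq (φ q) (w q) (-fundVF ξ (φ q) : EP)
    (mfderiv 𝓘(ℝ, EP) 𝓘(ℝ, EP) φ q (v 0)) 0
    (mfderiv 𝓘(ℝ, EP) 𝓘(ℝ, selfAdjoint (H →L[ℂ] H)) y q (v 0))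
  have hneg : ∀ (z : P) (X Y : EP), κ.f z ![(-X : EP), Y] = -κ.f z ![X, Y] := fun z X Y =>
    congrArg (fun α : EP [⋀^Fin 1]→L[ℝ] ℂ => α ![Y]) (contract_neg_vec (V := EP) X (κ.f z))
  refine Eq.trans ?_ (h1.trans ?_)
  · refine rawForm_congr (j := 2) (extD _ θ.form) (a := ((1 : G) • φ q, (w q : H →L[ℂ] H)))
      (b := (φ q, (w q : H →L[ℂ] H))) (by rw [one_smul]) fun i => ?_
    fin_cases i
    · exact h.mfderiv_liftMapG_orbit ξ
    · refine Eq.trans ?_ (hΓ (v 0))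
      refine (h.mfderiv_liftMapG 1 0 (v 0)).trans ?_
      refine Eq.trans ?_ (mfderiv_prodMk_vec (h.base.mdifferentiableAt one_ne_zero)
        (h.lift.mdifferentiableAt one_ne_zero) (v 0)).symm
      refine Prod.ext ?_ rfl
      exact (mfderiv_act_zero_left (1 : G) (φ q) _).trans (mfderiv_one_smul (E := EP) (φ q) _)
  · refine (congrArg₂ (HSub.hSub : ℂ → ℂ → ℂ) (Eq.trans ?_ (hneg q (fundVF ξ q) (v 0)))
      (hneg (φ q) (fundVF ξ (φ q)) _)).trans ?_
    · refine rawForm_congr κ.f h.act_eq.self_of_nhds fun i => ?_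
      fin_cases i
      · refine (dact_neg_fundVF B ξ (φ q) (w q)).trans ?_
        rw [h.act_eq.self_of_nhds]
        rfl
      · exact hact (v 0)
    · rw [sub_neg_eq_add, neg_add_eq_sub]
      refine congrArg₂ (HSub.hSub : ℂ → ℂ → ℂ) ?_ ?_
      · refine rawForm_congr (j := 2) κ.f rfl fun i => ?_
        fin_cases i <;> rfl
      · refine rawForm_congr (j := 2) κ.f rfl fun i => ?_
        fin_cases i <;> rfl

theorem dCartan_curving_zero_three (ξ : GroupLieAlgebra 𝓘(ℝ, EG) G) (x : P) :
    dCartan κ.cartan.1 ξ x 0 3 = extD 𝓘(ℝ, EP) κ.f x := by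
  refine (sub_zero _).trans ?_
  exact congrArg (fun w => extD 𝓘(ℝ, EP) w x) (funext (κ.cartan_f ξ))

theorem dCartan_curving_one_one (ξ : GroupLieAlgebra 𝓘(ℝ, EG) G) (x : P) :
    dCartan κ.cartan.1 ξ x 1 1 =
      extD 𝓘(ℝ, EP) (muForm κ ξ) x - contract (fundVF ξ x) (κ.f x) := by
  rw [← κ.cartan_f ξ x]
  rfl

theorem LiftAt.dCartan_one_one (h : LiftAt B ∞ φ w q) (ξ : GroupLieAlgebra 𝓘(ℝ, EG) G) :
    pb 𝓘(ℝ, EP) 𝓘(ℝ, EP) φ (fun x => dCartan κ.cartan.1 ξ x 1 1) q =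
      dCartan κ.cartan.1 ξ q 1 1 := by
  have h1 := h.of_le (le_trans (by norm_num) two_le_infty : (1 : WithTop ℕ∞) ≤ ∞)
  have hs := SmoothFormAt.pb 𝓘(ℝ, EP) 𝓘(ℝ, EP) h.base (smooth_muForm κ ξ (φ q))
  have hθ : SmoothFormAt _ θ.form (liftMapG G φ w (1, q)) := θ.smooth ((1 : G) • φ q) (w q)
  have hΓ := h.contMDiffAt_liftMapG (1 : G)
  have e1 := extD_slice 𝓘(ℝ, EG) 𝓘(ℝ, EP) (q := (1 : G)) (x := q) ξ
    (SmoothFormAt.pb (𝓘(ℝ, EG).prod 𝓘(ℝ, EP)) (𝓘(ℝ, EP).prod 𝓘(ℝ, H →L[ℂ] H)) hΓ hθ)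
    (Filter.Eventually.of_forall fun g => by
      rw [h1.restrictSlice_liftMapG, h1.restrictSlice_liftMapG])
  have e2 := extD_pb (𝓘(ℝ, EG).prod 𝓘(ℝ, EP)) (𝓘(ℝ, EP).prod 𝓘(ℝ, H →L[ℂ] H))
    (hΓ.of_le two_le_infty) (hθ.formContDiffAt.of_le (by simp))
  have e3 := h1.slice_curvature κ ξ
  rw [slice] at e3 e1
  rw [extD_congr _ (h.eventually.mono fun z hz => hz.slice_liftMapG κ ξ), e2, e3,
    extD_add_at _ ((smooth_muForm κ ξ q).formContDiffAt.of_le (by simp))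
    ((SmoothFormAt.const_smul _ hs _).formContDiffAt.of_le (by simp)), extD_smul_at,
    extD_pb _ _ (h.base.of_le two_le_infty)
      ((smooth_muForm κ ξ _).formContDiffAt.of_le (by simp))] at e1
  rw [funext (dCartan_curving_one_one κ ξ), dCartan_curving_one_one]
  ext v
  have e4 := congrArg (fun α : TangentSpace 𝓘(ℝ, EP) q [⋀^Fin 1]→L[ℝ] ℂ => α v) e1
  change extD 𝓘(ℝ, EP) (muForm κ ξ) q v + (-1 : ℝ) • pb 𝓘(ℝ, EP) 𝓘(ℝ, EP) φ
    (extD 𝓘(ℝ, EP) (muForm κ ξ)) q v = -(pb 𝓘(ℝ, EP) 𝓘(ℝ, EP) φ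
      (fun z => contract (fundVF ξ z) (κ.f z)) q v - contract (fundVF ξ q) (κ.f q) v) at e4
  change pb 𝓘(ℝ, EP) 𝓘(ℝ, EP) φ (extD 𝓘(ℝ, EP) (muForm κ ξ)) q v - pb 𝓘(ℝ, EP) 𝓘(ℝ, EP) φ
      (fun z => contract (fundVF ξ z) (κ.f z)) q v =
    extD 𝓘(ℝ, EP) (muForm κ ξ) q v - contract (fundVF ξ q) (κ.f q) v
  rw [neg_one_smul] at e4
  linear_combination -e4

theorem hasDegree_dCartan_curving : HasDegree 3 (dCartan κ.cartan.1) := κ.degree_two.dCartan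

theorem isBasic_dCartan_curving (ξ : GroupLieAlgebra 𝓘(ℝ, EG) G) (k j : ℕ) :
    IsBasic B (fun x => dCartan κ.cartan.1 ξ x k j) := by
  intro φ w q h
  by_cases hkj : 2 * k + j = 3
  · have : (k = 0 ∧ j = 3) ∨ (k = 1 ∧ j = 1) := by omega
    rcases this with ⟨rfl, rfl⟩ | ⟨rfl, rfl⟩
    · rw [funext (dCartan_curving_zero_three κ ξ)]
      exact h.extD_f κ
    · exact h.dCartan_one_one κ ξ
  · have h0 := fun x => hasDegree_dCartan_curving κ ξ x k j hkj
    rw [funext h0]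
    rfl

theorem invariant_of_mem {α : RawCartan EG G EP P} (hα : α ∈ cartanComplex EG G EP P)
    (g : G) (ξ : GroupLieAlgebra 𝓘(ℝ, EG) G) (k j : ℕ) (x : P) :
    pb 𝓘(ℝ, EP) 𝓘(ℝ, EP) (fun y => g • y) (fun y => α (Ad g ξ) y k j) x = α ξ x k j :=
  hα.2.2 g ξ x k j

theorem dCartan_curving_mem : dCartan κ.cartan.1 ∈ cartanComplex EG G EP P := by
  have := B.smul_smooth
  refine mem_cartanComplex (smooth_dCartan κ.cartan.2.1) (fun k j x => ?_)
    (invariant_dCartan κ.cartan.2.1 (invariant_of_mem κ.cartan.2))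
  by_cases hkj : 2 * k + j = 3
  · have : (k = 0 ∧ j = 3) ∨ (k = 1 ∧ j = 1) := by omega
    rcases this with ⟨rfl, rfl⟩ | ⟨rfl, rfl⟩
    · simp only [dCartan_curving_zero_three]
      exact IsPoly.const _
    · simp only [dCartan_curving_one_one]
      have hl : ∀ y, ∃ l : GroupLieAlgebra 𝓘(ℝ, EG) G →ₗ[ℝ]
          TangentSpace 𝓘(ℝ, EP) y [⋀^Fin 0]→L[ℝ] ℂ, ∀ ξ, muForm κ ξ y = l ξ := fun y =>
        (isPoly_of_mem κ.cartan.2 1 0 y).exists_linear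
      choose l hl using hl
      refine IsPoly.linear
        { toFun := fun ξ => extD 𝓘(ℝ, EP) (muForm κ ξ) x - contract (fundVF ξ x) (κ.f x)
          map_add' := fun ξ η => ?_
          map_smul' := fun c ξ => ?_ }
      · have e1 : muForm κ (ξ + η) = fun y => muForm κ ξ y + muForm κ η y := by
          funext y
          rw [hl, hl, hl, map_add]
        rw [e1, extD_add_at _ ((smooth_muForm κ ξ x).formContDiffAt.of_le (by simp))
          ((smooth_muForm κ η x).formContDiffAt.of_le (by simp)), fundVF_add, contract_add_vec]
        abel
      · have e1 : muForm κ (c • ξ) = fun y => c • muForm κ ξ y := by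
          funext y
          rw [hl, hl, map_smul]
        rw [e1, extD_smul_at, fundVF_smul, contract_smul_vec]
        ext v
        simp [mul_sub]
  · simp only [fun ξ => hasDegree_dCartan_curving κ ξ x k j hkj]
    exact IsPoly.zero k j

theorem dCartan_dCartan_curving [FiniteDimensional ℝ EG] : dCartan (dCartan κ.cartan.1) = 0 := by
  have := B.smul_smooth
  funext ξ x k j
  change dCartan (dCartan κ.cartan.1) ξ x k j = 0
  by_cases hkj : 2 * k + j = 4
  · have : (k = 0 ∧ j = 4) ∨ (k = 1 ∧ j = 2) ∨ (k = 2 ∧ j = 0) := by omega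
    rcases this with ⟨rfl, rfl⟩ | ⟨rfl, rfl⟩ | ⟨rfl, rfl⟩
    · refine (sub_zero _).trans ?_
      refine (congrArg (fun w => extD 𝓘(ℝ, EP) w x)
        (funext (dCartan_curving_zero_three κ ξ))).trans ?_
      exact extD_extD _ ((smooth_f κ x).formContDiffAt.of_le two_le_infty)
    · refine (congrArg₂ HSub.hSub (congrArg (fun w => extD 𝓘(ℝ, EP) w x)
        (funext (dCartan_curving_one_one κ ξ)))
        (congrArg (contract (fundVF ξ x)) (dCartan_curving_zero_three κ ξ x))).trans ?_
      have hinv : ∀ (g : G) x, pb 𝓘(ℝ, EP) 𝓘(ℝ, EP) (fun y => g • y) κ.f x = κ.f x := fun g x => by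
        have h := invariant_of_mem κ.cartan.2 g ξ 0 2 x
        rwa [funext (κ.cartan_f _), κ.cartan_f] at h
      have e1 : (fun y => extD 𝓘(ℝ, EP) (muForm κ ξ) y - contract (fundVF ξ y) (κ.f y)) =
          fun y => extD 𝓘(ℝ, EP) (muForm κ ξ) y +
            (-1 : ℝ) • contract (fundVF ξ y) (κ.f y) := by
        funext y
        ext v
        simp [sub_eq_add_neg]
      rw [e1, extD_add_at _ ((SmoothFormAt.extD _ (smooth_muForm κ ξ x)).formContDiffAt.of_le
        (by simp)) ((SmoothFormAt.const_smul _ (SmoothFormAt.contract_fundVF (smooth_f κ) ξ x)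
          _).formContDiffAt.of_le (by simp)),
        extD_extD _ ((smooth_muForm κ ξ x).formContDiffAt.of_le two_le_infty), extD_smul_at,
        extD_contract_fundVF (smooth_f κ) ξ x hinv]
      ext v
      simp
    · refine (zero_sub _).trans ?_
      refine (congrArg (fun α => -contract (fundVF ξ x) α)
        (dCartan_curving_one_one κ ξ x)).trans ?_
      have e2 : contract (fundVF ξ x) (contract (fundVF ξ x) (κ.f x)) = 0 :=
        contract_contract_self _ _
      have e3 : contract (fundVF ξ x) (extD 𝓘(ℝ, EP) (muForm κ ξ) x) = 0 := by
        ext v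
        refine (extD_zero_form 𝓘(ℝ, EP) (smooth_muForm κ ξ x) _).trans ?_
        refine mfderiv_fundVF_eq_zero (EG := EG) (E := EP) (F := ℂ)
          (c := fun ξ z => muForm κ ξ z ![]) ?_ ?_ ξ
          (((smoothFormAt_zero_iff 𝓘(ℝ, EP) _ x).1 (smooth_muForm κ ξ x)).mdifferentiableAt
            (by simp))
        · obtain ⟨l, hl⟩ := (isPoly_of_mem κ.cartan.2 1 0 x).exists_linear
          refine ⟨{ toFun := fun ξ => l ξ ![]
                    map_add' := fun ξ η => by rw [map_add, ContinuousAlternatingMap.add_apply]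
                    map_smul' := fun c ξ => by
                      rw [map_smul, ContinuousAlternatingMap.smul_apply, RingHom.id_apply] },
            fun ξ => ?_⟩
          exact congrArg (fun α : TangentSpace 𝓘(ℝ, EP) x [⋀^Fin 0]→L[ℝ] ℂ => α ![]) (hl ξ)
        · intro g ξ x
          refine Eq.trans ?_ (congrArg (fun α : TangentSpace 𝓘(ℝ, EP) x [⋀^Fin 0]→L[ℝ] ℂ => α ![])
            (invariant_of_mem κ.cartan.2 g ξ 1 0 x))
          exact congrArg (muForm κ (Ad g ξ) (g • x)) (Subsingleton.elim _ _)
      ext v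
      have e2' := congrArg (fun α : TangentSpace 𝓘(ℝ, EP) x [⋀^Fin 0]→L[ℝ] ℂ => α v) e2
      have e3' := congrArg (fun α : TangentSpace 𝓘(ℝ, EP) x [⋀^Fin 0]→L[ℝ] ℂ => α v) e3
      change -(contract (fundVF ξ x) (extD 𝓘(ℝ, EP) (muForm κ ξ) x) v -
        contract (fundVF ξ x) (contract (fundVF ξ x) (κ.f x)) v) = 0
      exact (congrArg₂ (fun a b : ℂ => -(a - b)) e3' e2').trans (by simp)
  · exact (hasDegree_dCartan_curving κ).dCartan ξ x k j hkj

end ThreeForm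

/-! ### The equivariant differential of fields of formal forms -/

namespace MF

variable {V : Type*} [AddCommGroup V] [Module ℝ V] [TopologicalSpace V]
  {A : Type*} [NormedRing A] [NormedAlgebra ℝ A]

/-- Multiplication by the formal variable. -/
def shift : MF V A →ₗ[ℝ] MF V A where
  toFun α := fun k j => match k with
    | 0 => 0
    | k + 1 => α k j
  map_add' α β := by
    ext k j : 1
    cases k with
    | zero => exact (add_zero _).symm
    | succ k => rfl
  map_smul' c α := by
    ext k j : 1
    cases k with
    | zero => exact (altMap_smul_zero c).symm
    | succ k => rfl

theorem shift_zero_left (α : MF V A) (j : ℕ) : shift α 0 j = 0 := rfl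

theorem shift_succ (α : MF V A) (k j : ℕ) : shift α (k + 1) j = α k j := rfl

theorem shift_mul (α β : MF V A) : shift α * β = shift (α * β) := by
  ext k j : 1
  cases k with
  | zero =>
    rw [shift_zero_left, mul_apply]
    simp only [Finset.Nat.antidiagonal_zero, Finset.sum_singleton, shift_zero_left,
      wedge'_zero_left, Finset.sum_const_zero]
  | succ k =>
    rw [shift_succ, mul_apply, mul_apply, Finset.Nat.sum_antidiagonal_succ]
    simp only [shift_zero_left, wedge'_zero_left, Finset.sum_const_zero, zero_add, shift_succ]

theorem mul_shift (α β : MF V A) : α * shift β = shift (α * β) := by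
  ext k j : 1
  cases k with
  | zero =>
    rw [shift_zero_left, mul_apply]
    simp only [Finset.Nat.antidiagonal_zero, Finset.sum_singleton, shift_zero_left,
      wedge'_zero_right, Finset.sum_const_zero]
  | succ k =>
    rw [shift_succ, mul_apply, mul_apply, Finset.Nat.sum_antidiagonal_succ']
    simp only [shift_zero_left, wedge'_zero_right, Finset.sum_const_zero, zero_add, shift_succ]

theorem eps_shift (α : MF V A) : eps (shift α) = shift (eps α) := by
  ext k j : 1
  cases k with
  | zero => exact altMap_smul_zero _
  | succ k => rfl

theorem map_shift {A' : Type*} [NormedRing A'] [NormedAlgebra ℝ A'] (φ : A →L[ℝ] A')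
    (α : MF V A) : map φ (shift α) = shift (map φ α) := by
  ext k j : 1
  cases k with
  | zero =>
    ext v
    exact _root_.map_zero φ
  | succ k => rfl

theorem const_mul_single (c : A) (k j : ℕ) (α : V [⋀^Fin j]→L[ℝ] A) :
    const c * single k j α =
      single k j (((ContinuousLinearMap.mul ℝ A) c).compContinuousAlternatingMap α) := by
  ext k' j' v
  rw [const_mul_apply]
  by_cases h : k' = k ∧ j' = j
  · obtain ⟨rfl, rfl⟩ := h
    simp only [single_apply_same]
    rfl
  · rw [single_apply_of_ne h, single_apply_of_ne h]
    exact mul_zero c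

theorem single_mul_const (c : A) (k j : ℕ) (α : V [⋀^Fin j]→L[ℝ] A) :
    single k j α * const c =
      single k j (((ContinuousLinearMap.mul ℝ A).flip c).compContinuousAlternatingMap α) := by
  ext k' j' v
  rw [mul_const_apply]
  by_cases h : k' = k ∧ j' = j
  · obtain ⟨rfl, rfl⟩ := h
    simp only [single_apply_same]
    rfl
  · rw [single_apply_of_ne h, single_apply_of_ne h]
    exact zero_mul c

theorem single_zero (k j : ℕ) : single k j (0 : V [⋀^Fin j]→L[ℝ] A) = 0 := by
  ext k' j' : 1
  by_cases h : k' = k ∧ j' = j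
  · obtain ⟨rfl, rfl⟩ := h
    rw [single_apply_same]
    rfl
  · rw [single_apply_of_ne h]
    rfl

theorem map_single {A' : Type*} [NormedRing A'] [NormedAlgebra ℝ A'] (φ : A →L[ℝ] A') (k j : ℕ)
    (α : V [⋀^Fin j]→L[ℝ] A) :
    map φ (single k j α) = single k j (φ.compContinuousAlternatingMap α) := by
  ext k' j' : 1
  rw [map_apply]
  by_cases h : k' = k ∧ j' = j
  · obtain ⟨rfl, rfl⟩ := h
    rw [single_apply_same, single_apply_same]
  · rw [single_apply_of_ne h, single_apply_of_ne h]
    ext v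
    exact _root_.map_zero φ

theorem comp_single {V' : Type*} [AddCommGroup V'] [Module ℝ V'] [TopologicalSpace V']
    (φ : V' →L[ℝ] V) (k j : ℕ) (α : V [⋀^Fin j]→L[ℝ] A) :
    comp φ (single k j α) = single k j (α.compContinuousLinearMap φ) := by
  ext k' j' : 1
  rw [comp_apply]
  by_cases h : k' = k ∧ j' = j
  · obtain ⟨rfl, rfl⟩ := h
    rw [single_apply_same, single_apply_same]
  · rw [single_apply_of_ne h, single_apply_of_ne h]
    rfl

theorem cont_single_succ (v : V) (k j : ℕ) (α : V [⋀^Fin (j + 1)]→L[ℝ] A) :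
    cont v (single k (j + 1) α) = single k j (contract v α) := by
  ext k' j' : 1
  rw [cont_apply]
  by_cases h : k' = k ∧ j' = j
  · obtain ⟨rfl, rfl⟩ := h
    rw [single_apply_same, single_apply_same]
  · rw [single_apply_of_ne h, single_apply_of_ne (by omega)]
    rfl

theorem cont_single_zero (v : V) (k : ℕ) (α : V [⋀^Fin 0]→L[ℝ] A) :
    cont v (single k 0 α) = 0 := by
  ext k' j' : 1
  rw [cont_apply, single_apply_of_ne (by omega)]
  rfl

theorem shift_single (k j : ℕ) (α : V [⋀^Fin j]→L[ℝ] A) :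
    shift (single k j α) = single (k + 1) j α := by
  ext k' j' : 1
  cases k' with
  | zero => rw [shift_zero_left, single_apply_of_ne (by omega)]
  | succ k' =>
    rw [shift_succ]
    by_cases h : k' = k ∧ j' = j
    · obtain ⟨rfl, rfl⟩ := h
      rw [single_apply_same, single_apply_same]
    · rw [single_apply_of_ne h, single_apply_of_ne (by omega)]

theorem shift_comp {V' : Type*} [AddCommGroup V'] [Module ℝ V'] [TopologicalSpace V']
    (φ : V' →L[ℝ] V) (α : MF V A) : comp φ (shift α) = shift (comp φ α) := by
  ext k j : 1
  cases k with
  | zero => rfl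
  | succ k => rfl

end MF

section EquivariantD

variable {E : Type*} [NormedAddCommGroup E] [NormedSpace ℝ E] {S : Type*} [TopologicalSpace S]
  (I : ModelWithCorners ℝ E S) {N : Type*} [TopologicalSpace N] [ChartedSpace S N]
  {A : Type*} [NormedRing A] [NormedAlgebra ℝ A] {A' : Type*} [NormedRing A'] [NormedAlgebra ℝ A']
  [I.Boundaryless] [IsManifold I ∞ N]

theorem SmoothFieldAt.single {k j : ℕ} {w : RawForm I N A j} {x : N} (hw : SmoothFormAt I w x) :
    SmoothFieldAt I (fun y => MF.single k j (w y)) x := fun k' j' => by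
  by_cases h : k' = k ∧ j' = j
  · obtain ⟨rfl, rfl⟩ := h
    simpa only [MF.single_apply_same] using hw
  · simp only [MF.single_apply_of_ne h]
    exact SmoothFormAt.zero I

theorem extDF_single {k j : ℕ} (w : RawForm I N A j) (x : N) :
    extDF I (fun y => MF.single k j (w y)) x = MF.single k (j + 1) (extD I w x) := by
  ext k' j' : 1
  have h0 : ∀ j, extD I (fun y => (0 : TangentSpace I y [⋀^Fin j]→L[ℝ] A)) x = 0 := fun j => by
    have h := extD_smul_at I (w := fun y => (0 : TangentSpace I y [⋀^Fin j]→L[ℝ] A)) (x := x) 0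
    simp only [altMap_zero_smul] at h
    exact h
  cases j' with
  | zero => rw [extDF_zero, MF.single_apply_of_ne (by omega)]
  | succ j' =>
    rw [extDF_succ]
    by_cases h : k' = k ∧ j' = j
    · obtain ⟨rfl, rfl⟩ := h
      simp only [MF.single_apply_same]
    · rw [MF.single_apply_of_ne (by omega)]
      simp only [MF.single_apply_of_ne h]
      exact h0 j'

/-- A function, as a form of degree zero. -/
def zeroForm {F : Type*} [NormedAddCommGroup F] [NormedSpace ℝ F] (s : N → F) : RawForm I N F 0 :=
  fun y => ContinuousAlternatingMap.constOfIsEmpty ℝ (TangentSpace I y) (Fin 0) (s y)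

theorem smooth_zeroForm {F : Type*} [NormedAddCommGroup F] [NormedSpace ℝ F] {s : N → F} {x : N}
    (hs : ContMDiffAt I 𝓘(ℝ, F) ∞ s x) : SmoothFormAt I (zeroForm I s) x :=
  (smoothFormAt_zero_iff I _ x).2 hs

theorem extD_zeroForm {F : Type*} [NormedAddCommGroup F] [NormedSpace ℝ F] {s : N → F} {x : N}
    (hs : ContMDiffAt I 𝓘(ℝ, F) ∞ s x) (v : Fin 1 → TangentSpace I x) :
    extD I (zeroForm I s) x v = (mfderiv I 𝓘(ℝ, F) s x (v 0) : F) :=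
  extD_zero_form I (smooth_zeroForm I hs) v

theorem SmoothFieldAt.const {s : N → A} {x : N} (hs : ContMDiffAt I 𝓘(ℝ, A) ∞ s x) :
    SmoothFieldAt I (fun y => MF.const (s y)) x :=
  SmoothFieldAt.single I (smooth_zeroForm I hs)

theorem extDF_const (s : N → A) (x : N) :
    extDF I (fun y => MF.const (s y)) x = MF.single 0 1 (extD I (zeroForm I s) x) :=
  extDF_single I (zeroForm I s) x

theorem pbF_single {E' : Type*} [NormedAddCommGroup E'] [NormedSpace ℝ E'] {S' : Type*}
    [TopologicalSpace S'] (I' : ModelWithCorners ℝ E' S') {N' : Type*} [TopologicalSpace N']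
    [ChartedSpace S' N'] (φ : N → N') (k j : ℕ) (w : RawForm I' N' A j) (x : N) :
    pbF I I' φ (fun y => MF.single k j (w y)) x = MF.single k j (pb I I' φ w x) :=
  MF.comp_single _ _ _ _

/-- The effect of a change of frame on the curvature. -/
theorem gauge_curvature {a b s : (x : N) → MF (TangentSpace I x) A} {x : N}
    (ha : SmoothFieldAt I a x) (hb : SmoothFieldAt I b x) (hs : SmoothFieldAt I s x)
    (ea : MF.eps (a x) = -a x) (es : MF.eps (s x) = s x)
    (h : ∀ᶠ y in 𝓝 x, s y * b y = a y * s y + extDF I s y) :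
    s x * (extDF I b x + b x * b x) = (extDF I a x + a x * a x) * s x := by
  have h1 := extDF_congr I h
  have hx := h.self_of_nhds
  rw [extDF_mul I hs hb, extDF_add I (SmoothFieldAt.mul I ha hs) (SmoothFieldAt.extDF I hs),
    extDF_mul I ha hs, extDF_extDF I hs, ea, es] at h1
  have h2 : extDF I s x = s x * b x - a x * s x := by rw [hx]; abel
  rw [h2] at h1
  have h3 : s x * extDF I b x = extDF I a x * s x + -a x * (s x * b x - a x * s x) -
      (s x * b x - a x * s x) * b x := by rw [← sub_eq_iff_eq_add'.2 h1.symm]; abel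
  rw [mul_add, h3]
  noncomm_ring

end EquivariantD

/-! ### Polynomial dependence on the Lie algebra -/

section Poly

variable {𝔤 : Type*} [AddCommGroup 𝔤] [Module ℝ 𝔤]
  {V : Type*} [AddCommGroup V] [Module ℝ V] [TopologicalSpace V]
  {A : Type*} [NormedRing A] [NormedAlgebra ℝ A]

theorem IsPoly.add {F : Type*} [NormedAddCommGroup F] [NormedSpace ℝ F] {k j : ℕ}
    {α β : 𝔤 → V [⋀^Fin j]→L[ℝ] F} (hα : IsPoly k α) (hβ : IsPoly k β) :
    IsPoly k (fun ξ => α ξ + β ξ) := by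
  obtain ⟨m, hm⟩ := hα
  obtain ⟨m', hm'⟩ := hβ
  exact ⟨m + m', fun ξ => by simp only [hm, hm']; rfl⟩

theorem IsPoly.smul {F : Type*} [NormedAddCommGroup F] [NormedSpace ℝ F] {k j : ℕ}
    {α : 𝔤 → V [⋀^Fin j]→L[ℝ] F} (hα : IsPoly k α) (c : ℝ) : IsPoly k (fun ξ => c • α ξ) := by
  obtain ⟨m, hm⟩ := hα
  exact ⟨c • m, fun ξ => by simp only [hm]; rfl⟩

theorem IsPoly.sum {F : Type*} [NormedAddCommGroup F] [NormedSpace ℝ F] {k j : ℕ} {ι : Type*}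
    (s : Finset ι) {α : ι → 𝔤 → V [⋀^Fin j]→L[ℝ] F} (hα : ∀ i ∈ s, IsPoly k (α i)) :
    IsPoly k (fun ξ => ∑ i ∈ s, α i ξ) := by
  classical
  induction s using Finset.induction_on with
  | empty => exact IsPoly.zero k j
  | insert i s hi ih =>
    simp only [Finset.sum_insert hi]
    exact (hα i (by simp)).add (ih fun l hl => hα l (by simp [hl]))

theorem IsPoly.map {F F' : Type*} [NormedAddCommGroup F] [NormedSpace ℝ F] [NormedAddCommGroup F']
    [NormedSpace ℝ F'] {k j : ℕ} {α : 𝔤 → V [⋀^Fin j]→L[ℝ] F} (hα : IsPoly k α) (φ : F →L[ℝ] F') :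
    IsPoly k (fun ξ => φ.compContinuousAlternatingMap (α ξ)) := by
  obtain ⟨m, hm⟩ := hα
  let l : (V [⋀^Fin j]→L[ℝ] F) →ₗ[ℝ] (V [⋀^Fin j]→L[ℝ] F') :=
    { toFun := fun α => φ.compContinuousAlternatingMap α
      map_add' := fun α β => by ext v; exact map_add φ _ _
      map_smul' := fun c α => by ext v; exact map_smul φ _ _ }
  exact ⟨l.compMultilinearMap m, fun ξ => by simp only [hm]; rfl⟩

theorem IsPoly.wedge' {k k' i l n : ℕ} {α : 𝔤 → V [⋀^Fin i]→L[ℝ] A} {β : 𝔤 → V [⋀^Fin l]→L[ℝ] A}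
    (hα : IsPoly k α) (hβ : IsPoly k' β) {k'' : ℕ} (hk : k + k' = k'') :
    IsPoly k'' (fun ξ => TwistedChern.wedge' i l n (α ξ) (β ξ)) := by
  obtain ⟨m, hm⟩ := hα
  obtain ⟨m', hm'⟩ := hβ
  let W : (V [⋀^Fin i]→L[ℝ] A) →ₗ[ℝ] (V [⋀^Fin l]→L[ℝ] A) →ₗ[ℝ] (V [⋀^Fin n]→L[ℝ] A) :=
    LinearMap.mk₂ ℝ (TwistedChern.wedge' i l n) (MF.wedge'_add_left i l n)
      (MF.wedge'_smul_left i l n) (MF.wedge'_add_right i l n)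
      (fun c a b => MF.wedge'_smul_right i l n c a b)
  refine ⟨((TensorProduct.lift W).compMultilinearMap (m.domCoprod m')).domDomCongr
    (finSumFinEquiv.trans (finCongr hk)), fun ξ => ?_⟩
  simp only [hm, hm']
  rfl

theorem IsPoly.mul {α β : 𝔤 → MF V A} (hα : ∀ k j, IsPoly k (fun ξ => α ξ k j))
    (hβ : ∀ k j, IsPoly k (fun ξ => β ξ k j)) (k j : ℕ) :
    IsPoly k (fun ξ => (α ξ * β ξ) k j) := by
  simp only [MF.mul_apply]
  refine IsPoly.sum _ fun p hp => IsPoly.sum _ fun q _ => ?_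
  exact (hα p.1 q.1).wedge' (hβ p.2 q.2) (Finset.HasAntidiagonal.mem_antidiagonal.1 hp)

theorem IsPoly.one (k j : ℕ) : IsPoly k (fun _ : 𝔤 => (1 : MF V A) k j) := by
  cases k with
  | zero => exact IsPoly.const _
  | succ k => exact IsPoly.zero _ _

theorem IsPoly.single_zero {j : ℕ} (α : V [⋀^Fin j]→L[ℝ] A) (k' j' : ℕ) :
    IsPoly k' (fun _ : 𝔤 => MF.single 0 j α k' j') := by
  by_cases h : k' = 0 ∧ j' = j
  · obtain ⟨rfl, rfl⟩ := h
    exact IsPoly.const _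
  · simp only [MF.single_apply_of_ne h]
    exact IsPoly.zero _ _

theorem IsPoly.single_one {j : ℕ} (l : 𝔤 →ₗ[ℝ] V [⋀^Fin j]→L[ℝ] A) (k' j' : ℕ) :
    IsPoly k' (fun ξ => MF.single 1 j (l ξ) k' j') := by
  by_cases h : k' = 1 ∧ j' = j
  · obtain ⟨rfl, rfl⟩ := h
    simp only [MF.single_apply_same]
    exact IsPoly.linear l
  · simp only [MF.single_apply_of_ne h]
    exact IsPoly.zero _ _

end Poly

/-! ### Equivariant modules with an abstract algebra of coefficients -/

section Gauge

variable {EG : Type*} [NormedAddCommGroup EG] [NormedSpace ℝ EG]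
  {G : Type*} [TopologicalSpace G] [ChartedSpace EG G] [Group G] [LieGroup 𝓘(ℝ, EG) ∞ G]
  {EP : Type*} [NormedAddCommGroup EP] [NormedSpace ℝ EP]
  {P : Type*} [TopologicalSpace P] [ChartedSpace EP P] [IsManifold 𝓘(ℝ, EP) ∞ P]
  [MulAction G P]
  {EM : Type*} [NormedAddCommGroup EM] [NormedSpace ℝ EM]
  {M : Type*} [TopologicalSpace M] [ChartedSpace EM M] [IsManifold 𝓘(ℝ, EM) ∞ M]
  [MulAction G M] [ContMDiffSMul 𝓘(ℝ, EG) 𝓘(ℝ, EM) ∞ G M]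
  {H : Type*} [NormedAddCommGroup H] [InnerProductSpace ℂ H] [CompleteSpace H]
  (B : EquivPUBundle EG G EM M EP P H)
  (𝒜 : Type*) [NormedRing 𝒜] [NormedAlgebra ℝ 𝒜] (ι : Type*)

/-- The matrices, in local frames indexed by `ι`, of the actions of `G` and of the lifting bundle
gerbe on a module, with values in an algebra `𝒜`. -/
structure GaugeBundle where
  dom : ι → Set P
  isOpen_dom : ∀ i, IsOpen (dom i)
  cover : ∀ p, ∃ i, p ∈ dom i
  S : ι → ι → G × P → 𝒜
  S_smooth : ∀ i j, ContMDiffOn (𝓘(ℝ, EG).prod 𝓘(ℝ, EP)) 𝓘(ℝ, 𝒜) ∞ (S i j)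
    {x | x.2 ∈ dom i ∧ x.1 • x.2 ∈ dom j}
  S_one : ∀ i, ∀ p ∈ dom i, S i i (1, p) = 1
  S_mul : ∀ i j k (g g' : G) p, p ∈ dom i → g' • p ∈ dom j → (g * g') • p ∈ dom k →
    S i k (g * g', p) = S j k (g, g' • p) * S i j (g', p)
  Psi : ι → ι → P → unitary (H →L[ℂ] H) → 𝒜
  Psi_smooth : ∀ i j u, ContMDiffOn (𝓘(ℝ, EP).prod 𝓘(ℝ, selfAdjoint (H →L[ℂ] H))) 𝓘(ℝ, 𝒜) ∞
    (fun x : P × selfAdjoint (H →L[ℂ] H) => Psi i j x.1 (u * selfAdjoint.expUnitary x.2))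
    {x | x.1 ∈ dom i ∧ B.act x.1 (u * selfAdjoint.expUnitary x.2) ∈ dom j}
  Psi_isUnit : ∀ i j p u, p ∈ dom i → B.act p u ∈ dom j → IsUnit (Psi i j p u)
  S_Psi : ∀ i j i' j' (g : G) p u, p ∈ dom i → B.act p u ∈ dom j → g • p ∈ dom i' →
    B.act (g • p) u ∈ dom j' →
    S i i' (g, p) * Psi i j p u = Psi i' j' (g • p) u * S j j' (g, B.act p u)

variable {B 𝒜 ι} (Q : GaugeBundle B 𝒜 ι)

namespace GaugeBundle

theorem contMDiffAt_S (i j : ι) {x : G × P} (h : x.2 ∈ Q.dom i) (h' : x.1 • x.2 ∈ Q.dom j) :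
    ContMDiffAt (𝓘(ℝ, EG).prod 𝓘(ℝ, EP)) 𝓘(ℝ, 𝒜) ∞ (Q.S i j) x := by
  have := B.smul_smooth
  refine (Q.S_smooth i j).contMDiffAt (IsOpen.mem_nhds ?_ ⟨h, h'⟩)
  exact ((Q.isOpen_dom i).preimage continuous_snd).inter
    ((Q.isOpen_dom j).preimage (contMDiff_act EG G EP P).continuous)

theorem contMDiffAt_S_left (i j : ι) {g : G} {p : P} (h : p ∈ Q.dom i) (h' : g • p ∈ Q.dom j) :
    ContMDiffAt 𝓘(ℝ, EG) 𝓘(ℝ, 𝒜) ∞ (fun g => Q.S i j (g, p)) g :=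
  ContMDiffAt.comp g (f := fun g : G => (g, p)) (Q.contMDiffAt_S i j (x := (g, p)) h h')
    (contMDiffAt_id.prodMk contMDiffAt_const)

theorem contMDiffAt_S_right (i j : ι) {g : G} {p : P} (h : p ∈ Q.dom i) (h' : g • p ∈ Q.dom j) :
    ContMDiffAt 𝓘(ℝ, EP) 𝓘(ℝ, 𝒜) ∞ (fun q => Q.S i j (g, q)) p :=
  ContMDiffAt.comp p (f := fun q : P => (g, q)) (Q.contMDiffAt_S i j (x := (g, p)) h h')
    (contMDiffAt_const.prodMk contMDiffAt_id)

theorem isUnit_S (i j : ι) (g : G) {p : P} (h : p ∈ Q.dom i) (h' : g • p ∈ Q.dom j) :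
    IsUnit (Q.S i j (g, p)) := by
  have e1 := Q.S_mul i j i g⁻¹ g p h h' (by simpa using h)
  have e2 := Q.S_mul j i j g g⁻¹ (g • p) h' (by simpa using h) (by simpa using h')
  rw [inv_mul_cancel, Q.S_one i p h] at e1
  rw [mul_inv_cancel, Q.S_one j _ h', inv_smul_smul] at e2
  exact ⟨⟨Q.S i j (g, p), Q.S j i (g⁻¹, g • p), e2.symm, e1.symm⟩, rfl⟩

theorem contMDiffAt_Psi (i j : ι) {p : P} {u : unitary (H →L[ℂ] H)} (h : p ∈ Q.dom i)
    (h' : B.act p u ∈ Q.dom j) :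
    ContMDiffAt (𝓘(ℝ, EP).prod 𝓘(ℝ, selfAdjoint (H →L[ℂ] H))) 𝓘(ℝ, 𝒜) ∞
      (fun x : P × selfAdjoint (H →L[ℂ] H) => Q.Psi i j x.1 (u * selfAdjoint.expUnitary x.2))
      (p, 0) := by
  refine (Q.Psi_smooth i j u).contMDiffAt (IsOpen.mem_nhds ?_ ⟨h, by simpa using h'⟩)
  exact ((Q.isOpen_dom i).preimage continuous_fst).inter
    ((Q.isOpen_dom j).preimage (B.act_smooth u).continuous)

/-- A family of formal forms, in the local frames, with values in the endomorphisms of the module,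
which is invariant under `G` and compatible with the action of the bundle gerbe. -/
structure Covariant (Z : ι → GroupLieAlgebra 𝓘(ℝ, EG) G → (x : P) →
    MF (TangentSpace 𝓘(ℝ, EP) x) 𝒜) : Prop where
  smooth : ∀ i ξ, ∀ p ∈ Q.dom i, SmoothFieldAt 𝓘(ℝ, EP) (Z i ξ) p
  poly : ∀ i, ∀ p ∈ Q.dom i, ∀ k j, IsPoly k (fun ξ => Z i ξ p k j)
  equivariant : ∀ i j (g : G) ξ p, p ∈ Q.dom i → g • p ∈ Q.dom j →
    MF.const (Q.S i j (g, p)) * Z i ξ p =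
      pbF 𝓘(ℝ, EP) 𝓘(ℝ, EP) (fun y => g • y) (Z j (Ad g ξ)) p * MF.const (Q.S i j (g, p))
  descends : ∀ i j φ w q, LiftAt B ∞ φ w q → φ q ∈ Q.dom i → q ∈ Q.dom j → ∀ ξ,
    MF.const (Q.Psi i j (φ q) (w q)) * Z j ξ q =
      pbF 𝓘(ℝ, EP) 𝓘(ℝ, EP) φ (Z i ξ) q * MF.const (Q.Psi i j (φ q) (w q))

variable {Q} {Z Z' : ι → GroupLieAlgebra 𝓘(ℝ, EG) G → (x : P) → MF (TangentSpace 𝓘(ℝ, EP) x) 𝒜}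

namespace Covariant

theorem pbF_mul (φ : P → P) (α β : (x : P) → MF (TangentSpace 𝓘(ℝ, EP) x) 𝒜) (x : P) :
    pbF 𝓘(ℝ, EP) 𝓘(ℝ, EP) φ (fun y => α y * β y) x =
      pbF 𝓘(ℝ, EP) 𝓘(ℝ, EP) φ α x * pbF 𝓘(ℝ, EP) 𝓘(ℝ, EP) φ β x := map_mul (MF.comp _) _ _

theorem mul (h : Q.Covariant Z) (h' : Q.Covariant Z') :
    Q.Covariant (fun i ξ x => Z i ξ x * Z' i ξ x) where
  smooth i ξ p hp := SmoothFieldAt.mul _ (h.smooth i ξ p hp) (h'.smooth i ξ p hp)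
  poly i p hp := IsPoly.mul (h.poly i p hp) (h'.poly i p hp)
  equivariant i j g ξ p hp hgp := by
    rw [pbF_mul, ← mul_assoc, h.equivariant i j g ξ p hp hgp, mul_assoc,
      h'.equivariant i j g ξ p hp hgp, mul_assoc]
  descends i j φ w q hL hi hj ξ := by
    rw [pbF_mul, ← mul_assoc, h.descends i j φ w q hL hi hj ξ, mul_assoc,
      h'.descends i j φ w q hL hi hj ξ, mul_assoc]

theorem add (h : Q.Covariant Z) (h' : Q.Covariant Z') :
    Q.Covariant (fun i ξ x => Z i ξ x + Z' i ξ x) where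
  smooth i ξ p hp := SmoothFieldAt.add _ (h.smooth i ξ p hp) (h'.smooth i ξ p hp)
  poly i p hp k j := (h.poly i p hp k j).add (h'.poly i p hp k j)
  equivariant i j g ξ p hp hgp := by
    rw [mul_add, h.equivariant i j g ξ p hp hgp, h'.equivariant i j g ξ p hp hgp, ← add_mul]
    rfl
  descends i j φ w q hL hi hj ξ := by
    rw [mul_add, h.descends i j φ w q hL hi hj ξ, h'.descends i j φ w q hL hi hj ξ, ← add_mul]
    rfl

theorem smul (h : Q.Covariant Z) (c : ℝ) : Q.Covariant (fun i ξ x => c • Z i ξ x) where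
  smooth i ξ p hp := SmoothFieldAt.smul _ (h.smooth i ξ p hp) c
  poly i p hp k j := (h.poly i p hp k j).smul c
  equivariant i j g ξ p hp hgp := by
    rw [mul_smul_comm, h.equivariant i j g ξ p hp hgp, ← smul_mul_assoc]
    rfl
  descends i j φ w q hL hi hj ξ := by
    rw [mul_smul_comm, h.descends i j φ w q hL hi hj ξ, ← smul_mul_assoc]
    rfl

theorem one : Q.Covariant (fun _ _ _ => 1) where
  smooth i ξ p _ := SmoothFieldAt.one _
  poly i p _ k j := IsPoly.one k j
  equivariant i j g ξ p hp hgp := by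
    rw [pbF, map_one, mul_one, one_mul]
  descends i j φ w q hL hi hj ξ := by
    rw [pbF, map_one, mul_one, one_mul]

theorem zero : Q.Covariant (fun _ _ _ => 0) := by
  simpa only [zero_smul] using (one (Q := Q)).smul 0

theorem pow (h : Q.Covariant Z) (n : ℕ) : Q.Covariant (fun i ξ x => Z i ξ x ^ n) := by
  induction n with
  | zero => simpa only [pow_zero] using one
  | succ n ih => simpa only [pow_succ] using ih.mul h

theorem sum {τ : Type*} (s : Finset τ) {Z : τ → ι → GroupLieAlgebra 𝓘(ℝ, EG) G → (x : P) →
    MF (TangentSpace 𝓘(ℝ, EP) x) 𝒜} (h : ∀ a ∈ s, Q.Covariant (Z a)) :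
    Q.Covariant (fun i ξ x => ∑ a ∈ s, Z a i ξ x) := by
  classical
  induction s using Finset.induction_on with
  | empty => simpa only [Finset.sum_empty] using zero
  | insert a s ha ih =>
    simp only [Finset.sum_insert ha]
    exact (h a (by simp)).add (ih fun b hb => h b (by simp [hb]))

theorem expSum (h : Q.Covariant Z) (n : ℕ) : Q.Covariant (fun i ξ x => MF.expSum n (Z i ξ x)) :=
  sum _ fun m _ => (h.pow m).smul _

/-- A family each component of which is a component of a covariant family is covariant. -/
theorem of_components (h : ∀ k j, ∃ Z', Q.Covariant Z' ∧ ∀ i ξ x, Z i ξ x k j = Z' i ξ x k j) :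
    Q.Covariant Z where
  smooth i ξ p hp k j := by
    obtain ⟨Z', h', e⟩ := h k j
    simpa only [e] using h'.smooth i ξ p hp k j
  poly i p hp k j := by
    obtain ⟨Z', h', e⟩ := h k j
    simpa only [e] using h'.poly i p hp k j
  equivariant i j g ξ p hp hgp := by
    ext k l v
    obtain ⟨Z', h', e⟩ := h k l
    have h1 := congrArg (fun α : MF (TangentSpace 𝓘(ℝ, EP) p) 𝒜 => α k l v)
      (h'.equivariant i j g ξ p hp hgp)
    simp only [MF.const_mul_apply, MF.mul_const_apply, pbF_apply, ← e] at h1 ⊢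
    exact h1
  descends i j φ w q hL hi hj ξ := by
    ext k l v
    obtain ⟨Z', h', e⟩ := h k l
    have h1 := congrArg (fun α : MF (TangentSpace 𝓘(ℝ, EP) q) 𝒜 => α k l v)
      (h'.descends i j φ w q hL hi hj ξ)
    simp only [MF.const_mul_apply, MF.mul_const_apply, pbF_apply, ← e] at h1 ⊢
    exact h1

end Covariant

end GaugeBundle

end Gauge

/-! ### Traces of covariant families -/

section CovD

variable {EG : Type*} [NormedAddCommGroup EG] [NormedSpace ℝ EG]
  {G : Type*} [TopologicalSpace G] [ChartedSpace EG G] [Group G] [LieGroup 𝓘(ℝ, EG) ∞ G]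
  {E : Type*} [NormedAddCommGroup E] [NormedSpace ℝ E]
  {N : Type*} [TopologicalSpace N] [ChartedSpace E N] [IsManifold 𝓘(ℝ, E) ∞ N]
  [MulAction G N] {A : Type*} [NormedRing A] [NormedAlgebra ℝ A]
  {A' : Type*} [NormedRing A'] [NormedAlgebra ℝ A']

/-- The equivariant differential of a field of formal forms. -/
def equivD (ξ : GroupLieAlgebra 𝓘(ℝ, EG) G) (α : (x : N) → MF (TangentSpace 𝓘(ℝ, E) x) A) (x : N) :
    MF (TangentSpace 𝓘(ℝ, E) x) A :=
  extDF 𝓘(ℝ, E) α x - MF.shift (MF.cont (fundVF ξ x) (α x))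

theorem dCartan_eq_equivD (α : RawCartan EG G E N) (ξ : GroupLieAlgebra 𝓘(ℝ, EG) G) (x : N) :
    dCartan α ξ x = equivD ξ (A := ℂ) (fun y => (α ξ y : MixedForm _ _)) x := by
  funext k j
  cases k <;> cases j <;> rfl

/-- The covariant equivariant differential, for the connection form `a`. -/
def covD (a : (x : N) → MF (TangentSpace 𝓘(ℝ, E) x) A) (ξ : GroupLieAlgebra 𝓘(ℝ, EG) G)
    (α : (x : N) → MF (TangentSpace 𝓘(ℝ, E) x) A) (x : N) : MF (TangentSpace 𝓘(ℝ, E) x) A :=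
  equivD ξ α x + (a x * α x - MF.eps (α x) * a x)

variable {a α β : (x : N) → MF (TangentSpace 𝓘(ℝ, E) x) A} {ξ : GroupLieAlgebra 𝓘(ℝ, EG) G} {x : N}

theorem equivD_mul (hα : SmoothFieldAt 𝓘(ℝ, E) α x) (hβ : SmoothFieldAt 𝓘(ℝ, E) β x) :
    equivD ξ (fun y => α y * β y) x = equivD ξ α x * β x + MF.eps (α x) * equivD ξ β x := by
  rw [equivD, extDF_mul _ hα hβ, MF.cont_mul, map_add, ← MF.shift_mul, ← MF.mul_shift, equivD, equivD]
  noncomm_ring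

theorem covD_mul (hα : SmoothFieldAt 𝓘(ℝ, E) α x) (hβ : SmoothFieldAt 𝓘(ℝ, E) β x) :
    covD a ξ (fun y => α y * β y) x = covD a ξ α x * β x + MF.eps (α x) * covD a ξ β x := by
  rw [covD, equivD_mul hα hβ, MF.eps_mul, covD, covD]
  noncomm_ring

theorem covD_add (hα : SmoothFieldAt 𝓘(ℝ, E) α x) (hβ : SmoothFieldAt 𝓘(ℝ, E) β x) :
    covD a ξ (fun y => α y + β y) x = covD a ξ α x + covD a ξ β x := by
  rw [covD, equivD, extDF_add _ hα hβ, map_add, map_add, map_add, covD, covD, equivD, equivD]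
  noncomm_ring

theorem covD_smul (c : ℝ) : covD a ξ (fun y => c • α y) x = c • covD a ξ α x := by
  rw [covD, equivD, extDF_smul, map_smul, map_smul, map_smul, covD, equivD, mul_smul_comm,
    smul_mul_assoc, smul_add, smul_sub, smul_sub]

theorem covD_one : covD a ξ (fun _ => 1) x = 0 := by
  have h1 : extDF 𝓘(ℝ, E) (fun y => (1 : MF (TangentSpace 𝓘(ℝ, E) y) A)) x = 0 := by
    have h := extDF_mul 𝓘(ℝ, E) (x := x) (α := fun y => (1 : MF (TangentSpace 𝓘(ℝ, E) y) A))
      (β := fun y => 1) (SmoothFieldAt.one _) (SmoothFieldAt.one _)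
    simp only [mul_one, MF.eps_one, one_mul] at h
    exact left_eq_add.1 h
  rw [covD, equivD, h1, MF.cont_one, map_zero, MF.eps_one, mul_one, one_mul]
  simp

theorem covD_sum {τ : Type*} (s : Finset τ) {α : τ → (x : N) → MF (TangentSpace 𝓘(ℝ, E) x) A}
    (hα : ∀ i ∈ s, SmoothFieldAt 𝓘(ℝ, E) (α i) x) :
    covD a ξ (fun y => ∑ i ∈ s, α i y) x = ∑ i ∈ s, covD a ξ (α i) x := by
  classical
  induction s using Finset.induction_on with
  | empty =>
    have h := covD_smul (a := a) (ξ := ξ) (x := x) (α := fun _ => 1) (0 : ℝ)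
    simpa only [zero_smul, Finset.sum_empty] using h
  | insert i s hi ih =>
    simp only [Finset.sum_insert hi]
    rw [covD_add (hα i (by simp)) (SmoothFieldAt.sum _ _ fun l hl => hα l (by simp [hl])),
      ih fun l hl => hα l (by simp [hl])]

/-- The trace of the covariant differential. -/
theorem map_covD {str : A →L[ℝ] A'} (hstr : ∀ a b, str (a * b) = str (b * a))
    (hα : SmoothFieldAt 𝓘(ℝ, E) α x) (ha : MF.eps (a x) = -a x) :
    equivD ξ (fun y => MF.map str (α y)) x = MF.map str (covD a ξ α x) := by
  have h1 : MF.map str (a x * α x - MF.eps (α x) * a x) = 0 := by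
    rw [map_sub, MF.map_mul_comm_odd str (fun _ _ _ _ => hstr _ _) ha, sub_self]
  rw [covD, map_add, h1, add_zero, equivD, extDF_map _ hα, MF.cont_map, ← MF.map_shift, equivD,
    map_sub]

/-- If `𝔻 X` is central and odd, then `𝔻 exp X = (𝔻 X) exp X`. -/
theorem covD_expSum {X h : (x : N) → MF (TangentSpace 𝓘(ℝ, E) x) A}
    (hX : SmoothFieldAt 𝓘(ℝ, E) X x) (heX : MF.eps (X x) = X x) (hc : Commute (h x) (X x))
    (hD : covD a ξ X x = h x) (n : ℕ) :
    covD a ξ (fun y => MF.expSum (n + 1) (X y)) x = h x * MF.expSum n (X x) := by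
  have hpow : ∀ n : ℕ, covD a ξ (fun y => X y ^ (n + 1)) x = ((n + 1 : ℕ) : ℝ) • (h x * X x ^ n) := by
    intro n
    induction n with
    | zero => simp [hD]
    | succ n ih =>
      simp only [pow_succ' _ (n + 1)]
      rw [covD_mul hX (SmoothFieldAt.pow _ hX _), hD, ih, heX, mul_smul_comm, ← mul_assoc, ← hc.eq,
        mul_assoc, ← pow_succ', Nat.cast_succ (n + 1), add_smul, one_smul, add_comm]
  simp only [MF.expSum]
  rw [covD_sum _ fun i _ => SmoothFieldAt.smul _ (SmoothFieldAt.pow _ hX i) _,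
    Finset.sum_range_succ', Finset.mul_sum]
  simp only [covD_smul, hpow, pow_zero, covD_one, smul_zero, add_zero]
  refine Finset.sum_congr rfl fun m _ => ?_
  rw [smul_smul, mul_smul_comm, Nat.factorial_succ]
  congr 1
  have : (m.factorial : ℝ) ≠ 0 := by positivity
  push_cast
  field_simp

theorem Ad_one : Ad (EG := EG) (1 : G) ξ = ξ := by
  have h : (fun h : G => 1 * h * 1⁻¹) = id := funext fun h => by simp
  rw [Ad, h, mfderiv_id]
  rfl

theorem pbF_one_smul (α : (x : N) → MF (TangentSpace 𝓘(ℝ, E) x) A) (x : N) :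
    pbF 𝓘(ℝ, E) 𝓘(ℝ, E) (fun y => (1 : G) • y) α x = α x := by
  have h : (fun y : N => (1 : G) • y) = id := funext fun y => one_smul G y
  rw [h, pbF, mfderiv_id]
  rfl

end CovD

section Trace

variable {V : Type*} [AddCommGroup V] [Module ℝ V] [TopologicalSpace V]
  {A : Type*} [NormedRing A] [NormedAlgebra ℝ A] {A' : Type*} [NormedRing A'] [NormedAlgebra ℝ A']

theorem MF.map_eq_of_conj {str : A →L[ℝ] A'} (hstr : ∀ a b, str (a * b) = str (b * a)) {s : A}
    (hs : IsUnit s) {α β : MF V A} (h : MF.const s * α = β * MF.const s) :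
    MF.map str α = MF.map str β := by
  obtain ⟨u, rfl⟩ := hs
  ext k j v
  have h1 := congrArg (fun γ : MF V A => γ k j v) h
  simp only [MF.const_mul_apply, MF.mul_const_apply] at h1
  change str (α k j v) = str (β k j v)
  rw [← Units.inv_mul_cancel_left u (α k j v), h1, hstr, mul_assoc, Units.mul_inv, mul_one]

variable {EG : Type*} [NormedAddCommGroup EG] [NormedSpace ℝ EG]
  {G : Type*} [TopologicalSpace G] [ChartedSpace EG G] [Group G] [LieGroup 𝓘(ℝ, EG) ∞ G]
  {EP : Type*} [NormedAddCommGroup EP] [NormedSpace ℝ EP]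
  {P : Type*} [TopologicalSpace P] [ChartedSpace EP P] [IsManifold 𝓘(ℝ, EP) ∞ P]
  [MulAction G P]
  {EM : Type*} [NormedAddCommGroup EM] [NormedSpace ℝ EM]
  {M : Type*} [TopologicalSpace M] [ChartedSpace EM M] [IsManifold 𝓘(ℝ, EM) ∞ M]
  [MulAction G M] [ContMDiffSMul 𝓘(ℝ, EG) 𝓘(ℝ, EM) ∞ G M]
  {H : Type*} [NormedAddCommGroup H] [InnerProductSpace ℂ H] [CompleteSpace H]
  {B : EquivPUBundle EG G EM M EP P H}
  {𝒜 : Type*} [NormedRing 𝒜] [NormedAlgebra ℝ 𝒜] {ι : Type*}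

namespace GaugeBundle

variable (Q : GaugeBundle B 𝒜 ι)

/-- The trace of a family of formal forms given in the local frames. -/
def trace (str : 𝒜 →L[ℝ] ℂ) (Z : ι → GroupLieAlgebra 𝓘(ℝ, EG) G → (x : P) →
    MF (TangentSpace 𝓘(ℝ, EP) x) 𝒜) : RawCartan EG G EP P :=
  fun ξ p k j => MF.map str (Z (Q.cover p).choose ξ p) k j

variable {Q} {Z : ι → GroupLieAlgebra 𝓘(ℝ, EG) G → (x : P) → MF (TangentSpace 𝓘(ℝ, EP) x) 𝒜}
  (hZ : Q.Covariant Z) {str : 𝒜 →L[ℝ] ℂ} (hstr : ∀ a b, str (a * b) = str (b * a))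

include hZ hstr

theorem trace_eq {i : ι} {p : P} (hp : p ∈ Q.dom i) (ξ : GroupLieAlgebra 𝓘(ℝ, EG) G) :
    Q.trace str Z ξ p = MF.map str (Z i ξ p) := by
  have hp' := (Q.cover p).choose_spec
  have h1 : (1 : G) • p ∈ Q.dom i := by rwa [one_smul]
  have h := hZ.equivariant _ i 1 ξ p hp' h1
  rw [Ad_one, pbF_one_smul] at h
  exact MF.map_eq_of_conj hstr (Q.isUnit_S _ i 1 hp' h1) h

theorem trace_eventually_eq {i : ι} {p : P} (hp : p ∈ Q.dom i) (ξ : GroupLieAlgebra 𝓘(ℝ, EG) G) :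
    ∀ᶠ q in 𝓝 p, Q.trace str Z ξ q = MF.map str (Z i ξ q) :=
  Filter.eventually_of_mem ((Q.isOpen_dom i).mem_nhds hp) fun _ hq => trace_eq hZ hstr hq ξ

theorem trace_mem : Q.trace str Z ∈ cartanComplex EG G EP P := by
  refine mem_cartanComplex (fun ξ k j p => ?_) (fun k j p => ?_) (fun g ξ k j p => ?_)
  · obtain ⟨i, hi⟩ := Q.cover p
    refine SmoothFormAt.congr _ (SmoothFieldAt.map _ (hZ.smooth i ξ p hi) str k j) ?_
    exact (trace_eventually_eq hZ hstr hi ξ).mono fun q hq => by rw [hq]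
  · obtain ⟨i, hi⟩ := Q.cover p
    simp only [trace_eq hZ hstr hi]
    exact (hZ.poly i p hi k j).map str
  · obtain ⟨i, hi⟩ := Q.cover p
    obtain ⟨j', hj⟩ := Q.cover (g • p)
    have h1 := MF.map_eq_of_conj hstr (Q.isUnit_S i j' g hi hj) (hZ.equivariant i j' g ξ p hi hj)
    rw [trace_eq hZ hstr hi, h1, pb, trace_eq hZ hstr hj]
    rfl

theorem isBasic_trace (ξ : GroupLieAlgebra 𝓘(ℝ, EG) G) (k j : ℕ) :
    IsBasic B (fun x => Q.trace str Z ξ x k j) := by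
  intro φ w q hL
  obtain ⟨i, hi⟩ := Q.cover (φ q)
  obtain ⟨j', hj⟩ := Q.cover q
  have h1 := MF.map_eq_of_conj hstr (Q.Psi_isUnit i j' (φ q) (w q) hi
    (by rwa [hL.act_eq.self_of_nhds])) (hZ.descends i j' φ w q hL hi hj ξ)
  change pb _ _ _ _ _ = Q.trace str Z ξ q k j
  rw [trace_eq hZ hstr hj, h1, pb, trace_eq hZ hstr hi]
  rfl

theorem dCartan_trace {i : ι} {p : P} (hp : p ∈ Q.dom i) (ξ : GroupLieAlgebra 𝓘(ℝ, EG) G)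
    {a : (x : P) → MF (TangentSpace 𝓘(ℝ, EP) x) 𝒜} (ha : MF.eps (a p) = -a p) :
    dCartan (Q.trace str Z) ξ p = MF.map str (covD a ξ (Z i ξ) p) := by
  rw [dCartan_eq_equivD, ← map_covD hstr (hZ.smooth i ξ p hp) ha]
  refine congrArg₂ (HSub.hSub : MF (TangentSpace 𝓘(ℝ, EP) p) ℂ → _ → _) ?_ ?_
  · exact extDF_congr _ (trace_eventually_eq hZ hstr hp ξ)
  · exact congrArg (fun α : MF (TangentSpace 𝓘(ℝ, EP) p) ℂ => MF.shift (MF.cont (fundVF ξ p) α))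
      (trace_eq hZ hstr hp ξ)

end GaugeBundle

end Trace

/-! ### Connections and their curvature -/

section Preliminaries

variable {V : Type*} [AddCommGroup V] [Module ℝ V] [TopologicalSpace V]
  {A : Type*} [NormedRing A] [NormedAlgebra ℝ A]

theorem gauge_single {s : A} {a b d : V [⋀^Fin 1]→L[ℝ] A}
    (h : ∀ X : V, s * b (fun _ => X) = a (fun _ => X) * s + d (fun _ => X)) :
    MF.const s * MF.single 0 1 b = MF.single 0 1 a * MF.const s + MF.single 0 1 d := by
  rw [MF.const_mul_single, MF.single_mul_const, ← MF.single_add]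
  congr 1
  ext v
  have hv : v = fun _ => v 0 := funext fun i => by rw [Subsingleton.elim i 0]
  rw [hv]
  exact h (v 0)

theorem MF.eps_single_one (k : ℕ) (a : V [⋀^Fin 1]→L[ℝ] A) :
    MF.eps (MF.single k 1 a) = -MF.single k 1 a := by
  rw [MF.eps_single, pow_one, neg_one_smul]

theorem MF.single_mul_self_apply (a : V [⋀^Fin 1]→L[ℝ] A) (v w : V) :
    (MF.single 0 1 a * MF.single 0 1 a : MF V A) 0 2 ![v, w] =
      a (fun _ => v) * a (fun _ => w) - a (fun _ => w) * a (fun _ => v) := by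
  have h0 : ∀ v : V, MF.cont v (MF.single 0 1 a) = MF.const (a (fun _ => v)) := fun v => by
    rw [MF.cont_single_succ, MF.const]
    congr 1
    ext z
    change a _ = a _
    congr 1
    funext i
    fin_cases i
    rfl
  have h1 := congrArg (fun α : MF V A => α 0 1 ![w])
    (MF.cont_mul v (MF.single 0 1 a) (MF.single 0 1 a))
  rw [MF.eps_single_one, h0, neg_mul, ← sub_eq_add_neg] at h1
  have hw : (![w] : Fin 1 → V) = fun _ => w := funext fun i => by rw [Subsingleton.elim i 0]; rfl
  refine h1.trans ?_
  change (MF.const _ * MF.single 0 1 a : MF V A) 0 1 ![w] -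
    (MF.single 0 1 a * MF.const _ : MF V A) 0 1 ![w] = _
  rw [MF.const_mul_apply, MF.mul_const_apply, MF.single_apply_same, hw]

variable {E : Type*} [NormedAddCommGroup E] [NormedSpace ℝ E] {S : Type*} [TopologicalSpace S]
  {I : ModelWithCorners ℝ E S} {N : Type*} [TopologicalSpace N] [ChartedSpace S N]
  [I.Boundaryless] [IsManifold I ∞ N]

/-- The derivative of a function with values in a normed space, in the direction of a vector. -/
def dvec {F : Type*} [NormedAddCommGroup F] [NormedSpace ℝ F] (I : ModelWithCorners ℝ E S)
    (s : N → F) (x : N) (Y : TangentSpace I x) : F := mfderiv I 𝓘(ℝ, F) s x Y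

theorem dvec_mul {s t : N → A} {x : N} (hs : ContMDiffAt I 𝓘(ℝ, A) ∞ s x)
    (ht : ContMDiffAt I 𝓘(ℝ, A) ∞ t x) (Y : TangentSpace I x) :
    dvec I (fun y => s y * t y) x Y = dvec I s x Y * t x + s x * dvec I t x Y := by
  have h := extDF_mul I (SmoothFieldAt.const I hs) (SmoothFieldAt.const I ht)
  simp only [MF.const_mul_const] at h
  rw [extDF_const, extDF_const, extDF_const, MF.eps_const] at h
  have h1 := congrArg (fun α : MF (TangentSpace I x) A => α 0 1 (fun _ => Y)) h
  simp only [MF.add_apply, MF.single_apply_same, ContinuousAlternatingMap.add_apply,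
    MF.const_mul_apply, MF.mul_const_apply] at h1
  have hst : ContMDiffAt I 𝓘(ℝ, A) ∞ (fun y => s y * t y) x :=
    (ContinuousLinearMap.mul ℝ A).isBoundedBilinearMap.contDiff.contMDiff.contMDiffAt.comp x
      (f := fun y => (s y, t y)) (hs.prodMk_space ht)
  rw [extD_zeroForm I hst, extD_zeroForm I hs, extD_zeroForm I ht] at h1
  exact h1

end Preliminaries

section Gauge

variable {EG : Type*} [NormedAddCommGroup EG] [NormedSpace ℝ EG]
  {G : Type*} [TopologicalSpace G] [ChartedSpace EG G] [Group G] [LieGroup 𝓘(ℝ, EG) ∞ G]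
  {EP : Type*} [NormedAddCommGroup EP] [NormedSpace ℝ EP]
  {P : Type*} [TopologicalSpace P] [ChartedSpace EP P] [IsManifold 𝓘(ℝ, EP) ∞ P]
  [MulAction G P]
  {EM : Type*} [NormedAddCommGroup EM] [NormedSpace ℝ EM]
  {M : Type*} [TopologicalSpace M] [ChartedSpace EM M] [IsManifold 𝓘(ℝ, EM) ∞ M]
  [MulAction G M] [ContMDiffSMul 𝓘(ℝ, EG) 𝓘(ℝ, EM) ∞ G M]
  {H : Type*} [NormedAddCommGroup H] [InnerProductSpace ℂ H] [CompleteSpace H]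
  {B : EquivPUBundle EG G EM M EP P H}
  {𝒜 : Type*} [NormedRing 𝒜] [NormedAlgebra ℝ 𝒜] {ι : Type*}

/-- A connection, given in the local frames by connection forms with values in `𝒜`; the scalars act
through the map `c`. -/
structure GaugeConnection (Q : GaugeBundle B 𝒜 ι) (θ : B.GerbeConnection) (c : ℂ →L[ℝ] 𝒜) where
  A : ι → RawForm 𝓘(ℝ, EP) P 𝒜 1
  smooth : ∀ i, ∀ p ∈ Q.dom i, SmoothFormAt 𝓘(ℝ, EP) (A i) p
  invariant : ∀ i j (g : G) p, p ∈ Q.dom i → g • p ∈ Q.dom j → ∀ X : TangentSpace 𝓘(ℝ, EP) p,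
    Q.S i j (g, p) * A i p (fun _ => X) =
      A j (g • p) (fun _ => mfderiv 𝓘(ℝ, EP) 𝓘(ℝ, EP) (fun q : P => g • q) p X) * Q.S i j (g, p) +
        dvec 𝓘(ℝ, EP) (fun q => Q.S i j (g, q)) p X
  compatible : ∀ i j p (u : unitary (H →L[ℂ] H)), p ∈ Q.dom i → B.act p u ∈ Q.dom j →
    ∀ (X : TangentSpace 𝓘(ℝ, EP) p) (b : selfAdjoint (H →L[ℂ] H)),
    Q.Psi i j p u * (A j (B.act p u) (fun _ => B.dact p u X b) +
        c (θ.form (p, (u : H →L[ℂ] H)) (fun _ => EquivPUBundle.tvec p u X b))) =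
      A i p (fun _ => X) * Q.Psi i j p u +
      dvec (𝓘(ℝ, EP).prod 𝓘(ℝ, selfAdjoint (H →L[ℂ] H)))
        (fun x : P × selfAdjoint (H →L[ℂ] H) => Q.Psi i j x.1 (u * selfAdjoint.expUnitary x.2))
        (p, 0) ((X, b) : EP × selfAdjoint (H →L[ℂ] H))

namespace GaugeConnection

variable {Q : GaugeBundle B 𝒜 ι} {θ : B.GerbeConnection} {c : ℂ →L[ℝ] 𝒜}
  (D : GaugeConnection Q θ c)

/-- The connection form as a field of formal forms. -/
def field (i : ι) (x : P) : MF (TangentSpace 𝓘(ℝ, EP) x) 𝒜 := MF.single 0 1 (D.A i x)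

/-- The curvature as a field of formal forms. -/
def curv (i : ι) (x : P) : MF (TangentSpace 𝓘(ℝ, EP) x) 𝒜 :=
  extDF 𝓘(ℝ, EP) (D.field i) x + D.field i x * D.field i x

/-- The moment map. -/
def moment (i : ι) (ξ : GroupLieAlgebra 𝓘(ℝ, EG) G) (p : P) : 𝒜 :=
  dvec 𝓘(ℝ, EG) (fun g : G => Q.S i i (g, p)) 1 ξ - D.A i p (fun _ => fundVF ξ p)

theorem smooth_field {i : ι} {p : P} (hp : p ∈ Q.dom i) : SmoothFieldAt 𝓘(ℝ, EP) (D.field i) p :=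
  SmoothFieldAt.single _ (D.smooth i p hp)

theorem smooth_curv {i : ι} {p : P} (hp : p ∈ Q.dom i) : SmoothFieldAt 𝓘(ℝ, EP) (D.curv i) p :=
  SmoothFieldAt.add _ (SmoothFieldAt.extDF _ (D.smooth_field hp))
    (SmoothFieldAt.mul _ (D.smooth_field hp) (D.smooth_field hp))

theorem eps_field (i : ι) (x : P) : MF.eps (D.field i x) = -D.field i x := MF.eps_single_one _ _

theorem curv_eq_single (i : ι) (x : P) : D.curv i x =
    MF.single 0 2 (extD 𝓘(ℝ, EP) (D.A i) x + wedge (rfl : 1 + 1 = 2) (D.A i x) (D.A i x)) := by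
  rw [MF.single_add]
  refine congrArg₂ (HAdd.hAdd) (extDF_single _ (D.A i) x) ?_
  exact MF.single_mul_single _ _ _ _ _ _

theorem bianchi {i : ι} {p : P} (hp : p ∈ Q.dom i) : extDF 𝓘(ℝ, EP) (D.curv i) p +
    (D.field i p * D.curv i p - D.curv i p * D.field i p) = 0 := by
  have h := D.smooth_field hp
  have e : extDF 𝓘(ℝ, EP) (D.curv i) p = extDF 𝓘(ℝ, EP) (D.field i) p * D.field i p -
      D.field i p * extDF 𝓘(ℝ, EP) (D.field i) p := by
    refine (extDF_add _ (SmoothFieldAt.extDF _ h) (SmoothFieldAt.mul _ h h)).trans ?_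
    rw [extDF_extDF _ h, extDF_mul _ h h, eps_field]
    noncomm_ring
  rw [e, curv]
  noncomm_ring

theorem pbF_curv (i : ι) (φ : P → P) (p : P) : pbF 𝓘(ℝ, EP) 𝓘(ℝ, EP) φ (D.curv i) p =
    pbF 𝓘(ℝ, EP) 𝓘(ℝ, EP) φ (extDF 𝓘(ℝ, EP) (D.field i)) p +
      pbF 𝓘(ℝ, EP) 𝓘(ℝ, EP) φ (D.field i) p * pbF 𝓘(ℝ, EP) 𝓘(ℝ, EP) φ (D.field i) p :=
  (map_add (MF.comp (mfderiv 𝓘(ℝ, EP) 𝓘(ℝ, EP) φ p)) _ _).trans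
    (congrArg (HAdd.hAdd _) (GaugeBundle.Covariant.pbF_mul φ (D.field i) (D.field i) p))

theorem curv_equivariant {i j : ι} {g : G} {p : P} (hi : p ∈ Q.dom i) (hj : g • p ∈ Q.dom j) :
    MF.const (Q.S i j (g, p)) * D.curv i p =
      pbF 𝓘(ℝ, EP) 𝓘(ℝ, EP) (fun y => g • y) (D.curv j) p * MF.const (Q.S i j (g, p)) := by
  have := B.smul_smooth
  have hg := (contMDiff_smul_left EG EP g (N := P)).contMDiffAt (x := p)
  have h := gauge_curvature 𝓘(ℝ, EP) (x := p) (a := pbF 𝓘(ℝ, EP) 𝓘(ℝ, EP) (fun y => g • y) (D.field j))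
    (b := D.field i) (s := fun q => MF.const (Q.S i j (g, q)))
    (SmoothFieldAt.pbF _ _ hg (D.smooth_field hj)) (D.smooth_field hi)
    (SmoothFieldAt.const _ (Q.contMDiffAt_S_right i j hi hj))
    (by rw [pbF, MF.eps_comp, eps_field, map_neg]) (MF.eps_const _) (by
      filter_upwards [(Q.isOpen_dom i).mem_nhds hi, hg.continuousAt.preimage_mem_nhds
        ((Q.isOpen_dom j).mem_nhds hj)] with q h1 h2
      rw [extDF_const]
      refine (gauge_single fun X => ?_).trans (congrArg (fun α => α * MF.const (Q.S i j (g, q)) + _)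
        (pbF_single 𝓘(ℝ, EP) 𝓘(ℝ, EP) (fun y : P => g • y) 0 1 (D.A j) q).symm)
      rw [D.invariant i j g q h1 h2 X, extD_zeroForm _ (Q.contMDiffAt_S_right i j h1 h2)]
      rfl)
  refine h.trans (congrArg (fun α => α * MF.const (Q.S i j (g, p))) ?_)
  rw [extDF_pbF _ _ hg (D.smooth_field hj)]
  exact (D.pbF_curv j (fun y => g • y) p).symm

end GaugeConnection

end Gauge

section ZeroForm

variable {E : Type*} [NormedAddCommGroup E] [NormedSpace ℝ E] {S : Type*} [TopologicalSpace S]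
  (I : ModelWithCorners ℝ E S) {N : Type*} [TopologicalSpace N] [ChartedSpace S N]
  {F : Type*} [NormedAddCommGroup F] [NormedSpace ℝ F] [I.Boundaryless] [IsManifold I ∞ N]

theorem extD_zeroForm_of_mdifferentiableAt {s : N → F} {x : N}
    (hs : MDifferentiableAt I 𝓘(ℝ, F) s x) (v : Fin 1 → TangentSpace I x) :
    extD I (zeroForm I s) x v = dvec I s x (v 0) := by
  have e : chartRep I (zeroForm I s) x = fun y =>
      ContinuousAlternatingMap.constOfIsEmptyLIE ℝ E F (Fin 0) (chartMap I 𝓘(ℝ, F) s x y) := rfl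
  have hd : DifferentiableAt ℝ (chartMap I 𝓘(ℝ, F) s x) (extChartAt I x x) := by
    have h := hs.differentiableWithinAt_writtenInExtChartAt
    rw [I.range_eq_univ, differentiableWithinAt_univ] at h
    exact h
  have hf : fderiv ℝ (chartRep I (zeroForm I s) x) (extChartAt I x x) =
      ((ContinuousAlternatingMap.constOfIsEmptyLIE ℝ E F (Fin 0)).toContinuousLinearEquiv :
        F →L[ℝ] E [⋀^Fin 0]→L[ℝ] F) ∘L fderiv ℝ (chartMap I 𝓘(ℝ, F) s x) (extChartAt I x x) := by
    rw [e]
    exact (((ContinuousAlternatingMap.constOfIsEmptyLIE ℝ E F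
      (Fin 0)).toContinuousLinearEquiv.hasFDerivAt).comp _ hd.hasFDerivAt).fderiv
  rw [extD_eq]
  refine Eq.trans ?_ (mfderiv_eq_fderiv_chartMap I 𝓘(ℝ, F) hs (v 0)).symm
  rw [extDeriv, hf]
  refine (ContinuousAlternatingMap.alternatizeUncurryFin_apply (E := E) _ _).trans ?_
  refine (Fin.sum_univ_one _).trans ?_
  change (-1 : ℤ) ^ ((0 : Fin 1) : ℕ) • fderiv ℝ (chartMap I 𝓘(ℝ, F) s x) (extChartAt I x x) (v 0) = _
  rw [Fin.val_zero, pow_zero, one_smul]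

end ZeroForm

section Gauge

variable {EG : Type*} [NormedAddCommGroup EG] [NormedSpace ℝ EG]
  {G : Type*} [TopologicalSpace G] [ChartedSpace EG G] [Group G] [LieGroup 𝓘(ℝ, EG) ∞ G]
  {EP : Type*} [NormedAddCommGroup EP] [NormedSpace ℝ EP]
  {P : Type*} [TopologicalSpace P] [ChartedSpace EP P] [IsManifold 𝓘(ℝ, EP) ∞ P]
  [MulAction G P]
  {EM : Type*} [NormedAddCommGroup EM] [NormedSpace ℝ EM]
  {M : Type*} [TopologicalSpace M] [ChartedSpace EM M] [IsManifold 𝓘(ℝ, EM) ∞ M]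
  [MulAction G M] [ContMDiffSMul 𝓘(ℝ, EG) 𝓘(ℝ, EM) ∞ G M]
  {H : Type*} [NormedAddCommGroup H] [InnerProductSpace ℂ H] [CompleteSpace H]
  {B : EquivPUBundle EG G EM M EP P H}
  {𝒜 : Type*} [NormedRing 𝒜] [NormedAlgebra ℝ 𝒜] {ι : Type*}
  {Q : GaugeBundle B 𝒜 ι} {θ : B.GerbeConnection} {c : ℂ →L[ℝ] 𝒜}
  (D : GaugeConnection Q θ c) (κ : EquivPUBundle.EquivCurving θ)
  {φ : P → P} {w : P → unitary (H →L[ℂ] H)} {q : P} {i j : ι}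

theorem LiftAt.contMDiffAt_Psi (Q : GaugeBundle B 𝒜 ι) (h : LiftAt B ∞ φ w q) (hi : φ q ∈ Q.dom i)
    (hj : q ∈ Q.dom j) :
    ContMDiffAt 𝓘(ℝ, EP) 𝓘(ℝ, 𝒜) ∞ (fun z => Q.Psi i j (φ z) (w z)) q := by
  obtain ⟨y, hy, hy0, hyw, -⟩ := exists_unitary_chart le_rfl (by simp) h.lift
  have hΨ := Q.contMDiffAt_Psi i j (u := w q) hi (by rwa [h.act_eq.self_of_nhds])
  rw [← hy0] at hΨ
  refine (ContMDiffAt.comp q (f := fun z => (φ z, y z)) hΨ (h.base.prodMk hy)).congr_of_eventuallyEq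
    (hyw.mono fun z hz => ?_)
  simp only [Function.comp]
  rw [← hz]

namespace GaugeConnection

theorem gauge_lift (h : LiftAt B 1 φ w q) (hi : φ q ∈ Q.dom i) (hj : q ∈ Q.dom j) :
    MDifferentiableAt 𝓘(ℝ, EP) 𝓘(ℝ, 𝒜) (fun z => Q.Psi i j (φ z) (w z)) q ∧
    ∀ Y : TangentSpace 𝓘(ℝ, EP) q,
      Q.Psi i j (φ q) (w q) * (D.A j q (fun _ => Y) + c (pb 𝓘(ℝ, EP)
        (𝓘(ℝ, EP).prod 𝓘(ℝ, H →L[ℂ] H)) (liftMap φ w) θ.form q (fun _ => Y))) =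
      D.A i (φ q) (fun _ => mfderiv 𝓘(ℝ, EP) 𝓘(ℝ, EP) φ q Y) * Q.Psi i j (φ q) (w q) +
        dvec 𝓘(ℝ, EP) (fun z => Q.Psi i j (φ z) (w z)) q Y := by
  have hq := h.act_eq.self_of_nhds
  obtain ⟨y, hy, hy0, hyw, hΓ, hact⟩ := h.exists_chart
  have hφ := h.base.mdifferentiableAt one_ne_zero
  have hj' : B.act (φ q) (w q) ∈ Q.dom j := by rwa [hq]
  have hΨ := (Q.contMDiffAt_Psi i j (u := w q) hi hj').mdifferentiableAt (by simp)
  have e : (fun z => Q.Psi i j (φ z) (w z)) =ᶠ[𝓝 q] fun z =>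
      (fun x : P × selfAdjoint (H →L[ℂ] H) => Q.Psi i j x.1 (w q * selfAdjoint.expUnitary x.2))
        (φ z, y z) := hyw.mono fun z hz => by simp only [hz]
  refine ⟨?_, fun Y => ?_⟩
  · have hΨ' := hΨ
    rw [← hy0] at hΨ'
    exact (MDifferentiableAt.comp q (f := fun z => (φ z, y z)) hΨ'
      (hφ.prodMk hy)).congr_of_eventuallyEq e
  · have h1 := D.compatible i j (φ q) (w q) hi hj' (mfderiv 𝓘(ℝ, EP) 𝓘(ℝ, EP) φ q Y)
      (mfderiv 𝓘(ℝ, EP) 𝓘(ℝ, selfAdjoint (H →L[ℂ] H)) y q Y)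
    have h2 := mfderiv_comp_prodMk hφ hy hy0 hΨ e Y
    refine Eq.trans ?_ (h1.trans (congrArg (HAdd.hAdd (_ : 𝒜)) h2.symm))
    congr 2
    · exact (rawForm_congr (D.A j) hq fun _ => hact Y).symm
    · congr 1
      exact rawForm_congr (j := 1) θ.form (a := (φ q, (w q : H →L[ℂ] H))) rfl fun _ => hΓ Y

theorem curv_descends (hc : ∀ z a, c z * a = a * c z) (h : LiftAt B ∞ φ w q) (hi : φ q ∈ Q.dom i)
    (hj : q ∈ Q.dom j) :
    MF.const (Q.Psi i j (φ q) (w q)) *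
        (D.curv j q + MF.single 0 2 (c.compContinuousAlternatingMap (κ.f q))) =
      (pbF 𝓘(ℝ, EP) 𝓘(ℝ, EP) φ (D.curv i) q + MF.single 0 2 (c.compContinuousAlternatingMap
        (pb 𝓘(ℝ, EP) 𝓘(ℝ, EP) φ κ.f q))) * MF.const (Q.Psi i j (φ q) (w q)) := by
  have hΓ := h.contMDiffAt_liftMap
  have hθ : SmoothFormAt _ θ.form (liftMap φ w q) := θ.smooth (φ q) (w q)
  let lam : RawForm 𝓘(ℝ, EP) P ℂ 1 :=
    pb 𝓘(ℝ, EP) (𝓘(ℝ, EP).prod 𝓘(ℝ, H →L[ℂ] H)) (liftMap φ w) θ.form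
  let l : RawForm 𝓘(ℝ, EP) P 𝒜 1 := fun z => c.compContinuousAlternatingMap (lam z)
  have hlam : SmoothFormAt 𝓘(ℝ, EP) lam q := SmoothFormAt.pb _ _ hΓ hθ
  have hl : SmoothFormAt 𝓘(ℝ, EP) l q := SmoothFormAt.map _ hlam c
  have hdl : extD 𝓘(ℝ, EP) l q = c.compContinuousAlternatingMap (κ.f q) -
      c.compContinuousAlternatingMap (pb 𝓘(ℝ, EP) 𝓘(ℝ, EP) φ κ.f q) := by
    rw [extD_map _ (hlam.formContDiffAt.of_le (by simp)), extD_pb _ _ (hΓ.of_le two_le_infty)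
      (hθ.formContDiffAt.of_le (by simp)),
      (h.of_le (le_trans (by norm_num) two_le_infty)).pb_curvature κ]
    ext v
    exact map_sub c _ _
  have hanti : ∀ β : MF (TangentSpace 𝓘(ℝ, EP) q) 𝒜,
      MF.single 0 1 (l q) * β = MF.eps β * MF.single 0 1 (l q) := by
    refine MF.mul_comm_odd (fun k' j' v a => ?_) (MF.eps_single_one _ _)
    by_cases hk : k' = 0 ∧ j' = 1
    · obtain ⟨rfl, rfl⟩ := hk
      rw [MF.single_apply_same]
      exact hc _ _
    · rw [MF.single_apply_of_ne hk]
      exact (zero_mul a).trans (mul_zero a).symm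
  have hll : MF.single 0 1 (l q) * MF.single 0 1 (l q) = 0 := by
    have h1 := hanti (MF.single 0 1 (l q))
    rw [MF.eps_single_one, neg_mul, eq_neg_iff_add_eq_zero, ← two_smul ℝ, smul_eq_zero] at h1
    exact h1.resolve_left two_ne_zero
  have hla := hanti (D.field j q)
  rw [eps_field] at hla
  have hfun : (fun z => D.field j z + MF.single 0 1 (l z)) =
      fun z => MF.single 0 1 (D.A j z + l z) := funext fun z => (MF.single_add _ _ _ _).symm
  have h1 := gauge_curvature 𝓘(ℝ, EP) (x := q) (a := pbF 𝓘(ℝ, EP) 𝓘(ℝ, EP) φ (D.field i))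
    (b := fun z => D.field j z + MF.single 0 1 (l z))
    (s := fun z => MF.const (Q.Psi i j (φ z) (w z)))
    (SmoothFieldAt.pbF _ _ h.base (D.smooth_field hi))
    (SmoothFieldAt.add _ (D.smooth_field hj) (SmoothFieldAt.single _ hl))
    (SmoothFieldAt.const _ (h.contMDiffAt_Psi Q hi hj))
    (by rw [pbF, MF.eps_comp, eps_field, map_neg]) (MF.eps_const _) (by
      filter_upwards [h.eventually, (Q.isOpen_dom j).mem_nhds hj,
        h.base.continuousAt.preimage_mem_nhds ((Q.isOpen_dom i).mem_nhds hi)] with z hz hzj hzi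
      obtain ⟨hd, hg⟩ := D.gauge_lift hz hzi hzj
      rw [extDF_const]
      refine Eq.trans (congrArg (fun α => MF.const (Q.Psi i j (φ z) (w z)) * α) (congrFun hfun z)) ?_
      refine (gauge_single fun X => ?_).trans (congrArg
        (fun α => α * MF.const (Q.Psi i j (φ z) (w z)) + _)
        (pbF_single 𝓘(ℝ, EP) 𝓘(ℝ, EP) φ 0 1 (D.A i) z).symm)
      rw [extD_zeroForm_of_mdifferentiableAt _ hd]
      exact hg X)
  rw [extDF_pbF _ _ h.base (D.smooth_field hi), ← pbF_curv,
    extDF_add _ (D.smooth_field hj) (SmoothFieldAt.single _ hl), extDF_single, hdl] at h1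
  have h2 : (D.field j q + MF.single 0 1 (l q)) * (D.field j q + MF.single 0 1 (l q)) =
      D.field j q * D.field j q := by
    rw [mul_add, add_mul, add_mul, hll, hla]
    noncomm_ring
  rw [h2] at h1
  have hcomm : MF.const (Q.Psi i j (φ q) (w q)) * MF.single 0 2 (c.compContinuousAlternatingMap
      (pb 𝓘(ℝ, EP) 𝓘(ℝ, EP) φ κ.f q)) = MF.single 0 2 (c.compContinuousAlternatingMap
      (pb 𝓘(ℝ, EP) 𝓘(ℝ, EP) φ κ.f q)) * MF.const (Q.Psi i j (φ q) (w q)) := by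
    rw [MF.const_mul_single, MF.single_mul_const]
    congr 1
    ext v
    exact (hc _ _).symm
  rw [add_mul, ← h1, ← hcomm, ← mul_add, curv]
  congr 1
  have e : ∀ x y : TangentSpace 𝓘(ℝ, EP) q [⋀^Fin 2]→L[ℝ] 𝒜,
      MF.single 0 (1 + 1) (x - y) = MF.single 0 2 x - MF.single 0 2 y := fun x y =>
    eq_sub_of_add_eq ((MF.single_add _ _ _ _).symm.trans (by rw [sub_add_cancel]))
  rw [e]
  abel

theorem dvec_mul_const {E : Type*} [NormedAddCommGroup E] [NormedSpace ℝ E] {S : Type*}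
    [TopologicalSpace S] {I : ModelWithCorners ℝ E S} {N : Type*} [TopologicalSpace N]
    [ChartedSpace S N] [I.Boundaryless] [IsManifold I ∞ N] {s : N → 𝒜} {x : N}
    (hs : ContMDiffAt I 𝓘(ℝ, 𝒜) ∞ s x) (a : 𝒜) (Y : TangentSpace I x) :
    dvec I (fun y => s y * a) x Y = dvec I s x Y * a := by
  refine (dvec_mul hs contMDiffAt_const Y).trans ?_
  have : dvec I (fun _ : N => a) x Y = 0 := by
    rw [dvec, mfderiv_const]
    rfl
  rw [this, mul_zero, add_zero]

theorem A_neg (i : ι) (p : P) (X : EP) :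
    D.A i p (fun _ => (-X : EP)) = -D.A i p (fun _ => X) := by
  have h := congrArg (fun α : EP [⋀^Fin 0]→L[ℝ] 𝒜 => α ![]) (contract_neg_vec (V := EP) X (D.A i p))
  refine Eq.trans ?_ (h.trans (congrArg Neg.neg ?_))
  · refine rawForm_congr (j := 1) (D.A i) rfl fun i => ?_
    fin_cases i
    rfl
  · refine rawForm_congr (j := 1) (D.A i) rfl fun i => ?_
    fin_cases i
    rfl

theorem moment_equivariant {g : G} {p : P} (hi : p ∈ Q.dom i) (hj : g • p ∈ Q.dom j)
    (ξ : GroupLieAlgebra 𝓘(ℝ, EG) G) : Q.S i j (g, p) * D.moment i ξ p =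
      D.moment j (Ad g ξ) (g • p) * Q.S i j (g, p) := by
  have := B.smul_smooth
  have hi1 : (1 : G) • p ∈ Q.dom i := by rwa [one_smul]
  have hj1 : (1 : G) • g • p ∈ Q.dom j := by rwa [one_smul]
  have horb : ContMDiffAt 𝓘(ℝ, EG) 𝓘(ℝ, EP) ∞ (fun h : G => h • p) 1 :=
    (contMDiff_smul_right EG EP p).contMDiffAt
  have hcj : ContMDiffAt 𝓘(ℝ, EG) 𝓘(ℝ, EG) ∞ (fun h : G => g * h * g⁻¹) 1 :=
    (contMDiff_conj g).contMDiffAt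
  have e1 : g * 1 * g⁻¹ = 1 := by simp
  have hS1 : ContMDiffAt 𝓘(ℝ, EG) 𝓘(ℝ, 𝒜) ∞ (fun h : G => Q.S j j (h, g • p)) 1 :=
    Q.contMDiffAt_S_left j j hj hj1
  have hS2 : ContMDiffAt 𝓘(ℝ, EP) 𝓘(ℝ, 𝒜) ∞ (fun y : P => Q.S i j (g, y)) p :=
    Q.contMDiffAt_S_right i j hi hj
  have hS1' : ContMDiffAt 𝓘(ℝ, EG) 𝓘(ℝ, 𝒜) ∞ (fun h : G => Q.S j j (g * h * g⁻¹, g • p)) 1 := by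
    refine ContMDiffAt.comp (1 : G) (g := fun h : G => Q.S j j (h, g • p)) ?_ hcj
    simpa only [e1] using hS1
  have hS2' : ContMDiffAt 𝓘(ℝ, EG) 𝓘(ℝ, 𝒜) ∞ (fun h : G => Q.S i j (g, h • p)) 1 := by
    refine ContMDiffAt.comp (1 : G) (g := fun y : P => Q.S i j (g, y)) ?_ horb
    simpa only [one_smul] using hS2
  have hS3 : ContMDiffAt 𝓘(ℝ, EG) 𝓘(ℝ, 𝒜) ∞ (fun h : G => Q.S i i (h, p)) 1 :=
    Q.contMDiffAt_S_left i i hi hi1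
  have hev : (fun h : G => Q.S j j (g * h * g⁻¹, g • p) * Q.S i j (g, p)) =ᶠ[𝓝 1]
      fun h => Q.S i j (g, h • p) * Q.S i i (h, p) := by
    have hc2 : ContinuousAt (fun h : G => g • h • p) 1 :=
      ((contMDiff_smul_left EG EP g).continuous.continuousAt).comp horb.continuousAt
    filter_upwards [horb.continuousAt.preimage_mem_nhds ((Q.isOpen_dom i).mem_nhds hi1),
      hc2.preimage_mem_nhds ((Q.isOpen_dom j).mem_nhds (by simpa using hj))] with h h1 h2
    have e : g * h * g⁻¹ * g = g * h := by group
    have h3 : (g * h) • p ∈ Q.dom j := by rw [mul_smul]; exact h2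
    rw [← Q.S_mul i j j (g * h * g⁻¹) g p hi hj (by rwa [e]), e, Q.S_mul i i j g h p hi h1 h3]
  have h1 := mfderiv_congr_vec (I := 𝓘(ℝ, EG)) (I' := 𝓘(ℝ, 𝒜)) hev ξ
  have h2 : dvec 𝓘(ℝ, EG) (fun h : G => Q.S j j (g * h * g⁻¹, g • p)) 1 ξ =
      dvec 𝓘(ℝ, EG) (fun h : G => Q.S j j (h, g • p)) 1 (Ad g ξ) :=
    mfderiv_comp_vec (f := fun h : G => g * h * g⁻¹) e1 (hS1.mdifferentiableAt (by simp))
      (hcj.mdifferentiableAt (by simp)) ξ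
  have h3 : dvec 𝓘(ℝ, EG) (fun h : G => Q.S i j (g, h • p)) 1 ξ =
      -dvec 𝓘(ℝ, EP) (fun y : P => Q.S i j (g, y)) p (fundVF ξ p) := by
    refine (mfderiv_comp_vec (f := fun h : G => h • p) (one_smul G p)
      (hS2.mdifferentiableAt (by simp)) (horb.mdifferentiableAt (by simp)) ξ).trans ?_
    refine Eq.trans ?_ (map_neg (mfderiv 𝓘(ℝ, EP) 𝓘(ℝ, 𝒜) (fun y : P => Q.S i j (g, y)) p) _)
    exact congrArg (fun v : EP => (mfderiv 𝓘(ℝ, EP) 𝓘(ℝ, 𝒜) (fun y : P => Q.S i j (g, y)) p v : 𝒜))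
      (neg_neg (mfderiv 𝓘(ℝ, EG) 𝓘(ℝ, EP) (fun h : G => h • p) 1 ξ : EP)).symm
  have h4 := (dvec_mul_const hS1' (Q.S i j (g, p)) ξ).symm.trans (h1.trans (dvec_mul hS2' hS3 ξ))
  rw [h2, h3, Q.S_one i p hi, mul_one, one_smul] at h4
  have h5 := D.invariant i j g p hi hj (fundVF ξ p)
  have h6 : D.A j (g • p) (fun _ => mfderiv 𝓘(ℝ, EP) 𝓘(ℝ, EP) (fun q : P => g • q) p (fundVF ξ p)) =
      D.A j (g • p) (fun _ => fundVF (Ad g ξ) (g • p)) :=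
    rawForm_congr (j := 1) (D.A j) rfl fun _ => mfderiv_smul_fundVF (E := EP) g ξ p
  rw [h6] at h5
  rw [moment, moment, mul_sub, sub_mul, h4, h5]
  abel

theorem moment_descends (hc : ∀ z a, c z * a = a * c z) {p : P} {u : unitary (H →L[ℂ] H)}
    (hi : p ∈ Q.dom i) (hj : B.act p u ∈ Q.dom j) (ξ : GroupLieAlgebra 𝓘(ℝ, EG) G) :
    Q.Psi i j p u * (D.moment j ξ (B.act p u) - c (κ.muL ξ (B.act p u))) =
      (D.moment i ξ p - c (κ.muL ξ p)) * Q.Psi i j p u := by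
  have := B.smul_smooth
  have hi1 : (1 : G) • p ∈ Q.dom i := by rwa [one_smul]
  have hj1 : (1 : G) • B.act p u ∈ Q.dom j := by rwa [one_smul]
  have hSi := Q.contMDiffAt_S_left i i hi hi1
  have hSj := Q.contMDiffAt_S_left j j hj hj1
  have hΨ := Q.contMDiffAt_Psi i j (u := u) hi hj
  have horb : ContMDiffAt 𝓘(ℝ, EG) 𝓘(ℝ, EP) ∞ (fun h : G => h • p) 1 :=
    (contMDiff_smul_right EG EP p).contMDiffAt
  have hΨ1 : ContMDiffAt 𝓘(ℝ, EG) 𝓘(ℝ, 𝒜) ∞ (fun h : G => Q.Psi i j (h • p) u) 1 := by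
    have hΨ' : ContMDiffAt (𝓘(ℝ, EP).prod 𝓘(ℝ, selfAdjoint (H →L[ℂ] H))) 𝓘(ℝ, 𝒜) ∞
      (fun x : P × selfAdjoint (H →L[ℂ] H) => Q.Psi i j x.1 (u * selfAdjoint.expUnitary x.2))
      ((1 : G) • p, 0) := by rwa [one_smul]
    have h := ContMDiffAt.comp (1 : G) (f := fun h : G => (h • p, (0 : selfAdjoint (H →L[ℂ] H))))
      hΨ' (horb.prodMk contMDiffAt_const)
    refine h.congr_of_eventuallyEq (Filter.Eventually.of_forall fun h => ?_)
    simp only [Function.comp, selfAdjoint.expUnitary_zero, mul_one]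
  have hev : (fun h : G => Q.S i i (h, p) * Q.Psi i j p u) =ᶠ[𝓝 1]
      fun h => Q.Psi i j (h • p) u * Q.S j j (h, B.act p u) := by
    have hc2 : ContinuousAt (fun h : G => h • B.act p u) 1 :=
      (contMDiff_smul_right EG EP (B.act p u)).continuous.continuousAt
    filter_upwards [horb.continuousAt.preimage_mem_nhds ((Q.isOpen_dom i).mem_nhds hi1),
      hc2.preimage_mem_nhds ((Q.isOpen_dom j).mem_nhds hj1)] with h h1 h2
    exact Q.S_Psi i j i j h p u hi hj h1 (by rw [← B.act_equivariant]; exact h2)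
  have h1 := mfderiv_congr_vec (I := 𝓘(ℝ, EG)) (I' := 𝓘(ℝ, 𝒜)) hev ξ
  have h2 : dvec 𝓘(ℝ, EG) (fun h : G => Q.Psi i j (h • p) u) 1 ξ =
      dvec (𝓘(ℝ, EP).prod 𝓘(ℝ, selfAdjoint (H →L[ℂ] H)))
        (fun x : P × selfAdjoint (H →L[ℂ] H) => Q.Psi i j x.1 (u * selfAdjoint.expUnitary x.2))
        (p, 0) ((-fundVF ξ p, 0) : EP × selfAdjoint (H →L[ℂ] H)) :=
    mfderiv_orbit_comp (hΨ.mdifferentiableAt (by simp)) (fun g => by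
      simp only [selfAdjoint.expUnitary_zero, mul_one]) ξ
  have h4 := (dvec_mul_const hSi (Q.Psi i j p u) ξ).symm.trans (h1.trans (dvec_mul hΨ1 hSj ξ))
  rw [h2, Q.S_one j _ hj, mul_one, one_smul] at h4
  have h5 := D.compatible i j p u hi hj (-fundVF ξ p : EP) 0
  have h6 : D.A j (B.act p u) (fun _ => B.dact p u (-fundVF ξ p : EP) 0) =
      -D.A j (B.act p u) (fun _ => fundVF ξ (B.act p u)) :=
    (rawForm_congr (j := 1) (D.A j) rfl fun _ => dact_neg_fundVF B ξ p u).trans (D.A_neg _ _ _)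
  have h7 : D.A i p (fun _ => (-fundVF ξ p : EP)) = -D.A i p (fun _ => fundVF ξ p) := D.A_neg _ _ _
  have h8 : θ.form (p, (u : H →L[ℂ] H)) (fun _ => EquivPUBundle.tvec p u (-fundVF ξ p : EP) 0) =
      κ.muL ξ p - κ.muL ξ (B.act p u) := (form_tvec_neg p u _).trans (κ.moment_eq p u ξ)
  rw [h6, h7, h8, map_sub] at h5
  have h9 := sub_eq_iff_eq_add'.2 h5
  rw [moment, moment, sub_sub, mul_sub, sub_sub (dvec _ _ _ _), sub_mul _ _ (Q.Psi i j p u), h4,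
    ← h9, add_mul, hc (κ.muL ξ p) (Q.Psi i j p u)]
  noncomm_ring

end GaugeConnection

end Gauge

/-! ### The differential of the moment map -/

section Gauge

variable {EG : Type*} [NormedAddCommGroup EG] [NormedSpace ℝ EG]
  {G : Type*} [TopologicalSpace G] [ChartedSpace EG G] [Group G] [LieGroup 𝓘(ℝ, EG) ∞ G]
  {EP : Type*} [NormedAddCommGroup EP] [NormedSpace ℝ EP]
  {P : Type*} [TopologicalSpace P] [ChartedSpace EP P] [IsManifold 𝓘(ℝ, EP) ∞ P]
  [MulAction G P]
  {EM : Type*} [NormedAddCommGroup EM] [NormedSpace ℝ EM]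
  {M : Type*} [TopologicalSpace M] [ChartedSpace EM M] [IsManifold 𝓘(ℝ, EM) ∞ M]
  [MulAction G M] [ContMDiffSMul 𝓘(ℝ, EG) 𝓘(ℝ, EM) ∞ G M]
  {H : Type*} [NormedAddCommGroup H] [InnerProductSpace ℂ H] [CompleteSpace H]
  {B : EquivPUBundle EG G EM M EP P H}
  {𝒜 : Type*} [NormedRing 𝒜] [NormedAlgebra ℝ 𝒜] {ι : Type*}
  {Q : GaugeBundle B 𝒜 ι} {θ : B.GerbeConnection} {c : ℂ →L[ℝ] 𝒜}
  (D : GaugeConnection Q θ c) {i : ι} {p : P}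

namespace GaugeConnection

/-- The pullback of the connection form along the action map, in the frame that is transported
along the action. -/
def actForm (i : ι) : RawForm (𝓘(ℝ, EG).prod 𝓘(ℝ, EP)) (G × P) 𝒜 1 := fun x =>
  ((ContinuousLinearMap.mul ℝ 𝒜) (Q.S i i (x.1⁻¹, x.1 • x.2))).compContinuousAlternatingMap
    (((ContinuousLinearMap.mul ℝ 𝒜).flip (Q.S i i x)).compContinuousAlternatingMap
      (pb (𝓘(ℝ, EG).prod 𝓘(ℝ, EP)) 𝓘(ℝ, EP) (fun x : G × P => x.1 • x.2) (D.A i) x) +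
    extD (𝓘(ℝ, EG).prod 𝓘(ℝ, EP)) (zeroForm _ (Q.S i i)) x)

theorem single_actForm (i : ι) (x : G × P) : MF.single 0 1 (D.actForm i x) =
    MF.const (Q.S i i (x.1⁻¹, x.1 • x.2)) *
      (pbF (𝓘(ℝ, EG).prod 𝓘(ℝ, EP)) 𝓘(ℝ, EP) (fun x : G × P => x.1 • x.2) (D.field i) x *
        MF.const (Q.S i i x) +
        extDF (𝓘(ℝ, EG).prod 𝓘(ℝ, EP)) (fun y => MF.const (Q.S i i y)) x) := by
  have e : pbF (𝓘(ℝ, EG).prod 𝓘(ℝ, EP)) 𝓘(ℝ, EP) (fun x : G × P => x.1 • x.2) (D.field i) x =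
      _ := pbF_single (𝓘(ℝ, EG).prod 𝓘(ℝ, EP)) 𝓘(ℝ, EP) (fun x : G × P => x.1 • x.2) 0 1 (D.A i) x
  rw [e, extDF_const, MF.single_mul_const, ← MF.single_add, MF.const_mul_single]
  rfl

theorem S_inv_mul {g : G} (hi : p ∈ Q.dom i) (hg : g • p ∈ Q.dom i) :
    Q.S i i (g⁻¹, g • p) * Q.S i i (g, p) = 1 := by
  rw [← Q.S_mul i i i g⁻¹ g p hi hg (by simpa using hi), inv_mul_cancel, Q.S_one i p hi]

theorem S_mul_inv {g : G} (hi : p ∈ Q.dom i) (hg : g • p ∈ Q.dom i) :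
    Q.S i i (g, p) * Q.S i i (g⁻¹, g • p) = 1 := by
  have h := Q.S_mul i i i g g⁻¹ (g • p) hg (by simpa using hi) (by simpa using hg)
  rw [mul_inv_cancel, Q.S_one i _ hg, inv_smul_smul] at h
  exact h.symm

theorem contMDiffAt_S_inv {x : G × P} (hi : x.2 ∈ Q.dom i) (hg : x.1 • x.2 ∈ Q.dom i) :
    ContMDiffAt (𝓘(ℝ, EG).prod 𝓘(ℝ, EP)) 𝓘(ℝ, 𝒜) ∞
      (fun x : G × P => Q.S i i (x.1⁻¹, x.1 • x.2)) x := by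
  have := B.smul_smooth
  refine ContMDiffAt.comp x (g := Q.S i i) (f := fun x : G × P => (x.1⁻¹, x.1 • x.2))
    (Q.contMDiffAt_S i i (x := (x.1⁻¹, x.1 • x.2)) hg (by simpa using hi))
    (ContMDiffAt.prodMk ?_ (contMDiff_act EG G EP P).contMDiffAt)
  exact ((contMDiff_inv 𝓘(ℝ, EG) ∞ (G := G)).contMDiffAt).comp x contMDiffAt_fst

theorem smooth_actForm {x : G × P} (hi : x.2 ∈ Q.dom i) (hg : x.1 • x.2 ∈ Q.dom i) :
    SmoothFormAt (𝓘(ℝ, EG).prod 𝓘(ℝ, EP)) (D.actForm i) x := by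
  have := B.smul_smooth
  have hs := SmoothFieldAt.const (𝓘(ℝ, EG).prod 𝓘(ℝ, EP)) (Q.contMDiffAt_S i i hi hg)
  have h := SmoothFieldAt.mul _
    (SmoothFieldAt.const (𝓘(ℝ, EG).prod 𝓘(ℝ, EP)) (contMDiffAt_S_inv (Q := Q) hi hg))
    (SmoothFieldAt.add _ (SmoothFieldAt.mul _ (SmoothFieldAt.pbF _ 𝓘(ℝ, EP)
      (contMDiff_act EG G EP P).contMDiffAt (D.smooth_field hg)) hs) (SmoothFieldAt.extDF _ hs)) 0 1
  simp only [← single_actForm, MF.single_apply_same] at h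
  exact h

theorem actForm_apply {x : G × P} (hi : x.2 ∈ Q.dom i) (hg : x.1 • x.2 ∈ Q.dom i) (v : EG × EP) :
    D.actForm i x (fun _ => v) = Q.S i i (x.1⁻¹, x.1 • x.2) * (D.A i (x.1 • x.2) (fun _ =>
      mfderiv (𝓘(ℝ, EG).prod 𝓘(ℝ, EP)) 𝓘(ℝ, EP) (fun x : G × P => x.1 • x.2) x v) * Q.S i i x +
        dvec (𝓘(ℝ, EG).prod 𝓘(ℝ, EP)) (Q.S i i) x v) := by
  have h := extD_zeroForm (𝓘(ℝ, EG).prod 𝓘(ℝ, EP)) (Q.contMDiffAt_S i i hi hg) (fun _ => v)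
  exact congrArg (fun a => Q.S i i (x.1⁻¹, x.1 • x.2) * (D.A i (x.1 • x.2) (fun _ =>
      mfderiv (𝓘(ℝ, EG).prod 𝓘(ℝ, EP)) 𝓘(ℝ, EP) (fun x : G × P => x.1 • x.2) x v) * Q.S i i x +
        a)) h

theorem restrictSlice_actForm {g : G} (hi : p ∈ Q.dom i) (hg : g • p ∈ Q.dom i) :
    restrictSlice 𝓘(ℝ, EG) 𝓘(ℝ, EP) (D.actForm i) g p = D.A i p := by
  have := B.smul_smooth
  ext v
  have hv : v = fun _ => v 0 := funext fun i => by rw [Subsingleton.elim i 0]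
  rw [hv]
  refine (D.actForm_apply (x := (g, p)) hi hg ((0, v 0) : EG × EP)).trans ?_
  have h1 : D.A i (g • p) (fun _ => mfderiv (𝓘(ℝ, EG).prod 𝓘(ℝ, EP)) 𝓘(ℝ, EP)
      (fun x : G × P => x.1 • x.2) (g, p) ((0, v 0) : EG × EP)) =
      D.A i (g • p) (fun _ => mfderiv 𝓘(ℝ, EP) 𝓘(ℝ, EP) (fun q : P => g • q) p (v 0)) :=
    rawForm_congr (j := 1) (D.A i) rfl fun _ => mfderiv_act_zero_left (EP := EP) g p (v 0)
  have h2 : dvec (𝓘(ℝ, EG).prod 𝓘(ℝ, EP)) (Q.S i i) (g, p) ((0, v 0) : EG × EP) =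
      dvec 𝓘(ℝ, EP) (fun q => Q.S i i (g, q)) p (v 0) := by
    refine ((mfderiv_comp_prodMk (I := 𝓘(ℝ, EP)) (Φ := Q.S i i) (φ := fun _ : P => g)
      (y := fun q : P => q) mdifferentiableAt_const mdifferentiableAt_id rfl
      ((Q.contMDiffAt_S i i (x := (g, p)) hi hg).mdifferentiableAt (by simp))
      (Filter.Eventually.of_forall fun _ => rfl) (v 0)).trans ?_).symm
    refine congrArg (fun v : EG × EP => (mfderiv (𝓘(ℝ, EG).prod 𝓘(ℝ, EP)) 𝓘(ℝ, 𝒜) (Q.S i i)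
      (g, p) v : 𝒜)) (Prod.ext ?_ ?_)
    · exact congrArg (fun L : EP →L[ℝ] EG => L (v 0)) (mfderiv_const (I := 𝓘(ℝ, EP)))
    · exact congrArg (fun L : EP →L[ℝ] EP => L (v 0)) (mfderiv_id (I := 𝓘(ℝ, EP)))
  have h3 := D.invariant i i g p hi hg (v 0)
  rw [h1, h2, ← h3, ← mul_assoc, S_inv_mul hi hg, one_mul]

theorem slice_actForm (hi : p ∈ Q.dom i) (ξ : GroupLieAlgebra 𝓘(ℝ, EG) G) :
    slice 𝓘(ℝ, EG) 𝓘(ℝ, EP) (D.actForm i) 1 ξ p = zeroForm 𝓘(ℝ, EP) (D.moment i ξ) p := by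
  have := B.smul_smooth
  have hg : (1 : G) • p ∈ Q.dom i := by rwa [one_smul]
  ext v
  have e : slice 𝓘(ℝ, EG) 𝓘(ℝ, EP) (D.actForm i) 1 ξ p v =
      D.actForm i (1, p) (fun _ => ((ξ, 0) : EG × EP)) := by
    refine rawForm_congr (j := 1) (D.actForm i) rfl fun l => ?_
    fin_cases l
    rfl
  refine e.trans ((D.actForm_apply (x := (1, p)) hi hg ((ξ, 0) : EG × EP)).trans ?_)
  have h1 : D.A i ((1 : G) • p) (fun _ => mfderiv (𝓘(ℝ, EG).prod 𝓘(ℝ, EP)) 𝓘(ℝ, EP)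
      (fun x : G × P => x.1 • x.2) (1, p) ((ξ, 0) : EG × EP)) =
      -D.A i p (fun _ => fundVF ξ p) :=
    (rawForm_congr (j := 1) (D.A i) (one_smul G p) fun _ =>
      (mfderiv_act_one (E := EP) p ξ 0).trans (add_zero (M := EP) _)).trans (D.A_neg _ _ _)
  have h2 : dvec (𝓘(ℝ, EG).prod 𝓘(ℝ, EP)) (Q.S i i) (1, p) ((ξ, 0) : EG × EP) =
      dvec 𝓘(ℝ, EG) (fun g => Q.S i i (g, p)) 1 ξ := by
    refine ((mfderiv_comp_prodMk (I := 𝓘(ℝ, EG)) (Φ := Q.S i i) (φ := fun g : G => g)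
      (y := fun _ : G => p) mdifferentiableAt_id mdifferentiableAt_const rfl
      ((Q.contMDiffAt_S i i (x := (1, p)) hi hg).mdifferentiableAt (by simp))
      (Filter.Eventually.of_forall fun _ => rfl) ξ).trans ?_).symm
    refine congrArg (fun v : EG × EP => (mfderiv (𝓘(ℝ, EG).prod 𝓘(ℝ, EP)) 𝓘(ℝ, 𝒜) (Q.S i i)
      (1, p) v : 𝒜)) (Prod.ext ?_ ?_)
    · exact congrArg (fun L : EG →L[ℝ] EG => L ξ) (mfderiv_id (I := 𝓘(ℝ, EG)))
    · exact congrArg (fun L : EG →L[ℝ] EP => L ξ) (mfderiv_const (I := 𝓘(ℝ, EG)))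
  simp only [inv_one, one_smul] at h1 ⊢
  rw [h1, h2, Q.S_one i p hi, one_mul, mul_one, neg_add_eq_sub]
  rfl

theorem smooth_zeroForm_moment (hi : p ∈ Q.dom i) (ξ : GroupLieAlgebra 𝓘(ℝ, EG) G) :
    SmoothFormAt 𝓘(ℝ, EP) (zeroForm 𝓘(ℝ, EP) (D.moment i ξ)) p := by
  refine SmoothFormAt.congr _ (SmoothFormAt.slice 𝓘(ℝ, EG) 𝓘(ℝ, EP) (q := (1 : G)) ξ
    (D.smooth_actForm (x := (1, p)) hi (by rwa [one_smul]))) ?_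
  filter_upwards [(Q.isOpen_dom i).mem_nhds hi] with q hq
  exact (D.slice_actForm hq ξ).symm

theorem curv_actForm (hi : p ∈ Q.dom i) :
    extDF (𝓘(ℝ, EG).prod 𝓘(ℝ, EP)) (fun x => MF.single 0 1 (D.actForm i x)) (1, p) +
      MF.single 0 1 (D.actForm i (1, p)) * MF.single 0 1 (D.actForm i (1, p)) =
    pbF (𝓘(ℝ, EG).prod 𝓘(ℝ, EP)) 𝓘(ℝ, EP) (fun x : G × P => x.1 • x.2) (D.curv i) (1, p) := by
  have := B.smul_smooth
  have hg : (1 : G) • p ∈ Q.dom i := by rwa [one_smul]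
  have hact : ContMDiffAt (𝓘(ℝ, EG).prod 𝓘(ℝ, EP)) 𝓘(ℝ, EP) ∞ (fun x : G × P => x.1 • x.2) (1, p) :=
    (contMDiff_act EG G EP P).contMDiffAt
  have h1 := gauge_curvature (𝓘(ℝ, EG).prod 𝓘(ℝ, EP)) (x := ((1 : G), p))
    (a := pbF (𝓘(ℝ, EG).prod 𝓘(ℝ, EP)) 𝓘(ℝ, EP) (fun x : G × P => x.1 • x.2) (D.field i))
    (b := fun x => MF.single 0 1 (D.actForm i x)) (s := fun x => MF.const (Q.S i i x))
    (SmoothFieldAt.pbF _ _ hact (D.smooth_field hg))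
    (SmoothFieldAt.single _ (D.smooth_actForm (x := (1, p)) hi hg))
    (SmoothFieldAt.const _ (Q.contMDiffAt_S i i (x := (1, p)) hi hg))
    (by rw [pbF, MF.eps_comp, eps_field, map_neg]) (MF.eps_const _) (by
      have hn : {x : G × P | x.2 ∈ Q.dom i ∧ x.1 • x.2 ∈ Q.dom i} ∈ 𝓝 ((1 : G), p) :=
        Filter.inter_mem (continuousAt_snd.preimage_mem_nhds ((Q.isOpen_dom i).mem_nhds hi))
          (hact.continuousAt.preimage_mem_nhds ((Q.isOpen_dom i).mem_nhds hg))
      filter_upwards [hn] with x hx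
      rw [single_actForm, ← mul_assoc, MF.const_mul_const, S_mul_inv hx.1 hx.2, MF.const_one, one_mul])
  rw [Q.S_one i p hi, MF.const_one, one_mul, mul_one, extDF_pbF _ _ hact (D.smooth_field hg)] at h1
  refine h1.trans ?_
  have e := map_mul (MF.comp (A := 𝒜) (mfderiv (𝓘(ℝ, EG).prod 𝓘(ℝ, EP)) 𝓘(ℝ, EP)
    (fun x : G × P => x.1 • x.2) (1, p))) (D.field i ((1 : G) • p)) (D.field i ((1 : G) • p))
  have e' := map_add (MF.comp (A := 𝒜) (mfderiv (𝓘(ℝ, EG).prod 𝓘(ℝ, EP)) 𝓘(ℝ, EP)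
    (fun x : G × P => x.1 • x.2) (1, p))) (extDF 𝓘(ℝ, EP) (D.field i) ((1 : G) • p))
    (D.field i ((1 : G) • p) * D.field i ((1 : G) • p))
  exact (e'.trans (congrArg (HAdd.hAdd _) e)).symm

theorem extD_moment (hi : p ∈ Q.dom i) (ξ : GroupLieAlgebra 𝓘(ℝ, EG) G)
    (Y : TangentSpace 𝓘(ℝ, EP) p) :
    extD 𝓘(ℝ, EP) (zeroForm 𝓘(ℝ, EP) (D.moment i ξ)) p (fun _ => Y) =
      D.curv i p 0 2 ![fundVF ξ p, Y] +
        (D.moment i ξ p * D.A i p (fun _ => Y) - D.A i p (fun _ => Y) * D.moment i ξ p) := by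
  have := B.smul_smooth
  have hg : (1 : G) • p ∈ Q.dom i := by rwa [one_smul]
  have hsm := D.smooth_actForm (x := (1, p)) hi hg
  have h1 := extD_slice 𝓘(ℝ, EG) 𝓘(ℝ, EP) (q := (1 : G)) ξ hsm (by
    have hc : ContinuousAt (fun h : G => h • p) 1 :=
      (contMDiff_smul_right EG EP p).continuous.continuousAt
    filter_upwards [hc.preimage_mem_nhds ((Q.isOpen_dom i).mem_nhds hg)] with g hg'
    rw [D.restrictSlice_actForm hi hg', D.restrictSlice_actForm hi hg])
  have h2 : extD 𝓘(ℝ, EP) (slice 𝓘(ℝ, EG) 𝓘(ℝ, EP) (D.actForm i) 1 ξ) p =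
      extD 𝓘(ℝ, EP) (zeroForm 𝓘(ℝ, EP) (D.moment i ξ)) p := by
    refine extD_congr _ ?_
    filter_upwards [(Q.isOpen_dom i).mem_nhds hi] with q hq
    exact D.slice_actForm hq ξ
  rw [h2] at h1
  have h3 := D.curv_actForm hi
  rw [extDF_single] at h3
  have h4 := congrArg (fun α : MF (EG × EP) 𝒜 =>
    α 0 2 ![((ξ, 0) : EG × EP), ((0, Y) : EG × EP)]) h3
  have h5 := MF.single_mul_self_apply (V := EG × EP) (D.actForm i (1, p)) ((ξ, 0) : EG × EP)
    ((0, Y) : EG × EP)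
  have h6 : D.actForm i (1, p) (fun _ => ((ξ, 0) : EG × EP)) = D.moment i ξ p := by
    refine Eq.trans ?_ (congrArg (fun α : EP [⋀^Fin 0]→L[ℝ] 𝒜 => α ![]) (D.slice_actForm hi ξ))
    refine rawForm_congr (j := 1) (D.actForm i) rfl fun l => ?_
    fin_cases l
    rfl
  have h7 : D.actForm i (1, p) (fun _ => ((0, Y) : EG × EP)) = D.A i p (fun _ => Y) :=
    congrArg (fun α : EP [⋀^Fin 1]→L[ℝ] 𝒜 => α (fun _ => Y)) (D.restrictSlice_actForm hi hg)
  replace h5 := h5.trans (congrArg₂ (HSub.hSub : 𝒜 → 𝒜 → 𝒜)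
    (congrArg₂ (HMul.hMul : 𝒜 → 𝒜 → 𝒜) h6 h7) (congrArg₂ (HMul.hMul : 𝒜 → 𝒜 → 𝒜) h7 h6))
  have h8 : extD (𝓘(ℝ, EG).prod 𝓘(ℝ, EP)) (D.actForm i) (1, p)
      ![((ξ, 0) : EG × EP), ((0, Y) : EG × EP)] +
      (D.moment i ξ p * D.A i p (fun _ => Y) - D.A i p (fun _ => Y) * D.moment i ξ p) =
      -D.curv i p 0 2 ![fundVF ξ p, Y] := by
    rw [← h5]
    refine Eq.trans ?_ (h4.trans ?_)
    · refine congrArg₂ (HAdd.hAdd : 𝒜 → 𝒜 → 𝒜) ?_ rfl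
      exact (congrArg (fun α : (EG × EP) [⋀^Fin 2]→L[ℝ] 𝒜 =>
        α ![((ξ, 0) : EG × EP), ((0, Y) : EG × EP)]) (MF.single_apply_same (V := EG × EP) 0 2
          (extD (𝓘(ℝ, EG).prod 𝓘(ℝ, EP)) (D.actForm i) (1, p)))).symm
    · refine Eq.trans ?_ (congrArg (fun α : EP [⋀^Fin 1]→L[ℝ] 𝒜 => α (fun _ => Y))
        (slice_pb_act (fun x => D.curv i x 0 2) ξ p)) |>.trans ?_
      · refine congrArg (D.curv i ((1 : G) • p) 0 2) (funext fun l => ?_)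
        fin_cases l <;> rfl
      · refine congrArg Neg.neg (congrArg (D.curv i p 0 2) (funext fun l => ?_))
        fin_cases l <;> rfl
  have h9 := congrArg (fun α : EP [⋀^Fin 1]→L[ℝ] 𝒜 => α (fun _ => Y)) h1
  refine h9.trans ?_
  have h10 : slice 𝓘(ℝ, EG) 𝓘(ℝ, EP) (extD (𝓘(ℝ, EG).prod 𝓘(ℝ, EP)) (D.actForm i)) 1 ξ p (fun _ => Y)
      = extD (𝓘(ℝ, EG).prod 𝓘(ℝ, EP)) (D.actForm i) (1, p)
      ![((ξ, 0) : EG × EP), ((0, Y) : EG × EP)] := by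
    refine rawForm_congr (j := 2) (extD (𝓘(ℝ, EG).prod 𝓘(ℝ, EP)) (D.actForm i)) rfl fun l => ?_
    fin_cases l <;> rfl
  refine (congrArg Neg.neg (h10.trans (eq_sub_of_add_eq h8))).trans ?_
  abel

/-- The moment map as a field of formal forms. -/
def mom (i : ι) (ξ : GroupLieAlgebra 𝓘(ℝ, EG) G) (x : P) : MF (TangentSpace 𝓘(ℝ, EP) x) 𝒜 :=
  MF.shift (MF.const (D.moment i ξ x))

theorem mom_eq_single (i : ι) (ξ : GroupLieAlgebra 𝓘(ℝ, EG) G) (x : P) :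
    D.mom i ξ x = MF.single 1 0 (zeroForm 𝓘(ℝ, EP) (D.moment i ξ) x) := MF.shift_single _ _ _

theorem smooth_mom (hi : p ∈ Q.dom i) (ξ : GroupLieAlgebra 𝓘(ℝ, EG) G) :
    SmoothFieldAt 𝓘(ℝ, EP) (D.mom i ξ) p := by
  rw [funext (D.mom_eq_single i ξ)]
  exact SmoothFieldAt.single _ (D.smooth_zeroForm_moment hi ξ)

theorem extDF_mom (hi : p ∈ Q.dom i) (ξ : GroupLieAlgebra 𝓘(ℝ, EG) G) :
    extDF 𝓘(ℝ, EP) (D.mom i ξ) p + (D.field i p * D.mom i ξ p - D.mom i ξ p * D.field i p) =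
      MF.shift (MF.cont (fundVF ξ p) (D.curv i p)) := by
  have e : extDF 𝓘(ℝ, EP) (D.mom i ξ) p =
      MF.shift (MF.single 0 1 (extD 𝓘(ℝ, EP) (zeroForm 𝓘(ℝ, EP) (D.moment i ξ)) p)) := by
    rw [funext (D.mom_eq_single i ξ), MF.shift_single]
    exact extDF_single _ (zeroForm 𝓘(ℝ, EP) (D.moment i ξ)) p
  rw [e, mom, MF.mul_shift, MF.shift_mul, ← map_sub, ← map_add]
  congr 1
  rw [field, MF.single_mul_const, MF.const_mul_single, ← eq_sub_iff_add_eq]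
  have h := D.curv_eq_single i p
  rw [h, MF.cont_single_succ, eq_sub_iff_add_eq, add_sub, sub_eq_iff_eq_add, ← MF.single_add,
    ← MF.single_add]
  congr 1
  ext v
  have hv : v = fun _ => v 0 := funext fun i => by rw [Subsingleton.elim i 0]
  have h1 := D.extD_moment hi ξ (v 0)
  rw [h, MF.single_apply_same] at h1
  rw [hv]
  refine (congrArg (fun a : 𝒜 => a + D.A i p (fun _ => v 0) * D.moment i ξ p) h1).trans ?_
  have h2 : ![fundVF ξ p, v 0] = Matrix.vecCons (fundVF ξ p) (fun _ : Fin 1 => v 0) := by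
    funext l
    fin_cases l <;> rfl
  rw [h2, add_assoc, sub_add_cancel]
  rfl

end GaugeConnection

end Gauge

namespace MF

variable {V : Type*} [AddCommGroup V] [Module ℝ V] [TopologicalSpace V]
  {A : Type*} [NormedRing A] [NormedAlgebra ℝ A] {A' : Type*} [NormedRing A'] [NormedAlgebra ℝ A']

theorem map_mul_left {c : A' →L[ℝ] A} {str : A →L[ℝ] A'} (h : ∀ z a, str (c z * a) = z * str a)
    (α : MF V A') (β : MF V A) : map str (map c α * β) = α * map str β := by
  ext k j v
  simp only [map_apply, mul_apply, ContinuousLinearMap.compContinuousAlternatingMap_coe,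
    Function.comp_apply, ContinuousAlternatingMap.sum_apply, map_sum]
  refine Finset.sum_congr rfl fun p _ => Finset.sum_congr rfl fun q hq => ?_
  rw [wedge'_eq (Finset.HasAntidiagonal.mem_antidiagonal.1 hq),
    wedge'_eq (Finset.HasAntidiagonal.mem_antidiagonal.1 hq), wedge_apply, wedge_apply]
  simp only [map_smul, map_sum, Units.smul_def, map_zsmul, tensorMul_apply,
    ContinuousLinearMap.compContinuousAlternatingMap_coe, Function.comp_apply, h]

theorem mul_apply_congr_right {α β β' : MF V A} {k j : ℕ}
    (h : ∀ k' j', k' ≤ k → j' ≤ j → β k' j' = β' k' j') : (α * β) k j = (α * β') k j := by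
  rw [mul_apply, mul_apply]
  refine Finset.sum_congr rfl fun p hp => Finset.sum_congr rfl fun q hq => ?_
  rw [Finset.HasAntidiagonal.mem_antidiagonal] at hp hq
  rw [h p.2 q.2 (by omega) (by omega)]

theorem expSum_apply_congr {α : MF V A} (h : α 0 0 = 0) {N N' k j : ℕ} (hN : k + j < N)
    (hN' : k + j < N') : expSum N α k j = expSum N' α k j := by
  rw [← exp_apply h hN, exp_apply h hN']

end MF

/-! ### Polynomials with coefficients in an algebra -/

section Quadrature

open Polynomial

variable {R : Type*} [Ring R] [Algebra ℝ R]

/-- Evaluation at a real number. -/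
def evalReal (t : ℝ) : R[X] →+* R :=
  eval₂RingHom' (RingHom.id R) (algebraMap ℝ R t) fun r => (Algebra.commutes t r).symm

theorem evalReal_C (t : ℝ) (r : R) : evalReal t (C r) = r :=
  eval₂_C _ _

theorem evalReal_X (t : ℝ) : evalReal t (X : R[X]) = algebraMap ℝ R t :=
  eval₂_X _ _

theorem evalReal_eq_sum {d : ℕ} {p : R[X]} (hp : p.natDegree ≤ d) (t : ℝ) :
    evalReal t p = ∑ m ∈ Finset.range (d + 1), t ^ m • p.coeff m := by
  change eval₂ (RingHom.id R) (algebraMap ℝ R t) p = _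
  rw [eval₂_eq_sum_range' _ (Nat.lt_succ_of_le hp)]
  refine Finset.sum_congr rfl fun m _ => ?_
  rw [RingHom.id_apply, ← map_pow, ← Algebra.commutes, ← Algebra.smul_def]

/-- The integral over `[0, 1]` of a polynomial. -/
def polyIntegral (p : R[X]) : R := ∑ m ∈ Finset.range (p.natDegree + 1), ((m : ℝ) + 1)⁻¹ • p.coeff m

theorem polyIntegral_eq {d : ℕ} {p : R[X]} (hp : p.natDegree ≤ d) :
    polyIntegral p = ∑ m ∈ Finset.range (d + 1), ((m : ℝ) + 1)⁻¹ • p.coeff m := by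
  refine Finset.sum_subset (Finset.range_subset_range.2 (by omega)) fun m _ hm => ?_
  rw [coeff_eq_zero_of_natDegree_lt (by simpa using hm), smul_zero]

theorem polyIntegral_derivative (p : R[X]) :
    polyIntegral (derivative p) = evalReal 1 p - evalReal 0 p := by
  rw [polyIntegral_eq (d := p.natDegree) (natDegree_derivative_le p |>.trans (Nat.sub_le _ _)),
    evalReal_eq_sum (d := p.natDegree + 1) (Nat.le_succ _),
    evalReal_eq_sum (d := p.natDegree + 1) (Nat.le_succ _), ← Finset.sum_sub_distrib,
    Finset.sum_range_succ' _ (p.natDegree + 1)]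
  simp only [one_pow, pow_succ, mul_zero, zero_smul, sub_zero, pow_zero, one_smul, sub_self, add_zero]
  refine Finset.sum_congr rfl fun m _ => ?_
  rw [coeff_derivative]
  have : p.coeff (m + 1) * ((m : R) + 1) = ((m : ℝ) + 1) • p.coeff (m + 1) := by
    rw [Algebra.smul_def, Algebra.commutes]
    simp
  rw [this, smul_smul, inv_mul_cancel₀ (by positivity), one_smul, mul_one, one_smul]

theorem exists_quadWeight (d : ℕ) : ∃ w : ℕ → ℝ, ∀ m ∈ Finset.range (d + 1),
    ∑ s ∈ Finset.range (d + 1), w s * (s : ℝ) ^ m = ((m : ℝ) + 1)⁻¹ := by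
  let v : Fin (d + 1) → ℝ := fun s => (s : ℕ)
  have hv : Function.Injective v := fun a b h => Fin.ext (Nat.cast_injective (R := ℝ) h)
  have hdet : IsUnit (Matrix.vandermonde v).det :=
    (Matrix.det_vandermonde_ne_zero_iff.2 hv).isUnit
  let b : Fin (d + 1) → ℝ := fun m => ((m : ℝ) + 1)⁻¹
  let w := Matrix.vecMul b (Matrix.vandermonde v)⁻¹
  have hw : Matrix.vecMul w (Matrix.vandermonde v) = b := by
    rw [Matrix.vecMul_vecMul, Matrix.nonsing_inv_mul _ hdet, Matrix.vecMul_one]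
  refine ⟨fun s => if h : s < d + 1 then w ⟨s, h⟩ else 0, fun m hm => ?_⟩
  have h1 := congrFun hw ⟨m, Finset.mem_range.1 hm⟩
  rw [Finset.sum_range]
  rw [Matrix.vecMul_eq_sum, Finset.sum_apply] at h1
  refine Eq.trans (Finset.sum_congr rfl fun s _ => ?_) h1
  exact congrArg (fun a => a * ((s : ℕ) : ℝ) ^ m) (dif_pos s.2)

/-- The weights of a quadrature formula with the nodes `0, …, d` which is exact in degrees up to
`d`. -/
def quadWeight (d : ℕ) : ℕ → ℝ := (exists_quadWeight d).choose

theorem polyIntegral_eq_quadrature {d : ℕ} {p : R[X]} (hp : p.natDegree ≤ d) :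
    polyIntegral p = ∑ s ∈ Finset.range (d + 1), quadWeight d s • evalReal (s : ℝ) p := by
  rw [polyIntegral_eq hp]
  simp only [evalReal_eq_sum hp, Finset.smul_sum]
  rw [Finset.sum_comm]
  refine Finset.sum_congr rfl fun m hm => ?_
  simp only [smul_smul, ← Finset.sum_smul]
  rw [quadWeight, (exists_quadWeight d).choose_spec m hm]

end Quadrature

section Transgression

open Polynomial

variable {V : Type*} [AddCommGroup V] [Module ℝ V] [TopologicalSpace V]
  {A : Type*} [NormedRing A] [NormedAlgebra ℝ A] {A' : Type*} [NormedRing A'] [NormedAlgebra ℝ A']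
  {str : A →L[ℝ] A'}

/-- The exponential sum of a polynomial. -/
def polyExp (N : ℕ) (x : (MF V A)[X]) : (MF V A)[X] :=
  ∑ n ∈ Finset.range N, C (algebraMap ℝ (MF V A) (n.factorial : ℝ)⁻¹) * x ^ n

theorem evalReal_polyExp (N : ℕ) (x : (MF V A)[X]) (t : ℝ) :
    evalReal t (polyExp N x) = MF.expSum N (evalReal t x) := by
  simp only [polyExp, map_sum, map_mul, map_pow, evalReal_C, MF.expSum, Algebra.smul_def]

theorem natDegree_polyExp {N : ℕ} {x : (MF V A)[X]} (hx : x.natDegree ≤ 2) :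
    (polyExp N x).natDegree ≤ 2 * N := by
  refine natDegree_sum_le_of_forall_le _ _ fun n hn => ?_
  refine (natDegree_C_mul_le _ _).trans (natDegree_pow_le.trans ?_)
  have := Finset.mem_range.1 hn
  nlinarith

/-- The trace of the derivative of the exponential. -/
theorem map_derivative_polyExp (hstr : ∀ a b, str (a * b) = str (b * a)) (x : (MF V A)[X]) (t : ℝ)
    (he : MF.eps (evalReal t x) = evalReal t x) (N : ℕ) :
    MF.map str (evalReal t (derivative (polyExp (N + 1) x))) =
      MF.map str (evalReal t (derivative x) * MF.expSum N (evalReal t x)) := by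
  have hee : ∀ n : ℕ, MF.eps (evalReal t x ^ n) = evalReal t x ^ n := fun n => by
    induction n with
    | zero => rw [pow_zero, MF.eps_one]
    | succ n ih => rw [pow_succ, MF.eps_mul, ih, he]
  have h1 : ∀ n m : ℕ, MF.map str (evalReal t (derivative (x ^ (n + 1))) * evalReal t x ^ m) =
      ((n + 1 : ℕ) : ℝ) • MF.map str (evalReal t (derivative x) * evalReal t x ^ (n + m)) := by
    intro n
    induction n with
    | zero => intro m; simp
    | succ n ih =>
      intro m
      rw [pow_succ x (n + 1), derivative_mul, map_add (evalReal t), map_mul (evalReal t),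
        map_mul (evalReal t), add_mul, map_add, mul_assoc, ← pow_succ', ih (m + 1),
        map_pow (evalReal t), mul_assoc, MF.map_mul_comm_even str (fun _ _ _ _ => hstr _ _) (hee _),
        mul_assoc, ← pow_add, Nat.cast_succ (n + 1), add_smul, one_smul,
        show n + (m + 1) = n + 1 + m by omega, show m + (n + 1) = n + 1 + m by omega]
  have h2 : derivative (polyExp (N + 1) x) = ∑ n ∈ Finset.range N,
      C (algebraMap ℝ (MF V A) ((n + 1).factorial : ℝ)⁻¹) * derivative (x ^ (n + 1)) := by
    rw [polyExp, Finset.sum_range_succ', derivative_add, derivative_sum]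
    simp
  rw [h2, map_sum, map_sum, MF.expSum, Finset.mul_sum, map_sum]
  refine Finset.sum_congr rfl fun n _ => ?_
  have h3 := h1 n 0
  rw [pow_zero, mul_one, add_zero] at h3
  rw [map_mul, evalReal_C, ← Algebra.smul_def, map_smul, h3, smul_smul, mul_smul_comm, map_smul,
    Nat.factorial_succ]
  congr 1
  have : (n.factorial : ℝ) ≠ 0 := by positivity
  push_cast
  field_simp

end Transgression

/-! ### The Chern character form of a connection -/

section Gauge

variable {EG : Type*} [NormedAddCommGroup EG] [NormedSpace ℝ EG]
  {G : Type*} [TopologicalSpace G] [ChartedSpace EG G] [Group G] [LieGroup 𝓘(ℝ, EG) ∞ G]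
  {EP : Type*} [NormedAddCommGroup EP] [NormedSpace ℝ EP]
  {P : Type*} [TopologicalSpace P] [ChartedSpace EP P] [IsManifold 𝓘(ℝ, EP) ∞ P]
  [MulAction G P]

theorem MF.eps_of_odd {V A : Type*} [AddCommGroup V] [Module ℝ V] [TopologicalSpace V]
    [NormedRing A] [NormedAlgebra ℝ A] {α : MF V A} (h : ∀ k j, ¬Odd j → α k j = 0) :
    MF.eps α = -α := by
  ext k j v
  rw [MF.eps_apply, MF.neg_apply]
  by_cases hj : Odd j
  · rw [hj.neg_one_pow]
    exact neg_one_smul ℝ _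
  · rw [h k j hj, altMap_smul_zero, neg_zero]

theorem dCartan_apply_congr {α β : RawCartan EG G EP P} {ξ : GroupLieAlgebra 𝓘(ℝ, EG) G} {x : P}
    {k j : ℕ} (h : ∀ k' j' y, k' + j' ≤ k + j → α ξ y k' j' = β ξ y k' j') :
    dCartan α ξ x k j = dCartan β ξ x k j := by
  cases k with
  | zero =>
    cases j with
    | zero => rfl
    | succ j =>
      have e : (fun y => α ξ y 0 j) = fun y => β ξ y 0 j := funext fun y => h 0 j y (by omega)
      simp only [dCartan, e]
  | succ k =>
    have e' : α ξ x k (j + 1) = β ξ x k (j + 1) := h _ _ _ (by omega)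
    cases j with
    | zero => simp only [dCartan, e']
    | succ j =>
      have e : (fun y => α ξ y (k + 1) j) = fun y => β ξ y (k + 1) j :=
        funext fun y => h (k + 1) j y (by omega)
      simp only [dCartan, e, e']

variable
  {EM : Type*} [NormedAddCommGroup EM] [NormedSpace ℝ EM]
  {M : Type*} [TopologicalSpace M] [ChartedSpace EM M] [IsManifold 𝓘(ℝ, EM) ∞ M]
  [MulAction G M] [ContMDiffSMul 𝓘(ℝ, EG) 𝓘(ℝ, EM) ∞ G M]
  {H : Type*} [NormedAddCommGroup H] [InnerProductSpace ℂ H] [CompleteSpace H]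
  {B : EquivPUBundle EG G EM M EP P H}
  {𝒜 : Type*} [NormedRing 𝒜] [NormedAlgebra ℝ 𝒜] {ι : Type*}
  {Q : GaugeBundle B 𝒜 ι} {θ : B.GerbeConnection} {c : ℂ →L[ℝ] 𝒜}
  (D : GaugeConnection Q θ c) (κ : EquivPUBundle.EquivCurving θ) {i j : ι} {p : P}

variable (c) in
/-- The equivariant curving, with scalar values in the algebra. -/
def curvingField (ξ : GroupLieAlgebra 𝓘(ℝ, EG) G) (x : P) : MF (TangentSpace 𝓘(ℝ, EP) x) 𝒜 :=
  MF.map c (A := ℂ) (κ.cartan.1 ξ x)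

theorem curving_eq (ξ : GroupLieAlgebra 𝓘(ℝ, EG) G) (x : P) :
    @Eq (MF (TangentSpace 𝓘(ℝ, EP) x) ℂ) (κ.cartan.1 ξ x)
      (MF.single 0 2 (κ.f x) + MF.shift (MF.const (-κ.muL ξ x))) := by
  ext k j v
  rw [MF.add_apply, MF.const, MF.shift_single]
  by_cases h : k = 0 ∧ j = 2
  · obtain ⟨rfl, rfl⟩ := h
    rw [MF.single_apply_same, MF.single_apply_of_ne (by omega), add_zero, ← κ.cartan_f ξ x]
  · by_cases h' : k = 1 ∧ j = 0
    · obtain ⟨rfl, rfl⟩ := h'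
      rw [MF.single_apply_same, MF.single_apply_of_ne (by omega), zero_add]
      exact κ.cartan_muL ξ x v
    · rw [MF.single_apply_of_ne h, MF.single_apply_of_ne (by omega), zero_add,
        κ.degree_two ξ x k j (by omega)]

theorem curvingField_eq (ξ : GroupLieAlgebra 𝓘(ℝ, EG) G) (x : P) : curvingField c κ ξ x =
    MF.single 0 2 (c.compContinuousAlternatingMap (κ.f x)) +
      MF.shift (MF.const (-c (κ.muL ξ x))) := by
  rw [curvingField, curving_eq, map_add, MF.map_single, MF.map_shift, MF.const, MF.map_single, MF.const]
  congr 4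
  ext v
  exact map_neg c _

theorem eps_curving (ξ : GroupLieAlgebra 𝓘(ℝ, EG) G) (x : P) :
    MF.eps (curvingField c κ ξ x) = curvingField c κ ξ x := by
  rw [curvingField_eq, map_add, MF.eps_shift, MF.eps_const, MF.eps_single]
  norm_num

theorem smooth_curvingField (ξ : GroupLieAlgebra 𝓘(ℝ, EG) G) (x : P) :
    SmoothFieldAt 𝓘(ℝ, EP) (curvingField c κ ξ) x :=
  SmoothFieldAt.map _ (α := fun y => (κ.cartan.1 ξ y : MF (TangentSpace 𝓘(ℝ, EP) y) ℂ))
    (fun k j => κ.cartan.2.1 ξ k j x) c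

variable (c) in
/-- The differential of the equivariant curving, with scalar values in the algebra. -/
def threeField (ξ : GroupLieAlgebra 𝓘(ℝ, EG) G) (x : P) : MF (TangentSpace 𝓘(ℝ, EP) x) 𝒜 :=
  MF.map c (A := ℂ) (dCartan κ.cartan.1 ξ x)

theorem equivD_curvingField (ξ : GroupLieAlgebra 𝓘(ℝ, EG) G) (x : P) :
    equivD ξ (curvingField c κ ξ) x = threeField c κ ξ x := by
  refine Eq.trans ?_ (congrArg (MF.map c (A := ℂ)) (dCartan_eq_equivD κ.cartan.1 ξ x).symm)
  refine Eq.trans ?_ (map_sub (MF.map c (A := ℂ)) _ _).symm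
  exact congrArg₂ HSub.hSub (extDF_map _
    (α := fun y => (κ.cartan.1 ξ y : MF (TangentSpace 𝓘(ℝ, EP) y) ℂ))
    (fun k j => κ.cartan.2.1 ξ k j x) c) 
    (MF.map_shift c (MF.cont (fundVF ξ x) (κ.cartan.1 ξ x : MF (TangentSpace 𝓘(ℝ, EP) x) ℂ))).symm

theorem eps_threeField (ξ : GroupLieAlgebra 𝓘(ℝ, EG) G) (x : P) :
    MF.eps (threeField c κ ξ x) = -threeField c κ ξ x := by
  refine (MF.eps_map c (A := ℂ) _).trans ((congrArg (MF.map c (A := ℂ)) ?_).trans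
    (map_neg (MF.map c (A := ℂ)) (dCartan κ.cartan.1 ξ x)))
  exact MF.eps_of_odd fun k j hj => hasDegree_dCartan_curving κ ξ x k j fun h => hj ⟨1 - k, by omega⟩

namespace GaugeConnection

/-- The equivariant curvature, corrected by the curving. -/
def total (i : ι) (ξ : GroupLieAlgebra 𝓘(ℝ, EG) G) (x : P) : MF (TangentSpace 𝓘(ℝ, EP) x) 𝒜 :=
  D.curv i x + D.mom i ξ x + curvingField c κ ξ x

theorem eps_total (i : ι) (ξ : GroupLieAlgebra 𝓘(ℝ, EG) G) (x : P) :
    MF.eps (D.total κ i ξ x) = D.total κ i ξ x := by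
  rw [total, map_add, map_add, eps_curving, mom, MF.eps_shift, MF.eps_const, curv_eq_single,
    MF.eps_single]
  norm_num

theorem total_zero_zero (i : ι) (ξ : GroupLieAlgebra 𝓘(ℝ, EG) G) (x : P) :
    D.total κ i ξ x 0 0 = 0 := by
  rw [total, curvingField_eq, curv_eq_single, MF.add_apply, MF.add_apply, MF.add_apply, mom,
    MF.shift_zero_left, MF.shift_zero_left, MF.single_apply_of_ne (by omega),
    MF.single_apply_of_ne (by omega)]
  simp

theorem total_eq (i : ι) (ξ : GroupLieAlgebra 𝓘(ℝ, EG) G) (x : P) : D.total κ i ξ x =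
    (D.curv i x + MF.single 0 2 (c.compContinuousAlternatingMap (κ.f x))) +
      MF.shift (MF.const (D.moment i ξ x - c (κ.muL ξ x))) := by
  have h : ∀ a b : 𝒜, MF.const (V := TangentSpace 𝓘(ℝ, EP) x) (a - b) =
      MF.const a + MF.const (-b) := fun a b => by
    rw [MF.const, MF.const, MF.const, ← MF.single_add, sub_eq_add_neg]
    rfl
  rw [total, curvingField_eq, h, map_add, mom]
  abel

theorem smooth_total (hi : p ∈ Q.dom i) (ξ : GroupLieAlgebra 𝓘(ℝ, EG) G) :
    SmoothFieldAt 𝓘(ℝ, EP) (D.total κ i ξ) p :=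
  SmoothFieldAt.add _ (SmoothFieldAt.add _ (D.smooth_curv hi) (D.smooth_mom hi ξ))
    (smooth_curvingField κ ξ p)

/-- The moment map, as a linear map. -/
def momentL (i : ι) (p : P) : GroupLieAlgebra 𝓘(ℝ, EG) G →ₗ[ℝ] 𝒜 where
  toFun ξ := D.moment i ξ p
  map_add' ξ η := by
    have := B.smul_smooth
    have h := congrArg (fun α : EP [⋀^Fin 0]→L[ℝ] 𝒜 => α ![])
      (contract_add_vec (V := EP) (fundVF ξ p) (fundVF η p) (D.A i p))
    have e : ∀ X : EP, (fun α : EP [⋀^Fin 0]→L[ℝ] 𝒜 => α ![]) (contract (V := EP) X (D.A i p)) = D.A i p (fun _ => X) := fun X =>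
      rawForm_congr (j := 1) (D.A i) rfl fun l => by fin_cases l; rfl
    have h1 : D.A i p (fun _ => fundVF (ξ + η) p) =
        D.A i p (fun _ => fundVF ξ p) + D.A i p (fun _ => fundVF η p) := by
      rw [fundVF_add]
      exact (e _).symm.trans (h.trans (congrArg₂ (HAdd.hAdd : 𝒜 → 𝒜 → 𝒜) (e _) (e _)))
    have h2 : dvec 𝓘(ℝ, EG) (fun g : G => Q.S i i (g, p)) 1 (ξ + η) =
        dvec 𝓘(ℝ, EG) (fun g : G => Q.S i i (g, p)) 1 ξ +
          dvec 𝓘(ℝ, EG) (fun g : G => Q.S i i (g, p)) 1 η := map_add (mfderiv _ _ _ _) _ _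
    rw [moment, h1, h2, moment, moment]
    abel
  map_smul' t ξ := by
    have := B.smul_smooth
    have h := congrArg (fun α : EP [⋀^Fin 0]→L[ℝ] 𝒜 => α ![])
      (contract_smul_vec (V := EP) t (fundVF ξ p) (D.A i p))
    have e : ∀ X : EP, (fun α : EP [⋀^Fin 0]→L[ℝ] 𝒜 => α ![]) (contract (V := EP) X (D.A i p)) = D.A i p (fun _ => X) := fun X =>
      rawForm_congr (j := 1) (D.A i) rfl fun l => by fin_cases l; rfl
    have h1 : D.A i p (fun _ => fundVF (t • ξ) p) = t • D.A i p (fun _ => fundVF ξ p) := by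
      rw [fundVF_smul]
      exact (e _).symm.trans (h.trans (congrArg (HSMul.hSMul t) (e _)))
    have h2 : dvec 𝓘(ℝ, EG) (fun g : G => Q.S i i (g, p)) 1 (t • ξ) =
        t • dvec 𝓘(ℝ, EG) (fun g : G => Q.S i i (g, p)) 1 ξ := map_smul (mfderiv _ _ _ _) _ _
    rw [moment, h1, h2, RingHom.id_apply, moment, smul_sub]

theorem comp_const {V V' : Type*} [AddCommGroup V] [Module ℝ V] [TopologicalSpace V]
    [AddCommGroup V'] [Module ℝ V'] [TopologicalSpace V'] (φ : V' →L[ℝ] V) (a : 𝒜) :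
    MF.comp φ (MF.const a : MF V 𝒜) = MF.const a := MF.comp_single _ _ _ _

theorem covariant_total (hc : ∀ z a, c z * a = a * c z) : Q.Covariant (D.total κ) where
  smooth i ξ p hp := D.smooth_total κ hp ξ
  poly i p hp k j := by
    refine IsPoly.add (IsPoly.add ?_ ?_) ((isPoly_of_mem κ.cartan.2 k j p).map c)
    · simp only [curv_eq_single]
      exact IsPoly.single_zero _ k j
    · let l : GroupLieAlgebra 𝓘(ℝ, EG) G →ₗ[ℝ] TangentSpace 𝓘(ℝ, EP) p [⋀^Fin 0]→L[ℝ] 𝒜 :=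
        { toFun := fun ξ => ContinuousAlternatingMap.constOfIsEmpty ℝ _ (Fin 0) (D.momentL i p ξ)
          map_add' := fun ξ η => by ext v; exact map_add (D.momentL i p) ξ η
          map_smul' := fun t ξ => by ext v; exact map_smul (D.momentL i p) t ξ }
      simp only [mom_eq_single]
      exact IsPoly.single_one l k j
  equivariant i j g ξ p hi hj := by
    have e : pbF 𝓘(ℝ, EP) 𝓘(ℝ, EP) (fun y => g • y) (D.total κ j (Ad g ξ)) p =
        pbF 𝓘(ℝ, EP) 𝓘(ℝ, EP) (fun y => g • y) (D.curv j) p +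
          MF.shift (MF.const (D.moment j (Ad g ξ) (g • p))) + curvingField c κ ξ p := by
      refine (map_add (MF.comp _) _ _).trans (congrArg₂ HAdd.hAdd ((map_add (MF.comp _) _ _).trans
        (congrArg (HAdd.hAdd _) ?_)) ?_)
      · refine (MF.shift_comp _ _).trans (congrArg _ (comp_const _ _))
      · refine (MF.map_comp _ _ _).symm.trans (congrArg (MF.map c (A := ℂ)) ?_)
        ext k l : 1
        exact invariant_of_mem κ.cartan.2 g ξ k l p
    have h1 : MF.const (Q.S i j (g, p)) * curvingField c κ ξ p =
        curvingField c κ ξ p * MF.const (Q.S i j (g, p)) :=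
      (MF.mul_comm_even (fun k l v a => hc _ _) (eps_curving κ ξ p) _).symm
    rw [e, total, mul_add, mul_add, D.curv_equivariant hi hj, mom, MF.mul_shift, MF.const_mul_const,
      D.moment_equivariant hi hj, h1, add_mul, add_mul, MF.shift_mul, MF.const_mul_const]
  descends i j φ w q h hi hj ξ := by
    have e : pbF 𝓘(ℝ, EP) 𝓘(ℝ, EP) φ (D.total κ i ξ) q =
        (pbF 𝓘(ℝ, EP) 𝓘(ℝ, EP) φ (D.curv i) q + MF.single 0 2 (c.compContinuousAlternatingMap
          (pb 𝓘(ℝ, EP) 𝓘(ℝ, EP) φ κ.f q))) +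
          MF.shift (MF.const (D.moment i ξ (φ q) - c (κ.muL ξ (φ q)))) := by
      have e1 : D.total κ i ξ (φ q) = (D.curv i (φ q) + MF.single 0 2
          (c.compContinuousAlternatingMap (κ.f (φ q)))) +
          MF.shift (MF.const (D.moment i ξ (φ q) - c (κ.muL ξ (φ q)))) := D.total_eq κ i ξ (φ q)
      refine (congrArg (MF.comp _) e1).trans ?_
      refine (map_add (MF.comp _) _ _).trans (congrArg₂ HAdd.hAdd ((map_add (MF.comp _) _ _).trans
        (congrArg (HAdd.hAdd _) (MF.comp_single _ _ _ _))) ?_)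
      exact (MF.shift_comp _ _).trans (congrArg _ (comp_const _ _))
    have hq := h.act_eq.self_of_nhds
    have h2 := D.moment_descends κ hc (u := w q) hi (by rwa [hq]) ξ
    rw [hq] at h2
    rw [e, D.total_eq, mul_add, D.curv_descends κ hc h hi hj, MF.mul_shift, MF.const_mul_const,
      h2, add_mul _ (MF.shift _), MF.shift_mul, MF.const_mul_const]

end GaugeConnection

end Gauge

section Gauge

variable {EG : Type*} [NormedAddCommGroup EG] [NormedSpace ℝ EG]
  {G : Type*} [TopologicalSpace G] [ChartedSpace EG G] [Group G] [LieGroup 𝓘(ℝ, EG) ∞ G]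
  {EP : Type*} [NormedAddCommGroup EP] [NormedSpace ℝ EP]
  {P : Type*} [TopologicalSpace P] [ChartedSpace EP P] [IsManifold 𝓘(ℝ, EP) ∞ P]
  [MulAction G P]
  {EM : Type*} [NormedAddCommGroup EM] [NormedSpace ℝ EM]
  {M : Type*} [TopologicalSpace M] [ChartedSpace EM M] [IsManifold 𝓘(ℝ, EM) ∞ M]
  [MulAction G M] [ContMDiffSMul 𝓘(ℝ, EG) 𝓘(ℝ, EM) ∞ G M]
  {H : Type*} [NormedAddCommGroup H] [InnerProductSpace ℂ H] [CompleteSpace H]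
  {B : EquivPUBundle EG G EM M EP P H}
  {𝒜 : Type*} [NormedRing 𝒜] [NormedAlgebra ℝ 𝒜] {ι : Type*}
  {Q : GaugeBundle B 𝒜 ι} {θ : B.GerbeConnection} {c : ℂ →L[ℝ] 𝒜}
  (D D' : GaugeConnection Q θ c) (κ : EquivPUBundle.EquivCurving θ) {i j : ι} {p : P}
  (hc : ∀ z a, c z * a = a * c z) {str : 𝒜 →L[ℝ] ℂ} (hstr : ∀ a b, str (a * b) = str (b * a))
  (hcs : ∀ z a, str (c z * a) = z * str a)

/-- The differential of the equivariant curving. -/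
def threeForm (ξ : GroupLieAlgebra 𝓘(ℝ, EG) G) (x : P) : MF (TangentSpace 𝓘(ℝ, EP) x) ℂ :=
  dCartan κ.cartan.1 ξ x

namespace GaugeConnection

theorem eps_curv (i : ι) (x : P) : MF.eps (D.curv i x) = D.curv i x := by
  rw [curv_eq_single, MF.eps_single]
  norm_num

include hc

theorem threeField_mul (ξ : GroupLieAlgebra 𝓘(ℝ, EG) G) (x : P)
    (β : MF (TangentSpace 𝓘(ℝ, EP) x) 𝒜) :
    threeField c κ ξ x * β = MF.eps β * threeField c κ ξ x :=
  MF.mul_comm_odd (fun _ _ _ _ => hc _ _) (eps_threeField κ ξ x) β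

/-- The equivariant Bianchi identity. -/
theorem covD_total (hi : p ∈ Q.dom i) (ξ : GroupLieAlgebra 𝓘(ℝ, EG) G) :
    covD (D.field i) ξ (D.total κ i ξ) p = threeField c κ ξ p := by
  have h1 : covD (D.field i) ξ (D.curv i) p = -MF.shift (MF.cont (fundVF ξ p) (D.curv i p)) := by
    have h := D.bianchi hi
    rw [covD, equivD, eps_curv, sub_add_eq_add_sub, h, zero_sub]
  have h2 : covD (D.field i) ξ (D.mom i ξ) p = MF.shift (MF.cont (fundVF ξ p) (D.curv i p)) := by
    have h3 : MF.cont (fundVF ξ p) (D.mom i ξ p) = 0 := by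
      rw [mom_eq_single, MF.cont_single_zero]
    have h4 : MF.eps (D.mom i ξ p) = D.mom i ξ p := by rw [mom, MF.eps_shift, MF.eps_const]
    rw [covD, equivD, h3, h4, map_zero, sub_zero, D.extDF_mom hi]
  have h3 : covD (D.field i) ξ (curvingField c κ ξ) p = threeField c κ ξ p := by
    rw [covD, equivD_curvingField, eps_curving,
      MF.mul_comm_even (fun k l v a => hc _ _) (eps_curving κ ξ p), sub_self, add_zero]
  refine (covD_add (SmoothFieldAt.add _ (D.smooth_curv hi) (D.smooth_mom hi ξ))
    (smooth_curvingField κ ξ p)).trans ?_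
  rw [covD_add (D.smooth_curv hi) (D.smooth_mom hi ξ), h1, h2, h3, neg_add_cancel, zero_add]

include hstr hcs

theorem dCartan_trace_mul_expSum {β : ι → GroupLieAlgebra 𝓘(ℝ, EG) G → (x : P) →
    MF (TangentSpace 𝓘(ℝ, EP) x) 𝒜} (hβ : Q.Covariant β) (hi : p ∈ Q.dom i)
    (ξ : GroupLieAlgebra 𝓘(ℝ, EG) G) (N : ℕ) :
    @Eq (MF (TangentSpace 𝓘(ℝ, EP) p) ℂ)
    (dCartan (Q.trace str fun i ξ x => β i ξ x * MF.expSum (N + 1) (D.total κ i ξ x)) ξ p)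
      (MF.map str (covD (D.field i) ξ (β i ξ) p * MF.expSum (N + 1) (D.total κ i ξ p)) +
        threeForm κ ξ p *
          MF.map str (β i ξ p * MF.expSum N (D.total κ i ξ p))) := by
  have hX := D.covariant_total κ hc
  refine (GaugeBundle.dCartan_trace (hβ.mul (hX.expSum _)) hstr hi ξ (D.eps_field i p)).trans ?_
  have hcomm : Commute (threeField c κ ξ p) (D.total κ i ξ p) := by
    refine (threeField_mul κ hc ξ p _).trans ?_
    rw [D.eps_total]
  rw [covD_mul (hβ.smooth i ξ p hi) (SmoothFieldAt.expSum _ (hX.smooth i ξ p hi) _),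
    covD_expSum (h := threeField c κ ξ) (hX.smooth i ξ p hi) (D.eps_total κ i ξ p) hcomm
      (D.covD_total κ hc hi ξ), ← mul_assoc (MF.eps _), ← threeField_mul κ hc, mul_assoc, map_add]
  exact congrArg (HAdd.hAdd _) (MF.map_mul_left hcs (threeForm κ ξ p) _)

omit hc hstr hcs

/-- The exponential of the equivariant curvature. -/
def expTotal (i : ι) (ξ : GroupLieAlgebra 𝓘(ℝ, EG) G) (x : P) : MF (TangentSpace 𝓘(ℝ, EP) x) 𝒜 :=
  MixedForm.exp (D.total κ i ξ x)

theorem expTotal_apply (i : ι) (ξ : GroupLieAlgebra 𝓘(ℝ, EG) G) (x : P) {N k j : ℕ}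
    (h : k + j < N) : D.expTotal κ i ξ x k j = MF.expSum N (D.total κ i ξ x) k j :=
  MF.exp_apply (D.total_zero_zero κ i ξ x) h

include hc

theorem covariant_expTotal : Q.Covariant (D.expTotal κ) :=
  GaugeBundle.Covariant.of_components fun k j =>
    ⟨_, (D.covariant_total κ hc).expSum (k + j + 1), fun i ξ x =>
      D.expTotal_apply κ i ξ x (Nat.lt_succ_self _)⟩

include hstr hcs

/-- The Chern character form is closed for the twisted differential. -/
theorem dCartan_trace_expTotal :
    dCartan (Q.trace str (D.expTotal κ)) =
      mulCartan (dCartan κ.cartan.1) (Q.trace str (D.expTotal κ)) := by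
  funext ξ p k j
  obtain ⟨i, hi⟩ := Q.cover p
  have h1 : dCartan (Q.trace str (D.expTotal κ)) ξ p k j = dCartan (Q.trace str
      fun i ξ x => 1 * MF.expSum (k + j + 1 + 1) (D.total κ i ξ x)) ξ p k j := by
    refine dCartan_apply_congr fun k' j' y h => ?_
    simp only [one_mul]
    exact congrArg str.compContinuousAlternatingMap (D.expTotal_apply κ _ ξ y (by omega))
  have h2 := congrArg (fun α : MF (TangentSpace 𝓘(ℝ, EP) p) ℂ => α k j)
    (D.dCartan_trace_mul_expSum κ hc hstr hcs GaugeBundle.Covariant.one hi ξ (k + j + 1))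
  refine h1.trans (h2.trans ?_)
  simp only [covD_one, zero_mul, map_zero, zero_add, one_mul]
  refine MF.mul_apply_congr_right fun k' j' hk hj => ?_
  have h3 := congrArg (fun α : MF (TangentSpace 𝓘(ℝ, EP) p) ℂ => α k' j')
    (GaugeBundle.trace_eq (D.covariant_expTotal κ hc) hstr hi ξ)
  refine Eq.trans ?_ h3.symm
  exact congrArg str.compContinuousAlternatingMap (D.expTotal_apply κ i ξ p (by omega)).symm

omit hc hstr hcs

/-! ### Transgression -/

/-- The points of the affine line through two connections. -/
def line (t : ℝ) : GaugeConnection Q θ c where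
  A i x := D.A i x + t • (D'.A i x - D.A i x)
  smooth i p hp := SmoothFormAt.add _ (D.smooth i p hp)
    (SmoothFormAt.const_smul _ (SmoothFormAt.sub _ (D'.smooth i p hp) (D.smooth i p hp)) t)
  invariant i j g p hi hj X := by
    have h := D.invariant i j g p hi hj X
    have h' := D'.invariant i j g p hi hj X
    simp only [ContinuousAlternatingMap.add_apply, ContinuousAlternatingMap.smul_apply,
      ContinuousAlternatingMap.sub_apply]
    rw [mul_add, mul_smul_comm, mul_sub, h, h', add_mul, smul_mul_assoc, sub_mul,
      add_sub_add_right_eq_sub]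
    abel
  compatible i j p u hi hj X b := by
    have h := D.compatible i j p u hi hj X b
    have h' := D'.compatible i j p u hi hj X b
    rw [mul_add] at h h'
    simp only [ContinuousAlternatingMap.add_apply, ContinuousAlternatingMap.smul_apply,
      ContinuousAlternatingMap.sub_apply]
    rw [mul_add, mul_add, mul_smul_comm, mul_sub, eq_sub_of_add_eq h, eq_sub_of_add_eq h', add_mul,
      smul_mul_assoc, sub_mul, sub_sub_sub_cancel_right, add_sub_add_right_eq_sub]
    abel

/-- The difference of two connections. -/
def delta (i : ι) (x : P) : MF (TangentSpace 𝓘(ℝ, EP) x) 𝒜 := MF.single 0 1 (D'.A i x - D.A i x)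

theorem field_line (t : ℝ) (i : ι) (x : P) :
    (D.line D' t).field i x = D.field i x + t • D.delta D' i x := by
  rw [field, field, delta, ← MF.single_smul, ← MF.single_add]
  rfl

theorem eps_delta (i : ι) (x : P) : MF.eps (D.delta D' i x) = -D.delta D' i x :=
  MF.eps_single_one _ _

theorem smooth_delta (hi : p ∈ Q.dom i) : SmoothFieldAt 𝓘(ℝ, EP) (D.delta D' i) p :=
  SmoothFieldAt.single _ (SmoothFormAt.sub _ (D'.smooth i p hi) (D.smooth i p hi))

theorem covariant_delta : Q.Covariant fun i _ => D.delta D' i where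
  smooth i ξ p hp := D.smooth_delta D' hp
  poly i p hp k j := IsPoly.single_zero _ k j
  equivariant i j g ξ p hi hj := by
    refine Eq.trans ?_ (congrArg (fun α => α * MF.const (Q.S i j (g, p)))
      (pbF_single 𝓘(ℝ, EP) 𝓘(ℝ, EP) (fun y => g • y) 0 1 (fun x => D'.A j x - D.A j x) p).symm)
    rw [← add_zero (_ * MF.const _), ← MF.single_zero 0 1]
    refine gauge_single fun X => ?_
    have h := D.invariant i j g p hi hj X
    have h' := D'.invariant i j g p hi hj X
    rw [ContinuousAlternatingMap.sub_apply, mul_sub, h, h', add_sub_add_right_eq_sub, ← sub_mul]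
    exact (add_zero _).symm
  descends i j φ w q hL hi hj ξ := by
    refine Eq.trans ?_ (congrArg (fun α => α * MF.const (Q.Psi i j (φ q) (w q)))
      (pbF_single 𝓘(ℝ, EP) 𝓘(ℝ, EP) φ 0 1 (fun x => D'.A i x - D.A i x) q).symm)
    rw [← add_zero (_ * MF.const _), ← MF.single_zero 0 1]
    refine gauge_single fun X => ?_
    have hL' := hL.of_le (le_trans (by norm_num) two_le_infty : (1 : WithTop ℕ∞) ≤ ∞)
    have h := (D.gauge_lift hL' hi hj).2 X
    have h' := (D'.gauge_lift hL' hi hj).2 X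
    rw [mul_add] at h h'
    rw [ContinuousAlternatingMap.sub_apply, mul_sub, eq_sub_of_add_eq h, eq_sub_of_add_eq h',
      sub_sub_sub_cancel_right, add_sub_add_right_eq_sub, ← sub_mul]
    exact (add_zero _).symm

theorem covD_line (t : ℝ) (i : ι) (p : P) (ξ : GroupLieAlgebra 𝓘(ℝ, EG) G) :
    covD ((D.line D' t).field i) ξ (D.delta D' i) p =
      covD (D.field i) ξ (D.delta D' i) p + (2 * t) • (D.delta D' i p * D.delta D' i p) := by
  rw [covD, covD, field_line, eps_delta, add_mul, neg_mul, mul_add, neg_mul, smul_mul_assoc,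
    mul_smul_comm, two_mul, add_smul]
  abel

theorem total_line (t : ℝ) (hi : p ∈ Q.dom i) (ξ : GroupLieAlgebra 𝓘(ℝ, EG) G) :
    (D.line D' t).total κ i ξ p = D.total κ i ξ p + t • covD (D.field i) ξ (D.delta D' i) p +
      (t * t) • (D.delta D' i p * D.delta D' i p) := by
  have h1 : (D.line D' t).mom i ξ p =
      D.mom i ξ p - t • MF.shift (MF.cont (fundVF ξ p) (D.delta D' i p)) := by
    have e : MF.cont (fundVF ξ p) (D.delta D' i p) =
        MF.const ((D'.A i p - D.A i p) (fun _ => fundVF ξ p)) := by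
      rw [delta, MF.cont_single_succ, MF.const]
      congr 1
      ext v
      change (D'.A i p - D.A i p) _ = (D'.A i p - D.A i p) _
      congr 1
      funext l
      fin_cases l
      rfl
    rw [mom, mom, e, ← map_smul, ← map_sub]
    congr 1
    rw [MF.const, MF.const, MF.const, ← MF.single_smul, eq_sub_iff_add_eq, ← MF.single_add]
    congr 1
    ext v
    change (dvec _ _ _ _ - (D.A i p (fun _ => fundVF ξ p) +
      t • (D'.A i p - D.A i p) (fun _ => fundVF ξ p))) +
        t • (D'.A i p - D.A i p) (fun _ => fundVF ξ p) = dvec _ _ _ _ - D.A i p (fun _ => fundVF ξ p)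
    abel
  have h2 : (D.line D' t).curv i p = D.curv i p + t • (extDF 𝓘(ℝ, EP) (D.delta D' i) p +
      (D.field i p * D.delta D' i p + D.delta D' i p * D.field i p)) +
      (t * t) • (D.delta D' i p * D.delta D' i p) := by
    rw [curv, funext (D.field_line D' t i), extDF_add _ (D.smooth_field hi)
      (SmoothFieldAt.smul _ (D.smooth_delta D' hi) t), extDF_smul, curv, mul_add, add_mul, add_mul,
      smul_mul_assoc, smul_mul_assoc, mul_smul_comm, mul_smul_comm, smul_smul, smul_add, smul_add]
    abel
  rw [total, h1, h2, total, covD, equivD, eps_delta, neg_mul, sub_neg_eq_add]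
  simp only [smul_add, smul_sub]
  abel

end GaugeConnection

end Gauge

section Gauge

open Polynomial

variable {EG : Type*} [NormedAddCommGroup EG] [NormedSpace ℝ EG]
  {G : Type*} [TopologicalSpace G] [ChartedSpace EG G] [Group G] [LieGroup 𝓘(ℝ, EG) ∞ G]
  {EP : Type*} [NormedAddCommGroup EP] [NormedSpace ℝ EP]
  {P : Type*} [TopologicalSpace P] [ChartedSpace EP P] [IsManifold 𝓘(ℝ, EP) ∞ P]
  [MulAction G P]
  {EM : Type*} [NormedAddCommGroup EM] [NormedSpace ℝ EM]
  {M : Type*} [TopologicalSpace M] [ChartedSpace EM M] [IsManifold 𝓘(ℝ, EM) ∞ M]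
  [MulAction G M] [ContMDiffSMul 𝓘(ℝ, EG) 𝓘(ℝ, EM) ∞ G M]
  {H : Type*} [NormedAddCommGroup H] [InnerProductSpace ℂ H] [CompleteSpace H]
  {B : EquivPUBundle EG G EM M EP P H}
  {𝒜 : Type*} [NormedRing 𝒜] [NormedAlgebra ℝ 𝒜] {ι : Type*}
  {Q : GaugeBundle B 𝒜 ι} {θ : B.GerbeConnection} {c : ℂ →L[ℝ] 𝒜}
  (D D' : GaugeConnection Q θ c) (κ : EquivPUBundle.EquivCurving θ) {i j : ι} {p : P}
  (hc : ∀ z a, c z * a = a * c z) {str : 𝒜 →L[ℝ] ℂ} (hstr : ∀ a b, str (a * b) = str (b * a))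
  (hcs : ∀ z a, str (c z * a) = z * str a)

namespace GaugeConnection

theorem line_one : D.line D' 1 = D' := by
  cases D'
  simp only [line, one_smul, add_sub_cancel]

theorem line_zero : D.line D' 0 = D := by
  cases D
  simp only [line, altMap_zero_smul, add_zero]

/-- The equivariant curvature along the line through two connections, as a polynomial. -/
def totalPoly (i : ι) (ξ : GroupLieAlgebra 𝓘(ℝ, EG) G) (x : P) :
    (MF (TangentSpace 𝓘(ℝ, EP) x) 𝒜)[X] :=
  C (D.total κ i ξ x) + C (covD (D.field i) ξ (D.delta D' i) x) * X +
    C (D.delta D' i x * D.delta D' i x) * X ^ 2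

theorem natDegree_totalPoly (i : ι) (ξ : GroupLieAlgebra 𝓘(ℝ, EG) G) (x : P) :
    (D.totalPoly D' κ i ξ x).natDegree ≤ 2 := by
  rw [totalPoly]
  compute_degree

theorem evalReal_totalPoly (hi : p ∈ Q.dom i) (ξ : GroupLieAlgebra 𝓘(ℝ, EG) G) (t : ℝ) :
    evalReal t (D.totalPoly D' κ i ξ p) = (D.line D' t).total κ i ξ p := by
  rw [D.total_line D' κ t hi, totalPoly]
  simp only [map_add, map_mul, map_pow, evalReal_C, evalReal_X]
  rw [← map_pow, ← Algebra.commutes, ← Algebra.commutes, ← Algebra.smul_def, ← Algebra.smul_def, sq]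

theorem evalReal_derivative_totalPoly (i : ι) (ξ : GroupLieAlgebra 𝓘(ℝ, EG) G) (x : P) (t : ℝ) :
    evalReal t (derivative (D.totalPoly D' κ i ξ x)) =
      covD ((D.line D' t).field i) ξ (D.delta D' i) x := by
  rw [D.covD_line D', totalPoly, derivative_add, derivative_add, derivative_C, derivative_C_mul_X,
    derivative_C_mul_X_pow]
  simp only [map_add, map_mul, map_pow, evalReal_C, evalReal_X, zero_add]
  congr 1
  rw [show 2 - 1 = 1 from rfl, pow_one, ← Algebra.commutes, ← Algebra.smul_def, mul_comm 2 t, mul_smul,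
    Nat.cast_ofNat, mul_two, two_smul]

/-- The transgression form, truncated. -/
def transSum (N : ℕ) (i : ι) (ξ : GroupLieAlgebra 𝓘(ℝ, EG) G) (x : P) :
    MF (TangentSpace 𝓘(ℝ, EP) x) 𝒜 :=
  ∑ s ∈ Finset.range (2 * N + 2 + 1), quadWeight (2 * N + 2) s •
    (D.delta D' i x * MF.expSum N ((D.line D' (s : ℝ)).total κ i ξ x))

/-- The transgression form. -/
def transgression (i : ι) (ξ : GroupLieAlgebra 𝓘(ℝ, EG) G) (x : P) :
    MF (TangentSpace 𝓘(ℝ, EP) x) 𝒜 := fun k j => D.transSum D' κ (k + j + 1) i ξ x k j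

theorem transSum_apply (hi : p ∈ Q.dom i) (ξ : GroupLieAlgebra 𝓘(ℝ, EG) G) {N N' k j : ℕ}
    (hN : k + j < N) (hN' : N ≤ N') : D.transSum D' κ N i ξ p k j = D.transSum D' κ N' i ξ p k j := by
  have hd : (C (D.delta D' i p) * polyExp N (D.totalPoly D' κ i ξ p)).natDegree ≤ 2 * N :=
    (natDegree_C_mul_le _ _).trans (natDegree_polyExp (D.natDegree_totalPoly D' κ i ξ p))
  have he : ∀ d : ℕ, ∑ s ∈ Finset.range (d + 1), quadWeight d s •
      (D.delta D' i p * MF.expSum N ((D.line D' (s : ℝ)).total κ i ξ p)) =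
      ∑ s ∈ Finset.range (d + 1), quadWeight d s •
        evalReal (s : ℝ) (C (D.delta D' i p) * polyExp N (D.totalPoly D' κ i ξ p)) := fun d => by
    refine Finset.sum_congr rfl fun s _ => ?_
    rw [map_mul, evalReal_C, evalReal_polyExp, D.evalReal_totalPoly D' κ hi]
  rw [transSum, he, ← polyIntegral_eq_quadrature (by omega),
    polyIntegral_eq_quadrature (d := 2 * N' + 2) (by omega), ← he, transSum, MF.sum_apply,
    MF.sum_apply]
  refine Finset.sum_congr rfl fun s _ => ?_
  rw [MF.smul_apply, MF.smul_apply]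
  congr 1
  refine MF.mul_apply_congr_right fun k' j' hk hj => ?_
  exact MF.expSum_apply_congr (total_zero_zero _ _ _ _ _) (by omega) (by omega)

include hc

theorem covariant_transSum (N : ℕ) : Q.Covariant (D.transSum D' κ N) :=
  GaugeBundle.Covariant.sum _ fun s _ =>
    ((D.covariant_delta D').mul (((D.line D' s).covariant_total κ hc).expSum N)).smul _

theorem covariant_transgression : Q.Covariant (D.transgression D' κ) :=
  GaugeBundle.Covariant.of_components fun k j =>
    ⟨_, D.covariant_transSum D' κ hc (k + j + 1), fun _ _ _ => rfl⟩

omit hc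

theorem trace_transgression_apply (ξ : GroupLieAlgebra 𝓘(ℝ, EG) G) (x : P) {N k j : ℕ}
    (hN : k + j < N) : Q.trace str (D.transgression D' κ) ξ x k j =
      Q.trace str (D.transSum D' κ N) ξ x k j :=
  congrArg str.compContinuousAlternatingMap
    (D.transSum_apply D' κ (Q.cover x).choose_spec ξ (Nat.lt_succ_self _) hN)

theorem twistedD_apply (h : RawCartan EG G EP P) (α : cartanComplex EG G EP P)
    (ξ : GroupLieAlgebra 𝓘(ℝ, EG) G) (x : P) (k j : ℕ) : twistedD h α ξ x k j =
      dCartan α.1 ξ x k j - mulCartan h α.1 ξ x k j := rfl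

theorem sum_apply_cartan {τ : Type*} (s : Finset τ) (α : τ → RawCartan EG G EP P)
    (ξ : GroupLieAlgebra 𝓘(ℝ, EG) G) (x : P) (k j : ℕ) :
    (∑ a ∈ s, α a) ξ x k j = ∑ a ∈ s, α a ξ x k j := by
  classical
  induction s using Finset.induction_on with
  | empty => rfl
  | insert a s ha ih =>
    rw [Finset.sum_insert ha, Finset.sum_insert ha, RawCartan.add_apply, ih]

include hc hstr hcs

/-- The Chern character forms of two connections are cohomologous. -/
theorem twistedD_transgression (hα : Q.trace str (D.transgression D' κ) ∈ cartanComplex EG G EP P) :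
    twistedD (dCartan κ.cartan.1) ⟨_, hα⟩ =
      Q.trace str (D'.expTotal κ) - Q.trace str (D.expTotal κ) := by
  funext ξ p k j
  obtain ⟨i, hi⟩ := Q.cover p
  set N := k + j + 1 with hN
  set d := 2 * (N + 1) + 2 with hd
  have hs : ∀ s : ℕ, Q.Covariant fun i ξ x =>
      D.delta D' i x * MF.expSum (N + 1) ((D.line D' (s : ℝ)).total κ i ξ x) := fun s =>
    (D.covariant_delta D').mul (((D.line D' s).covariant_total κ hc).expSum (N + 1))
  let α : ℕ → cartanComplex EG G EP P := fun s => ⟨_, GaugeBundle.trace_mem (hs s) hstr⟩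
  let β : cartanComplex EG G EP P := ∑ s ∈ Finset.range (d + 1), (quadWeight d s : ℂ) • α s
  have hβ : ∀ k' j' y, k' + j' ≤ k + j → Q.trace str (D.transgression D' κ) ξ y k' j' =
      β.1 ξ y k' j' := fun k' j' y h => by
    rw [D.trace_transgression_apply D' κ ξ y (N := N + 1) (by omega)]
    change _ = ((cartanComplex EG G EP P).subtype β) ξ y k' j'
    rw [map_sum, sum_apply_cartan]
    change MF.map str (D.transSum D' κ (N + 1) _ ξ y) k' j' = _
    rw [transSum, map_sum, MF.sum_apply]
    refine Finset.sum_congr rfl fun s _ => ?_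
    rw [map_smul, MF.smul_apply]
    ext v
    exact (Complex.real_smul).trans rfl
  have h1 : twistedD (dCartan κ.cartan.1) ⟨_, hα⟩ ξ p k j =
      twistedD (dCartan κ.cartan.1) β ξ p k j := by
    rw [twistedD_apply, twistedD_apply]
    refine congrArg₂ HSub.hSub (dCartan_apply_congr hβ) ?_
    exact MF.mul_apply_congr_right fun k' j' hk hj => hβ k' j' p (by omega)
  have h2 : ∀ s, twistedD (dCartan κ.cartan.1) (α s) ξ p k j =
      MF.map str (evalReal (s : ℝ) (derivative (polyExp (N + 1 + 1) (D.totalPoly D' κ i ξ p)))) k j := by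
    intro s
    have e1 := congrArg (fun α : MF (TangentSpace 𝓘(ℝ, EP) p) ℂ => α k j)
      ((D.line D' s).dCartan_trace_mul_expSum κ hc hstr hcs (D.covariant_delta D') hi ξ N)
    have e2 := GaugeBundle.trace_eq (hs s) hstr hi ξ
    rw [map_derivative_polyExp hstr _ _ (by rw [D.evalReal_totalPoly D' κ hi, eps_total]),
      evalReal_derivative_totalPoly, D.evalReal_totalPoly D' κ hi, twistedD_apply]
    refine (congrArg₂ HSub.hSub e1 ?_).trans (add_sub_cancel_right _ _)
    refine MF.mul_apply_congr_right fun k' j' hk hj => ?_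
    refine (congrFun (congrFun e2 k') j').trans ?_
    refine congrArg str.compContinuousAlternatingMap ?_
    refine MF.mul_apply_congr_right fun k'' j'' hk' hj' => ?_
    exact MF.expSum_apply_congr (total_zero_zero _ _ _ _ _) (by omega) (by omega)
  have h3 : twistedD (dCartan κ.cartan.1) β ξ p k j = MF.map str (polyIntegral
      (derivative (polyExp (N + 1 + 1) (D.totalPoly D' κ i ξ p)))) k j := by
    have hdeg := (natDegree_derivative_le (polyExp (N + 1 + 1) (D.totalPoly D' κ i ξ p))).trans
      ((Nat.sub_le _ _).trans (natDegree_polyExp (N := N + 1 + 1)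
        (D.natDegree_totalPoly D' κ i ξ p)))
    rw [polyIntegral_eq_quadrature (d := d) (by omega)]
    refine (congrArg (fun α : RawCartan EG G EP P => α ξ p k j) (map_sum _ _ _)).trans ?_
    refine (sum_apply_cartan _ _ ξ p k j).trans ?_
    rw [map_sum, MF.sum_apply]
    refine Finset.sum_congr rfl fun s _ => ?_
    rw [map_smul, map_smul, MF.smul_apply, RawCartan.smul_apply, h2]
    ext v
    exact Complex.real_smul.symm
  have h4 : ∀ t : ℝ, MF.map str (evalReal t (polyExp (N + 1 + 1) (D.totalPoly D' κ i ξ p))) k j =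
      Q.trace str ((D.line D' t).expTotal κ) ξ p k j := fun t => by
    have e := congrFun (congrFun
      (GaugeBundle.trace_eq ((D.line D' t).covariant_expTotal κ hc) hstr hi ξ) k) j
    rw [evalReal_polyExp, D.evalReal_totalPoly D' κ hi]
    refine Eq.trans ?_ e.symm
    exact congrArg str.compContinuousAlternatingMap
      ((D.line D' t).expTotal_apply κ i ξ p (by omega)).symm
  rw [h1, h3, polyIntegral_derivative, map_sub, MF.sub_apply, h4, h4, line_one, line_zero]
  rfl

end GaugeConnection

end Gauge

/-! ### Pairs of equivariant modules -/

section Module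

variable {EG : Type*} [NormedAddCommGroup EG] [NormedSpace ℝ EG]
  {G : Type*} [TopologicalSpace G] [ChartedSpace EG G] [Group G] [LieGroup 𝓘(ℝ, EG) ∞ G]
  {EP : Type*} [NormedAddCommGroup EP] [NormedSpace ℝ EP]
  {P : Type*} [TopologicalSpace P] [ChartedSpace EP P] [IsManifold 𝓘(ℝ, EP) ∞ P]
  [MulAction G P]
  {EM : Type*} [NormedAddCommGroup EM] [NormedSpace ℝ EM]
  {M : Type*} [TopologicalSpace M] [ChartedSpace EM M] [IsManifold 𝓘(ℝ, EM) ∞ M]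
  [MulAction G M] [ContMDiffSMul 𝓘(ℝ, EG) 𝓘(ℝ, EM) ∞ G M]
  {H : Type*} [NormedAddCommGroup H] [InnerProductSpace ℂ H] [CompleteSpace H]
  {B : EquivPUBundle EG G EM M EP P H}

theorem contMDiffAt_mul_of_normedAlgebra {E S N A : Type*} [NormedAddCommGroup E]
    [NormedSpace ℝ E] [TopologicalSpace S] {I : ModelWithCorners ℝ E S} [TopologicalSpace N]
    [ChartedSpace S N] [NormedRing A] [NormedAlgebra ℝ A] {s t : N → A} {x : N}
    (hs : ContMDiffAt I 𝓘(ℝ, A) ∞ s x) (ht : ContMDiffAt I 𝓘(ℝ, A) ∞ t x) :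
    ContMDiffAt I 𝓘(ℝ, A) ∞ (fun y => s y * t y) x :=
  (ContinuousLinearMap.mul ℝ A).isBoundedBilinearMap.contDiff.contMDiff.contMDiffAt.comp x
    (f := fun y => (s y, t y)) (hs.prodMk_space ht)

namespace OpPair

/-- The pair of the operators `1 + K₀` and `1 + K₁`. -/
def onePlus (K₀ K₁ : TraceClass H) : OpPair H := 1 + inlL (TraceClass.opL K₁) + inrL (K₀ - K₁)

@[simp] theorem low_onePlus (K₀ K₁ : TraceClass H) : low (onePlus K₀ K₁) = 1 + K₁.op := by
  simp [onePlus, TraceClass.opL_apply]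

@[simp] theorem high_onePlus (K₀ K₁ : TraceClass H) : high (onePlus K₀ K₁) = 1 + K₀.op := by
  simp only [onePlus, map_add, high_one, high_inlL, high_inrL, TraceClass.opL_apply, map_sub]
  abel

theorem contMDiffAt_onePlus {E S N : Type*} [NormedAddCommGroup E] [NormedSpace ℝ E]
    [TopologicalSpace S] {I : ModelWithCorners ℝ E S} [TopologicalSpace N] [ChartedSpace S N]
    {s t : N → TraceClass H} {x : N} (hs : ContMDiffAt I 𝓘(ℝ, TraceClass H) ∞ s x)
    (ht : ContMDiffAt I 𝓘(ℝ, TraceClass H) ∞ t x) :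
    ContMDiffAt I 𝓘(ℝ, OpPair H) ∞ (fun y => onePlus (s y) (t y)) x := by
  have h : ContDiff ℝ ∞ (fun z : TraceClass H × TraceClass H => onePlus z.1 z.2) := by
    unfold onePlus
    fun_prop
  exact h.contMDiff.contMDiffAt.comp x (f := fun y => (s y, t y)) (hs.prodMk_space ht)

end OpPair

namespace EquivPUBundle.EquivModule

variable {E : P → Type*} [∀ p, AddCommGroup (E p)] [∀ p, Module ℂ (E p)] (𝓔 : B.EquivModule E)

theorem sigmaMat_one {a p : P} (hp : p ∈ 𝓔.dom a) : 𝓔.sigmaMat a a (1, p) = 0 := by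
  refine TraceClass.op_injective (ContinuousLinearMap.ext fun v => ?_)
  have h := 𝓔.sigma_frame a a 1 p p (one_smul G p) hp hp v
  rw [𝓔.sigma_one] at h
  simpa using (𝓔.frame a p).injective h

theorem sigmaMat_mul {a b c : P} {g g' : G} {p : P} (ha : p ∈ 𝓔.dom a) (hb : g' • p ∈ 𝓔.dom b)
    (hc : (g * g') • p ∈ 𝓔.dom c) : 1 + (𝓔.sigmaMat a c (g * g', p)).op =
      (1 + (𝓔.sigmaMat b c (g, g' • p)).op) * (1 + (𝓔.sigmaMat a b (g', p)).op) := by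
  refine ContinuousLinearMap.ext fun v => (𝓔.frame c ((g * g') • p)).injective ?_
  have h1 := 𝓔.sigma_frame a c (g * g') p _ rfl ha hc v
  rw [𝓔.sigma_mul g g' p (g' • p) _ rfl (smul_smul g g' p) rfl,
    𝓔.sigma_frame a b g' p _ rfl ha hb,
    𝓔.sigma_frame b c g (g' • p) _ (smul_smul g g' p) hb hc] at h1
  exact h1.symm

theorem trans_mul {a b p : P} (h : p ∈ 𝓔.dom a ∩ 𝓔.dom b) :
    (1 + (𝓔.trans a b p).op) * (1 + (𝓔.trans b a p).op) = 1 := by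
  refine ContinuousLinearMap.ext fun v => (𝓔.frame a p).injective ?_
  have h1 := 𝓔.frame_trans b a p h.symm v
  rw [𝓔.frame_trans a b p h] at h1
  exact h1.symm

theorem contMDiffAt_sigmaMat {a b : P} {x : G × P} (h : x.2 ∈ 𝓔.dom a)
    (h' : x.1 • x.2 ∈ 𝓔.dom b) :
    ContMDiffAt (𝓘(ℝ, EG).prod 𝓘(ℝ, EP)) 𝓘(ℝ, TraceClass H) ∞ (𝓔.sigmaMat a b) x := by
  have := B.smul_smooth
  exact (𝓔.sigmaMat_smooth a b).contMDiffAt ((((𝓔.isOpen_dom a).preimage continuous_snd).inter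
    ((𝓔.isOpen_dom b).preimage (contMDiff_act EG G EP P).continuous)).mem_nhds ⟨h, h'⟩)

theorem contMDiffAt_psiMat {a b : P} {u : unitary (H →L[ℂ] H)} {x : P × selfAdjoint (H →L[ℂ] H)}
    (h : x.1 ∈ 𝓔.dom a) (h' : B.act x.1 (u * selfAdjoint.expUnitary x.2) ∈ 𝓔.dom b) :
    ContMDiffAt (𝓘(ℝ, EP).prod 𝓘(ℝ, selfAdjoint (H →L[ℂ] H))) 𝓘(ℝ, TraceClass H) ∞
      (fun x : P × selfAdjoint (H →L[ℂ] H) =>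
        𝓔.psiMat a b (x.1, u * selfAdjoint.expUnitary x.2)) x :=
  (𝓔.psiMat_smooth a b u).contMDiffAt ((((𝓔.isOpen_dom a).preimage continuous_fst).inter
    ((𝓔.isOpen_dom b).preimage (B.act_smooth u).continuous)).mem_nhds ⟨h, h'⟩)

theorem mem_L {p : P} (u : unitary (H →L[ℂ] H)) : (u : H →L[ℂ] H) ∈ B.L p (B.act p u) :=
  Submodule.subset_span ⟨u, rfl, rfl⟩

theorem psiMatrix_mul_inv {a b p q : P} {u v : unitary (H →L[ℂ] H)} (ha : p ∈ 𝓔.dom a)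
    (hq : B.act p u = q) (hb : q ∈ 𝓔.dom b) (huv : u * v = 1) :
    𝓔.psiMatrix a b p u * 𝓔.psiMatrix b a q v = 1 := by
  have hp : B.act q v = p := by rw [← hq, ← B.act_mul, huv, B.act_one]
  refine ContinuousLinearMap.ext fun e => (𝓔.frame a p).injective ?_
  have hu : (u : H →L[ℂ] H) ∈ B.L p q := hq ▸ mem_L u
  have hv : (v : H →L[ℂ] H) ∈ B.L q p := hp ▸ mem_L v
  have h1 : (1 : H →L[ℂ] H) ∈ B.L p p :=
    Submodule.subset_span ⟨1, rfl, B.act_one p⟩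
  have h2 := 𝓔.psi_mul p q p ⟨_, hu⟩ ⟨_, hv⟩ ⟨1, h1⟩ (congrArg Subtype.val huv).symm (𝓔.frame a p e)
  rw [𝓔.psi_one p _ rfl, 𝓔.psi_frame b a q p v ⟨_, hv⟩ rfl hp hb ha,
    𝓔.psi_frame a b p q u ⟨_, hu⟩ rfl hq ha hb] at h2
  exact h2.symm

theorem sigmaMat_psiMatrix {a b a' b' p : P} {g : G} {u : unitary (H →L[ℂ] H)} (ha : p ∈ 𝓔.dom a)
    (hb : B.act p u ∈ 𝓔.dom b) (ha' : g • p ∈ 𝓔.dom a') (hb' : B.act (g • p) u ∈ 𝓔.dom b') :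
    (1 + (𝓔.sigmaMat a a' (g, p)).op) * 𝓔.psiMatrix a b p u =
      𝓔.psiMatrix a' b' (g • p) u * (1 + (𝓔.sigmaMat b b' (g, B.act p u)).op) := by
  refine ContinuousLinearMap.ext fun e => (𝓔.frame a' (g • p)).injective ?_
  have h := 𝓔.psi_sigma g p (B.act p u) (g • p) (B.act (g • p) u) rfl (B.act_equivariant g p u)
    ⟨_, mem_L u⟩ ⟨_, mem_L u⟩ rfl (𝓔.frame b _ e)
  rw [𝓔.psi_frame a b p _ u ⟨_, mem_L u⟩ rfl rfl ha hb,
    𝓔.sigma_frame a a' g p _ rfl ha ha', 𝓔.sigma_frame b b' g _ _ (B.act_equivariant g p u) hb hb',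
    𝓔.psi_frame a' b' _ _ u ⟨_, mem_L u⟩ rfl rfl ha' hb'] at h
  exact h

end EquivPUBundle.EquivModule

open EquivPUBundle.EquivModule

variable {E₀ : P → Type*} [∀ p, AddCommGroup (E₀ p)] [∀ p, Module ℂ (E₀ p)]
  {E₁ : P → Type*} [∀ p, AddCommGroup (E₁ p)] [∀ p, Module ℂ (E₁ p)]
  (𝓔₀ : B.EquivModule E₀) (𝓔₁ : B.EquivModule E₁)

/-- The matrix of the gerbe action on the pair of modules. -/
def pairPsi (i j : P × P) (p : P) (u : unitary (H →L[ℂ] H)) : OpPair H :=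
  OpPair.onePlus (𝓔₀.psiMat i.1 j.1 (p, u)) (𝓔₁.psiMat i.2 j.2 (p, u)) *
    OpPair.inlL (u : H →L[ℂ] H)

theorem low_pairPsi (i j : P × P) (p : P) (u : unitary (H →L[ℂ] H)) :
    OpPair.low (pairPsi 𝓔₀ 𝓔₁ i j p u) = 𝓔₁.psiMatrix i.2 j.2 p u := by
  simp [pairPsi, EquivPUBundle.EquivModule.psiMatrix]

theorem high_pairPsi (i j : P × P) (p : P) (u : unitary (H →L[ℂ] H)) :
    OpPair.high (pairPsi 𝓔₀ 𝓔₁ i j p u) = 𝓔₀.psiMatrix i.1 j.1 p u := by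
  simp [pairPsi, EquivPUBundle.EquivModule.psiMatrix]

theorem pairPsi_mul_inv {i j : P × P} {p q : P} {u v : unitary (H →L[ℂ] H)}
    (hp : p ∈ 𝓔₀.dom i.1 ∩ 𝓔₁.dom i.2) (hq : B.act p u = q) (hj : q ∈ 𝓔₀.dom j.1 ∩ 𝓔₁.dom j.2)
    (huv : u * v = 1) : pairPsi 𝓔₀ 𝓔₁ i j p u * pairPsi 𝓔₀ 𝓔₁ j i q v = 1 := by
  refine OpPair.ext_op ?_ ?_
  · rw [OpPair.low_mul, low_pairPsi, low_pairPsi, OpPair.low_one]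
    exact 𝓔₁.psiMatrix_mul_inv hp.2 hq hj.2 huv
  · rw [OpPair.high_mul, high_pairPsi, high_pairPsi, OpPair.high_one]
    exact 𝓔₀.psiMatrix_mul_inv hp.1 hq hj.1 huv

theorem contDiff_expUnitary :
    ContDiff ℝ ∞ (fun a : selfAdjoint (H →L[ℂ] H) => (selfAdjoint.expUnitary a : H →L[ℂ] H)) := by
  simp only [selfAdjoint.expUnitary_coe]
  have h : ContDiff ℝ ∞ (fun T : H →L[ℂ] H => NormedSpace.exp T) :=
    contDiff_iff_contDiffAt.2 fun T =>
      ((NormedSpace.exp_analytic (𝕂 := ℂ) T).contDiffAt (n := ∞)).restrict_scalars ℝ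
  have h2 : ContDiff ℝ ∞ (fun a : selfAdjoint (H →L[ℂ] H) => Complex.I • (a : H →L[ℂ] H)) :=
    (ContDiff.const_smul _ (selfAdjoint.submodule ℝ (H →L[ℂ] H)).subtypeL.contDiff)
  exact h.comp h2

theorem contDiff_inlL_mul_expUnitary (u : unitary (H →L[ℂ] H)) :
    ContDiff ℝ ∞ fun a : selfAdjoint (H →L[ℂ] H) =>
      OpPair.inlL ((u * selfAdjoint.expUnitary a : unitary (H →L[ℂ] H)) : H →L[ℂ] H) := by
  have h : ContDiff ℝ ∞ fun T : H →L[ℂ] H => OpPair.inlL ((u : H →L[ℂ] H) * T) := by fun_prop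
  exact h.comp contDiff_expUnitary

theorem contMDiffAt_pairPsi {i j : P × P} {u : unitary (H →L[ℂ] H)}
    {x : P × selfAdjoint (H →L[ℂ] H)} (hi : x.1 ∈ 𝓔₀.dom i.1 ∩ 𝓔₁.dom i.2)
    (hj : B.act x.1 (u * selfAdjoint.expUnitary x.2) ∈ 𝓔₀.dom j.1 ∩ 𝓔₁.dom j.2) :
    ContMDiffAt (𝓘(ℝ, EP).prod 𝓘(ℝ, selfAdjoint (H →L[ℂ] H))) 𝓘(ℝ, OpPair H) ∞
      (fun x : P × selfAdjoint (H →L[ℂ] H) =>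
        pairPsi 𝓔₀ 𝓔₁ i j x.1 (u * selfAdjoint.expUnitary x.2)) x := by
  have h1 := OpPair.contMDiffAt_onePlus (𝓔₀.contMDiffAt_psiMat hi.1 hj.1)
    (𝓔₁.contMDiffAt_psiMat hi.2 hj.2)
  have h2 : ContMDiffAt (𝓘(ℝ, EP).prod 𝓘(ℝ, selfAdjoint (H →L[ℂ] H))) 𝓘(ℝ, OpPair H) ∞
      (fun x : P × selfAdjoint (H →L[ℂ] H) => OpPair.inlL
        ((u * selfAdjoint.expUnitary x.2 : unitary (H →L[ℂ] H)) : H →L[ℂ] H)) x :=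
    ContMDiffAt.comp (I' := 𝓘(ℝ, selfAdjoint (H →L[ℂ] H))) x (g := fun a => OpPair.inlL
        ((u * selfAdjoint.expUnitary a : unitary (H →L[ℂ] H)) : H →L[ℂ] H)) (f := Prod.snd)
      (contDiff_inlL_mul_expUnitary u).contMDiff.contMDiffAt contMDiffAt_snd
  exact contMDiffAt_mul_of_normedAlgebra h1 h2

/-- The pair of two modules: the frames are the pairs of frames of the modules. -/
def pairBundle : GaugeBundle B (OpPair H) (P × P) where
  dom i := 𝓔₀.dom i.1 ∩ 𝓔₁.dom i.2
  isOpen_dom i := (𝓔₀.isOpen_dom _).inter (𝓔₁.isOpen_dom _)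
  cover p := ⟨(p, p), 𝓔₀.mem_dom p, 𝓔₁.mem_dom p⟩
  S i j x := OpPair.onePlus (𝓔₀.sigmaMat i.1 j.1 x) (𝓔₁.sigmaMat i.2 j.2 x)
  S_smooth i j := by
    intro x hx
    exact (OpPair.contMDiffAt_onePlus (𝓔₀.contMDiffAt_sigmaMat hx.1.1 hx.2.1)
      (𝓔₁.contMDiffAt_sigmaMat hx.1.2 hx.2.2)).contMDiffWithinAt
  S_one i p hp := by
    rw [𝓔₀.sigmaMat_one hp.1, 𝓔₁.sigmaMat_one hp.2]
    simp [OpPair.onePlus]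
  S_mul i j k g g' p hi hj hk := by
    refine OpPair.ext_op ?_ ?_
    · simpa using 𝓔₁.sigmaMat_mul hi.2 hj.2 hk.2
    · simpa using 𝓔₀.sigmaMat_mul hi.1 hj.1 hk.1
  Psi := pairPsi 𝓔₀ 𝓔₁
  Psi_smooth i j u := by
    intro x hx
    exact (contMDiffAt_pairPsi _ _ hx.1 hx.2).contMDiffWithinAt
  Psi_isUnit i j p u hi hj := by
    refine ⟨⟨pairPsi 𝓔₀ 𝓔₁ i j p u, pairPsi 𝓔₀ 𝓔₁ j i (B.act p u) u⁻¹, ?_, ?_⟩, rfl⟩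
    · exact pairPsi_mul_inv _ _ hi rfl hj (mul_inv_cancel u)
    · exact pairPsi_mul_inv _ _ hj (by rw [← B.act_mul, mul_inv_cancel, B.act_one]) hi
        (inv_mul_cancel u)
  S_Psi i j i' j' g p u hi hj hi' hj' := by
    refine OpPair.ext_op ?_ ?_
    · rw [OpPair.low_mul, OpPair.low_mul, low_pairPsi, low_pairPsi, OpPair.low_onePlus,
        OpPair.low_onePlus]
      exact 𝓔₁.sigmaMat_psiMatrix hi.2 hj.2 hi'.2 hj'.2
    · rw [OpPair.high_mul, OpPair.high_mul, high_pairPsi, high_pairPsi, OpPair.high_onePlus,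
        OpPair.high_onePlus]
      exact 𝓔₀.sigmaMat_psiMatrix hi.1 hj.1 hi'.1 hj'.1

end Module

/-! ### Pairs of connections with trace class difference -/

section PairConnection

variable {EG : Type*} [NormedAddCommGroup EG] [NormedSpace ℝ EG]
  {G : Type*} [TopologicalSpace G] [ChartedSpace EG G] [Group G] [LieGroup 𝓘(ℝ, EG) ∞ G]
  {EP : Type*} [NormedAddCommGroup EP] [NormedSpace ℝ EP]
  {P : Type*} [TopologicalSpace P] [ChartedSpace EP P] [IsManifold 𝓘(ℝ, EP) ∞ P]
  [MulAction G P]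
  {EM : Type*} [NormedAddCommGroup EM] [NormedSpace ℝ EM]
  {M : Type*} [TopologicalSpace M] [ChartedSpace EM M] [IsManifold 𝓘(ℝ, EM) ∞ M]
  [MulAction G M] [ContMDiffSMul 𝓘(ℝ, EG) 𝓘(ℝ, EM) ∞ G M]
  {H : Type*} [NormedAddCommGroup H] [InnerProductSpace ℂ H] [CompleteSpace H]
  {B : EquivPUBundle EG G EM M EP P H}

section dvec

variable {E S N F F' : Type*} [NormedAddCommGroup E] [NormedSpace ℝ E] [TopologicalSpace S]
  {I : ModelWithCorners ℝ E S} [TopologicalSpace N] [ChartedSpace S N]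
  [NormedAddCommGroup F] [NormedSpace ℝ F] [NormedAddCommGroup F'] [NormedSpace ℝ F']

theorem dvec_clm (L : F →L[ℝ] F') {s : N → F} {x : N} (hs : ContMDiffAt I 𝓘(ℝ, F) ∞ s x)
    (Y : TangentSpace I x) : dvec I (fun y => L (s y)) x Y = L (dvec I s x Y) := by
  have h := (L.hasMFDerivAt (x := s x)).comp x (hs.mdifferentiableAt (by simp)).hasMFDerivAt
  exact congrArg (fun T : TangentSpace I x →L[ℝ] F' => T Y) h.mfderiv

theorem dvec_one_add_op {t : N → TraceClass H} {x : N}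
    (ht : ContMDiffAt I 𝓘(ℝ, TraceClass H) ∞ t x) (Y : TangentSpace I x) :
    dvec I (fun y => 1 + (t y).op) x Y = (dvec I t x Y).op := by
  have h := ((TraceClass.opL (H := H)).hasMFDerivAt (x := t x)).comp x
    (ht.mdifferentiableAt (by simp)).hasMFDerivAt
  exact congrArg (fun T : TangentSpace I x →L[ℝ] (H →L[ℂ] H) => T Y)
    (((hasMFDerivAt_const (I := I) (I' := 𝓘(ℝ, H →L[ℂ] H)) (1 : H →L[ℂ] H) x).add
      h).mfderiv.trans (zero_add _))

variable {t₀ t₁ : N → TraceClass H} {x : N}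

theorem low_dvec_onePlus (h₀ : ContMDiffAt I 𝓘(ℝ, TraceClass H) ∞ t₀ x)
    (h₁ : ContMDiffAt I 𝓘(ℝ, TraceClass H) ∞ t₁ x) (Y : TangentSpace I x) :
    OpPair.low (dvec I (fun y => OpPair.onePlus (t₀ y) (t₁ y)) x Y) = (dvec I t₁ x Y).op := by
  rw [← dvec_one_add_op h₁]
  refine (dvec_clm OpPair.lowL (OpPair.contMDiffAt_onePlus h₀ h₁) Y).symm.trans ?_
  simp only [OpPair.lowL_apply, OpPair.low_onePlus]

theorem high_dvec_onePlus (h₀ : ContMDiffAt I 𝓘(ℝ, TraceClass H) ∞ t₀ x)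
    (h₁ : ContMDiffAt I 𝓘(ℝ, TraceClass H) ∞ t₁ x) (Y : TangentSpace I x) :
    OpPair.high (dvec I (fun y => OpPair.onePlus (t₀ y) (t₁ y)) x Y) = (dvec I t₀ x Y).op := by
  rw [← dvec_one_add_op h₀]
  refine (dvec_clm OpPair.highL (OpPair.contMDiffAt_onePlus h₀ h₁) Y).symm.trans ?_
  simp only [OpPair.highL_apply, OpPair.high_onePlus]

end dvec

/-- The gauge transform `T' (α T + dT)` of a form, which is the connection form in a frame changed
by `T` if `T'` is inverse to `T`. -/
theorem exists_gauge_transform {A : Type*} [NormedRing A] [NormedAlgebra ℝ A]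
    {α : RawForm 𝓘(ℝ, EP) P A 1} {T T' : P → A} {p : P} (hα : SmoothFormAt 𝓘(ℝ, EP) α p)
    (hT : ∀ᶠ q in 𝓝 p, ContMDiffAt 𝓘(ℝ, EP) 𝓘(ℝ, A) ∞ T q)
    (hT' : ContMDiffAt 𝓘(ℝ, EP) 𝓘(ℝ, A) ∞ T' p) :
    ∃ β : RawForm 𝓘(ℝ, EP) P A 1, SmoothFormAt 𝓘(ℝ, EP) β p ∧ ∀ᶠ q in 𝓝 p,
      ∀ X : TangentSpace 𝓘(ℝ, EP) q, β q (fun _ => X) =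
        T' q * (α q (fun _ => X) * T q + dvec 𝓘(ℝ, EP) T q X) := by
  let β : (q : P) → MF (TangentSpace 𝓘(ℝ, EP) q) A := fun q =>
    MF.const (T' q) * (MF.single 0 1 (α q) * MF.const (T q) +
      extDF 𝓘(ℝ, EP) (fun q => MF.const (T q)) q)
  have hc := SmoothFieldAt.const 𝓘(ℝ, EP) hT.self_of_nhds
  have hβ : SmoothFieldAt 𝓘(ℝ, EP) β p :=
    SmoothFieldAt.mul _ (SmoothFieldAt.const _ hT') (SmoothFieldAt.add _
      (SmoothFieldAt.mul _ (SmoothFieldAt.single _ hα) hc) (SmoothFieldAt.extDF _ hc))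
  refine ⟨fun q => β q 0 1, hβ 0 1, ?_⟩
  filter_upwards [hT] with q hq X
  simp only [β]
  rw [extDF_const, MF.const_mul_apply, MF.add_apply, ContinuousAlternatingMap.add_apply,
    MF.mul_const_apply, MF.single_apply_same, MF.single_apply_same, extD_zeroForm _ hq]
  rfl

variable {E₀ : P → Type*} [∀ p, AddCommGroup (E₀ p)] [∀ p, Module ℂ (E₀ p)]
  {E₁ : P → Type*} [∀ p, AddCommGroup (E₁ p)] [∀ p, Module ℂ (E₁ p)]
  {𝓔₀ : B.EquivModule E₀} {𝓔₁ : B.EquivModule E₁} {θ : B.GerbeConnection}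
  {D₀ : 𝓔₀.Connection θ} {D₁ : 𝓔₁.Connection θ}

theorem EquivPUBundle.EquivModule.contMDiffAt_trans {E : P → Type*} [∀ p, AddCommGroup (E p)]
    [∀ p, Module ℂ (E p)] (𝓔 : B.EquivModule E) {a b p : P} (h : p ∈ 𝓔.dom a ∩ 𝓔.dom b) :
    ContMDiffAt 𝓘(ℝ, EP) 𝓘(ℝ, TraceClass H) ∞ (𝓔.trans a b) p :=
  (𝓔.trans_smooth a b).contMDiffAt (((𝓔.isOpen_dom a).inter (𝓔.isOpen_dom b)).mem_nhds h)

theorem EquivPUBundle.EquivModule.Connection.A_eq {E : P → Type*} [∀ p, AddCommGroup (E p)]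
    [∀ p, Module ℂ (E p)] {𝓔 : B.EquivModule E} (D : 𝓔.Connection θ) {a b p : P}
    (h : p ∈ 𝓔.dom a ∩ 𝓔.dom b) (X : TangentSpace 𝓘(ℝ, EP) p) : D.A b p (fun _ => X) =
      (1 + (𝓔.trans b a p).op) * (D.A a p (fun _ => X) * (1 + (𝓔.trans a b p).op) +
        (dvec 𝓘(ℝ, EP) (𝓔.trans a b) p X).op) := by
  have e := congrArg (fun T => (1 + (𝓔.trans b a p).op) * T) (D.gauge a b p h X)
  simp only [← mul_assoc, 𝓔.trans_mul h.symm, one_mul] at e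
  exact e

theorem exists_smooth_pair (hD : EquivPUBundle.TraceClassDifference D₀ D₁) {i : P × P} {p : P}
    (hp : p ∈ 𝓔₀.dom i.1 ∩ 𝓔₁.dom i.2) : ∃ α : RawForm 𝓘(ℝ, EP) P (OpPair H) 1,
      SmoothFormAt 𝓘(ℝ, EP) α p ∧ ∀ᶠ q in 𝓝 p, ∀ X : TangentSpace 𝓘(ℝ, EP) q,
        OpPair.low (α q fun _ => X) = D₁.A i.2 q (fun _ => X) ∧
        OpPair.high (α q fun _ => X) = D₀.A i.1 q (fun _ => X) := by
  obtain ⟨a, b, W, hW, hpW, hsub, δ, hδ⟩ := hD p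
  have hO : ∀ᶠ q in 𝓝 p, q ∈ W ∧ q ∈ 𝓔₀.dom i.1 ∩ 𝓔₁.dom i.2 :=
    (hW.inter ((𝓔₀.isOpen_dom _).inter (𝓔₁.isOpen_dom _))).mem_nhds ⟨hpW, hp⟩
  obtain ⟨β, hβ, hβ'⟩ := exists_gauge_transform
    (α := fun q => OpPair.inlL.compContinuousAlternatingMap (D₁.A b q) +
      OpPair.inrL.compContinuousAlternatingMap (δ q))
    (T := fun q => OpPair.onePlus (𝓔₀.trans a i.1 q) (𝓔₁.trans b i.2 q))
    (T' := fun q => OpPair.onePlus (𝓔₀.trans i.1 a q) (𝓔₁.trans i.2 b q)) (p := p)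
    (SmoothFormAt.add _ (SmoothFormAt.map _ (D₁.smooth b p (hsub hpW).2) _)
      (SmoothFormAt.map _ (hδ p hpW).1 _))
    (hO.mono fun q hq => OpPair.contMDiffAt_onePlus
      (𝓔₀.contMDiffAt_trans ⟨(hsub hq.1).1, hq.2.1⟩) (𝓔₁.contMDiffAt_trans ⟨(hsub hq.1).2, hq.2.2⟩))
    (OpPair.contMDiffAt_onePlus (𝓔₀.contMDiffAt_trans ⟨hp.1, (hsub hpW).1⟩)
      (𝓔₁.contMDiffAt_trans ⟨hp.2, (hsub hpW).2⟩))
  refine ⟨β, hβ, ?_⟩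
  filter_upwards [hO, hβ'] with q hq e X
  have h₀ := 𝓔₀.contMDiffAt_trans ⟨(hsub hq.1).1, hq.2.1⟩
  have h₁ := 𝓔₁.contMDiffAt_trans ⟨(hsub hq.1).2, hq.2.2⟩
  rw [e X, D₁.A_eq ⟨(hsub hq.1).2, hq.2.2⟩, D₀.A_eq ⟨(hsub hq.1).1, hq.2.1⟩]
  constructor
  · rw [OpPair.low_mul, map_add, OpPair.low_mul, low_dvec_onePlus h₀ h₁]
    simp
  · rw [OpPair.high_mul, map_add, OpPair.high_mul, high_dvec_onePlus h₀ h₁, OpPair.high_onePlus,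
      OpPair.high_onePlus, ← sub_add_cancel (D₀.A a q fun _ => X) (D₁.A b q fun _ => X),
      (hδ q hq.1).2, add_comm (δ q _).op]
    simp

/-- `α` is the connection form of the pair of connections `D₀`, `D₁` at a point. -/
def IsPairForm (D₀ : 𝓔₀.Connection θ) (D₁ : 𝓔₁.Connection θ) (i : P × P) (p : P)
    (α : (TangentSpace 𝓘(ℝ, EP) p) [⋀^Fin 1]→L[ℝ] OpPair H) : Prop :=
  ∀ X : TangentSpace 𝓘(ℝ, EP) p, OpPair.low (α fun _ => X) = D₁.A i.2 p (fun _ => X) ∧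
    OpPair.high (α fun _ => X) = D₀.A i.1 p (fun _ => X)

theorem IsPairForm.unique {i : P × P} {p : P}
    {α β : (TangentSpace 𝓘(ℝ, EP) p) [⋀^Fin 1]→L[ℝ] OpPair H} (hα : IsPairForm D₀ D₁ i p α)
    (hβ : IsPairForm D₀ D₁ i p β) : α = β := by
  ext v
  have hv : v = fun _ => v 0 := funext fun l => by fin_cases l; rfl
  rw [hv]
  exact OpPair.ext_op ((hα _).1.trans (hβ _).1.symm) ((hα _).2.trans (hβ _).2.symm)

open Classical in
variable (D₀ D₁) in
/-- The connection form of the pair of connections. -/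
def pairForm (i : P × P) : RawForm 𝓘(ℝ, EP) P (OpPair H) 1 := fun p =>
  if h : ∃ α, IsPairForm D₀ D₁ i p α then h.choose else 0

theorem pairForm_eq {i : P × P} {p : P}
    {α : (TangentSpace 𝓘(ℝ, EP) p) [⋀^Fin 1]→L[ℝ] OpPair H} (hα : IsPairForm D₀ D₁ i p α) :
    pairForm D₀ D₁ i p = α := by
  have h : ∃ α, IsPairForm D₀ D₁ i p α := ⟨α, hα⟩
  rw [pairForm, dif_pos h]
  exact h.choose_spec.unique hα

theorem isPairForm_pairForm (hD : EquivPUBundle.TraceClassDifference D₀ D₁) {i : P × P} {p : P}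
    (hp : p ∈ 𝓔₀.dom i.1 ∩ 𝓔₁.dom i.2) : IsPairForm D₀ D₁ i p (pairForm D₀ D₁ i p) := by
  obtain ⟨α, -, hα⟩ := exists_smooth_pair hD hp
  have h : IsPairForm D₀ D₁ i p (α p) := hα.self_of_nhds
  rwa [pairForm_eq h]

/-- The pair of two connections with trace class difference. -/
def pairConnection (hD : EquivPUBundle.TraceClassDifference D₀ D₁) :
    GaugeConnection (pairBundle 𝓔₀ 𝓔₁) θ OpPair.scalarL where
  A := pairForm D₀ D₁
  smooth i p hp := by
    obtain ⟨α, hα, hα'⟩ := exists_smooth_pair hD hp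
    exact SmoothFormAt.congr _ hα (hα'.mono fun q hq => pairForm_eq hq)
  invariant i j g p hi hj X := by
    have hA := isPairForm_pairForm hD hi
    have hA' := isPairForm_pairForm hD hj
    have h₀ : ContMDiffAt 𝓘(ℝ, EP) 𝓘(ℝ, TraceClass H) ∞ (fun q => 𝓔₀.sigmaMat i.1 j.1 (g, q)) p :=
      (𝓔₀.contMDiffAt_sigmaMat (x := (g, p)) hi.1 hj.1).comp p
        (contMDiffAt_const.prodMk contMDiffAt_id)
    have h₁ : ContMDiffAt 𝓘(ℝ, EP) 𝓘(ℝ, TraceClass H) ∞ (fun q => 𝓔₁.sigmaMat i.2 j.2 (g, q)) p :=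
      (𝓔₁.contMDiffAt_sigmaMat (x := (g, p)) hi.2 hj.2).comp p
        (contMDiffAt_const.prodMk contMDiffAt_id)
    refine OpPair.ext_op ?_ ?_
    · rw [map_add, OpPair.low_mul, OpPair.low_mul, (hA X).1, (hA' _).1]
      refine Eq.trans ?_ (congrArg _ (low_dvec_onePlus h₀ h₁ X).symm)
      refine Eq.trans ?_ (add_comm _ _)
      simp only [pairBundle, OpPair.low_onePlus]
      exact (D₁.invariant i.2 j.2 g p hi.2 hj.2 X).symm
    · rw [map_add, OpPair.high_mul, OpPair.high_mul, (hA X).2, (hA' _).2]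
      refine Eq.trans ?_ (congrArg _ (high_dvec_onePlus h₀ h₁ X).symm)
      refine Eq.trans ?_ (add_comm _ _)
      simp only [pairBundle, OpPair.high_onePlus]
      exact (D₀.invariant i.1 j.1 g p hi.1 hj.1 X).symm
  compatible i j p u hi hj X b := by
    have hA := isPairForm_pairForm hD hi
    have hA' := isPairForm_pairForm hD hj
    have hs := contMDiffAt_pairPsi 𝓔₀ 𝓔₁ (i := i) (j := j) (u := u) (x := (p, 0)) hi
      (by rw [selfAdjoint.expUnitary_zero, mul_one]; exact hj)
    refine OpPair.ext_op ?_ ?_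
    · rw [map_add, OpPair.low_mul, OpPair.low_mul, map_add, (hA X).1, (hA' _).1,
        OpPair.low_scalarL]
      refine Eq.trans ?_ (add_comm _ _)
      refine Eq.trans ?_ (congrArg (fun T => T + _) (dvec_clm OpPair.lowL hs _))
      simp only [pairBundle, low_pairPsi, OpPair.lowL_apply]
      exact (D₁.compatible i.2 j.2 p u hi.2 hj.2 X b).symm
    · rw [map_add, OpPair.high_mul, OpPair.high_mul, map_add, (hA X).2, (hA' _).2,
        OpPair.high_scalarL]
      refine Eq.trans ?_ (add_comm _ _)
      refine Eq.trans ?_ (congrArg (fun T => T + _) (dvec_clm OpPair.highL hs _))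
      simp only [pairBundle, high_pairPsi, OpPair.highL_apply]
      exact (D₀.compatible i.1 j.1 p u hi.1 hj.1 X b).symm

end PairConnection

/-! ### The Chern character form of a pair of connections -/

section PairConnection

variable {EG : Type*} [NormedAddCommGroup EG] [NormedSpace ℝ EG]
  {G : Type*} [TopologicalSpace G] [ChartedSpace EG G] [Group G] [LieGroup 𝓘(ℝ, EG) ∞ G]
  {EP : Type*} [NormedAddCommGroup EP] [NormedSpace ℝ EP]
  {P : Type*} [TopologicalSpace P] [ChartedSpace EP P] [IsManifold 𝓘(ℝ, EP) ∞ P]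
  [MulAction G P]
  {EM : Type*} [NormedAddCommGroup EM] [NormedSpace ℝ EM]
  {M : Type*} [TopologicalSpace M] [ChartedSpace EM M] [IsManifold 𝓘(ℝ, EM) ∞ M]
  [MulAction G M] [ContMDiffSMul 𝓘(ℝ, EG) 𝓘(ℝ, EM) ∞ G M]
  {H : Type*} [NormedAddCommGroup H] [InnerProductSpace ℂ H] [CompleteSpace H]
  {B : EquivPUBundle EG G EM M EP P H}

namespace EquivPUBundle.EquivModule

variable {E : P → Type*} [∀ p, AddCommGroup (E p)] [∀ p, Module ℂ (E p)] (𝓔 : B.EquivModule E)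

theorem dvec_sigmaMat_inv {a p : P} (hp : p ∈ 𝓔.dom a) (ξ : GroupLieAlgebra 𝓘(ℝ, EG) G) :
    dvec 𝓘(ℝ, EG) (fun g : G => 𝓔.sigmaMat a a (g, g⁻¹ • p)) 1 ξ =
      dvec 𝓘(ℝ, EG) (fun g : G => 𝓔.sigmaMat a a (g, p)) 1 ξ := by
  have := B.smul_smooth
  have hΦ : MDifferentiableAt (𝓘(ℝ, EG).prod 𝓘(ℝ, EP)) 𝓘(ℝ, TraceClass H) (𝓔.sigmaMat a a) (1, p) :=
    (𝓔.contMDiffAt_sigmaMat (x := (1, p)) hp (by simpa using hp)).mdifferentiableAt (by simp)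
  have hy : MDifferentiableAt 𝓘(ℝ, EG) 𝓘(ℝ, EP) (fun g : G => g⁻¹ • p) 1 :=
    ((contMDiff_act EG G EP P).comp ((contMDiff_inv 𝓘(ℝ, EG) ∞).prodMk
      (contMDiff_const (c := p)))).mdifferentiable (by simp) 1
  let Y : EP := mfderiv 𝓘(ℝ, EG) 𝓘(ℝ, EP) (fun g : G => g⁻¹ • p) 1 ξ
  let T : EG × EP →L[ℝ] TraceClass H :=
    mfderiv (𝓘(ℝ, EG).prod 𝓘(ℝ, EP)) 𝓘(ℝ, TraceClass H) (𝓔.sigmaMat a a) (1, p)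
  have e1 : dvec 𝓘(ℝ, EG) (fun g : G => 𝓔.sigmaMat a a (g, g⁻¹ • p)) 1 ξ = T (ξ, Y) := by
    refine (mfderiv_comp_prodMk (I := 𝓘(ℝ, EG)) (φ := fun g : G => g) (x := (1 : G)) mdifferentiableAt_id hy
      (by simp) hΦ Filter.EventuallyEq.rfl ξ).trans ?_
    exact congrArg (fun v : EG => T (v, Y)) (congrArg (fun L : EG →L[ℝ] EG => L ξ) mfderiv_id)
  have e2 : dvec 𝓘(ℝ, EG) (fun g : G => 𝓔.sigmaMat a a (g, p)) 1 ξ = T (ξ, 0) := by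
    refine (mfderiv_comp_prodMk (I := 𝓘(ℝ, EG)) (φ := fun g : G => g) (y := fun _ => p) (x := (1 : G)) mdifferentiableAt_id
      mdifferentiableAt_const rfl hΦ Filter.EventuallyEq.rfl ξ).trans ?_
    exact congrArg₂ (fun (v : EG) (w : EP) => T (v, w))
      (congrArg (fun L : EG →L[ℝ] EG => L ξ) mfderiv_id)
      (congrArg (fun L : EG →L[ℝ] EP => L ξ) mfderiv_const)
  have e3 : T (0, Y) = 0 := by
    have ha : ∀ᶠ q in 𝓝 p, q ∈ 𝓔.dom a := (𝓔.isOpen_dom a).mem_nhds hp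
    have h := mfderiv_comp_prodMk (I := 𝓘(ℝ, EP)) (I'' := 𝓘(ℝ, TraceClass H))
      (φ := fun _ : P => (1 : G)) (y := fun q : P => q) (x := p)
      (f := fun _ => (0 : TraceClass H)) mdifferentiableAt_const mdifferentiableAt_id rfl hΦ
      (ha.mono fun q hq => (𝓔.sigmaMat_one hq).symm) Y
    have h0 : @Eq (TraceClass H) (mfderiv 𝓘(ℝ, EP) 𝓘(ℝ, TraceClass H)
        (fun _ : P => (0 : TraceClass H)) p Y) 0 := by
      rw [mfderiv_const]
      rfl
    refine Eq.trans ?_ (h.symm.trans h0)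
    exact congrArg₂ (fun (v : EG) (w : EP) => T (v, w))
      (congrArg (fun L : EP →L[ℝ] EG => L Y) mfderiv_const).symm
      (congrArg (fun L : EP →L[ℝ] EP => L Y) mfderiv_id).symm
  have e4 : ∀ ζ : EG, ((ζ, Y) : EG × EP) = (ζ, 0) + (0, Y) := fun ζ => by simp
  rw [e1, e2]
  refine (congrArg T (e4 ξ)).trans ((map_add T _ _).trans ?_)
  rw [e3, add_zero]

end EquivPUBundle.EquivModule

variable {E₀ : P → Type*} [∀ p, AddCommGroup (E₀ p)] [∀ p, Module ℂ (E₀ p)]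
  {E₁ : P → Type*} [∀ p, AddCommGroup (E₁ p)] [∀ p, Module ℂ (E₁ p)]
  {𝓔₀ : B.EquivModule E₀} {𝓔₁ : B.EquivModule E₁} {θ : B.GerbeConnection}
  {D₀ : 𝓔₀.Connection θ} {D₁ : 𝓔₁.Connection θ} (κ : EquivPUBundle.EquivCurving θ)

theorem EquivPUBundle.EquivModule.Connection.total_eq_single {E : P → Type*}
    [∀ p, AddCommGroup (E p)] [∀ p, Module ℂ (E p)] {𝓔 : B.EquivModule E} (D : 𝓔.Connection θ)
    (a : P) (ξ : GroupLieAlgebra 𝓘(ℝ, EG) G) (p : P) :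
    @Eq (MF (TangentSpace 𝓘(ℝ, EP) p) (H →L[ℂ] H)) (D.total κ a ξ p)
      (MF.single 0 2 (D.curvature a p + ((ContinuousLinearMap.toSpanSingleton ℂ
        (1 : H →L[ℂ] H)).restrictScalars ℝ).compContinuousAlternatingMap (κ.f p)) +
      MF.shift (MF.const (D.moment a ξ p - κ.muL ξ p • (1 : H →L[ℂ] H)))) := by
  ext k j : 1
  rw [MF.add_apply, MF.const, MF.shift_single]
  by_cases h : k = 0 ∧ j = 2
  · obtain ⟨rfl, rfl⟩ := h
    rw [MF.single_apply_same, MF.single_apply_of_ne (by omega), add_zero]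
    rfl
  by_cases h' : k = 1 ∧ j = 0
  · obtain ⟨rfl, rfl⟩ := h'
    rw [MF.single_apply_same, MF.single_apply_of_ne (by omega), zero_add]
    rfl
  rw [MF.single_apply_of_ne h, MF.single_apply_of_ne h', add_zero]
  rcases k with _ | _ | k <;> rcases j with _ | _ | _ | j <;> first | rfl | omega

/-- A multiplicative map which takes a gauge connection to a module connection maps the equivariant
curvature to the equivariant curvature. -/
theorem map_total {𝒜 ι : Type*} [NormedRing 𝒜] [NormedAlgebra ℝ 𝒜] {Q : GaugeBundle B 𝒜 ι}
    {c : ℂ →L[ℝ] 𝒜} (D : GaugeConnection Q θ c) {L : 𝒜 →L[ℝ] (H →L[ℂ] H)}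
    (hL : ∀ a b, L (a * b) = L a * L b) (hc : ∀ z, L (c z) = z • 1) {E : P → Type*}
    [∀ p, AddCommGroup (E p)] [∀ p, Module ℂ (E p)] {𝓔 : B.EquivModule E} {D' : 𝓔.Connection θ}
    {i : ι} {a p : P} (hp : p ∈ Q.dom i)
    (hA : ∀ q ∈ Q.dom i, L.compContinuousAlternatingMap (D.A i q) = D'.A a q)
    {ξ : GroupLieAlgebra 𝓘(ℝ, EG) G} (hm : L (D.moment i ξ p) = D'.moment a ξ p) :
    MF.map L (D.total κ i ξ p) = D'.total κ a ξ p := by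
  rw [D.total_eq, D'.total_eq_single, map_add, map_add, MF.map_single, MF.map_shift, MF.const,
    MF.map_single, MF.single_add]
  refine congrArg₂ HAdd.hAdd (congrArg₂ HAdd.hAdd ?_ ?_) ?_
  · have h1 : extD 𝓘(ℝ, EP) (D'.A a) p =
        L.compContinuousAlternatingMap (extD 𝓘(ℝ, EP) (D.A i) p) := by
      rw [← extD_map _ ((SmoothFormAt.formContDiffAt _ (D.smooth i p hp)).of_le (by simp))]
      refine extD_congr _ ?_
      filter_upwards [(Q.isOpen_dom i).mem_nhds hp] with q hq
      exact (hA q hq).symm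
    rw [D.curv_eq_single, MF.single_add, map_add, MF.map_single,
      EquivPUBundle.EquivModule.Connection.curvature, MF.single_add, h1]
    refine congrArg₂ HAdd.hAdd rfl ?_
    have h2 := MF.map_mul L hL (MF.single 0 1 (D.A i p)) (MF.single 0 1 (D.A i p))
    rw [MF.map_single, hA p hp, MF.single_mul_single, MF.single_mul_single] at h2
    exact h2
  · refine congrArg (MF.single 0 2) ?_
    ext v : 1
    exact hc _
  · refine congrArg (fun α => MF.shift (MF.single 0 0 α)) ?_
    ext v : 1
    refine (map_sub L _ _).trans ?_
    rw [hm, hc]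
    rfl

variable (hD : EquivPUBundle.TraceClassDifference D₀ D₁)

theorem low_high_moment {i : P × P} {p : P} (hp : p ∈ 𝓔₀.dom i.1 ∩ 𝓔₁.dom i.2)
    (ξ : GroupLieAlgebra 𝓘(ℝ, EG) G) :
    OpPair.low ((pairConnection hD).moment i ξ p) = D₁.moment i.2 ξ p ∧
    OpPair.high ((pairConnection hD).moment i ξ p) = D₀.moment i.1 ξ p := by
  have hA := isPairForm_pairForm hD hp (fundVF ξ p)
  have hs : ContMDiffAt 𝓘(ℝ, EG) (𝓘(ℝ, EG).prod 𝓘(ℝ, EP)) ∞ (fun g : G => (g, p)) 1 :=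
    contMDiffAt_id.prodMk contMDiffAt_const
  have h₀ := (𝓔₀.contMDiffAt_sigmaMat (x := (1, p)) hp.1 (by simpa using hp.1)).comp 1 hs
  have h₁ := (𝓔₁.contMDiffAt_sigmaMat (x := (1, p)) hp.2 (by simpa using hp.2)).comp 1 hs
  rw [GaugeConnection.moment, map_sub, map_sub]
  constructor
  · refine congrArg₂ HSub.hSub ((low_dvec_onePlus h₀ h₁ ξ).trans ?_) hA.1
    exact congrArg _ (𝓔₁.dvec_sigmaMat_inv hp.2 ξ).symm
  · refine congrArg₂ HSub.hSub ((high_dvec_onePlus h₀ h₁ ξ).trans ?_) hA.2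
    exact congrArg _ (𝓔₀.dvec_sigmaMat_inv hp.1 ξ).symm

theorem op_diff_expTotal {i : P × P} {p : P} (hp : p ∈ 𝓔₀.dom i.1 ∩ 𝓔₁.dom i.2)
    (ξ : GroupLieAlgebra 𝓘(ℝ, EG) G) (k j : ℕ) (v : Fin j → TangentSpace 𝓘(ℝ, EP) p) :
    (OpPair.diff ((pairConnection hD).expTotal κ i ξ p k j v)).op =
      EquivPUBundle.expDiff D₀ D₁ κ i.1 i.2 ξ p k j v := by
  have hv : ∀ {q : P} (w : Fin 1 → TangentSpace 𝓘(ℝ, EP) q), w = fun _ => w 0 := fun w =>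
    funext fun l => by fin_cases l; rfl
  have key : ∀ (L : OpPair H →L[ℝ] (H →L[ℂ] H)) (_ : ∀ a b, L (a * b) = L a * L b) (_ : L 1 = 1)
      {α : MixedForm (TangentSpace 𝓘(ℝ, EP) p) (H →L[ℂ] H)} (_ : α 0 0 = 0)
      (_ : MF.map L ((pairConnection hD).total κ i ξ p) = α),
      L ((pairConnection hD).expTotal κ i ξ p k j v) = MixedForm.exp α k j v := by
    intro L hL hL1 α hα h
    have e1 := MF.map_expSum L hL hL1 ((pairConnection hD).total κ i ξ p) (k + j + 1)
    rw [h] at e1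
    rw [GaugeConnection.expTotal_apply _ κ i ξ p (Nat.lt_succ_self (k + j)),
      MF.exp_apply hα (Nat.lt_succ_self (k + j)), ← e1]
    rfl
  have hm := low_high_moment hD hp ξ
  have h₁ := key OpPair.lowL OpPair.low_mul OpPair.low_one (α := D₁.total κ i.2 ξ p) rfl
    (map_total κ (pairConnection hD) OpPair.low_mul OpPair.low_scalarL hp (fun q hq => by
      ext w : 1
      rw [hv w]
      exact (isPairForm_pairForm hD hq _).1) hm.1)
  have h₀ := key OpPair.highL OpPair.high_mul OpPair.high_one (α := D₀.total κ i.1 ξ p) rfl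
    (map_total κ (pairConnection hD) OpPair.high_mul OpPair.high_scalarL hp (fun q hq => by
      ext w : 1
      rw [hv w]
      exact (isPairForm_pairForm hD hq _).2) hm.2)
  refine Eq.trans ?_ (congrArg₂ HSub.hSub h₀ h₁)
  rw [OpPair.highL_apply, OpPair.lowL_apply, OpPair.high_apply, add_sub_cancel_left]

/-- The Chern character form on `P`. -/
def chernForm : RawCartan EG G EP P :=
  (pairBundle 𝓔₀ 𝓔₁).trace OpPair.strL ((pairConnection hD).expTotal κ)

theorem chernForm_apply {a b p : P} (hp : p ∈ 𝓔₀.dom a ∩ 𝓔₁.dom b)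
    (ξ : GroupLieAlgebra 𝓘(ℝ, EG) G) (k j : ℕ) (v : Fin j → TangentSpace 𝓘(ℝ, EP) p) :
    chernForm κ hD ξ p k j v = opTrace (EquivPUBundle.expDiff D₀ D₁ κ a b ξ p k j v) := by
  have h := GaugeBundle.trace_eq ((pairConnection hD).covariant_expTotal κ OpPair.scalarL_mul_comm)
    OpPair.strL_mul_comm (i := (a, b)) hp ξ
  refine (congrArg (fun α : MF (TangentSpace 𝓘(ℝ, EP) p) ℂ => α k j v) h).trans ?_
  refine (OpPair.strL_apply _).trans ?_
  exact congrArg opTrace (op_diff_expTotal κ hD (i := (a, b)) hp ξ k j v)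

include hD in
theorem isTraceClass_expDiff {a b p : P} (hp : p ∈ 𝓔₀.dom a ∩ 𝓔₁.dom b)
    (ξ : GroupLieAlgebra 𝓘(ℝ, EG) G) (k j : ℕ) (v : Fin j → TangentSpace 𝓘(ℝ, EP) p) :
    IsTraceClass (EquivPUBundle.expDiff D₀ D₁ κ a b ξ p k j v) := by
  rw [← op_diff_expTotal κ hD (i := (a, b)) hp]
  exact TraceClass.isTraceClass _

theorem exists_twistedCocycle {h : RawCartan EG G EM M} (hh : B.pullback h = dCartan κ.cartan.1) :
    ∃ w : twistedCocycles h, B.pullback w.1.1 = chernForm κ hD := by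
  have hcov := (pairConnection hD).covariant_expTotal κ OpPair.scalarL_mul_comm
  obtain ⟨η, hη, e⟩ := exists_descent B (GaugeBundle.trace_mem hcov OpPair.strL_mul_comm)
    (GaugeBundle.isBasic_trace hcov OpPair.strL_mul_comm)
  refine ⟨⟨⟨η, hη⟩, ?_⟩, e⟩
  refine LinearMap.mem_ker.2 (sub_eq_zero.2 (pullback_injective B ?_))
  rw [pullback_dCartan B hη.1, pullback_mulCartan, hh]
  change dCartan (B.pullback η) = mulCartan _ (B.pullback η)
  rw [e]
  exact (pairConnection hD).dCartan_trace_expTotal κ OpPair.scalarL_mul_comm OpPair.strL_mul_comm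
    OpPair.strL_scalarL_mul

theorem exists_twistedD_eq {D₀' : 𝓔₀.Connection θ} {D₁' : 𝓔₁.Connection θ}
    (hD' : EquivPUBundle.TraceClassDifference D₀' D₁') {h : RawCartan EG G EM M}
    (hh : B.pullback h = dCartan κ.cartan.1) {w w' : twistedCocycles h}
    (hw : B.pullback w.1.1 = chernForm κ hD) (hw' : B.pullback w'.1.1 = chernForm κ hD') :
    ∃ η : cartanComplex EG G EM M, twistedD h η = w'.1.1 - w.1.1 := by
  have hcov := (pairConnection hD).covariant_transgression (pairConnection hD') κ
    OpPair.scalarL_mul_comm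
  have hα := GaugeBundle.trace_mem hcov OpPair.strL_mul_comm
  obtain ⟨η, hη, e⟩ := exists_descent B hα (GaugeBundle.isBasic_trace hcov OpPair.strL_mul_comm)
  refine ⟨⟨η, hη⟩, pullback_injective B ?_⟩
  refine (pullback_sub B _ _).trans (Eq.trans ?_ (pullback_sub B _ _).symm)
  rw [pullback_dCartan B hη.1, pullback_mulCartan, hh, hw, hw']
  change dCartan (B.pullback η) - mulCartan _ (B.pullback η) = _
  rw [e]
  exact (pairConnection hD).twistedD_transgression (pairConnection hD') κ OpPair.scalarL_mul_comm
    OpPair.strL_mul_comm OpPair.strL_scalarL_mul hα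

end PairConnection

end TwistedChern

end

theorem mainTheorem3
    {EG : Type*} [NormedAddCommGroup EG] [NormedSpace ℝ EG] [FiniteDimensional ℝ EG]
    {G : Type*} [TopologicalSpace G] [ChartedSpace EG G] [Group G] [LieGroup 𝓘(ℝ, EG) ∞ G]
    [T2Space G] [CompactSpace G]
    {EM : Type*} [NormedAddCommGroup EM] [NormedSpace ℝ EM] [FiniteDimensional ℝ EM]
    {M : Type*} [TopologicalSpace M] [ChartedSpace EM M] [IsManifold 𝓘(ℝ, EM) ∞ M]
    [T2Space M] [SecondCountableTopology M]
    [MulAction G M] [ContMDiffSMul 𝓘(ℝ, EG) 𝓘(ℝ, EM) ∞ G M]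
    {EP : Type*} [NormedAddCommGroup EP] [NormedSpace ℝ EP] [CompleteSpace EP]
    {P : Type*} [TopologicalSpace P] [ChartedSpace EP P] [IsManifold 𝓘(ℝ, EP) ∞ P]
    [MulAction G P]
    {H : Type*} [NormedAddCommGroup H] [InnerProductSpace ℂ H] [CompleteSpace H]
    (B : EquivPUBundle EG G EM M EP P H) (θ : B.GerbeConnection)
    (κ : EquivPUBundle.EquivCurving θ)
    {E₀ : P → Type*} [∀ p, AddCommGroup (E₀ p)] [∀ p, Module ℂ (E₀ p)]
    {E₁ : P → Type*} [∀ p, AddCommGroup (E₁ p)] [∀ p, Module ℂ (E₁ p)]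
    (𝓔₀ : B.EquivModule E₀) (𝓔₁ : B.EquivModule E₁) :
    ∃ h ∈ cartanComplex EG G EM M, HasDegree 3 h ∧ dCartan h = 0 ∧
      B.pullback h = dCartan κ.cartan.1 ∧
      ∃ ch : TwistedCohomology h, ∀ (D₀ : 𝓔₀.Connection θ) (D₁ : 𝓔₁.Connection θ),
        EquivPUBundle.TraceClassDifference D₀ D₁ →
        (∀ a b, ∀ p ∈ 𝓔₀.dom a ∩ 𝓔₁.dom b, ∀ ξ k j v,
          IsTraceClass (EquivPUBundle.expDiff D₀ D₁ κ a b ξ p k j v)) ∧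
        ∃ w : twistedCocycles h,
          (∀ a b, ∀ p ∈ 𝓔₀.dom a ∩ 𝓔₁.dom b, ∀ ξ k j v,
            B.pullback w.1.1 ξ p k j v =
              opTrace (EquivPUBundle.expDiff D₀ D₁ κ a b ξ p k j v)) ∧
          Submodule.Quotient.mk w = ch := by
  obtain ⟨h, hh, hph⟩ := exists_descent B (dCartan_curving_mem κ) (isBasic_dCartan_curving κ)
  refine ⟨h, hh, HasDegree.of_pullback B (hph ▸ hasDegree_dCartan_curving κ),
    pullback_injective B ?_, hph, ?_⟩
  · rw [pullback_dCartan B hh.1, hph, dCartan_dCartan_curving κ]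
    rfl
  by_cases hex : ∃ (D₀ : 𝓔₀.Connection θ) (D₁ : 𝓔₁.Connection θ),
      EquivPUBundle.TraceClassDifference D₀ D₁
  · obtain ⟨D₀, D₁, hD⟩ := hex
    obtain ⟨w, hw⟩ := exists_twistedCocycle κ hD hph
    refine ⟨Submodule.Quotient.mk w, fun D₀' D₁' hD' =>
      ⟨fun a b p hp => isTraceClass_expDiff κ hD' hp, ?_⟩⟩
    obtain ⟨w', hw'⟩ := exists_twistedCocycle κ hD' hph
    refine ⟨w', fun a b p hp ξ k j v => ?_, ?_⟩
    · rw [hw']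
      exact chernForm_apply κ hD' hp ξ k j v
    · obtain ⟨η, hη⟩ := exists_twistedD_eq κ hD hD' hph hw hw'
      exact (Submodule.Quotient.eq _).2 ⟨η, hη⟩
  · exact ⟨0, fun D₀ D₁ hD => absurd ⟨D₀, D₁, hD⟩ hex⟩
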